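/- **Polygons.** A convex lattice polygon $\Delta\subset\mathbb R^2$ (with nonempty interior) is *$h$-transverse* if each of its sides has a direction vector $(\pm1,0)$ or $(m,\pm1)$ with $m\in\mathbb Z$, *horizontal* if it has a horizontal top side and a horizontal bottom side, and *non-singular* if its toric surface is non-singular, i.e. at each vertex the primitive outgoing normal vectors of the two adjacent sides form a basis of $\mathbb Z^2$. Write $g_{\max}(\Delta)$ for the number of interior lattice points, $a(\Delta)$ for the height, $b^\top(\Delta)$ and $b^\bot(\Delta)$ for the integral lengths of the top and bottom sides, and $b_{\rm left}(\Delta)$ (resp. $b_{\rm right}(\Delta)$) for the multiset of integers in which $k$ has as multiplicity the integral length of the side with outgoing normal vector $(-1,k)$ (resp. $(1,k)$). **Floor diagrams.** A floor diagram $\mathcal D$ with Newton polygon $\Delta$ and genus $g$ is a connected, oriented, acyclic graph of first Betti number $g$ with positive integral edge weights $w(e)$, with $a(\Delta)$ vertices (floors), $b^\bot(\Delta)$ sources (ends entering a floor) and $b^\top(\Delta)$ sinks (ends leaving a floor), all ends having weight $1$, the set of the other (bounded) edges being denoted by $E^0$, together with bijections $L,R$ from the floors to the multisets $b_{\rm left}(\Delta)$,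 $b_{\rm right}(\Delta)$ such that for each floor $v$ the total incoming weight minus the total outgoing weight is $L(v)+R(v)$. A marking is an increasing bijection from the set of floors and edges to $\{1,\dots,N\}$; marked floor diagrams are considered up to isomorphism. The codegree is $\mathrm{codeg}(\mathcal D)=\mathrm{Area}(\Delta)-\frac{b^\top+b^\bot}{2}-\sum_{e\in E^0}w(e)$. For $s\ge 0$, a marked floor diagram is *$s$-compatible* if $2s\leq N$ and for each $j\le s$ the markings $2j-1,2j$ are carried by an edge and an adjacent floor, or by two edges both entering or both leaving the same floor. **Göttsche–Schroeter invariants.** Put $[n](q)=\frac{q^{n/2}-q^{-n/2}}{q^{1/2}-q^{-1/2}}$. The refined multiplicity $\mu_s(\mathcal D)(q)$ of an $s$-compatible marked floor diagram is the product of a factor $[w(e)]^2$ for each edge whose marking is $>2s$, a factor $[w(e)](q^2)$ for each of the $s$ pairs that consists of an edge $e$ and a floor, and a factor $\frac{[w(e)]\,[w(e')]\,[w(e)+w(e')]}{[2]}$ for each of the $s$ pairs that consists of two edges $e,e'$. Let $BG_g(\Delta,s)(q)=\sum\mu_s(\mathcal D)(q)$, the sum running over the $s$-compatible marked floor diagrams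 with Newton polygon $\Delta$ and genus $g$, and clear the denominators: $$\widetilde{BG}_g(\Delta,s)(x)=x^{\mathrm{Area}(\Delta)}\Big[(q^{1/2}-q^{-1/2})^{b^\top+b^\bot+2(a(\Delta)-1+g)}\Big(\frac{q^{1/2}+q^{-1/2}}{q^{1/2}-q^{-1/2}}\Big)^s BG_g(\Delta,s)(q)\Big]_{q=1/x}\in\mathbb Z[\![x]\!].$$ Let also $\widehat{BG}_g(\Delta,s)(x)$ be the count of the same diagrams with the multiplicity $$x^{\mathrm{codeg}(\mathcal D)}(1-x)^{b^\top+b^\bot}\Big(\frac{1+x}{1-x}\Big)^s\prod_{e\in E^0}(1-x^{w(e)})^2 .$$ **Asymptotic invariants.** Let $X$ be the toric surface of an $h$-transverse, horizontal and non-singular polygon, and let $\chi$ be its Euler characteristic, i.e. the number of its toric divisors. An ample divisor class $\beta$ on $X$ corresponds to the lattice polygon $\Delta_\beta$, unique up to translation, that has the same normal fan and whose side dual to the toric divisor $D$ has integral length $\beta\cdot D$. The asymptotic refined invariant $AR^X_{g,s}$ is a function $\beta\mapsto AR^X_{g,s}(\beta)\in\mathbb Z[\![x]\!]$ on the ample classes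 that is polynomial in $\beta$ (given by a polynomial with coefficients in $\mathbb Q[\![x]\!]$ in the intersection numbers of $\beta$ with the toric divisors) and satisfies $$\widetilde{BG}_g(\Delta_\beta,s)=AR^X_{g,s}(\beta)+o(1)\quad\text{as }\beta\to\infty,$$ that is, for each $n$ there is a $C$ such that both sides agree modulo $x^n$ for all $\beta$ with $\beta\cdot D\ge C$ for every toric divisor $D$ of $X$. **Theorem.** For each $s\ge0$ the genus $1$ asymptotic refined invariant $AR^X_{1,s}$ exists, is unique, and is given by $$AR^X_{1,s}(\beta)=p(x)^{\chi}\Big(g_{\max}(\Delta_\beta)+2s\,\frac{x}{1-x}-12E_2(x)\Big),$$ where $p(x)=\prod_{j\ge1}\frac1{1-x^j}$ is the generating series of the partition numbers and $E_2(x)=\sum_{a\ge1}\sigma_1(a)x^a$. The same holds with $\widehat{BG}$ in place of $\widetilde{BG}$. -/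

import Mathlib

noncomputable section

namespace RefinedFloors

/-! ### Lattice polygons and their toric surfaces -/

/-- The inclusion of the lattice `ℤ²` in the plane `ℝ²`. -/
def toPlane (u : ℤ × ℤ) : ℝ × ℝ := ((u.1 : ℝ), (u.2 : ℝ))

/-- The pairing of a (co)vector `n` with a lattice point `u`. -/
def pairing (n u : ℤ × ℤ) : ℤ := n.1 * u.1 + n.2 * u.2

/-- A convex lattice polygon in the plane: the convex hull of finitely many lattice points, with
nonempty interior. -/
structure LatticePolygon where
  carrier : Set (ℝ × ℝ)
  isHull : ∃ S : Finset (ℤ × ℤ), carrier = convexHull ℝ (toPlane '' (S : Set (ℤ × ℤ)))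
  interior_nonempty : (interior carrier).Nonempty

namespace LatticePolygon

variable (Δ : LatticePolygon)

/-- The lattice points of the polygon. -/
def points : Set (ℤ × ℤ) := {u | toPlane u ∈ Δ.carrier}

/-- The Euclidean area. -/
def area : ℝ := (MeasureTheory.volume Δ.carrier).toReal

/-- `g_max`, the number of interior lattice points. -/
def gmax : ℕ := {u : ℤ × ℤ | toPlane u ∈ interior Δ.carrier}.ncard

/-- The lattice points of the face of `Δ` on which the linear form `n` is maximal, i.e. of the
face (a side or a vertex) with outgoing normal vector `n`. -/
def face (n : ℤ × ℤ) : Set (ℤ × ℤ) :=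
  {u | u ∈ Δ.points ∧ ∀ v ∈ Δ.points, pairing n v ≤ pairing n u}

/-- The integral length of the face with outgoing normal vector `n` (which is `0` when that face
is a vertex). -/
def sideLength (n : ℤ × ℤ) : ℕ := (Δ.face n).ncard - 1

/-- The primitive outgoing normal vectors of the sides. They generate the rays of the normal fan,
hence they determine this (complete, two-dimensional) fan and the toric surface `X` of `Δ`, and
they index the toric divisors of `X`. -/
def outerNormals : Set (ℤ × ℤ) := {n | IsCoprime n.1 n.2 ∧ 0 < Δ.sideLength n}

/-- The Euler characteristic of the toric surface of `Δ`: the number of rays of the fan. -/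
def eulerChar : ℕ := Δ.outerNormals.ncard

/-- Each side has a direction vector of the form `(±1, 0)` or `(m, ±1)`: the side with primitive
normal vector `n` has the primitive direction vectors `±(-n.2, n.1)`. -/
def IsHTransverse : Prop :=
  ∀ n ∈ Δ.outerNormals, n = (0, 1) ∨ n = (0, -1) ∨ n.1 = 1 ∨ n.1 = -1

/-- There are a top and a bottom horizontal side. -/
def IsHorizontal : Prop := (0, 1) ∈ Δ.outerNormals ∧ (0, -1) ∈ Δ.outerNormals

/-- The toric surface of `Δ` is nonsingular: the primitive normal vectors of two sides that meet
in a vertex (the generators of a maximal cone of the fan) form a basis of `ℤ²`. -/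
def IsNonsingular : Prop :=
  ∀ n ∈ Δ.outerNormals, ∀ m ∈ Δ.outerNormals, n ≠ m → (Δ.face n ∩ Δ.face m).Nonempty →
    IsUnit (n.1 * m.2 - n.2 * m.1)

/-- The height `a(Δ)`. -/
def height : ℕ := (sSup (Prod.snd '' Δ.points) - sInf (Prod.snd '' Δ.points)).toNat

/-- The length `b^⊤(Δ)` of the top side. -/
def topLength : ℕ := Δ.sideLength (0, 1)

/-- The length `b^⊥(Δ)` of the bottom side. -/
def bottomLength : ℕ := Δ.sideLength (0, -1)

/-- The multiplicity of `k` in the multiset `b_left(Δ)`. -/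
def leftMult (k : ℤ) : ℕ := Δ.sideLength (-1, k)

/-- The multiplicity of `k` in the multiset `b_right(Δ)`. -/
def rightMult (k : ℤ) : ℕ := Δ.sideLength (1, k)

end LatticePolygon

/-! ### Marked floor diagrams -/

/-- An element of a marked graph whose floors and edges are numbered by `Fin N`: a floor `v` with
the values `L(v)`, `R(v)`; a bounded edge with its first and last floor and its weight; a source
(an end of weight `1` entering a floor); a sink (an end of weight `1` leaving a floor). -/
inductive Piece (N : ℕ) where
  | floor (left right : ℤ)
  | bounded (first last : Fin N) (w : ℕ)
  | source (last : Fin N)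
  | sink (first : Fin N)

namespace Piece

variable {N : ℕ}

/-- The values `(L(v), R(v))` of a floor `v`. -/
def slopes : Piece N → Option (ℤ × ℤ)
  | floor l r => some (l, r)
  | _ => none

def isFloor : Piece N → Bool
  | floor _ _ => true
  | _ => false

def isBounded : Piece N → Bool
  | bounded _ _ _ => true
  | _ => false

def isSource : Piece N → Bool
  | source _ => true
  | _ => false

def isSink : Piece N → Bool
  | sink _ => true
  | _ => false

/-- The floor that an edge leaves. -/
def tail : Piece N → Option (Fin N)
  | bounded v _ _ => some v
  | sink v => some v
  | _ => none

/-- The floor that an edge enters. -/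
def head : Piece N → Option (Fin N)
  | bounded _ v _ => some v
  | source v => some v
  | _ => none

/-- The weight of an edge (`0` for a floor, which has no weight). -/
def weight : Piece N → ℕ
  | floor _ _ => 0
  | bounded _ _ w => w
  | source _ => 1
  | sink _ => 1

end Piece

/-- An isomorphism class of marked floor diagrams with Newton polygon `Δ`. As the marking is a
bijection from the floors and edges to `{1, …, N}`, the class has exactly one representative whose
set of floors and edges is `Fin N` and whose marking is the identity (shifted by one); this is the
representative that is recorded here. That the marking is increasing is the conjunction of
`tail_lt` and `lt_head`; it forces the orientation to be acyclic. -/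
structure MarkedFloorDiagram (Δ : LatticePolygon) where
  size : ℕ
  piece : Fin size → Piece size
  tail_lt : ∀ e v, (piece e).tail = some v → (piece v).isFloor = true ∧ v < e
  lt_head : ∀ e v, (piece e).head = some v → (piece v).isFloor = true ∧ e < v
  weight_pos : ∀ e, (piece e).isFloor = false → 0 < (piece e).weight
  card_floors : (Finset.univ.filter fun i => (piece i).isFloor = true).card = Δ.height
  card_sinks : (Finset.univ.filter fun i => (piece i).isSink = true).card = Δ.topLength
  card_sources : (Finset.univ.filter fun i => (piece i).isSource = true).card = Δ.bottomLength
  /-- `L` is a bijection from the floors to the multiset `b_left(Δ)`. -/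
  card_left : ∀ k : ℤ, (Finset.univ.filter fun i =>
    (piece i).slopes.map Prod.fst = some k).card = Δ.leftMult k
  /-- `R` is a bijection from the floors to the multiset `b_right(Δ)`. -/
  card_right : ∀ k : ℤ, (Finset.univ.filter fun i =>
    (piece i).slopes.map Prod.snd = some k).card = Δ.rightMult k
  /-- The divergence (incoming minus outgoing weight) of a floor `v` is `L(v) + R(v)`. -/
  divergence : ∀ v l r, piece v = Piece.floor l r →
    (∑ e with (piece e).head = some v, ((piece e).weight : ℤ))
      - ∑ e with (piece e).tail = some v, ((piece e).weight : ℤ) = l + r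
  connected : ∀ v v', (piece v).isFloor = true → (piece v').isFloor = true →
    Relation.EqvGen (fun u u' => ∃ e w, piece e = Piece.bounded u u' w) v v'

namespace MarkedFloorDiagram

variable {Δ : LatticePolygon} (D : MarkedFloorDiagram Δ)

/-- The number of bounded edges. -/
def numBounded : ℕ := (Finset.univ.filter fun i => (D.piece i).isBounded = true).card

/-- The first Betti number of the underlying (connected) graph. -/
def genus : ℤ := (D.numBounded : ℤ) - (Δ.height : ℤ) + 1

/-- The degree of a floor diagram. -/
def degree : ℝ := (Δ.topLength : ℝ) / 2 + (Δ.bottomLength : ℝ) / 2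
  + ∑ e with (D.piece e).isBounded = true, ((D.piece e).weight : ℝ)

/-- The codegree of a floor diagram. -/
def codeg : ℝ := Δ.area - D.degree

/-- The positions `i, i'` (counted from `0`) form one of the pairs
`{1, 2}, {3, 4}, …, {2s - 1, 2s}` of markings, `i` being the smaller one. -/
def IsPair (s : ℕ) (i i' : Fin D.size) : Prop :=
  i.val % 2 = 0 ∧ i'.val = i.val + 1 ∧ i'.val < 2 * s

instance (s : ℕ) (i i' : Fin D.size) : Decidable (D.IsPair s i i') := by
  unfold IsPair; infer_instance

/-- The edge `e` is adjacent to the floor `v`. -/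
def IsAdjacent (e v : Fin D.size) : Prop :=
  (D.piece e).tail = some v ∨ (D.piece e).head = some v

/-- The diagram is `s`-compatible: each of the `s` pairs of markings is carried by an edge and an
adjacent floor, or by two edges both leaving or both entering the same floor. -/
def IsCompatible (s : ℕ) : Prop :=
  2 * s ≤ D.size ∧ ∀ i i', D.IsPair s i i' →
    D.IsAdjacent i i' ∨ D.IsAdjacent i' i ∨
    ∃ v, ((D.piece i).tail = some v ∧ (D.piece i').tail = some v) ∨
      ((D.piece i).head = some v ∧ (D.piece i').head = some v)

end MarkedFloorDiagram

/-! ### Power series -/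

/-- `1 / (1 - x)`. -/
def invOneSub : PowerSeries ℤ := PowerSeries.mk fun _ => 1

/-- `1 / (1 + x)`. -/
def invOneAdd : PowerSeries ℤ := PowerSeries.mk fun n => (-1) ^ n

/-- `1 + x + ⋯ + x ^ (w - 1)`: the quantum integer `[w](q)` at `q = 1/x`, times
`x ^ ((w - 1) / 2)`. -/
def qInt (w : ℕ) : PowerSeries ℤ := ∑ i ∈ Finset.range w, PowerSeries.X ^ i

/-- `1 + x² + ⋯ + x ^ (2w - 2)`: the quantum integer `[w](q²)` at `q = 1/x`, times
`x ^ (w - 1)`. -/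
def qIntSq (w : ℕ) : PowerSeries ℤ := ∑ i ∈ Finset.range w, PowerSeries.X ^ (2 * i)

/-- The generating series `p(x) = ∏_{j ≥ 1} 1 / (1 - x ^ j)` of the partition numbers. -/
def partitionSeries : PowerSeries ℤ := PowerSeries.mk fun n => (Fintype.card (Nat.Partition n) : ℤ)

/-- The Eisenstein series `E₂(x) = ∑_{a ≥ 1} σ₁(a) x ^ a`. -/
def eisensteinTwo : PowerSeries ℤ :=
  PowerSeries.mk fun n => (ArithmeticFunction.sigma 1 n : ℤ)

/-! ### Refined invariants -/

/-- The contribution of a pair of markings to the refined multiplicity: `[w](q²)` for an edge of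
weight `w` and an adjacent floor, `[w][w'][w + w'] / [2]` for two edges of weights `w` and `w'`;
at `q = 1/x` and normalized to have constant term `1`. -/
def pairFactor {N : ℕ} : Piece N → Piece N → PowerSeries ℤ
  | Piece.floor _ _, e => qIntSq e.weight
  | e, Piece.floor _ _ => qIntSq e.weight
  | e, e' => qInt e.weight * qInt e'.weight * qInt (e.weight + e'.weight) * invOneAdd

namespace MarkedFloorDiagram

variable {Δ : LatticePolygon} (D : MarkedFloorDiagram Δ)

/-- The Göttsche–Schroeter multiplicity of an `s`-compatible marked floor diagram: the product of
`[w(e)]²` over the edges `e` that are not in a pair, and of the contributions of the `s` pairs; at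
`q = 1/x` and normalized to have constant term `1`. -/
def refinedMult (s : ℕ) : PowerSeries ℤ :=
  (∏ e with (D.piece e).isFloor = false ∧ 2 * s ≤ e.val, qInt (D.piece e).weight ^ 2)
    * ∏ i, ∏ i', if D.IsPair s i i' then pairFactor (D.piece i) (D.piece i') else 1

/-- The Göttsche–Schroeter multiplicity with cleared denominators, in the variable `x`. The
clearing factor only depends on `Δ`, the genus and `s`, because all diagrams of the same genus
have the same number of bounded edges. The codegree is a nonnegative integer. -/
def clearedMult (s : ℕ) : PowerSeries ℤ :=
  PowerSeries.X ^ ⌊D.codeg⌋₊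
    * (1 - PowerSeries.X) ^ (Δ.topLength + Δ.bottomLength + 2 * D.numBounded)
    * ((1 + PowerSeries.X) * invOneSub) ^ s
    * D.refinedMult s

/-- The multiplicity
`x^codeg (1 - x)^(b^⊤ + b^⊥) ((1 + x) / (1 - x))^s ∏_{e bounded} (1 - x^w(e))²`. -/
def simpleMult (s : ℕ) : PowerSeries ℤ :=
  PowerSeries.X ^ ⌊D.codeg⌋₊
    * (1 - PowerSeries.X) ^ (Δ.topLength + Δ.bottomLength)
    * ((1 + PowerSeries.X) * invOneSub) ^ s
    * ∏ e with (D.piece e).isBounded = true, (1 - PowerSeries.X ^ (D.piece e).weight) ^ 2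

end MarkedFloorDiagram

/-- The `s`-compatible marked floor diagrams with Newton polygon `Δ` and genus `g`, up to
isomorphism. There are finitely many of them. -/
abbrev CompatibleDiagram (Δ : LatticePolygon) (g s : ℕ) : Type :=
  {D : MarkedFloorDiagram Δ // D.genus = (g : ℤ) ∧ D.IsCompatible s}

/-- The genus `g` Göttsche–Schroeter invariant of `Δ` with `s` pairs of conjugate points, with
cleared denominators, as a power series in `x`. -/
def gsInvariant (g s : ℕ) (Δ : LatticePolygon) : PowerSeries ℤ :=
  ∑ᶠ D : CompatibleDiagram Δ g s, D.1.clearedMult s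

/-- The count of the `s`-compatible marked floor diagrams with the multiplicity `simpleMult`. -/
def simpleCount (g s : ℕ) (Δ : LatticePolygon) : PowerSeries ℤ :=
  ∑ᶠ D : CompatibleDiagram Δ g s, D.1.simpleMult s

/-! ### Asymptotic refined invariants -/

/-- The ample divisor classes `β` of the toric surface of `Δ`, each given by a polygon `Δ_β`,
i.e. by a polygon with the same normal fan as `Δ`. The intersection number of `β` with the toric
divisor of `n` is `Δ_β.sideLength n`; these numbers determine `β`, and `Δ_β` up to translation. -/
abbrev Ample (Δ : LatticePolygon) : Type :=
  {Δ' : LatticePolygon // Δ'.outerNormals = Δ.outerNormals}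

/-- `A` is a polynomial function of the class `β` (equivalently, of its intersection numbers with
the toric divisors). -/
def IsPolynomial (Δ : LatticePolygon) (A : Ample Δ → PowerSeries ℤ) : Prop :=
  ∃ P : MvPolynomial Δ.outerNormals (PowerSeries ℚ), ∀ β : Ample Δ,
    PowerSeries.map (Int.castRingHom ℚ) (A β) =
      MvPolynomial.eval (fun n => (β.1.sideLength n.1 : PowerSeries ℚ)) P

/-- `A` is the asymptotic invariant of `F` on the toric surface of `Δ`: it is a polynomial
function of `β`, and `F(Δ_β) = A(β) + o(1)` in `ℤ⟦x⟧` as `β → ∞`, i.e. for each `n` the two sides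
agree modulo `x ^ n` as soon as the intersection numbers of `β` with all toric divisors are at
least some constant. -/
def IsAsymptotic (Δ : LatticePolygon) (F : LatticePolygon → PowerSeries ℤ)
    (A : Ample Δ → PowerSeries ℤ) : Prop :=
  IsPolynomial Δ A ∧
    ∀ n : ℕ, ∃ C : ℕ, ∀ β : Ample Δ, (∀ m ∈ Δ.outerNormals, C ≤ β.1.sideLength m) →
      ∀ i < n, PowerSeries.coeff i (F β.1) = PowerSeries.coeff i (A β)

end RefinedFloors

end

/-! Everything is computed modulo `x ^ n` on polygons with long sides, where only diagrams of
codegree less than `n` count. The codegree splits into nonnegative costs (`codeg_eq`): the weighted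
inversions in the order of the left slopes and of the right slopes, `m - 1` for a source entering
floor number `m` and `a - m` for a sink leaving it, and `w * (i' - i - 1)` for a bounded edge of
weight `w` from floor `i` to floor `i'`. At small codegree the weight passing between any two
consecutive floors is large (`le_flow`), while edges that skip a floor are light. Hence a diagram of
genus one is a chain of floors with one further edge at a level `j`, parallel to a chain edge or
longer (`exists_dataWord`). All but fewer than `n` sources precede every other element, so the pairs
of markings are pairs of sources entering the same floor. Such pairs have multiplicity one, and the
two multiplicities of the theorem agree (`clearedMult_eq_simpleMult`).

The powers of `p` come from free positions. Arrangements of `l + 1` consecutive slopes, all of large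
multiplicity, weighted by `x ^ cost`, sum to `p ^ l` (`sum_arrangements_cost`). A source placed
after `c` floors has total weight `x ^ c` once a factor `1 - x` is attached to it; almost all
sources sit in the first place, and every other place contributes `1 / (1 - x ^ c)`. A level has two
places, which gives `p ^ 2`, and the further edge creates a third place at level `j`, which gives `1
/ (1 - x ^ j)`. Upside down, the sinks give `p ^ 2 / (1 - x ^ (a - j))`. Up to these level factors
the exponent is `4 + l + l'`, the number of sides.

The other factor comes from the further edge. A parallel pair of total weight `f` can be split in `f
- 1` ways, up to a correction independent of `f`, and `f` depends linearly on the number of ends of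
certain kinds and on prefix sums of slopes. Such linear statistics are averaged by differentiation
in dual numbers. In the sum over `j` (`dataSum_eq`) the ends contribute `-8 E₂` and the term `2 s x
/ (1 - x)`, the multiplicities of the further edge contribute `-4 E₂`, the `E₂` terms of the slopes
cancel, and the constant is `(a - 1) (b - 1)` minus the sums of pairwise minima of the slopes, which
is `g_max` (`gmax_eq`).

Polygons enter through unit horizontal strips, on which both boundary lines have integral slopes;
nonsingularity makes the slopes consecutive integers (`slope_succ_le`). Uniqueness follows by
restricting a polynomial to the multiples `t β` of one class (`IsAsymptotic.unique`). -/

noncomputable section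

namespace RefinedFloors

open Finset

/-! ### Truncated geometric series and complete homogeneous polynomials -/

section Ring

variable {A : Type*} [CommRing A]

/-- The geometric series of `r`, truncated at order `n`. -/
def geo (n : ℕ) (r : A) : A := ∑ q ∈ range n, r ^ q

lemma one_sub_mul_geo {n : ℕ} {r : A} (h : r ^ n = 0) : (1 - r) * geo n r = 1 := by
  rw [geo, mul_neg_geom_sum, h, sub_zero]

/-- Inverses are unique. This identifies any series characterized as an inverse of `1 - r` after
reduction. -/
lemma eq_geo_of_mul_eq_one {n : ℕ} {r z : A} (h : r ^ n = 0) (hz : (1 - r) * z = 1) :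
    z = geo n r := by
  calc z = ((1 - r) * geo n r) * z := by rw [one_sub_mul_geo h, one_mul]
    _ = ((1 - r) * z) * geo n r := by ring
    _ = geo n r := by rw [hz, one_mul]

lemma geo_eq_one_add {n : ℕ} {r : A} (h : r ^ n = 0) : geo n r = 1 + r * geo n r := by
  linear_combination one_sub_mul_geo h

@[simp] lemma geo_zero {n : ℕ} (hn : 0 < n) : geo n (0 : A) = 1 := by
  obtain ⟨m, rfl⟩ : ∃ m, n = m + 1 := ⟨n - 1, by omega⟩
  simp [geo, sum_range_succ']

lemma pow_pow_eq_zero {n : ℕ} {x : A} (hx : x ^ n = 0) {j : ℕ} (hj : 1 ≤ j) : (x ^ j) ^ n = 0 := by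
  rw [← pow_mul, mul_comm, pow_mul, hx, zero_pow (by omega)]

lemma pow_eq_zero_of_le_exp {n : ℕ} {x : A} (hx : x ^ n = 0) {j : ℕ} (hj : n ≤ j) : x ^ j = 0 := by
  obtain ⟨m, rfl⟩ := Nat.exists_eq_add_of_le hj
  rw [pow_add, hx, zero_mul]

/-- The complete homogeneous symmetric polynomial of degree `B` in the entries of a list. -/
def hc (cs : List A) (B : ℕ) : A :=
  PowerSeries.coeff B (cs.map fun c => PowerSeries.mk fun q => c ^ q).prod

lemma hc_perm {cs cs' : List A} (h : cs.Perm cs') (B : ℕ) : hc cs B = hc cs' B := by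
  rw [hc, hc, (h.map _).prod_eq]

@[simp] lemma hc_degree_zero (cs : List A) : hc cs 0 = 1 := by
  induction cs with
  | nil => simp [hc]
  | cons c cs ih =>
    simp only [hc, PowerSeries.coeff_zero_eq_constantCoeff_apply] at ih
    simp [hc, ih, ← PowerSeries.coeff_zero_eq_constantCoeff_apply (PowerSeries.mk _)]

@[simp] lemma hc_nil_succ (B : ℕ) : hc ([] : List A) (B + 1) = 0 := by
  simp [hc, PowerSeries.coeff_one]

lemma hc_cons (c : A) (cs : List A) (B : ℕ) :
    hc (c :: cs) B = ∑ q ∈ range (B + 1), c ^ q * hc cs (B - q) := by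
  simp only [hc, List.map_cons, List.prod_cons]
  rw [PowerSeries.coeff_mul, Nat.sum_antidiagonal_eq_sum_range_succ_mk]
  simp

lemma hc_cons_succ (c : A) (cs : List A) (B : ℕ) :
    hc (c :: cs) (B + 1) = hc cs (B + 1) + c * hc (c :: cs) B := by
  rw [hc_cons, hc_cons, sum_range_succ', mul_sum, add_comm]
  simp [pow_succ', mul_assoc]

lemma hc_singleton (c : A) (B : ℕ) : hc [c] B = c ^ B := by
  induction B with
  | zero => simp
  | succ B ih => rw [hc_cons_succ, ih, hc_nil_succ, zero_add, pow_succ']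

open Classical in
-- A nilpotent entry occurs at most `n - 1` times in a nonzero monomial, and all remaining degree
-- falls on the unit `u`. For large `B` no monomial in the nilpotent entries is cut off by the
-- degree, so the sum becomes a product of geometric series. Entries equal to zero are neutral,
-- which is why only nonzero ones enter the bound.
lemma hc_stable {n : ℕ} (hn : 0 < n) {u v : A} (huv : u * v = 1) (cs : List A)
    (hcs : ∀ r ∈ cs, r ^ n = 0) (B : ℕ) (hB : n * cs.countP (fun r => r ≠ 0) ≤ B) :
    hc (u :: cs) B = u ^ B * (cs.map fun r => geo n (r * v)).prod := by
  induction cs generalizing B with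
  | nil => simp [hc_singleton]
  | cons r cs ih =>
    have ih' := ih (fun z hz => hcs z (List.mem_cons_of_mem _ hz))
    have hr : r ^ n = 0 := hcs r List.mem_cons_self
    rw [hc_perm (List.Perm.swap r u cs), hc_cons, List.map_cons, List.prod_cons]
    by_cases h0 : r = 0
    · subst h0
      rw [sum_range_succ', sum_eq_zero (by simp)]
      simp only [pow_zero, one_mul, zero_add, Nat.sub_zero, zero_mul, geo_zero hn]
      exact ih' B (by simpa using hB)
    · rw [List.countP_cons_of_pos (by simpa using h0), mul_add, mul_one] at hB
      have hsub : range n ⊆ range (B + 1) := by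
        intro q; simp only [mem_range]; omega
      rw [← sum_subset hsub]
      · rw [geo, sum_mul, mul_sum]
        refine sum_congr rfl fun q hq => ?_
        rw [mem_range] at hq
        rw [ih' (B - q) (by omega)]
        have : u ^ (B - q) = u ^ B * v ^ q := by
          conv_rhs => rw [← Nat.sub_add_cancel (show q ≤ B by omega), pow_add, mul_assoc, ← mul_pow,
            huv, one_pow, mul_one]
        rw [this, mul_pow]; ring
      · intro q _ hq
        rw [mem_range, not_lt] at hq
        rw [pow_eq_zero_of_le_exp hr hq, zero_mul]

/-- The product of the geometric series of `x, x², …, x ^ n`. -/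
def partProd (n : ℕ) (x : A) : A := ∏ j ∈ range n, geo n (x ^ (j + 1))

/-- The term `x ^ j / (1 - x ^ j)`. -/
def lamb (n : ℕ) (x : A) (j : ℕ) : A := x ^ j * geo n (x ^ j)

/-- The Lambert series `∑ j x ^ j / (1 - x ^ j)`. -/
def eisSum (n : ℕ) (x : A) : A := ∑ j ∈ range n, ((j + 1 : ℕ) : A) * lamb n x (j + 1)

lemma lamb_eq_zero {n : ℕ} {x : A} (hx : x ^ n = 0) {j : ℕ} (hj : n ≤ j) : lamb n x j = 0 := by
  rw [lamb, pow_eq_zero_of_le_exp hx hj, zero_mul]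

lemma geo_eq_one_add_lamb {n : ℕ} {x : A} (hx : x ^ n = 0) {j : ℕ} (hj : 1 ≤ j) :
    geo n (x ^ j) = 1 + lamb n x j := geo_eq_one_add (pow_pow_eq_zero hx hj)

lemma geo_pow_eq_one {n : ℕ} (hn : 0 < n) {x : A} (hx : x ^ n = 0) {j : ℕ} (hj : n ≤ j) :
    geo n (x ^ j) = 1 := by
  rw [pow_eq_zero_of_le_exp hx hj, geo_zero hn]

lemma partProd_eq {n N : ℕ} (hn : 0 < n) {x : A} (hx : x ^ n = 0) (hN : n ≤ N + 1) :
    partProd n x = ∏ j ∈ range N, geo n (x ^ (j + 1)) := by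
  have key : ∀ M, n ≤ M + 1 → ∏ j ∈ range M, geo n (x ^ (j + 1)) =
      ∏ j ∈ range (n - 1), geo n (x ^ (j + 1)) := by
    intro M hM
    refine (prod_subset (range_mono (show n - 1 ≤ M by omega)) ?_).symm
    intro j _ hj
    rw [mem_range] at hj
    exact geo_pow_eq_one hn hx (by omega)
  rw [partProd, key n (by omega), key N hN]

lemma sum_mul_lamb {n N : ℕ} {x : A} (hx : x ^ n = 0) (hN : n ≤ N) (c : ℕ → A) :
    ∑ j ∈ Ico 1 N, c j * lamb n x j = ∑ j ∈ Ico 1 n, c j * lamb n x j := by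
  refine (sum_subset (Ico_subset_Ico_right hN) ?_).symm
  intro j hj hj'
  simp only [mem_Ico] at hj hj'
  rw [lamb_eq_zero hx (by omega), mul_zero]

lemma eisSum_eq {n N : ℕ} {x : A} (hx : x ^ n = 0) (hN : n ≤ N) :
    eisSum n x = ∑ j ∈ Ico 1 N, (j : A) * lamb n x j := by
  have h1 : eisSum n x = ∑ j ∈ Ico 1 (n + 1), ((j : ℕ) : A) * lamb n x j := by
    rw [eisSum, range_eq_Ico, sum_Ico_add' (fun j : ℕ => (j : A) * lamb n x j) 0 n 1]
  rw [h1, sum_mul_lamb hx hN, sum_mul_lamb hx (Nat.le_succ n)]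

lemma sum_lamb_inner {n : ℕ} {x : A} (hx : x ^ n = 0) {j : ℕ} (hj : 1 ≤ j) :
    ∑ w ∈ Ico 1 n, x ^ (w * j) = lamb n x j := by
  have h := pow_pow_eq_zero hx hj
  have h2 : geo n (x ^ j) = 1 + ∑ w ∈ Ico 1 n, x ^ (w * j) := by
    rcases Nat.eq_zero_or_pos n with rfl | hn
    · have : (1 : A) = 0 := by simpa using hx
      have hs : Subsingleton A := subsingleton_of_zero_eq_one this.symm
      exact Subsingleton.elim _ _
    · rw [geo, range_eq_Ico, sum_eq_sum_Ico_succ_bot hn]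
      simp [mul_comm, pow_mul]
  have h3 := geo_eq_one_add_lamb hx hj
  linear_combination h3 - h2

/-- With `y = x ^ j`, `y / (1 - y) + (y / (1 - y)) ^ 2 = y / (1 - y) ^ 2 = ∑ q y ^ q`. Exchanging
the sums over `j` and `q` leaves the Lambert series. This is where `E₂` arises in the sum over
levels. -/
lemma sum_lamb_add_sq {n : ℕ} {x : A} (hx : x ^ n = 0) :
    ∑ j ∈ Ico 1 n, (lamb n x j + lamb n x j ^ 2) = eisSum n x := by
  have key : ∀ (y : A), y ^ n = 0 → y * geo n y + (y * geo n y) ^ 2 =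
      ∑ q ∈ Ico 1 n, (q : A) * y ^ q := by
    intro y hy
    have h1 := one_sub_mul_geo hy
    have h2 : (1 - y) * ((1 - y) * ∑ q ∈ Ico 1 n, (q : A) * y ^ q) = y := by
      -- A closed form of the finite sum, whose boundary term has the factor `y ^ m` and dies at `m
      -- = n`.
      have h3 : ∀ m, (1 - y) * ((1 - y) * ∑ q ∈ range m, (q : A) * y ^ q) =
          y - y ^ m * (m + y - m * y) := by
        intro m
        induction m with
        | zero => simp
        | succ m ih =>
          rw [sum_range_succ, mul_add, mul_add, ih]; push_cast; ring
      have h4 : ∑ q ∈ Ico 1 n, (q : A) * y ^ q = ∑ q ∈ range n, (q : A) * y ^ q := by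
        rcases Nat.eq_zero_or_pos n with rfl | hn
        · simp
        · rw [range_eq_Ico, sum_eq_sum_Ico_succ_bot hn]; simp
      rw [h4, h3, hy]; ring
    have h5 : ∑ q ∈ Ico 1 n, (q : A) * y ^ q = y * geo n y ^ 2 := by
      set z := ∑ q ∈ Ico 1 n, (q : A) * y ^ q
      set g := geo n y
      linear_combination g ^ 2 * h2 - (z * (1 - y) * g + z) * h1
    rw [h5]
    linear_combination (- (y * geo n y)) * h1
  have h1 : ∀ j ∈ Ico 1 n, lamb n x j + lamb n x j ^ 2 =
      ∑ q ∈ Ico 1 n, (q : A) * x ^ (j * q) := by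
    intro j hj
    rw [mem_Ico] at hj
    rw [lamb, key _ (pow_pow_eq_zero hx hj.1)]
    simp [pow_mul]
  rw [sum_congr rfl h1, sum_comm, eisSum_eq hx le_rfl]
  refine sum_congr rfl fun q hq => ?_
  rw [mem_Ico] at hq
  rw [← mul_sum, sum_lamb_inner hx hq.1]

end Ring

/-! ### Reduction of power series -/

section Reduction

variable {A : Type*} [CommRing A] {n : ℕ} (φ : PowerSeries ℤ →+* A)

lemma map_eq_of_coeff (hφ : φ PowerSeries.X ^ n = 0) {f g : PowerSeries ℤ}
    (h : ∀ i < n, PowerSeries.coeff i f = PowerSeries.coeff i g) : φ f = φ g := by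
  have : PowerSeries.X ^ n ∣ f - g := by
    rw [PowerSeries.X_pow_dvd_iff]
    intro m hm
    rw [map_sub, h m hm, sub_self]
  obtain ⟨k, hk⟩ := this
  have h2 : φ (f - g) = 0 := by rw [hk, map_mul, map_pow, hφ, zero_mul]
  rwa [map_sub, sub_eq_zero] at h2

lemma map_invOneSub (hφ : φ PowerSeries.X ^ n = 0) : φ invOneSub = geo n (φ PowerSeries.X) := by
  refine eq_geo_of_mul_eq_one hφ ?_
  rw [← map_one φ, ← map_sub, ← map_mul, mul_comm]
  congr 1
  exact PowerSeries.mk_one_mul_one_sub_eq_one ℤ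

lemma map_eisensteinTwo (hφ : φ PowerSeries.X ^ n = 0) :
    φ eisensteinTwo = eisSum n (φ PowerSeries.X) := by
  have h : φ eisensteinTwo = φ (∑ j ∈ Ico 1 n, ∑ q ∈ Ico 1 n,
      ((j : ℕ) : PowerSeries ℤ) * PowerSeries.X ^ (q * j)) := by
    refine map_eq_of_coeff φ hφ fun i hi => ?_
    simp only [map_sum, eisensteinTwo, PowerSeries.coeff_mk, ArithmeticFunction.sigma_one_apply]
    have hc : ∀ j q : ℕ, PowerSeries.coeff i (((j : ℕ) : PowerSeries ℤ) * PowerSeries.X ^ (q * j))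
        = if i = q * j then (j : ℤ) else 0 := by
      intro j q
      rw [← nsmul_eq_mul, map_nsmul, PowerSeries.coeff_X_pow]
      split_ifs <;> simp
    simp only [hc]
    push_cast
    rcases Nat.eq_zero_or_pos i with rfl | hi0
    · simp only [Nat.divisors_zero, sum_empty]
      symm
      refine sum_eq_zero fun j hj => sum_eq_zero fun q hq => ?_
      rw [mem_Ico] at hj hq
      rw [if_neg]
      exact (Nat.mul_pos (by omega) (by omega)).ne
    · have hsub : i.divisors ⊆ Ico 1 n := by
        intro d hd
        have h1 := Nat.pos_of_mem_divisors hd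
        have h2 := Nat.divisor_le hd
        rw [mem_Ico]; omega
      rw [← sum_subset hsub]
      · refine sum_congr rfl fun j hj => ?_
        obtain ⟨⟨q, hq⟩, _⟩ := Nat.mem_divisors.mp hj
        have hj1 := Nat.pos_of_mem_divisors hj
        have hq1 : 0 < q := by
          rcases Nat.eq_zero_or_pos q with rfl | h
          · simp at hq; omega
          · exact h
        rw [sum_eq_single q]
        · rw [if_pos (by rw [hq, mul_comm])]
        · intro q' _ hne
          rw [if_neg]
          intro h
          rw [hq, mul_comm] at h
          exact hne (Nat.eq_of_mul_eq_mul_right hj1 h).symm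
        · intro hnot
          exfalso; apply hnot
          rw [mem_Ico]
          refine ⟨hq1, lt_of_le_of_lt ?_ hi⟩
          rw [hq]; exact Nat.le_mul_of_pos_left q hj1
      · intro j _ hj
        refine sum_eq_zero fun q _ => ?_
        rw [if_neg]
        intro h
        exact hj (Nat.mem_divisors.mpr ⟨⟨q, by rw [h, mul_comm]⟩, by omega⟩)
  rw [h, eisSum_eq hφ le_rfl, map_sum]
  refine sum_congr rfl fun j hj => ?_
  rw [mem_Ico] at hj
  rw [← sum_lamb_inner hφ hj.1, map_sum, mul_sum]
  simp

open scoped PowerSeries.WithPiTopology in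
lemma map_partitionSeries (hn : 0 < n) (hφ : φ PowerSeries.X ^ n = 0) :
    φ partitionSeries = partProd n (φ PowerSeries.X) := by
  -- For discrete coefficients, convergence of Euler's product means that each coefficient is
  -- eventually constant, so a finite product computes the first `n` coefficients.
  let _ : TopologicalSpace ℤ := ⊥
  have : DiscreteTopology ℤ := ⟨rfl⟩
  have hp := Nat.Partition.hasProd_powerSeriesMk_card_restricted ℤ (fun _ => True)
  have hP : (PowerSeries.mk fun m => ((Nat.Partition.restricted m (fun _ => True)).card : ℤ))
      = partitionSeries := by
    ext m
    simp [partitionSeries, Nat.Partition.restricted]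
  rw [hP] at hp
  simp only [if_true] at hp
  rw [HasProd, PowerSeries.WithPiTopology.tendsto_iff_coeff_tendsto] at hp
  have hev : ∀ᶠ s : Finset ℕ in Filter.atTop, ∀ i ∈ range n,
      PowerSeries.coeff i (∏ b ∈ s, ∑' j : ℕ, (PowerSeries.X : PowerSeries ℤ) ^ ((b + 1) * j)) =
        PowerSeries.coeff i partitionSeries := by
    rw [Filter.eventually_all_finset]
    intro i _
    have := hp i
    rw [nhds_discrete] at this
    exact Filter.tendsto_pure.mp this
  obtain ⟨s, hs1, hs2⟩ := (hev.and (Filter.eventually_ge_atTop (range n))).exists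
  have hgeom : ∀ b : ℕ, (1 - PowerSeries.X ^ (b + 1)) *
      ∑' j : ℕ, (PowerSeries.X : PowerSeries ℤ) ^ ((b + 1) * j) = 1 := by
    intro b
    simp only [pow_mul]
    exact PowerSeries.WithPiTopology.one_sub_mul_tsum_pow_of_constantCoeff_eq_zero (by simp)
  have hfac : ∀ b : ℕ, φ (∑' j : ℕ, (PowerSeries.X : PowerSeries ℤ) ^ ((b + 1) * j)) =
      geo n (φ PowerSeries.X ^ (b + 1)) := by
    intro b
    refine eq_geo_of_mul_eq_one (pow_pow_eq_zero hφ (by omega)) ?_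
    rw [← map_one φ, ← map_pow, ← map_sub, ← map_mul, hgeom]
  rw [← map_eq_of_coeff φ hφ (fun i hi => hs1 i (mem_range.mpr hi)), map_prod, partProd]
  simp only [hfac]
  symm
  refine prod_subset hs2 ?_
  intro b _ hb
  rw [mem_range] at hb
  exact geo_pow_eq_one hn hφ (by omega)

end Reduction

/-! ### Arrangements of a multiset of integers -/

section Shuffles

variable {α : Type*} [DecidableEq α]

/-- The lists whose underlying multiset is `M`. -/
def arrangements (M : Multiset α) : Finset (List α) := M.toList.permutations.toFinset

@[simp] lemma mem_arrangements {M : Multiset α} {l : List α} :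
    l ∈ arrangements M ↔ (l : Multiset α) = M := by
  rw [arrangements, List.mem_toFinset, List.mem_permutations, ← Multiset.coe_eq_coe,
    Multiset.coe_toList]

/-- The lists obtained by inserting `B` copies of `k` into a list. -/
def shuffles (k : α) : List α → ℕ → Finset (List α)
  | [], B => {List.replicate B k}
  | h :: u, 0 => {h :: u}
  | h :: u, B + 1 => (shuffles k (h :: u) B).image (List.cons k) ∪
      (shuffles k u (B + 1)).image (List.cons h)
termination_by u B => (u.length, B)

lemma mem_shuffles {k : α} {l u : List α} {B : ℕ} (hk : k ∉ u) :
    l ∈ shuffles k u B ↔ l.filter (fun z => z ≠ k) = u ∧ l.count k = B := by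
  induction l generalizing u B with
  | nil =>
    rcases u with _ | ⟨h, u⟩ <;> rcases B with _ | B <;> simp [shuffles, List.replicate_succ]
  | cons z l ih =>
    rcases u with _ | ⟨h, u⟩
    · simp only [shuffles, mem_singleton]
      rw [List.eq_replicate_iff, List.filter_eq_nil_iff]
      constructor
      · rintro ⟨h1, h2⟩
        refine ⟨fun y hy => by simpa using h2 y hy, ?_⟩
        rw [← h1, List.count_eq_length]
        exact fun y hy => (h2 y hy).symm
      · rintro ⟨h1, h2⟩
        have h3 : ∀ y ∈ z :: l, y = k := fun y hy => by simpa using h1 y hy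
        refine ⟨?_, h3⟩
        rw [← h2, eq_comm, List.count_eq_length]
        exact fun y hy => (h3 y hy).symm
    · rw [List.mem_cons, not_or] at hk
      rcases B with _ | B
      · simp only [shuffles, mem_singleton]
        by_cases hz : z = k
        · subst hz
          simp [hk.1]
        · rw [List.filter_cons_of_pos (by simpa using hz), List.count_cons_of_ne hz]
          rw [List.cons.injEq, List.cons.injEq, and_assoc]
          refine and_congr_right fun _ => ?_
          constructor
          · rintro rfl
            refine ⟨List.filter_eq_self.mpr fun y hy => ?_, List.count_eq_zero.mpr hk.2⟩
            have : y ≠ k := fun h => hk.2 (h ▸ hy)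
            simpa using this
          · rintro ⟨h1, h2⟩
            rw [← h1, eq_comm, List.filter_eq_self]
            intro y hy
            have : y ≠ k := fun h => (List.count_eq_zero.mp h2) (h ▸ hy)
            simpa using this
      · simp only [shuffles, mem_union, mem_image, List.cons.injEq]
        by_cases hz : z = k
        · subst hz
          rw [List.filter_cons_of_neg (by simp), List.count_cons_self]
          have := @ih (h :: u) B (by simp [hk.1, hk.2])
          simp only [Nat.add_right_cancel_iff]
          rw [← this]
          constructor
          · rintro (⟨y, hy, _, rfl⟩ | ⟨y, _, h1, _⟩)
            · exact hy
            · exact absurd h1.symm hk.1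
          · intro h1
            exact Or.inl ⟨l, h1, by simp⟩
        · rw [List.filter_cons_of_pos (by simpa using hz), List.count_cons_of_ne hz]
          rw [List.cons.injEq, and_assoc, ← @ih u (B + 1) hk.2]
          constructor
          · rintro (⟨y, _, h1, _⟩ | ⟨y, hy, h1, rfl⟩)
            · exact absurd h1.symm hz
            · exact ⟨h1.symm, hy⟩
          · rintro ⟨rfl, h2⟩
            exact Or.inr ⟨l, h2, rfl, rfl⟩

lemma coe_eq_of_mem_shuffles {k : α} {l u : List α} {B : ℕ} (hk : k ∉ u)
    (h : l ∈ shuffles k u B) : (l : Multiset α) = Multiset.replicate B k + u := by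
  rw [mem_shuffles hk] at h
  have h1 := Multiset.filter_add_not (fun z => z ≠ k) (l : Multiset α)
  have h2 : Multiset.filter (fun z => ¬ z ≠ k) (l : Multiset α) = Multiset.replicate B k := by
    simp only [not_not, Multiset.filter_eq']
    rw [Multiset.coe_count, h.2]
  rw [h2, Multiset.filter_coe, h.1] at h1
  rw [← h1, add_comm]

/-- An arrangement is determined by its subword of entries different from `k` and by the places of
the copies of `k`. This peels off one value of a multiset of slopes at a time. -/
lemma sum_arrangements_replicate_add {A : Type*} [AddCommMonoid A] {k : α} {B : ℕ}
    {M : Multiset α} (hk : k ∉ M) (f : List α → A) :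
    ∑ l ∈ arrangements (Multiset.replicate B k + M), f l =
      ∑ u ∈ arrangements M, ∑ l ∈ shuffles k u B, f l := by
  have hku : ∀ u ∈ arrangements M, k ∉ u := by
    intro u hu h
    rw [mem_arrangements] at hu
    exact hk (hu ▸ (by simpa using h))
  rw [← sum_biUnion]
  · refine sum_congr ?_ fun _ _ => rfl
    ext l
    simp only [mem_biUnion, mem_arrangements]
    constructor
    · intro h
      have hf : Multiset.filter (fun z => z ≠ k) (l : Multiset α) = M := by
        rw [h, Multiset.filter_add, Multiset.filter_eq_nil.mpr, zero_add, Multiset.filter_eq_self]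
        · intro y hy e; exact hk (e ▸ hy)
        · intro y hy; simpa using Multiset.eq_of_mem_replicate hy
      have hc : l.count k = B := by
        rw [← Multiset.coe_count, h, Multiset.count_add, Multiset.count_replicate_self,
          Multiset.count_eq_zero_of_notMem hk, add_zero]
      rw [Multiset.filter_coe] at hf
      refine ⟨_, hf, ?_⟩
      rw [mem_shuffles (by simp)]
      exact ⟨rfl, hc⟩
    · rintro ⟨u, hu, hl⟩
      rw [coe_eq_of_mem_shuffles (hku u (by simpa using hu)) hl, hu]
  · intro u hu v hv huv
    rw [Function.onFun, disjoint_left]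
    intro l hl hl'
    rw [mem_shuffles (hku u hu)] at hl
    rw [mem_shuffles (hku v hv)] at hl'
    exact huv (hl.1.symm.trans hl'.1)

end Shuffles

/-! ### Inversion cost of an ordering of slopes -/

/-- The cost of a list of integers: the sum of `h - z` over all inversions `(h, z)`. -/
def cost : List ℤ → ℕ
  | [] => 0
  | h :: t => (t.map fun z => (h - z).toNat).sum + cost t

/-- The sum of the minima of all pairs of entries of a list. -/
def pairMin : List ℤ → ℤ
  | [] => 0
  | h :: t => (t.map fun z => min h z).sum + pairMin t

lemma cost_append (p q : List ℤ) :
    cost (p ++ q) = cost p + cost q + (p.map fun h => (q.map fun z => (h - z).toNat).sum).sum := by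
  induction p with
  | nil => simp [cost]
  | cons h t ih => simp only [List.cons_append, cost, List.map_append, List.sum_append, ih,
      List.map_cons, List.sum_cons]; ring

/-- An entry `h` occurs in one prefix for each later entry `z`, and `h = min h z + (h - z)⁺`. The
minima do not depend on the order, so the cost measures how far the prefix sums exceed those of the
sorted list. -/
lemma sum_sum_take (l : List ℤ) :
    ∑ i ∈ range l.length, (l.take i).sum = pairMin l + cost l := by
  induction l with
  | nil => simp [pairMin, cost]
  | cons h t ih =>
    have h1 : ∀ t : List ℤ, (t.length : ℤ) * h = (t.map fun z => min h z).sum +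
        ((t.map fun z => (h - z).toNat).sum : ℕ) := by
      intro t
      induction t with
      | nil => simp
      | cons z t ih =>
        simp only [List.length_cons, List.map_cons, List.sum_cons]
        push_cast at ih ⊢
        have : (h : ℤ) = min h z + ((h - z).toNat : ℤ) := by omega
        linarith
    rw [List.length_cons, sum_range_succ']
    simp only [List.take_succ_cons, List.sum_cons, List.take_zero, List.sum_nil, add_zero]
    rw [sum_add_distrib, ih, sum_const, card_range, nsmul_eq_mul, h1 t, pairMin, cost]
    push_cast; ring

/-- The right-hand side is visibly symmetric, so `pairMin` depends only on the multiset. -/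
lemma two_mul_pairMin (l : List ℤ) :
    2 * pairMin l + l.sum = (l.map fun z => (l.map fun z' => min z z').sum).sum := by
  induction l with
  | nil => simp [pairMin]
  | cons h t ih =>
    simp only [pairMin, List.sum_cons, List.map_cons, min_self, List.sum_map_add]
    rw [← ih]
    have : (t.map fun z => min z h) = t.map fun z => min h z := by simp [min_comm]
    rw [this]; ring

lemma pairMin_perm {l l' : List ℤ} (h : (l : Multiset ℤ) = l') : pairMin l = pairMin l' := by
  have hp : l.Perm l' := Multiset.coe_eq_coe.mp h
  have h1 := two_mul_pairMin l
  have h2 := two_mul_pairMin l'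
  have h3 : (l.map fun z => (l.map fun z' => min z z').sum).sum =
      (l'.map fun z => (l'.map fun z' => min z z').sum).sum := by
    have : ∀ z, (l.map fun z' => min z z').sum = (l'.map fun z' => min z z').sum :=
      fun z => (hp.map _).sum_eq
    simp only [this]
    exact (hp.map _).sum_eq
  have h4 := hp.sum_eq
  omega

lemma le_sum_of_count {α : Type*} [DecidableEq α] (f : α → ℕ) (k : α) (hk : 1 ≤ f k)
    (t : List α) : t.count k ≤ (t.map f).sum := by
  induction t with
  | nil => simp
  | cons z t ih =>
    rw [List.map_cons, List.sum_cons]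
    by_cases hz : z = k
    · subst hz; rw [List.count_cons_self]; omega
    · rw [List.count_cons_of_ne hz]; omega

/-- A larger entry among the first `n` places would precede at least `n` copies of `k`, since fewer
than `n` of the `2 * n` copies can stand before it; each such inversion costs at least one. -/
lemma take_eq_replicate_of_cost_lt {l : List ℤ} {k : ℤ} {n : ℕ} (hmin : ∀ z ∈ l, k ≤ z)
    (hcount : 2 * n ≤ l.count k) (hcost : cost l < n) {i : ℕ} (hi : i ≤ n) :
    l.take i = List.replicate i k := by
  have hlen := List.count_le_length (a := k) (l := l)
  rw [List.eq_replicate_iff]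
  refine ⟨by rw [List.length_take]; omega, fun z hz => ?_⟩
  by_contra hne
  obtain ⟨p, q, hpq⟩ := List.append_of_mem hz
  have hl : l = p ++ z :: (q ++ l.drop i) := by
    conv_lhs => rw [← List.take_append_drop i l, hpq]
    simp
  have hp : p.length < n := by
    have := congrArg List.length hpq
    rw [List.length_take, List.length_append, List.length_cons] at this
    omega
  have hz' : k ≤ z := hmin z (List.mem_of_mem_take hz)
  have h1 : cost l ≥ (q ++ l.drop i).count k := by
    rw [hl, cost_append]
    simp only [cost]
    have := le_sum_of_count (fun y => (z - y).toNat) k (by omega) (q ++ l.drop i)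
    rw [← hl]
    omega
  have h2 : l.count k = p.count k + (q ++ l.drop i).count k := by
    conv_lhs => rw [hl]
    rw [List.count_append, List.count_cons_of_ne hne]
  have h3 := List.count_le_length (a := k) (l := p)
  omega

lemma drop_eq_replicate_of_cost_lt {l : List ℤ} {k : ℤ} {n : ℕ} (hmax : ∀ z ∈ l, z ≤ k)
    (hcount : 2 * n ≤ l.count k) (hcost : cost l < n) {i : ℕ} (hi : i ≤ n) :
    l.drop (l.length - i) = List.replicate i k := by
  have hlen := List.count_le_length (a := k) (l := l)
  rw [List.eq_replicate_iff]
  refine ⟨by rw [List.length_drop]; omega, fun z hz => ?_⟩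
  by_contra hne
  obtain ⟨p, q, hpq⟩ := List.append_of_mem hz
  set r := l.take (l.length - i) with hr
  have hl : l = (r ++ p) ++ z :: q := by
    conv_lhs => rw [← List.take_append_drop (l.length - i) l, hpq]
    simp [hr]
  have hq : q.length < n := by
    have := congrArg List.length hpq
    rw [List.length_drop, List.length_append, List.length_cons] at this
    omega
  have hz' : z ≤ k := hmax z (List.mem_of_mem_drop hz)
  have h1 : (r ++ p).count k ≤ cost l := by
    have e := le_sum_of_count (fun y => ((z :: q).map fun w => (y - w).toNat).sum) k
      (by simp only [List.map_cons, List.sum_cons]; omega) (r ++ p)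
    rw [hl, cost_append]
    omega
  have h2 : l.count k = (r ++ p).count k + q.count k := by
    conv_lhs => rw [hl]
    rw [List.count_append, List.count_cons_of_ne hne]
  have h3 := List.count_le_length (a := k) (l := q)
  omega

/-! ### Partition numbers from arrangements of slopes -/

section PartitionLimit

variable {A : Type*} [CommRing A]

/-- The weights of the places at which a copy of `k` may be inserted into a list. -/
def slotL (x : A) (k : ℤ) : ℕ → List ℤ → List A
  | e, [] => [x ^ e]
  | e, h :: u => x ^ e :: slotL x k (e + (h - k).toNat) u

lemma cost_replicate (B : ℕ) (k : ℤ) : cost (List.replicate B k) = 0 := by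
  induction B with
  | zero => rfl
  | succ B ih => simp [List.replicate_succ, cost, ih]

/-- A copy of the smallest value `k` pays `h - k` for every entry `h` before it, so its cost depends
only on its place; `e` is the cost accumulated so far. Choosing places with repetition gives a
complete homogeneous polynomial, and the recursion of `shuffles` is that of `hc_cons_succ`. -/
lemma sum_shuffles_cost (x : A) (k : ℤ) (u : List ℤ) (hu : ∀ z ∈ u, k < z) (B e : ℕ) :
    ∑ l ∈ shuffles k u B, x ^ (e * B + cost l) = x ^ cost u * hc (slotL x k e u) B := by
  induction u, B using shuffles.induct generalizing e with
  | case1 B => simp [shuffles, slotL, hc_singleton, cost_replicate, cost, pow_mul]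
  | case2 h u => simp [shuffles]
  | case3 h u B ih1 ih2 =>
    have hk : k ∉ h :: u := fun hm => lt_irrefl _ (hu k hm)
    have hk' : k ∉ u := fun hm => hk (List.mem_cons_of_mem _ hm)
    have hh : k < h := hu h List.mem_cons_self
    have hu' : ∀ z ∈ u, k < z := fun z hz => hu z (List.mem_cons_of_mem _ hz)
    rw [shuffles, sum_union, sum_image (fun _ _ _ _ h => (List.cons.inj h).2),
      sum_image (fun _ _ _ _ h => (List.cons.inj h).2)]
    · have e1 : ∀ l ∈ shuffles k (h :: u) B, x ^ (e * (B + 1) + cost (k :: l)) =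
          x ^ e * x ^ (e * B + cost l) := by
        intro l hl
        have hl' := coe_eq_of_mem_shuffles hk hl
        have : (l.map fun z => (k - z).toNat).sum = 0 := by
          rw [List.sum_eq_zero]
          intro y hy
          obtain ⟨z, hz, rfl⟩ := List.mem_map.mp hy
          have hz' : z ∈ (l : Multiset ℤ) := hz
          rw [hl', Multiset.mem_add] at hz'
          rcases hz' with hz' | hz'
          · rw [Multiset.eq_of_mem_replicate hz']; simp
          · have := hu z hz'; omega
        rw [cost, this, ← pow_add]; congr 1; ring
      have e2 : ∀ l ∈ shuffles k u (B + 1), x ^ (e * (B + 1) + cost (h :: l)) =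
          x ^ (u.map fun z => (h - z).toNat).sum *
            x ^ ((e + (h - k).toNat) * (B + 1) + cost l) := by
        intro l hl
        have hl' := coe_eq_of_mem_shuffles hk' hl
        have : (l.map fun z => (h - z).toNat).sum =
            (B + 1) * (h - k).toNat + (u.map fun z => (h - z).toNat).sum := by
          have := congrArg (fun M : Multiset ℤ => (M.map fun z => (h - z).toNat).sum) hl'
          simp at this
          rw [this]; ring
        rw [cost, this, ← pow_add]; congr 1; ring
      rw [sum_congr rfl e1, sum_congr rfl e2, ← mul_sum, ← mul_sum, ih1 hu, ih2 hu']
      rw [slotL, hc_cons_succ, cost, pow_add]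
      ring
    · rw [disjoint_left]
      intro l hl hl'
      obtain ⟨y, _, rfl⟩ := mem_image.mp hl
      obtain ⟨z, _, hz⟩ := mem_image.mp hl'
      exact hh.ne (List.cons.inj hz).1.symm

lemma slotL_replicate_append (x : A) (k : ℤ) (e q : ℕ) (u : List ℤ) :
    slotL x k e (List.replicate q (k + 1) ++ u) =
      ((List.range q).map fun i => x ^ (e + i)) ++ slotL x k (e + q) u := by
  induction q generalizing e with
  | zero => simp
  | succ q ih =>
    rw [List.replicate_succ, List.cons_append, slotL, List.range_succ_eq_map]
    simp only [List.map_cons, List.cons_append, add_zero, List.map_map]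
    congr 1
    have : (k + 1 - k).toNat = 1 := by omega
    rw [this, ih]
    congr 1
    · apply List.map_congr_left; intro i _; simp only [Function.comp]; congr 1; omega
    · congr 1; omega

lemma slotL_eq_zero {n : ℕ} {x : A} (hx : x ^ n = 0) (k : ℤ) {e : ℕ} (he : n ≤ e) (u : List ℤ) :
    ∀ r ∈ slotL x k e u, r = 0 := by
  induction u generalizing e with
  | nil => simp [slotL, pow_eq_zero_of_le_exp hx he]
  | cons h u ih =>
    intro r hr
    rw [slotL, List.mem_cons] at hr
    rcases hr with rfl | hr
    · exact pow_eq_zero_of_le_exp hx he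
    · exact ih (by omega) r hr

lemma prod_geo_eq_one {n : ℕ} (hn : 0 < n) (cs : List A) (h : ∀ r ∈ cs, r = 0) (v : A) :
    (cs.map fun r => geo n (r * v)).prod = 1 := by
  rw [List.prod_eq_one]
  intro y hy
  obtain ⟨r, hr, rfl⟩ := List.mem_map.mp hy
  rw [h r hr, zero_mul, geo_zero hn]

/-- When the list starts with copies of `k + 1`, successive places have the weights `1, x, x², …`,
and the later ones vanish. The stable value of the homogeneous polynomial is then Euler's product.
-/
lemma hc_slotL {n : ℕ} (hn : 0 < n) {x : A} (hx : x ^ n = 0) {k : ℤ} {u : List ℤ}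
    (hu : u.take n = List.replicate n (k + 1)) {B : ℕ} (hB : n * n ≤ B) :
    hc (slotL x k 0 u) B = partProd n x := by
  classical
  obtain ⟨m, rfl⟩ : ∃ m, n = m + 1 := ⟨n - 1, by omega⟩
  rw [← List.take_append_drop (m + 1) u, hu, slotL_replicate_append, List.range_succ_eq_map]
  simp only [List.map_cons, List.cons_append, List.map_map, pow_zero, zero_add]
  set zs := slotL x k (m + 1) (u.drop (m + 1)) with hzs
  have hz : ∀ r ∈ zs, r = 0 := slotL_eq_zero hx k le_rfl _
  rw [hc_stable hn (one_mul 1)]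
  · rw [List.map_append, List.prod_append, prod_geo_eq_one hn zs hz, one_pow, one_mul, mul_one,
      partProd_eq (N := m) hn hx le_rfl, List.map_map]
    rw [Finset.prod_eq_multiset_prod]
    simp [Multiset.range, Function.comp_def]
  · intro r hr
    rw [List.mem_append] at hr
    rcases hr with hr | hr
    · obtain ⟨i, _, rfl⟩ := List.mem_map.mp hr
      exact pow_pow_eq_zero hx (by simp)
    · rw [hz r hr, zero_pow (by omega)]
  · have h0 : zs.countP (fun r => r ≠ 0) = 0 := by
      rw [List.countP_eq_zero]; intro r hr; simp [hz r hr]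
    have h1 := List.countP_le_length (p := fun r : A => decide (r ≠ 0))
      (l := (List.range m).map ((fun i => x ^ i) ∘ Nat.succ))
    rw [List.length_map, List.length_range] at h1
    refine le_trans (Nat.mul_le_mul_left _ ?_) hB
    rw [List.countP_append, h0]
    omega

/-- The multiset in which the consecutive integers from `k` have the given multiplicities. -/
def block : ℤ → List ℕ → Multiset ℤ
  | _, [] => 0
  | k, m :: ms => Multiset.replicate m k + block (k + 1) ms

lemma le_of_mem_block {k z : ℤ} {ms : List ℕ} (h : z ∈ block k ms) :
    k ≤ z ∧ z < k + ms.length := by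
  induction ms generalizing k with
  | nil => simp [block] at h
  | cons m ms ih =>
    rw [block, Multiset.mem_add] at h
    rw [List.length_cons]
    rcases h with h | h
    · rw [Multiset.eq_of_mem_replicate h]; push_cast; omega
    · have := ih h; push_cast; omega

lemma count_block (k : ℤ) (m : ℕ) (ms : List ℕ) : (block k (m :: ms)).count k = m := by
  rw [block, Multiset.count_add, Multiset.count_replicate_self, Multiset.count_eq_zero_of_notMem,
    add_zero]
  intro h
  have := le_of_mem_block h
  omega

lemma count_block_last (k : ℤ) (ms : List ℕ) (m : ℕ) :
    (block k (ms ++ [m])).count (k + ms.length) = m := by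
  induction ms generalizing k with
  | nil => simp [block]
  | cons m' ms ih =>
    rw [List.cons_append, block, Multiset.count_add, Multiset.count_replicate, if_neg, zero_add]
    · have := ih (k + 1)
      rw [List.length_cons]; push_cast
      rwa [show k + ((ms.length : ℤ) + 1) = k + 1 + ms.length by ring]
    · rw [List.length_cons]; push_cast; omega

/-- Inserting the copies of the smallest value into an arrangement of the others yields one factor
`p`: if that arrangement has cost less than `n`, it starts with the next value and `hc_slotL`
applies, and otherwise its term vanishes. The last value has nothing to be inserted into, so there
is one factor fewer than values. -/
theorem sum_arrangements_cost {n : ℕ} (hn : 0 < n) {x : A} (hx : x ^ n = 0) (k : ℤ) (m : ℕ)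
    (ms : List ℕ) (hm : ∀ z ∈ m :: ms, n * n + 2 * n ≤ z) :
    ∑ l ∈ arrangements (block k (m :: ms)), x ^ cost l = partProd n x ^ ms.length := by
  induction ms generalizing k m with
  | nil =>
    have : arrangements (block k [m]) = {List.replicate m k} := by
      ext l
      rw [mem_arrangements, mem_singleton, block, block, add_zero, ← Multiset.coe_replicate,
        Multiset.coe_eq_coe, List.perm_replicate]
    rw [this]
    simp [cost_replicate]
  | cons m' ms ih =>
    have hk : k ∉ block (k + 1) (m' :: ms) := by
      intro h; have := le_of_mem_block h; omega
    rw [block, sum_arrangements_replicate_add hk]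
    have h1 : ∀ u ∈ arrangements (block (k + 1) (m' :: ms)),
        ∑ l ∈ shuffles k u m, x ^ cost l = partProd n x * x ^ cost u := by
      intro u hu
      rw [mem_arrangements] at hu
      have hmin : ∀ z ∈ u, k + 1 ≤ z := by
        intro z hz
        have : z ∈ block (k + 1) (m' :: ms) := by rw [← hu]; exact hz
        exact (le_of_mem_block this).1
      have h2 := sum_shuffles_cost x k u (fun z hz => by have := hmin z hz; omega) m 0
      simp only [zero_mul, zero_add] at h2
      rw [h2]
      by_cases hc' : cost u < n
      · have hcount : 2 * n ≤ u.count (k + 1) := by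
          rw [← Multiset.coe_count, hu, count_block]
          have := hm m' (by simp)
          omega
        rw [hc_slotL hn hx (take_eq_replicate_of_cost_lt hmin hcount hc' le_rfl), mul_comm]
        have := hm m (by simp)
        omega
      · rw [pow_eq_zero_of_le_exp hx (by omega), zero_mul, mul_zero]
    rw [sum_congr rfl h1, ← mul_sum, ih (k + 1) m' (fun z hz => hm z (List.mem_cons_of_mem _ hz)),
      List.length_cons, pow_succ']

end PartitionLimit

/-! ### Logarithmic derivatives in dual numbers -/

section Dual

variable {R : Type*} [CommRing R]

/-- The dual number `p (1 + q ε)`. -/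
def ld (p q : R) : DualNumber R := TrivSqZeroExt.inl p + TrivSqZeroExt.inr (p * q)

@[simp] lemma fst_ld (p q : R) : (ld p q).fst = p := by simp [ld]
@[simp] lemma snd_ld (p q : R) : (ld p q).snd = p * q := by simp [ld]

lemma ld_ext {z : DualNumber R} {p q : R} (h1 : z.fst = p) (h2 : z.snd = p * q) : z = ld p q :=
  TrivSqZeroExt.ext (by simpa using h1) (by simpa using h2)

lemma ld_one_zero : ld (1 : R) 0 = 1 := by
  symm; exact ld_ext (by simp) (by simp)

lemma ld_mul (p q p' q' : R) : ld p q * ld p' q' = ld (p * p') (q + q') :=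
  ld_ext (by simp) (by simp; ring)

lemma ld_pow (p q : R) (m : ℕ) : ld p q ^ m = ld (p ^ m) (m * q) := by
  induction m with
  | zero => simp [ld_one_zero]
  | succ m ih => rw [pow_succ, ih, ld_mul, pow_succ]; congr 1; push_cast; ring

lemma ld_prod {ι : Type*} (s : Finset ι) (p q : ι → R) :
    ∏ i ∈ s, ld (p i) (q i) = ld (∏ i ∈ s, p i) (∑ i ∈ s, q i) := by
  classical
  induction s using Finset.induction_on with
  | empty => simp [ld_one_zero]
  | insert i s hi ih => rw [prod_insert hi, ih, ld_mul, prod_insert hi, sum_insert hi]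

lemma geo_eq_ld {n : ℕ} {r : DualNumber R} {y q : R} (hr : r ^ n = 0) (hy : y ^ n = 0)
    (h : 1 - r = ld (1 - y) q) : geo n r = ld (geo n y) (-q) := by
  symm
  refine eq_geo_of_mul_eq_one hr ?_
  rw [h, ld_mul, one_sub_mul_geo hy, add_neg_cancel, ld_one_zero]

lemma ld_one_pow_eq_zero {n : ℕ} {x : R} (hx : x ^ n = 0) (q : R) : ld x q ^ n = 0 := by
  rw [ld_pow, hx]; exact TrivSqZeroExt.ext (by simp) (by simp)

/-- The logarithmic derivative `x p' / p` is the Lambert series of `E₂`. -/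
lemma partProd_ld {n : ℕ} {x : R} (hx : x ^ n = 0) :
    partProd n (ld x 1) = ld (partProd n x) (eisSum n x) := by
  have h : ∀ j ∈ range n, geo n (ld x 1 ^ (j + 1)) =
      ld (geo n (x ^ (j + 1))) (((j + 1 : ℕ) : R) * lamb n x (j + 1)) := by
    intro j _
    have hj := pow_pow_eq_zero hx (show 1 ≤ j + 1 by omega)
    rw [show ((j + 1 : ℕ) : R) * lamb n x (j + 1) = -(-(((j + 1 : ℕ) : R) * lamb n x (j + 1))) by
      ring]
    refine geo_eq_ld (pow_pow_eq_zero (ld_one_pow_eq_zero hx 1) (by omega)) hj ?_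
    rw [ld_pow]
    refine ld_ext (by simp) ?_
    have h1 := one_sub_mul_geo hj
    simp only [TrivSqZeroExt.snd_sub, TrivSqZeroExt.snd_one, snd_ld, lamb, mul_one, zero_sub]
    linear_combination (x ^ (j + 1) * ((j + 1 : ℕ) : R)) * h1
  rw [partProd, prod_congr rfl h, ld_prod]
  rfl

/-- The previous count at the dual number `x (1 + ε)`: the power with exponent `c` is `x ^ c (1 + c
ε)`, so the `ε`-part weights each arrangement by its cost. -/
theorem sum_arrangements_cost_mul {n : ℕ} (hn : 0 < n) {x : R} (hx : x ^ n = 0) (k : ℤ) (m : ℕ)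
    (ms : List ℕ) (hm : ∀ z ∈ m :: ms, n * n + 2 * n ≤ z) :
    ∑ l ∈ arrangements (block k (m :: ms)), x ^ cost l * (cost l : R) =
      partProd n x ^ ms.length * (ms.length * eisSum n x) := by
  have h := sum_arrangements_cost hn (ld_one_pow_eq_zero hx 1) k m ms hm
  rw [partProd_ld hx, ld_pow] at h
  have h2 := congrArg TrivSqZeroExt.snd h
  rw [TrivSqZeroExt.snd_sum, snd_ld] at h2
  rw [← h2]
  refine sum_congr rfl fun l _ => ?_
  rw [ld_pow, snd_ld, mul_one]

end Dual

/-! ### Words of ends -/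

/-- A letter of the word of a diagram in which all floors and bounded edges are replaced by `K`:
a source that enters or a sink that leaves the floor number `m` gives the letter `S m` or `T m`. -/
inductive Ltr where
  | K
  | S (m : ℕ)
  | T (m : ℕ)

namespace Ltr

/-- The letter stands for a floor or a bounded edge. -/
def isK : Ltr → Bool
  | K => true
  | _ => false

/-- The letter stands for a source. -/
def isS : Ltr → Bool
  | S _ => true
  | _ => false

/-- The letter stands for a sink. -/
def isT : Ltr → Bool
  | T _ => true
  | _ => false

end Ltr

instance : DecidableEq Ltr := Classical.decEq _

/-- The words of length `N` in an alphabet. -/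
def words {α : Type*} [DecidableEq α] (alph : Finset α) : ℕ → Finset (List α)
  | 0 => {[]}
  | N + 1 => (alph ×ˢ words alph N).image fun p => p.1 :: p.2

lemma mem_words {α : Type*} [DecidableEq α] {alph : Finset α} {N : ℕ} {l : List α} :
    l ∈ words alph N ↔ l.length = N ∧ ∀ z ∈ l, z ∈ alph := by
  induction N generalizing l with
  | zero => rcases l with _ | ⟨z, l⟩ <;> simp [words]
  | succ N ih =>
    rcases l with _ | ⟨z, l⟩
    · simp [words]
    · simp only [words, mem_image, mem_product, Prod.exists, List.cons.injEq, List.length_cons,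
        Nat.add_right_cancel_iff, List.forall_mem_cons]
      constructor
      · rintro ⟨z', l', ⟨h1, h2⟩, rfl, rfl⟩
        rw [ih] at h2
        exact ⟨h2.1, h1, h2.2⟩
      · rintro ⟨h1, h2, h3⟩
        exact ⟨z, l, ⟨h2, ih.mpr ⟨h1, h3⟩⟩, rfl, rfl⟩

lemma sum_words_succ {α A : Type*} [DecidableEq α] [AddCommMonoid A] (alph : Finset α) (N : ℕ)
    (f : List α → A) :
    ∑ l ∈ words alph (N + 1), f l = ∑ z ∈ alph, ∑ l ∈ words alph N, f (z :: l) := by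
  rw [words, sum_image, sum_product]
  rintro ⟨z, l⟩ _ ⟨z', l'⟩ _ h
  simpa using h

/-- The letters that refer to floors with number at most `a`. -/
def letters (a : ℕ) : Finset Ltr :=
  insert Ltr.K ((range (a + 1)).image Ltr.S ∪ (range (a + 1)).image Ltr.T)

lemma sum_letters {A : Type*} [AddCommMonoid A] (a : ℕ) (f : Ltr → A) :
    ∑ z ∈ letters a, f z = f Ltr.K + (∑ m ∈ range (a + 1), f (Ltr.S m) +
      ∑ m ∈ range (a + 1), f (Ltr.T m)) := by
  rw [letters, sum_insert, sum_union, sum_image, sum_image]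
  · intro _ _ _ _ h; exact Ltr.T.inj h
  · intro _ _ _ _ h; exact Ltr.S.inj h
  · rw [disjoint_left]
    intro z h h'
    obtain ⟨m, _, rfl⟩ := mem_image.mp h
    obtain ⟨m', _, h2⟩ := mem_image.mp h'
    cases h2
  · simp

/-- The ends of a word are attached in agreement with the order, `lev p` being the number of floors
among the first `p` floors and bounded edges. -/
def ValidWord (a : ℕ) : (ℕ → ℕ) → List Ltr → Prop
  | _, [] => True
  | lev, Ltr.K :: ω => ValidWord a (fun p => lev (p + 1)) ω
  | lev, Ltr.S m :: ω => (lev 0 < m ∧ m ≤ a) ∧ ValidWord a lev ω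
  | lev, Ltr.T m :: ω => (1 ≤ m ∧ m ≤ lev 0 ∧ m ≤ a) ∧ ValidWord a lev ω

/-- The word starts with `s` pairs of equal sources. -/
def PairPrefix : ℕ → List Ltr → Prop
  | 0, _ => True
  | s + 1, Ltr.S m :: Ltr.S m' :: ω => m = m' ∧ PairPrefix s ω
  | _ + 1, _ => False

open Classical in
/-- The valid words with `κ` letters `K`, with `B` sources and `B'` sinks that start with `s` pairs
of equal sources. -/
def endWords (a s : ℕ) (lev : ℕ → ℕ) (κ B B' : ℕ) : Finset (List Ltr) :=
  (words (letters a) (κ + B + B')).filter fun ω => ValidWord a lev ω ∧ PairPrefix s ω ∧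
    ω.countP Ltr.isK = κ ∧ ω.countP Ltr.isS = B ∧ ω.countP Ltr.isT = B'

lemma mem_letters_of_validWord {a : ℕ} {lev : ℕ → ℕ} {ω : List Ltr} (h : ValidWord a lev ω) :
    ∀ z ∈ ω, z ∈ letters a := by
  induction ω generalizing lev with
  | nil => simp
  | cons z ω ih =>
    rw [List.forall_mem_cons]
    rcases z with _ | m | m
    · exact ⟨by simp [letters], ih h⟩
    · exact ⟨by simp [letters]; have := h.1; omega, ih h.2⟩
    · exact ⟨by simp [letters]; have := h.1; omega, ih h.2⟩

lemma length_eq_counts (ω : List Ltr) :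
    ω.length = ω.countP Ltr.isK + ω.countP Ltr.isS + ω.countP Ltr.isT := by
  induction ω with
  | nil => simp
  | cons z ω ih =>
    rcases z with _ | m | m <;> simp [List.countP_cons, Ltr.isK, Ltr.isS, Ltr.isT, ih] <;> omega

lemma mem_endWords {a s : ℕ} {lev : ℕ → ℕ} {κ B B' : ℕ} {ω : List Ltr} :
    ω ∈ endWords a s lev κ B B' ↔ ValidWord a lev ω ∧ PairPrefix s ω ∧
      ω.countP Ltr.isK = κ ∧ ω.countP Ltr.isS = B ∧ ω.countP Ltr.isT = B' := by
  simp only [endWords, mem_filter, and_iff_right_iff_imp, mem_words]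
  rintro ⟨h1, -, rfl, rfl, rfl⟩
  exact ⟨length_eq_counts ω, mem_letters_of_validWord h1⟩

/-- The list of the values of `f` at `lev 0, …, lev κ`. -/
def slotList {A : Type*} (f : ℕ → A) (lev : ℕ → ℕ) (κ : ℕ) : List A :=
  (List.range (κ + 1)).map fun q => f (lev q)

lemma slotList_succ {A : Type*} (f : ℕ → A) (lev : ℕ → ℕ) (κ : ℕ) :
    slotList f lev (κ + 1) = f (lev 0) :: slotList f (fun p => lev (p + 1)) κ := by
  rw [slotList, List.range_succ_eq_map]; simp [slotList, Function.comp_def]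

lemma slotList_eq_cons {A : Type*} (f : ℕ → A) (lev : ℕ → ℕ) (κ : ℕ) :
    ∃ cs, slotList f lev κ = f (lev 0) :: cs ∧
      (∀ κ', κ = κ' + 1 → cs = slotList f (fun p => lev (p + 1)) κ') ∧ (κ = 0 → cs = []) := by
  rcases κ with _ | κ
  · exact ⟨[], by simp [slotList], by simp, by simp⟩
  · refine ⟨_, slotList_succ f lev κ, ?_, by simp⟩
    intro κ' h; rw [Nat.add_right_cancel h]

/-! ### Factorization of sums over words of ends -/

section EndSum

variable {A : Type*} [CommRing A]

/-- The weight of a letter. -/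
def ltrWt (α β : ℕ → A) : Ltr → A
  | Ltr.K => 1
  | Ltr.S m => α m
  | Ltr.T m => β m

/-- The total weight of a source at a given place. -/
def slotS (a : ℕ) (α : ℕ → A) (c : ℕ) : A := ∑ m ∈ Ioc c a, α m

/-- The total weight of a sink at a given place. -/
def slotT (a : ℕ) (β : ℕ → A) (c : ℕ) : A := ∑ m ∈ Icc 1 (min c a), β m

lemma sum_range_ite_slotS (a : ℕ) (α : ℕ → A) (c : ℕ) :
    ∑ m ∈ range (a + 1), (if c < m ∧ m ≤ a then α m else 0) = slotS a α c := by
  rw [← sum_filter, slotS]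
  refine sum_congr ?_ fun _ _ => rfl
  ext m; simp only [mem_filter, mem_range, mem_Ioc]; omega

lemma sum_range_ite_slotT (a : ℕ) (β : ℕ → A) (c : ℕ) :
    ∑ m ∈ range (a + 1), (if 1 ≤ m ∧ m ≤ c ∧ m ≤ a then β m else 0) = slotT a β c := by
  rw [← sum_filter, slotT]
  refine sum_congr ?_ fun _ _ => rfl
  ext m; simp only [mem_filter, mem_range, mem_Icc]; omega

lemma ite_and_mul (P Q : Prop) [Decidable P] [Decidable Q] [Decidable (P ∧ Q)] (u v : A) :
    (if P ∧ Q then u * v else 0) = (if P then u else 0) * (if Q then v else 0) := by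
  split_ifs <;> simp_all

open Classical in
-- Induction on the first letter: `K` discards the first place, a source or a sink uses it. The
-- three cases reproduce the product of the two homogeneous polynomials up to an error in which the
-- first place carries both a source and a sink; the hypothesis on products of place weights kills
-- it, so sources and sinks are distributed independently.
lemma sum_endWords_zero (a : ℕ) (α β : ℕ → A) (N : ℕ) (lev : ℕ → ℕ) (κ B B' : ℕ)
    (hN : N = κ + B + B') (h0 : ∀ q ≤ κ, slotS a α (lev q) * slotT a β (lev q) = 0) :
    (∑ ω ∈ words (letters a) N, if ValidWord a lev ω ∧
        ω.countP Ltr.isK = κ ∧ ω.countP Ltr.isS = B ∧ ω.countP Ltr.isT = B'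
      then (ω.map (ltrWt α β)).prod else 0) =
      hc (slotList (slotS a α) lev κ) B * hc (slotList (slotT a β) lev κ) B' := by
  induction N generalizing lev κ B B' with
  | zero =>
    obtain ⟨rfl, rfl, rfl⟩ : κ = 0 ∧ B = 0 ∧ B' = 0 := by omega
    simp [words, ValidWord]
  | succ N ih =>
    rw [sum_words_succ, sum_letters]
    obtain ⟨cs, hcs, hcs1, hcs0⟩ := slotList_eq_cons (slotS a α) lev κ
    obtain ⟨ct, hct, hct1, hct0⟩ := slotList_eq_cons (slotT a β) lev κ
    have hK : (∑ l ∈ words (letters a) N, if ValidWord a lev (Ltr.K :: l) ∧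
        (Ltr.K :: l).countP Ltr.isK = κ ∧ (Ltr.K :: l).countP Ltr.isS = B ∧
          (Ltr.K :: l).countP Ltr.isT = B'
        then ((Ltr.K :: l).map (ltrWt α β)).prod else 0) = hc cs B * hc ct B' := by
      rcases κ with _ | κ
      · rw [sum_eq_zero]
        · rw [hcs0 rfl, hct0 rfl]
          rcases B with _ | B
          · rcases B' with _ | B'
            · omega
            · simp
          · simp
        · intro l _
          rw [if_neg]
          simp [List.countP_cons, Ltr.isK]
      · rw [hcs1 κ rfl, hct1 κ rfl, ← ih _ κ B B' (by omega)
          (fun q hq => h0 (q + 1) (by omega))]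
        refine sum_congr rfl fun l _ => ?_
        simp [List.countP_cons, Ltr.isK, Ltr.isS, Ltr.isT, ValidWord, ltrWt]
    have hS : (∑ m ∈ range (a + 1), ∑ l ∈ words (letters a) N,
        if ValidWord a lev (Ltr.S m :: l) ∧
        (Ltr.S m :: l).countP Ltr.isK = κ ∧ (Ltr.S m :: l).countP Ltr.isS = B ∧
          (Ltr.S m :: l).countP Ltr.isT = B'
        then ((Ltr.S m :: l).map (ltrWt α β)).prod else 0) =
        (hc (slotList (slotS a α) lev κ) B - hc cs B) *
          hc (slotList (slotT a β) lev κ) B' := by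
      rcases B with _ | B
      · rw [hc_degree_zero, hc_degree_zero, sub_self, zero_mul]
        refine sum_eq_zero fun m _ => sum_eq_zero fun l _ => ?_
        rw [if_neg]
        simp [List.countP_cons, Ltr.isS]
      · rw [hcs, hc_cons_succ, ← hcs, add_sub_cancel_left, mul_assoc,
          ← ih lev κ B B' (by omega) h0, ← sum_range_ite_slotS, sum_mul]
        refine sum_congr rfl fun m _ => ?_
        rw [mul_sum]
        refine sum_congr rfl fun l _ => ?_
        rw [← ite_and_mul]
        simp [List.countP_cons, Ltr.isK, Ltr.isS, Ltr.isT, ValidWord, ltrWt, and_assoc]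
    have hT : (∑ m ∈ range (a + 1), ∑ l ∈ words (letters a) N,
        if ValidWord a lev (Ltr.T m :: l) ∧
        (Ltr.T m :: l).countP Ltr.isK = κ ∧ (Ltr.T m :: l).countP Ltr.isS = B ∧
          (Ltr.T m :: l).countP Ltr.isT = B'
        then ((Ltr.T m :: l).map (ltrWt α β)).prod else 0) =
        hc (slotList (slotS a α) lev κ) B *
          (hc (slotList (slotT a β) lev κ) B' - hc ct B') := by
      rcases B' with _ | B'
      · rw [hc_degree_zero (slotList (slotT a β) lev κ), hc_degree_zero ct, sub_self, mul_zero]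
        refine sum_eq_zero fun m _ => sum_eq_zero fun l _ => ?_
        rw [if_neg]
        simp [List.countP_cons, Ltr.isT]
      · rw [hct, hc_cons_succ _ ct, ← hct, add_sub_cancel_left, mul_left_comm,
          ← ih lev κ B B' (by omega) h0, ← sum_range_ite_slotT, sum_mul]
        refine sum_congr rfl fun m _ => ?_
        rw [mul_sum]
        refine sum_congr rfl fun l _ => ?_
        rw [← ite_and_mul]
        simp [List.countP_cons, Ltr.isK, Ltr.isS, Ltr.isT, ValidWord, ltrWt, and_assoc]
    rw [hK, hS, hT]
    -- This is the error term of the three cases; it contains the product of the source weight and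
    -- the sink weight of the first place.
    have hz : (hc (slotList (slotS a α) lev κ) B - hc cs B) *
        (hc (slotList (slotT a β) lev κ) B' - hc ct B') = 0 := by
      rcases B with _ | B
      · simp
      · rcases B' with _ | B'
        · simp
        · rw [hcs, hct, hc_cons_succ, hc_cons_succ, add_sub_cancel_left, add_sub_cancel_left,
            mul_mul_mul_comm, h0 0 (Nat.zero_le _), zero_mul]
    linear_combination hz

open Classical in
-- The pairs stand at the very beginning, at level `lev 0`; each consists of two sources entering
-- one floor `m` and contributes `α m ^ 2`, summed over `m`. The remaining word is free.
theorem sum_endWords (a s : ℕ) (α β : ℕ → A) (lev : ℕ → ℕ) (κ B B' : ℕ)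
    (h0 : ∀ q ≤ κ, slotS a α (lev q) * slotT a β (lev q) = 0) :
    ∑ ω ∈ endWords a s lev κ (2 * s + B) B', (ω.map (ltrWt α β)).prod =
      slotS a (fun m => α m ^ 2) (lev 0) ^ s *
        (hc (slotList (slotS a α) lev κ) B * hc (slotList (slotT a β) lev κ) B') := by
  rw [endWords, sum_filter]
  induction s with
  | zero =>
    rw [pow_zero, one_mul, ← sum_endWords_zero a α β _ lev κ B B' rfl h0]
    simp [PairPrefix]
  | succ s ih =>
    rw [pow_succ', mul_assoc, ← ih, show κ + (2 * (s + 1) + B) + B' =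
      κ + (2 * s + B) + B' + 1 + 1 by ring, sum_words_succ, sum_letters, ← sum_range_ite_slotS,
      sum_mul]
    have e1 : ∑ l ∈ words (letters a) (κ + (2 * s + B) + B' + 1),
        (if ValidWord a lev (Ltr.K :: l) ∧ PairPrefix (s + 1) (Ltr.K :: l) ∧
          (Ltr.K :: l).countP Ltr.isK = κ ∧ (Ltr.K :: l).countP Ltr.isS = 2 * (s + 1) + B ∧
          (Ltr.K :: l).countP Ltr.isT = B'
        then ((Ltr.K :: l).map (ltrWt α β)).prod else 0) = 0 :=
      sum_eq_zero fun l _ => by rw [if_neg]; simp [PairPrefix]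
    have e2 : ∑ m ∈ range (a + 1), ∑ l ∈ words (letters a) (κ + (2 * s + B) + B' + 1),
        (if ValidWord a lev (Ltr.T m :: l) ∧ PairPrefix (s + 1) (Ltr.T m :: l) ∧
          (Ltr.T m :: l).countP Ltr.isK = κ ∧ (Ltr.T m :: l).countP Ltr.isS = 2 * (s + 1) + B ∧
          (Ltr.T m :: l).countP Ltr.isT = B'
        then ((Ltr.T m :: l).map (ltrWt α β)).prod else 0) = 0 :=
      sum_eq_zero fun m _ => sum_eq_zero fun l _ => by rw [if_neg]; simp [PairPrefix]
    rw [e1, e2, zero_add, add_zero]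
    refine sum_congr rfl fun m hm => ?_
    rw [sum_words_succ, sum_letters, mul_sum]
    have e3 : ∑ l ∈ words (letters a) (κ + (2 * s + B) + B'),
        (if ValidWord a lev (Ltr.S m :: Ltr.K :: l) ∧ PairPrefix (s + 1) (Ltr.S m :: Ltr.K :: l) ∧
          (Ltr.S m :: Ltr.K :: l).countP Ltr.isK = κ ∧
          (Ltr.S m :: Ltr.K :: l).countP Ltr.isS = 2 * (s + 1) + B ∧
          (Ltr.S m :: Ltr.K :: l).countP Ltr.isT = B'
        then ((Ltr.S m :: Ltr.K :: l).map (ltrWt α β)).prod else 0) = 0 :=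
      sum_eq_zero fun l _ => by rw [if_neg]; simp [PairPrefix]
    have e4 : ∑ m' ∈ range (a + 1), ∑ l ∈ words (letters a) (κ + (2 * s + B) + B'),
        (if ValidWord a lev (Ltr.S m :: Ltr.T m' :: l) ∧
          PairPrefix (s + 1) (Ltr.S m :: Ltr.T m' :: l) ∧
          (Ltr.S m :: Ltr.T m' :: l).countP Ltr.isK = κ ∧
          (Ltr.S m :: Ltr.T m' :: l).countP Ltr.isS = 2 * (s + 1) + B ∧
          (Ltr.S m :: Ltr.T m' :: l).countP Ltr.isT = B'
        then ((Ltr.S m :: Ltr.T m' :: l).map (ltrWt α β)).prod else 0) = 0 :=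
      sum_eq_zero fun m _ => sum_eq_zero fun l _ => by rw [if_neg]; simp [PairPrefix]
    rw [e3, e4, zero_add, add_zero, sum_eq_single m]
    · refine sum_congr rfl fun l _ => ?_
      rw [← ite_and_mul]
      have h1 : (ValidWord a lev (Ltr.S m :: Ltr.S m :: l) ∧
          PairPrefix (s + 1) (Ltr.S m :: Ltr.S m :: l) ∧
          (Ltr.S m :: Ltr.S m :: l).countP Ltr.isK = κ ∧
          (Ltr.S m :: Ltr.S m :: l).countP Ltr.isS = 2 * (s + 1) + B ∧
          (Ltr.S m :: Ltr.S m :: l).countP Ltr.isT = B') ↔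
          ((lev 0 < m ∧ m ≤ a) ∧ ValidWord a lev l ∧ PairPrefix s l ∧
          l.countP Ltr.isK = κ ∧ l.countP Ltr.isS = 2 * s + B ∧ l.countP Ltr.isT = B') := by
        simp only [ValidWord, PairPrefix, List.countP_cons, Ltr.isK, Ltr.isS, Ltr.isT, if_true,
          true_and, Bool.false_eq_true, if_false, add_zero]
        rw [show l.countP Ltr.isS + 1 + 1 = 2 * (s + 1) + B ↔ l.countP Ltr.isS = 2 * s + B by omega]
        tauto
      simp only [h1]
      simp [ltrWt, sq, mul_assoc]
    · intro m' _ hne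
      refine sum_eq_zero fun l _ => ?_
      rw [if_neg]
      simp [PairPrefix, hne.symm]
    · intro h; exact absurd hm h

end EndSum

/-! ### Generating series of the ends -/

/-- The number of floors among the first `p` floors and bounded edges of a diagram with one bounded
edge between any two consecutive floors, and a further one that is placed between the floors `j`
and `j + 1`. -/
def levAt (j p : ℕ) : ℕ := (p + if p ≤ 2 * j then 1 else 0) / 2

lemma levAt_reflect {a j q : ℕ} (hj : j ≤ a) (hq : q ≤ 2 * a) :
    a - levAt j q = levAt (a - j) (2 * a - q) := by
  unfold levAt; split_ifs <;> omega

lemma levAt_le {a j q : ℕ} (hj : j < a) (hq : q ≤ 2 * a) : levAt j q ≤ a := by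
  unfold levAt; split_ifs <;> omega

/-- The places after the first one have levels as follows: a level `c` between `1` and `a - 1` has a
place after its floor and one after its chain edge, the level `j` has one more after the further
edge, and the level `a` only has the place after the last floor. -/
lemma prod_levAt {M : Type*} [CommMonoid M] {a j : ℕ} (hj : 1 ≤ j) (hja : j < a) (F : ℕ → M) :
    ∏ q ∈ range (2 * a), F (levAt j (q + 1)) = (∏ c ∈ Ico 1 a, F c ^ 2) * F j * F a := by
  have h1 : ∀ i ≤ j, ∏ q ∈ range (2 * i), F (levAt j (q + 1)) = ∏ c ∈ Ico 1 (i + 1), F c ^ 2 := by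
    intro i hi
    induction i with
    | zero => simp
    | succ i ih =>
      rw [show 2 * (i + 1) = 2 * i + 1 + 1 by ring, prod_range_succ, prod_range_succ,
        ih (by omega), prod_Ico_succ_top (show 1 ≤ i + 1 by omega), mul_assoc, sq]
      congr 2
      · congr 1; unfold levAt; split_ifs <;> omega
      · congr 1; unfold levAt; split_ifs <;> omega
  have h2 : ∀ k, ∏ t ∈ range (2 * (k + 1)), F (levAt j (2 * j + t + 1)) =
      (∏ c ∈ Ico (j + 1) (j + k + 1), F c ^ 2) * F j * F (j + k + 1) := by
    intro k
    induction k with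
    | zero =>
      rw [show 2 * (0 + 1) = 0 + 1 + 1 by ring, prod_range_succ, prod_range_succ]
      simp only [range_zero, prod_empty, one_mul, add_zero, Ico_self]
      congr 2
      · unfold levAt; split_ifs <;> omega
      · unfold levAt; split_ifs <;> omega
    | succ k ih =>
      rw [show 2 * (k + 1 + 1) = 2 * (k + 1) + 1 + 1 by ring, prod_range_succ, prod_range_succ, ih,
        show j + (k + 1) + 1 = j + k + 1 + 1 by ring,
        prod_Ico_succ_top (show j + 1 ≤ j + k + 1 by omega)]
      have e1 : levAt j (2 * j + 2 * (k + 1) + 1) = j + k + 1 := by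
        unfold levAt; split_ifs <;> omega
      have e2 : levAt j (2 * j + (2 * (k + 1) + 1) + 1) = j + k + 1 + 1 := by
        unfold levAt; split_ifs <;> omega
      rw [e1, e2, sq]
      ac_rfl
  obtain ⟨k, rfl⟩ : ∃ k, a = j + k + 1 := ⟨a - j - 1, by omega⟩
  rw [show 2 * (j + k + 1) = 2 * j + 2 * (k + 1) by ring, prod_range_add, h1 j le_rfl]
  have h3 := h2 k
  rw [h3, ← prod_Ico_consecutive (fun c => F c ^ 2) (show 1 ≤ j + 1 by omega)
    (show j + 1 ≤ j + k + 1 by omega)]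
  ac_rfl

section Slots

variable {A : Type*} [CommRing A]

/-- The weight of a source entering the floor `m`. -/
def srcWt (x y : A) (i m : ℕ) : A := (1 - x) * (x ^ (m - 1) * if m ≤ i then y else 1)

/-- The weight of a sink leaving the floor `m`. -/
def snkWt (x y : A) (a i m : ℕ) : A := (1 - x) * (x ^ (a - m) * if i < m then y else 1)

lemma sum_Ioc_one_sub_mul_pow (x : A) {c d : ℕ} (h : c ≤ d) :
    ∑ m ∈ Ioc c d, (1 - x) * x ^ (m - 1) = x ^ c - x ^ d := by
  induction d, h using Nat.le_induction with
  | base => simp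
  | succ d hd ih =>
    rw [← insert_Ioc_right_eq_Ioc_add_one hd, sum_insert (by simp), ih]
    simp only [Nat.add_sub_cancel]; ring

lemma slotS_srcWt (x y : A) {a c i : ℕ} (hc : c ≤ a) (hi : i ≤ a) :
    slotS a (srcWt x y i) c =
      if c < i then y * (x ^ c - x ^ i) + (x ^ i - x ^ a) else x ^ c - x ^ a := by
  rw [slotS]
  split_ifs with h
  · rw [← sum_Ioc_consecutive _ h.le hi, ← sum_Ioc_one_sub_mul_pow x h.le,
      ← sum_Ioc_one_sub_mul_pow x hi, mul_sum]
    congr 1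
    · refine sum_congr rfl fun m hm => ?_
      rw [mem_Ioc] at hm
      rw [srcWt, if_pos hm.2]; ring
    · refine sum_congr rfl fun m hm => ?_
      rw [mem_Ioc] at hm
      rw [srcWt, if_neg (by omega)]; ring
  · rw [← sum_Ioc_one_sub_mul_pow x hc]
    refine sum_congr rfl fun m hm => ?_
    rw [mem_Ioc] at hm
    rw [srcWt, if_neg (by omega)]; ring

/-- Turning a diagram upside down, `m ↦ a + 1 - m`, exchanges sinks with sources and replaces every
level by its complement to `a`. -/
lemma slotT_snkWt (x y : A) {a c i : ℕ} (hc : c ≤ a) (hi : i ≤ a) :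
    slotT a (snkWt x y a i) c = slotS a (srcWt x y (a - i)) (a - c) := by
  rw [slotT, slotS, min_eq_left hc]
  refine sum_nbij' (fun m => a + 1 - m) (fun m => a + 1 - m) ?_ ?_ ?_ ?_ ?_
  · intro m hm; simp only [mem_Icc, mem_Ioc] at *; omega
  · intro m hm; simp only [mem_Icc, mem_Ioc] at *; omega
  · intro m hm; simp only [mem_Icc] at *; omega
  · intro m hm; simp only [mem_Ioc] at *; omega
  · intro m hm
    rw [mem_Icc] at hm
    rw [snkWt, srcWt, show a + 1 - m - 1 = a - m by omega]
    congr 2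
    refine if_congr ?_ rfl rfl
    omega

end Slots

lemma slotList_reflect {A : Type*} {f : ℕ → A} {a j : ℕ} (hj : j ≤ a) :
    (slotList (fun c => f (a - c)) (levAt j) (2 * a)).Perm
      (slotList f (levAt (a - j)) (2 * a)) := by
  have h : (slotList (fun c => f (a - c)) (levAt j) (2 * a)).reverse =
      slotList f (levAt (a - j)) (2 * a) := by
    refine List.ext_getElem (by simp [slotList]) fun i h1 h2 => ?_
    simp only [slotList, List.length_map, List.length_range] at h2
    simp only [slotList, List.getElem_reverse, List.length_map, List.length_range,
      List.getElem_map, List.getElem_range]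
    rw [levAt_reflect hj (by omega)]
    congr 2; omega
  rw [← h]
  exact (List.reverse_perm _).symm

lemma countP_map_range_le {A : Type*} (p : A → Bool) (f : ℕ → A) {N M : ℕ}
    (h : ∀ q, M ≤ q → p (f q) = false) : ((List.range N).map f).countP p ≤ M := by
  induction N with
  | zero => simp
  | succ N ih =>
    rw [List.range_succ, List.map_append, List.countP_append]
    rcases Nat.lt_or_ge N M with h1 | h1
    · have h2 := List.countP_le_length (p := p) (l := (List.range N).map f)
      have h3 := List.countP_le_length (p := p) (l := [N].map f)
      simp only [List.length_map, List.length_range, List.length_singleton] at h2 h3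
      omega
    · simp only [List.map_cons, List.map_nil, List.countP_singleton, h N h1]
      simpa using ih

/-! ### Ends with their contribution to the flow as a derivative -/

section DualSlots

variable {R : Type*} [CommRing R] {n : ℕ} {x : R}

/-- The derivative of the weight of a slot. -/
def slotDer (x : R) (i c : ℕ) : R := if c < i then 1 - x ^ (i - c) else 0

/-- The derivative of the geometric series of a slot. -/
def slotLog (n : ℕ) (x : R) (i c : ℕ) : R := if c < i then x ^ i else lamb n x c * (1 - x ^ i)

/-- The mark `y = 1 + ε` is put on the ends counted by `ltrIn`, so that `ε`-parts count them. The
sum over the floors telescopes, and the term `x ^ a` at the far end vanishes because `n ≤ a`. -/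
lemma slotS_dual (hx : x ^ n = 0) {a c i : ℕ} (hna : n ≤ a) (hc : c ≤ a) (hi : i ≤ a) :
    slotS a (srcWt (ld x 0) (ld 1 1) i) c = ld (x ^ c) (slotDer x i c) := by
  have hxa : (ld x 0 : DualNumber R) ^ a = 0 := by
    rw [ld_pow, pow_eq_zero_of_le_exp hx hna]; exact TrivSqZeroExt.ext (by simp) (by simp)
  rw [slotS_srcWt _ _ hc hi, hxa]
  simp only [ld_pow, mul_zero, sub_zero, slotDer]
  split_ifs with h
  · refine ld_ext (by simp) ?_
    simp only [TrivSqZeroExt.snd_add, TrivSqZeroExt.snd_mul, TrivSqZeroExt.snd_sub,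
      TrivSqZeroExt.fst_sub, fst_ld, snd_ld, smul_eq_mul, MulOpposite.smul_eq_mul_unop,
      MulOpposite.unop_op]
    have : x ^ i = x ^ c * x ^ (i - c) := by rw [← pow_add]; congr 1; omega
    rw [this]; ring
  · rfl

lemma ld_zero_left (q : R) : ld 0 q = 0 := TrivSqZeroExt.ext (by simp) (by simp)

/-- The first place, at level `0`, has the unit weight `1 + (1 - x ^ j) ε` and all others are
nilpotent, so `hc_stable` applies; about `2 * n` places are nonzero, hence the bound on `B`. The
unit gives the term with `B`. The other places give `p ^ 2`, together with `1 / (1 - x ^ j)` for the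
extra place at level `j`, and their logarithmic derivatives. -/
lemma hc_src (hn : 0 < n) (hx : x ^ n = 0) {a j : ℕ} (hna : n ≤ a) (hj : 1 ≤ j) (hja : j < a)
    {B : ℕ} (hB : n * (2 * n) ≤ B) :
    hc (slotList (slotS a (srcWt (ld x 0) (ld 1 1) j)) (levAt j) (2 * a)) B =
      ld (partProd n x ^ 2 * geo n (x ^ j))
        (B * (1 - x ^ j) - (∑ c ∈ Ico 1 a, 2 * slotLog n x j c + slotLog n x j j)) := by
  classical
  have hlist : slotList (slotS a (srcWt (ld x 0) (ld 1 1) j)) (levAt j) (2 * a) =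
      ld 1 (1 - x ^ j) :: (List.range (2 * a)).map
        fun q => ld (x ^ levAt j (q + 1)) (slotDer x j (levAt j (q + 1))) := by
    have h1 : slotList (slotS a (srcWt (ld x 0) (ld 1 1) j)) (levAt j) (2 * a) =
        slotList (fun c => ld (x ^ c) (slotDer x j c)) (levAt j) (2 * a) := by
      rw [slotList, slotList]
      refine List.map_congr_left fun q hq => ?_
      rw [List.mem_range] at hq
      exact slotS_dual hx hna (levAt_le hja (by omega)) hja.le
    rw [h1, slotList, List.range_succ_eq_map]
    have h0 : levAt j 0 = 0 := by unfold levAt; split_ifs <;> omega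
    simp only [List.map_cons, List.map_map, h0, pow_zero, Function.comp_def, Nat.succ_eq_add_one]
    congr 2
    rw [slotDer, if_pos (by omega), Nat.sub_zero]
  have hlev : ∀ q, 1 ≤ levAt j (q + 1) := by
    intro q; unfold levAt; split_ifs <;> omega
  rw [hlist, hc_stable hn (v := ld 1 (-(1 - x ^ j)))]
  · have hgeo : ∀ c, 1 ≤ c → geo n (ld (x ^ c) (slotDer x j c) * ld 1 (-(1 - x ^ j))) =
        ld (geo n (x ^ c)) (-slotLog n x j c) := by
      intro c hc
      have hxc := pow_pow_eq_zero hx hc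
      rw [ld_mul, mul_one]
      refine geo_eq_ld (ld_one_pow_eq_zero hxc _) hxc (ld_ext (by simp) ?_)
      simp only [TrivSqZeroExt.snd_sub, TrivSqZeroExt.snd_one, snd_ld, slotDer, slotLog, lamb]
      split_ifs with h
      · have : x ^ j = x ^ c * x ^ (j - c) := by rw [← pow_add]; congr 1; omega
        rw [this]; ring
      · linear_combination (- x ^ c * (1 - x ^ j)) * one_sub_mul_geo hxc
    rw [List.map_map]
    have hprod : ((List.range (2 * a)).map ((fun r => geo n (r * ld 1 (-(1 - x ^ j)))) ∘
        fun q => ld (x ^ levAt j (q + 1)) (slotDer x j (levAt j (q + 1))))).prod =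
        ∏ q ∈ range (2 * a), (fun c => ld (geo n (x ^ c)) (-slotLog n x j c))
          (levAt j (q + 1)) := by
      rw [Finset.prod_eq_multiset_prod]
      simp only [Multiset.range, range_val, Multiset.map_coe, Multiset.prod_coe]
      congr 1
      exact List.map_congr_left fun q _ => hgeo _ (hlev q)
    rw [hprod, prod_levAt hj hja (fun c => ld (geo n (x ^ c)) (-slotLog n x j c))]
    simp only [ld_pow]
    rw [ld_prod, ld_mul, ld_mul, ld_mul]
    have ha : geo n (x ^ a) = 1 := geo_pow_eq_one hn hx hna
    have hpp : ∏ c ∈ Ico 1 a, geo n (x ^ c) ^ 2 = partProd n x ^ 2 := by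
      rw [prod_pow, partProd_eq (N := a - 1) hn hx (by omega), prod_Ico_eq_prod_range]
      simp only [add_comm 1]
    have hla : slotLog n x j a = 0 := by
      rw [slotLog, if_neg (by omega), lamb_eq_zero hx hna, zero_mul]
    rw [ha, hpp, hla]
    congr 1
    · ring
    · simp only [mul_neg, sum_neg_distrib]; push_cast; ring
  · rw [ld_mul, mul_one, add_neg_cancel, ld_one_zero]
  · intro r hr
    obtain ⟨q, _, rfl⟩ := List.mem_map.mp hr
    exact ld_one_pow_eq_zero (pow_pow_eq_zero hx (hlev q)) _
  · refine le_trans (Nat.mul_le_mul_left _ (countP_map_range_le _ _ fun q hq => ?_)) hB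
    have : n ≤ levAt j (q + 1) := by unfold levAt; split_ifs <;> omega
    rw [pow_eq_zero_of_le_exp hx this, ld_zero_left]
    simp

lemma slotList_snk {a j : ℕ} (x y : R) (hja : j < a) :
    (slotList (slotT a (snkWt x y a j)) (levAt j) (2 * a)).Perm
      (slotList (slotS a (srcWt x y (a - j))) (levAt (a - j)) (2 * a)) := by
  have h1 : slotList (slotT a (snkWt x y a j)) (levAt j) (2 * a) =
      slotList (fun c => slotS a (srcWt x y (a - j)) (a - c)) (levAt j) (2 * a) := by
    rw [slotList, slotList]
    refine List.map_congr_left fun q hq => ?_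
    rw [List.mem_range] at hq
    exact slotT_snkWt x y (levAt_le hja (by omega)) hja.le
  rw [h1]
  exact slotList_reflect hja.le

/-- The logarithmic derivative of the series of the sources. -/
def srcLog (n : ℕ) (x : R) (a B j : ℕ) : R :=
  B * (1 - x ^ j) - (∑ c ∈ Ico 1 a, 2 * slotLog n x j c + slotLog n x j j)

/-- Since `(1 + x) / (1 - x) * (1 - x) ^ 2 = 1 - x ^ 2`, a normalized pair behaves like a single
source with `x` and `y` replaced by their squares. The clearing factor of a pair is thus exactly
what makes its total weight `1`. -/
lemma pair_weight (hx : x ^ n = 0) {a j : ℕ} (hna : n ≤ a) (hj : 1 ≤ j) (hja : j < a) :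
    ((1 + ld x 0) * geo n (ld x 0)) *
      slotS a (fun m => srcWt (ld x 0) (ld 1 1) j m ^ 2) 0 = ld 1 (2 * (1 - x ^ (2 * j))) := by
  have hx' : (ld x 0 : DualNumber R) ^ n = 0 := ld_one_pow_eq_zero hx 0
  have h1 : ((1 + ld x 0) * geo n (ld x 0)) *
      slotS a (fun m => srcWt (ld x 0) (ld 1 1) j m ^ 2) 0 =
      slotS a (srcWt (ld x 0 ^ 2) (ld 1 1 ^ 2) j) 0 := by
    rw [slotS, slotS, mul_sum]
    refine sum_congr rfl fun m _ => ?_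
    have h2 := one_sub_mul_geo hx'
    simp only [srcWt]
    rw [← pow_mul, mul_comm 2 (m - 1), pow_mul]
    split_ifs
    · linear_combination ((1 + ld x 0) * (1 - ld x 0) * (ld x 0 ^ (m - 1)) ^ 2 * (ld 1 1) ^ 2) * h2
    · linear_combination ((1 + ld x 0) * (1 - ld x 0) * (ld x 0 ^ (m - 1)) ^ 2) * h2
  rw [h1, slotS_srcWt _ _ (Nat.zero_le _) hja.le, if_pos (by omega)]
  have h3 : (ld x 0 ^ 2 : DualNumber R) ^ a = 0 := by
    rw [← pow_mul, mul_comm, pow_mul, pow_eq_zero_of_le_exp hx' hna, zero_pow (by norm_num)]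
  rw [h3, pow_zero, sub_zero, ← pow_mul]
  simp only [ld_pow]
  refine ld_ext (by simp) ?_
  simp only [TrivSqZeroExt.snd_add, TrivSqZeroExt.snd_mul, TrivSqZeroExt.snd_sub,
      TrivSqZeroExt.fst_sub, fst_ld, snd_ld, smul_eq_mul, MulOpposite.smul_eq_mul_unop,
      MulOpposite.unop_op, TrivSqZeroExt.fst_one, TrivSqZeroExt.snd_one]
  push_cast; ring

theorem sum_endWords_dual (hn : 0 < n) (hx : x ^ n = 0) {a j s B B' : ℕ} (hna : n ≤ a)
    (hj : 1 ≤ j) (hja : j < a) (hB : n * (2 * n) ≤ B) (hB' : n * (2 * n) ≤ B') :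
    ((1 + ld x 0) * geo n (ld x 0)) ^ s *
      ∑ ω ∈ endWords a s (levAt j) (2 * a) (2 * s + B) B',
        (ω.map (ltrWt (srcWt (ld x 0) (ld 1 1) j) (snkWt (ld x 0) (ld 1 1) a j))).prod =
      ld (partProd n x ^ 4 * (geo n (x ^ j) * geo n (x ^ (a - j))))
        (s * (2 * (1 - x ^ (2 * j))) + (srcLog n x a B j + srcLog n x a B' (a - j))) := by
  rw [sum_endWords, ← mul_assoc, ← mul_pow]
  · have h0 : levAt j 0 = 0 := by unfold levAt; split_ifs <;> omega
    rw [h0, pair_weight hx hna hj hja, hc_src hn hx hna hj hja hB, hc_perm (slotList_snk _ _ hja),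
      hc_src hn hx hna (by omega) (by omega) hB', ld_pow, ld_mul, ld_mul]
    rw [one_pow, srcLog, srcLog]
    congr 1
    ring
  -- A source and a sink at the same place of level `c` have the product of weights `x ^ c * x ^ (a
  -- - c) = x ^ a = 0`.
  · intro q hq
    have hl : levAt j q ≤ a := levAt_le hja (by omega)
    rw [slotT_snkWt _ _ hl hja.le, slotS_dual hx hna hl hja.le,
      slotS_dual hx hna (by omega) (by omega), ld_mul, ← pow_add,
      Nat.add_sub_cancel' hl, pow_eq_zero_of_le_exp hx hna, ld_zero_left]

/-- The contribution of an end to the codegree. -/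
def ltrCost (a : ℕ) : Ltr → ℕ
  | Ltr.K => 0
  | Ltr.S m => m - 1
  | Ltr.T m => a - m

/-- The indicator of a source that does not pass the level `j` and of a sink that does not pass
it. -/
def ltrIn (j : ℕ) : Ltr → ℕ
  | Ltr.K => 0
  | Ltr.S m => if m ≤ j then 1 else 0
  | Ltr.T m => if j < m then 1 else 0

lemma prod_ltrWt (a j : ℕ) (ω : List Ltr) :
    (ω.map (ltrWt (srcWt (ld x 0) (ld 1 1) j) (snkWt (ld x 0) (ld 1 1) a j))).prod =
      ld ((1 - x) ^ (ω.countP Ltr.isS + ω.countP Ltr.isT) * x ^ (ω.map (ltrCost a)).sum)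
        ((ω.map (ltrIn j)).sum : ℕ) := by
  have hone : (1 - ld x 0 : DualNumber R) = ld (1 - x) 0 := ld_ext (by simp) (by simp)
  have hif : ∀ (P : Prop) [Decidable P], (if P then ld 1 1 else 1 : DualNumber R) =
      ld 1 ((if P then 1 else 0 : ℕ) : R) := by
    intro P _; split_ifs <;> simp [ld_one_zero]
  induction ω with
  | nil => simp [ld_one_zero]
  | cons z ω ih =>
    rw [List.map_cons, List.prod_cons, ih]
    rcases z with _ | m | m
    · simp [ltrWt, ltrCost, ltrIn, Ltr.isS, Ltr.isT]
    · simp only [ltrWt, srcWt, hif, hone, ld_pow, ld_mul, List.countP_cons, Ltr.isS, Ltr.isT,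
        List.map_cons, List.sum_cons, ltrCost, ltrIn]
      congr 1
      · simp only [if_true, Bool.false_eq_true, if_false]; ring
      · push_cast; ring
    · simp only [ltrWt, snkWt, hif, hone, ld_pow, ld_mul, List.countP_cons, Ltr.isS, Ltr.isT,
        List.map_cons, List.sum_cons, ltrCost, ltrIn]
      congr 1
      · simp only [if_true, Bool.false_eq_true, if_false]; ring
      · push_cast; ring

/-- The common factor in the series of the ends. -/
def endFactor (n : ℕ) (x : R) (s N : ℕ) : R := ((1 + x) * geo n x) ^ s * (1 - x) ^ N

lemma geo_ld_zero (hx : x ^ n = 0) :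
    ((1 + ld x 0) * geo n (ld x 0) : DualNumber R) = ld ((1 + x) * geo n x) 0 := by
  have h : (geo n (ld x 0) : DualNumber R) = ld (geo n x) (-0) :=
    geo_eq_ld (ld_one_pow_eq_zero hx 0) hx (ld_ext (by simp) (by simp))
  have h1 : (1 + ld x 0 : DualNumber R) = ld (1 + x) 0 := ld_ext (by simp) (by simp)
  rw [h, h1, ld_mul]; simp

lemma sum_endWords_dual' (hn : 0 < n) (hx : x ^ n = 0) {a j s B B' : ℕ} (hna : n ≤ a)
    (hj : 1 ≤ j) (hja : j < a) (hB : n * (2 * n) ≤ B) (hB' : n * (2 * n) ≤ B') :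
    ∑ ω ∈ endWords a s (levAt j) (2 * a) (2 * s + B) B',
        ld (endFactor n x s (2 * s + B + B') * x ^ (ω.map (ltrCost a)).sum)
          ((ω.map (ltrIn j)).sum : ℕ) =
      ld (partProd n x ^ 4 * (geo n (x ^ j) * geo n (x ^ (a - j))))
        (s * (2 * (1 - x ^ (2 * j))) + (srcLog n x a B j + srcLog n x a B' (a - j))) := by
  rw [← sum_endWords_dual hn hx hna hj hja hB hB', mul_sum, geo_ld_zero hx, ld_pow]
  refine sum_congr rfl fun ω hω => ?_
  obtain ⟨-, -, -, h1, h2⟩ := mem_endWords.mp hω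
  rw [prod_ltrWt, ld_mul, h1, h2, endFactor]
  congr 1
  · ring
  · ring

/-- The two components of the identity of dual numbers are used separately: this one counts the
words, the next one weights them by the number of marked ends. -/
theorem sum_endWords_base (hn : 0 < n) (hx : x ^ n = 0) {a j s B B' : ℕ} (hna : n ≤ a)
    (hj : 1 ≤ j) (hja : j < a) (hB : n * (2 * n) ≤ B) (hB' : n * (2 * n) ≤ B') :
    ∑ ω ∈ endWords a s (levAt j) (2 * a) (2 * s + B) B',
        endFactor n x s (2 * s + B + B') * x ^ (ω.map (ltrCost a)).sum =
      partProd n x ^ 4 * (geo n (x ^ j) * geo n (x ^ (a - j))) := by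
  have h := congrArg TrivSqZeroExt.fst (sum_endWords_dual' (s := s) hn hx hna hj hja hB hB')
  rwa [TrivSqZeroExt.fst_sum, fst_ld, sum_congr rfl fun _ _ => fst_ld _ _] at h

theorem sum_endWords_in (hn : 0 < n) (hx : x ^ n = 0) {a j s B B' : ℕ} (hna : n ≤ a)
    (hj : 1 ≤ j) (hja : j < a) (hB : n * (2 * n) ≤ B) (hB' : n * (2 * n) ≤ B') :
    ∑ ω ∈ endWords a s (levAt j) (2 * a) (2 * s + B) B',
        endFactor n x s (2 * s + B + B') * x ^ (ω.map (ltrCost a)).sum *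
          ((ω.map (ltrIn j)).sum : ℕ) =
      partProd n x ^ 4 * (geo n (x ^ j) * geo n (x ^ (a - j))) *
        (s * (2 * (1 - x ^ (2 * j))) + (srcLog n x a B j + srcLog n x a B' (a - j))) := by
  have h := congrArg TrivSqZeroExt.snd (sum_endWords_dual' (s := s) hn hx hna hj hja hB hB')
  rwa [TrivSqZeroExt.snd_sum, snd_ld, sum_congr rfl fun _ _ => snd_ld _ _] at h

end DualSlots

/-! ### Summation over the levels -/

section Levels

variable {R : Type*} [CommRing R] {n : ℕ} {x : R}

lemma sum_Ico_reflect' {M : Type*} [AddCommMonoid M] (a : ℕ) (f : ℕ → M) :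
    ∑ j ∈ Ico 1 a, f (a - j) = ∑ j ∈ Ico 1 a, f j := by
  refine sum_nbij' (fun j => a - j) (fun j => a - j) ?_ ?_ ?_ ?_ ?_
  · intro j hj; simp only [mem_Ico] at *; omega
  · intro j hj; simp only [mem_Ico] at *; omega
  · intro j hj; simp only [mem_Ico] at *; omega
  · intro j hj; simp only [mem_Ico] at *; omega
  · intro j _; rfl

lemma lamb_mul_pow (hx : x ^ n = 0) {i j : ℕ} (h : n ≤ i + j) : lamb n x i * x ^ j = 0 := by
  rw [lamb, mul_right_comm, ← pow_add, pow_eq_zero_of_le_exp hx h, zero_mul]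

/-- Corrections at the bottom have order `x ^ j` and those at the top `x ^ (a - j)`; as `n ≤ a`,
they never interact. -/
lemma lamb_mul_lamb (hx : x ^ n = 0) {i j : ℕ} (h : n ≤ i + j) : lamb n x i * lamb n x j = 0 := by
  rw [lamb.eq_1 n x j, ← mul_assoc, lamb_mul_pow hx h, zero_mul]

/-- The correction term for a doubled edge. -/
def dblCorr (n : ℕ) (x : R) : R := ∑ w ∈ Ico 1 n, 2 * ((1 - x ^ w) ^ 2 - 1)

/-- The total weight of the long edges passing the level `j`. -/
def longSum (n : ℕ) (x : R) (a j : ℕ) : R :=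
  ∑ i ∈ Icc 1 j, ∑ i' ∈ Icc (j + 1) a, ∑ w ∈ Ico 1 n,
    if i + 2 ≤ i' then 2 * (x ^ (w * (i' - i - 1)) * (1 - x ^ w) ^ 2) else 0

lemma one_sub_mul_sum_pow_Icc (y : R) (j : ℕ) :
    (1 - y) * ∑ i ∈ Icc 1 j, y ^ (j - i) = 1 - y ^ j := by
  rw [← mul_neg_geom_sum]
  congr 1
  refine sum_nbij' (fun i => j - i) (fun i => j - i) ?_ ?_ ?_ ?_ ?_
  · intro i hi; simp only [mem_Icc, mem_range] at *; omega
  · intro i hi; simp only [mem_Icc, mem_range] at *; omega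
  · intro i hi; simp only [mem_Icc] at *; omega
  · intro i hi; simp only [mem_range] at *; omega
  · intro i _; rfl

lemma one_sub_mul_sum_pow_Icc' (y : R) {j a : ℕ} (hja : j ≤ a) :
    (1 - y) * ∑ i ∈ Icc (j + 1) a, y ^ (i - j - 1) = 1 - y ^ (a - j) := by
  rw [← mul_neg_geom_sum]
  congr 1
  refine sum_nbij' (fun i => i - j - 1) (fun i => i + j + 1) ?_ ?_ ?_ ?_ ?_
  · intro i hi; simp only [mem_Icc, mem_range] at *; omega
  · intro i hi; simp only [mem_Icc, mem_range] at *; omega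
  · intro i hi; simp only [mem_Icc] at *; omega
  · intro i hi; simp only [mem_range] at *; omega
  · intro i _; rfl

/-- For fixed weight `w` put `y = x ^ w`. Summing `y ^ (i' - i - 1) * (1 - y) ^ 2` over all edges
passing the level telescopes to `(1 - y ^ j) * (1 - y ^ (a - j))`. The edge from `j` to `j + 1`,
absent from the long edges, is supplied by the correction for a doubled edge. Only `-2 (y ^ j + y ^
(a - j))` survives, and it is summed over `w`. -/
lemma dblCorr_add_longSum (hx : x ^ n = 0) {a j : ℕ} (hna : n ≤ a) (hj : 1 ≤ j) (hja : j < a) :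
    dblCorr n x + longSum n x a j = -2 * (lamb n x j + lamb n x (a - j)) := by
  have h1 : longSum n x a j = ∑ w ∈ Ico 1 n, ∑ i ∈ Icc 1 j, ∑ i' ∈ Icc (j + 1) a,
      if i + 2 ≤ i' then 2 * (x ^ (w * (i' - i - 1)) * (1 - x ^ w) ^ 2) else 0 := by
    rw [longSum, sum_comm]
    conv_rhs => rw [sum_comm]
    conv_lhs => rw [sum_comm]
    exact sum_congr rfl fun i _ => sum_comm
  have h2 : ∀ w ∈ Ico 1 n, 2 * ((1 - x ^ w) ^ 2 - 1) + (∑ i ∈ Icc 1 j, ∑ i' ∈ Icc (j + 1) a,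
      if i + 2 ≤ i' then 2 * (x ^ (w * (i' - i - 1)) * (1 - x ^ w) ^ 2) else 0) =
      -2 * (x ^ (w * j) + x ^ (w * (a - j))) := by
    intro w hw
    rw [mem_Ico] at hw
    set y := x ^ w with hy
    -- The only pair `(i, i')` excluded by `i + 2 ≤ i'` is `(j, j + 1)`; adding its term makes the
    -- double sum a product.
    have h3 : (∑ i ∈ Icc 1 j, ∑ i' ∈ Icc (j + 1) a,
        if i + 2 ≤ i' then 2 * (x ^ (w * (i' - i - 1)) * (1 - y) ^ 2) else 0) +
        2 * (1 - y) ^ 2 = ∑ i ∈ Icc 1 j, ∑ i' ∈ Icc (j + 1) a,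
          2 * (y ^ (i' - i - 1) * (1 - y) ^ 2) := by
      have h4 : ∀ i ∈ Icc 1 j, ∀ i' ∈ Icc (j + 1) a, 2 * (y ^ (i' - i - 1) * (1 - y) ^ 2) =
          (if i + 2 ≤ i' then 2 * (x ^ (w * (i' - i - 1)) * (1 - y) ^ 2) else 0) +
          if i = j then (if i' = j + 1 then 2 * (1 - y) ^ 2 else 0) else 0 := by
        intro i hi i' hi'
        rw [mem_Icc] at hi hi'
        by_cases h5 : i + 2 ≤ i'
        · rw [if_pos h5, hy, ← pow_mul]
          by_cases h6 : i = j
          · rw [if_pos h6, if_neg (by omega), add_zero]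
          · rw [if_neg h6, add_zero]
        · rw [if_neg h5, if_pos (by omega), if_pos (by omega),
            show i' - i - 1 = 0 by omega]
          ring
      rw [sum_congr rfl fun i hi => sum_congr rfl (h4 i hi)]
      simp only [sum_add_distrib]
      congr 1
      rw [sum_eq_single j]
      · simp only [if_true]
        rw [sum_eq_single (j + 1)]
        · simp
        · intro i' _ h; rw [if_neg h]
        · intro h; exfalso; apply h; rw [mem_Icc]; omega
      · intro i _ h; simp [h]
      · intro h; exfalso; apply h; rw [mem_Icc]; omega
    have h4 : ∑ i ∈ Icc 1 j, ∑ i' ∈ Icc (j + 1) a, 2 * (y ^ (i' - i - 1) * (1 - y) ^ 2) =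
        2 * ((1 - y ^ j) * (1 - y ^ (a - j))) := by
      rw [← one_sub_mul_sum_pow_Icc y j, ← one_sub_mul_sum_pow_Icc' y hja.le, mul_mul_mul_comm,
        sum_mul_sum, mul_sum, mul_sum]
      refine sum_congr rfl fun i hi => ?_
      rw [mul_sum, mul_sum]
      refine sum_congr rfl fun i' hi' => ?_
      rw [mem_Icc] at hi hi'
      rw [show i' - i - 1 = (j - i) + (i' - j - 1) by omega, pow_add]; ring
    have h5 : y ^ j * y ^ (a - j) = 0 := by
      rw [← pow_add, hy, ← pow_mul]
      refine pow_eq_zero_of_le_exp hx ?_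
      have : j + (a - j) = a := by omega
      rw [this]
      calc n ≤ a := hna
        _ ≤ w * a := Nat.le_mul_of_pos_left a hw.1
    rw [pow_mul, pow_mul, ← hy]
    linear_combination h3 + h4 + 2 * h5
  rw [dblCorr, h1, ← sum_add_distrib, sum_congr rfl h2, ← mul_sum, sum_add_distrib,
    sum_lamb_inner hx hj, sum_lamb_inner hx (by omega)]

/-- The product of the geometric series of a level. -/
def levGeo (n : ℕ) (x : R) (a j : ℕ) : R := geo n (x ^ j) * geo n (x ^ (a - j))

lemma levGeo_eq (hx : x ^ n = 0) {a j : ℕ} (hna : n ≤ a) (hj : 1 ≤ j) (hja : j < a) :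
    levGeo n x a j = 1 + lamb n x j + lamb n x (a - j) := by
  rw [levGeo, geo_eq_one_add_lamb hx hj, geo_eq_one_add_lamb hx (show 1 ≤ a - j by omega)]
  linear_combination lamb_mul_lamb hx (show n ≤ j + (a - j) by omega)

lemma sum_lamb_eq (hx : x ^ n = 0) {a : ℕ} (hna : n ≤ a) :
    ∑ j ∈ Ico 1 a, lamb n x j = ∑ j ∈ Ico 1 n, lamb n x j := by
  simpa using sum_mul_lamb hx hna fun _ => (1 : R)

/-- With mixed products zero, the summand splits into `-2 (λ + λ²)` at `j` and at `a - j`, where `λ`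
is `lamb n x`. Each half sums to `E₂`. -/
lemma sum_levGeo_corr (hx : x ^ n = 0) {a : ℕ} (hna : n ≤ a) :
    ∑ j ∈ Ico 1 a, levGeo n x a j * (dblCorr n x + longSum n x a j) = -4 * eisSum n x := by
  have h1 : ∀ j ∈ Ico 1 a, levGeo n x a j * (dblCorr n x + longSum n x a j) =
      -2 * ((lamb n x j + lamb n x j ^ 2) + (lamb n x (a - j) + lamb n x (a - j) ^ 2)) := by
    intro j hj
    rw [mem_Ico] at hj
    rw [levGeo_eq hx hna hj.1 hj.2, dblCorr_add_longSum hx hna hj.1 hj.2]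
    linear_combination -4 * lamb_mul_lamb hx (show n ≤ j + (a - j) by omega)
  rw [sum_congr rfl h1, ← mul_sum, sum_add_distrib,
    sum_Ico_reflect' a fun j => lamb n x j + lamb n x j ^ 2]
  have h2 : ∑ j ∈ Ico 1 a, (lamb n x j + lamb n x j ^ 2) = eisSum n x := by
    rw [← sum_lamb_add_sq hx]
    refine (sum_subset (Ico_subset_Ico_right hna) ?_).symm
    intro j hj hj'
    simp only [mem_Ico] at hj hj'
    rw [lamb_eq_zero hx (by omega)]; ring
  rw [h2]; ring

/-- Places below level `j` have derivative `x ^ j`, the others a multiple of `1 - x ^ j`. The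
geometric series turns the former into `lamb n x j` and cancels the latter; the odd factor `2 * j -
1` counts the `2 (j - 1)` places below and the extra place at level `j`. -/
lemma geo_mul_srcLog (hx : x ^ n = 0) {a j : ℕ} (hj : 1 ≤ j) (hja : j < a) (B : ℕ) :
    geo n (x ^ j) * srcLog n x a B j =
      B - ((2 * j - 1) * lamb n x j + 2 * ∑ c ∈ Ico j a, lamb n x c) := by
  have h1 := one_sub_mul_geo (pow_pow_eq_zero hx hj)
  have h2 : ∑ c ∈ Ico 1 a, 2 * slotLog n x j c =
      2 * (((j - 1 : ℕ) : R) * x ^ j) + 2 * ((1 - x ^ j) * ∑ c ∈ Ico j a, lamb n x c) := by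
    rw [← sum_Ico_consecutive _ hj hja.le]
    congr 1
    · rw [← mul_sum]
      congr 1
      have e : ∀ c ∈ Ico 1 j, slotLog n x j c = x ^ j := by
        intro c hc
        rw [mem_Ico] at hc
        rw [slotLog, if_pos hc.2]
      rw [sum_congr rfl e, sum_const, Nat.card_Ico, nsmul_eq_mul]
    · rw [← mul_sum]
      congr 1
      rw [mul_sum]
      refine sum_congr rfl fun c hc => ?_
      rw [mem_Ico] at hc
      rw [slotLog, if_neg (by omega)]; ring
  have h3 : slotLog n x j j = x ^ j := by
    rw [slotLog, if_neg (by omega), lamb]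
    linear_combination x ^ j * h1
  rw [srcLog, h2, h3, lamb]
  push_cast [hj]
  linear_combination (B - 2 * ∑ c ∈ Ico j a, lamb n x c) * h1

lemma sum_sum_lamb (hx : x ^ n = 0) {a : ℕ} (hna : n ≤ a) :
    ∑ j ∈ Ico 1 a, ∑ c ∈ Ico j a, lamb n x c = eisSum n x := by
  rw [eisSum_eq hx hna, sum_comm' (t' := Ico 1 a) (s' := fun c => Icc 1 c)]
  · refine sum_congr rfl fun c _ => ?_
    rw [sum_const, Nat.card_Icc, nsmul_eq_mul, Nat.add_sub_cancel]
  · intro j c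
    simp only [mem_Ico, mem_Icc]; omega

/-- Subtracting `B'` turns the number of marked ends into the contribution of the ends to the flow,
and `-1` is the one in `f - 1`. Sources and sinks each give `-4 E₂`: one half from `∑ j λ_j`, the
other from the tails `∑_{c ≥ j} λ_c`. The pairs leave `2 s ∑ x ^ j`. The multiple of `∑ λ_j` is kept
to be cancelled by the slopes. -/
lemma sum_levGeo_ends (hx : x ^ n = 0) {a : ℕ} (hna : n ≤ a) (hn : 0 < n) (s B B' : ℕ) :
    ∑ j ∈ Ico 1 a, levGeo n x a j * (s * (2 * (1 - x ^ (2 * j))) +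
      (srcLog n x a B j + srcLog n x a B' (a - j)) - B' - 1) =
      ((a : R) - 1) * ((2 * s + B : ℕ) - 1) +
        ((2 * s + B : ℕ) - (B' : R)) * ∑ j ∈ Ico 1 n, lamb n x j
        + 2 * s * lamb n x 1 - 8 * eisSum n x := by
  set t : ℕ → ℕ → R := fun C j =>
    C - ((2 * j - 1) * lamb n x j + 2 * ∑ c ∈ Ico j a, lamb n x c) with ht
  have h1 : ∀ j ∈ Ico 1 a, levGeo n x a j * (s * (2 * (1 - x ^ (2 * j))) +
      (srcLog n x a B j + srcLog n x a B' (a - j)) - B' - 1) =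
      (2 * s * (1 + x ^ j) + t B j + t B' (a - j) - B' - 1) +
        ((2 * s + B) - B' - 1) * lamb n x (a - j) + (-1) * lamb n x j := by
    intro j hj
    rw [mem_Ico] at hj
    have e1 := geo_mul_srcLog hx hj.1 hj.2 B
    have e2 := geo_mul_srcLog hx (show 1 ≤ a - j by omega) (show a - j < a by omega) B'
    have g1 := geo_eq_one_add_lamb hx hj.1
    have g2 := geo_eq_one_add_lamb hx (show 1 ≤ a - j by omega)
    have i1 := one_sub_mul_geo (pow_pow_eq_zero hx hj.1)
    have z1 : lamb n x (a - j) * x ^ j = 0 := lamb_mul_pow hx (by omega)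
    have z2 : lamb n x (a - j) * lamb n x j = 0 := lamb_mul_lamb hx (by omega)
    have z3 : lamb n x (a - j) * ∑ c ∈ Ico j a, lamb n x c = 0 := by
      rw [mul_sum]
      refine sum_eq_zero fun c hc => ?_
      rw [mem_Ico] at hc
      exact lamb_mul_lamb hx (by omega)
    have z4 : lamb n x j * ∑ c ∈ Ico (a - j) a, lamb n x c = 0 := by
      rw [mul_sum]
      refine sum_eq_zero fun c hc => ?_
      rw [mem_Ico] at hc
      exact lamb_mul_lamb hx (by omega)
    have e1' : geo n (x ^ j) * srcLog n x a B j = t B j := e1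
    have e2' : geo n (x ^ (a - j)) * srcLog n x a B' (a - j) = t B' (a - j) := e2
    have y1 : lamb n x (a - j) * t B j = B * lamb n x (a - j) := by
      simp only [ht]
      linear_combination (-(2 * (j : R) - 1)) * z2 - 2 * z3
    have y2 : lamb n x j * t B' (a - j) = B' * lamb n x j := by
      simp only [ht]
      linear_combination (-(2 * ((a - j : ℕ) : R) - 1)) * z2 - 2 * z4
    have h3 : levGeo n x a j * (s * (2 * (1 - x ^ (2 * j)))) =
        2 * s * (1 + x ^ j) + 2 * s * lamb n x (a - j) := by
      rw [levGeo, g2, two_mul j, pow_add]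
      linear_combination (2 * s * (1 + x ^ j) * (1 + lamb n x (a - j))) * i1 + 2 * s * z1
    have h4 : levGeo n x a j * srcLog n x a B j = t B j + B * lamb n x (a - j) := by
      rw [levGeo, g2]
      linear_combination (1 + lamb n x (a - j)) * e1' + y1
    have h5 : levGeo n x a j * srcLog n x a B' (a - j) = t B' (a - j) + B' * lamb n x j := by
      rw [levGeo, g1]
      linear_combination (1 + lamb n x j) * e2' + y2
    have h6 := levGeo_eq hx hna hj.1 hj.2
    linear_combination h3 + h4 + h5 - (B' + 1) * h6
  have hS := sum_lamb_eq hx hna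
  have hT : ∀ C, ∑ j ∈ Ico 1 a, t C j = ((a : R) - 1) * C - 4 * eisSum n x +
      ∑ j ∈ Ico 1 n, lamb n x j := by
    intro C
    have e : ∀ j ∈ Ico 1 a, t C j = (C : R) - 2 * (j * lamb n x j) + lamb n x j -
        2 * ∑ c ∈ Ico j a, lamb n x c := by
      intro j _; simp only [ht]; ring
    rw [sum_congr rfl e, sum_sub_distrib, sum_add_distrib, sum_sub_distrib, sum_const, ← mul_sum,
      ← mul_sum, sum_sum_lamb hx hna, ← eisSum_eq hx hna, hS, Nat.card_Ico, nsmul_eq_mul]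
    push_cast [show 1 ≤ a by omega]; ring
  have hP : ∑ j ∈ Ico 1 a, x ^ j = lamb n x 1 := by
    rw [← sum_lamb_inner hx le_rfl]
    simp only [mul_one]
    refine (sum_subset (Ico_subset_Ico_right hna) ?_).symm
    intro j hj hj'
    simp only [mem_Ico] at hj hj'
    exact pow_eq_zero_of_le_exp hx (by omega)
  rw [sum_congr rfl h1]
  simp only [sum_add_distrib, sum_sub_distrib, ← mul_sum, hP, hT,
    sum_Ico_reflect' a (t B'), sum_Ico_reflect' a (lamb n x), hS, sum_const, Nat.card_Ico,
    nsmul_eq_mul]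
  push_cast [show 1 ≤ a by omega]
  ring

end Levels

/-! ### The weighted sum over all combinatorial data -/

/-- The contribution of an end to the flow through the level `j`. -/
def ltrFlow (j : ℕ) : Ltr → ℤ
  | Ltr.K => 0
  | Ltr.S m => if m ≤ j then 1 else 0
  | Ltr.T m => if m ≤ j then -1 else 0

/-- The total weight of the bounded edges that pass the level `j`. -/
def flow (j : ℕ) (L R : List ℤ) (ω : List Ltr) : ℤ :=
  (ω.map (ltrFlow j)).sum - (L.take j).sum - (R.take j).sum

lemma sum_ltrFlow (j : ℕ) (ω : List Ltr) :
    (ω.map (ltrFlow j)).sum = ((ω.map (ltrIn j)).sum : ℕ) - (ω.countP Ltr.isT : ℤ) := by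
  induction ω with
  | nil => simp
  | cons z ω ih =>
    rw [List.map_cons, List.sum_cons, ih, List.map_cons, List.sum_cons, List.countP_cons]
    rcases z with _ | m | m
    · simp [ltrFlow, ltrIn, Ltr.isT]
    · simp only [ltrFlow, ltrIn, Ltr.isT, Bool.false_eq_true, if_false, Nat.cast_add]
      split_ifs <;> simp only [Nat.cast_one, Nat.cast_zero] <;> omega
    · simp only [ltrFlow, ltrIn, Ltr.isT, if_true, Nat.cast_add]
      split_ifs <;> simp only [Nat.cast_one, Nat.cast_zero] <;> omega

lemma le_sum_ltrFlow {a j : ℕ} (hj : 1 ≤ j) (hja : j < a) {ω : List Ltr} :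
    (ω.countP Ltr.isS : ℤ) ≤ (ω.map (ltrFlow j)).sum + (ω.map (ltrCost a)).sum := by
  induction ω with
  | nil => simp
  | cons z ω ih =>
    rw [List.map_cons, List.sum_cons, List.map_cons, List.sum_cons, List.countP_cons]
    rcases z with _ | m | m
    · simpa [ltrFlow, ltrCost, Ltr.isS] using ih
    · simp only [ltrFlow, ltrCost, Ltr.isS, if_true, Nat.cast_add]
      split_ifs <;> simp only [Nat.cast_one] <;> omega
    · simp only [ltrFlow, ltrCost, Ltr.isS, Bool.false_eq_true, if_false, Nat.cast_add]
      split_ifs <;> omega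

/-- The difference between `length * prefix sum` and `j * total sum` is the sum of `h - z` over the
entries `h` before and `z` after the cut, and this is at most the cost of the inversions across the
cut. So prefix sums hardly exceed linear interpolation. -/
lemma length_mul_sum_take_le (l : List ℤ) {j : ℕ} (hj : j ≤ l.length) :
    (l.length : ℤ) * (l.take j).sum ≤ j * l.sum + cost l := by
  set p := l.take j with hp
  set q := l.drop j with hq
  have hl : p ++ q = l := List.take_append_drop j l
  have hpl : p.length = j := by rw [hp, List.length_take]; omega
  have h1 : (q.length : ℤ) * p.sum - p.length * q.sum ≤
      ((p.map fun h => (q.map fun z => (h - z).toNat).sum).sum : ℕ) := by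
    have h2 : ∀ (h : ℤ) (q : List ℤ), (q.length : ℤ) * h - q.sum ≤
        ((q.map fun z => (h - z).toNat).sum : ℕ) := by
      intro h q
      induction q with
      | nil => simp
      | cons z q ih =>
        rw [List.length_cons, List.sum_cons, List.map_cons, List.sum_cons]
        push_cast at ih ⊢
        have : h - z ≤ ((h - z).toNat : ℤ) := Int.self_le_toNat _
        simp only [Int.toNat_eq_max] at this ih ⊢
        linarith
    clear hpl hl hp
    induction p with
    | nil => simp
    | cons h p ih =>
      rw [List.length_cons, List.sum_cons, List.map_cons, List.sum_cons]
      have := h2 h q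
      push_cast at ih this ⊢
      linarith
  have h3 : cost l = cost p + cost q +
      (p.map fun h => (q.map fun z => (h - z).toNat).sum).sum := by rw [← hl]; exact cost_append p q
  have h4 : (l.length : ℤ) = p.length + q.length := by rw [← hl]; simp
  have h5 : l.sum = p.sum + q.sum := by rw [← hl]; simp
  rw [h3, h4, h5, ← hpl]
  rw [Nat.cast_add, Nat.cast_add]
  have := Int.natCast_nonneg (cost p)
  have := Int.natCast_nonneg (cost q)
  linarith

/-- Up to the cost, the ends bring at least `b` to every level, and the prefix sums of slopes take
away at most the interpolated part `j (b - b') / a`. What remains lies between `b` and `b'`. This is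
the source of all largeness: every level of a diagram of small codegree carries a large weight. -/
lemma le_flow {a j b b' n : ℕ} {L R : List ℤ} {ω : List Ltr} (hj : 1 ≤ j) (hja : j < a)
    (hL : L.length = a) (hR : R.length = a) (hsum : L.sum + R.sum = b - b')
    (hω : ω.countP Ltr.isS = b) (hcost : cost L + cost R + (ω.map (ltrCost a)).sum < n) :
    (min b b' : ℤ) - 2 * n ≤ flow j L R ω := by
  have h1 := length_mul_sum_take_le L (j := j) (by omega)
  have h2 := length_mul_sum_take_le R (j := j) (by omega)
  have h3 := le_sum_ltrFlow hj hja (ω := ω)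
  rw [hL] at h1
  rw [hR] at h2
  rw [hω] at h3
  by_contra hlt
  rw [not_le, flow] at hlt
  set tL := (L.take j).sum
  set tR := (R.take j).sum
  have h4 : (b : ℤ) - n - tL - tR < min (b : ℤ) b' - 2 * n := by
    have : ((ω.map (ltrCost a)).sum : ℤ) < n := by exact_mod_cast (by omega)
    linarith
  have ha : (0 : ℤ) < a := by exact_mod_cast (by omega)
  have hc : ((cost L : ℤ) + cost R) < n := by exact_mod_cast (by omega)
  have h5 : (a : ℤ) * (tL + tR) ≤ j * (b - b') + n := by
    rw [← hsum]; linarith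
  have h6 : (a : ℤ) * (b - min (b : ℤ) b' + n + 1) ≤ a * (tL + tR) :=
    mul_le_mul_of_nonneg_left (by linarith) ha.le
  have h7 : (j : ℤ) * (b - b') ≤ a * (b - min (b : ℤ) b') := by
    have e1 : (b : ℤ) - b' ≤ b - min (b : ℤ) b' := by have := min_le_right (b : ℤ) b'; linarith
    have e2 : (0 : ℤ) ≤ b - min (b : ℤ) b' := by have := min_le_left (b : ℤ) b'; linarith
    have e3 : (j : ℤ) ≤ a := by exact_mod_cast hja.le
    calc (j : ℤ) * (b - b') ≤ j * (b - min (b : ℤ) b') :=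
          mul_le_mul_of_nonneg_left e1 (by positivity)
      _ ≤ a * (b - min (b : ℤ) b') := mul_le_mul_of_nonneg_right e3 e2
  have h8 : (n : ℤ) ≤ a * n := le_mul_of_one_le_left (by positivity) (by linarith)
  linarith

section DataSum

variable {R : Type*} [CommRing R] {n : ℕ} {x : R}

/-- The sum of the multiplicities of the doubled edges with total weight `f`. -/
def dblSum (x : R) (f : ℤ) : R :=
  ∑ w ∈ Ico 1 f.toNat, (1 - x ^ w) ^ 2 * (1 - x ^ (f.toNat - w)) ^ 2

/-- At most one of `w` and `f - w` is smaller than `n`, so in each product one factor is `1`. The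
corrections at the two ends of the range are equal and no longer depend on `f`. The pairs `(w, f -
w)` are ordered, as the two edges have different markings. -/
lemma dblSum_eq (hx : x ^ n = 0) (hn : 0 < n) {f : ℤ} (hf : 2 * n ≤ f) :
    dblSum x f = f - 1 + dblCorr n x := by
  obtain ⟨F, rfl⟩ : ∃ F : ℕ, f = F := ⟨f.toNat, by omega⟩
  have hF : 2 * n ≤ F := by exact_mod_cast hf
  rw [dblSum, Int.toNat_natCast]
  have h1 : ∀ w ∈ Ico 1 F, (1 - x ^ w) ^ 2 * (1 - x ^ (F - w)) ^ 2 =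
      ((1 - x ^ w) ^ 2 - 1) + ((1 - x ^ (F - w)) ^ 2 - 1) + 1 := by
    intro w hw
    rcases Nat.lt_or_ge w n with h | h
    · rw [pow_eq_zero_of_le_exp hx (show n ≤ F - w by omega)]; ring
    · rw [pow_eq_zero_of_le_exp hx h]; ring
  rw [sum_congr rfl h1, sum_add_distrib, sum_add_distrib,
    sum_Ico_reflect' F fun w => (1 - x ^ w) ^ 2 - 1, sum_const, Nat.card_Ico, nsmul_eq_mul]
  have h2 : ∑ w ∈ Ico 1 F, ((1 - x ^ w) ^ 2 - 1) = ∑ w ∈ Ico 1 n, ((1 - x ^ w) ^ 2 - 1) := by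
    refine (sum_subset (Ico_subset_Ico_right (by omega)) ?_).symm
    intro w hw hw'
    simp only [mem_Ico] at hw hw'
    rw [pow_eq_zero_of_le_exp hx (by omega)]; ring
  rw [h2, dblCorr, ← mul_sum]
  push_cast [show 1 ≤ F by omega]
  ring

/-- The weighted sum over the arrangements of the slopes, the words of ends and the position of the
edge that lies in the cycle. -/
def dataSum (n : ℕ) (x : R) (a s b b' : ℕ) (ML MR : Multiset ℤ) : R :=
  ∑ j ∈ Ico 1 a, ∑ L ∈ arrangements ML, ∑ L' ∈ arrangements MR,
    ∑ ω ∈ endWords a s (levAt j) (2 * a) b b',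
      endFactor n x s (b + b') * x ^ (cost L + cost L' + (ω.map (ltrCost a)).sum) *
        (dblSum x (flow j L L' ω) + longSum n x a j)

/-- In an arrangement of small cost the first floors have the least slope and the last ones the
greatest. The corrections at the bottom and at the top therefore give `k E₂` and `-(k + l) E₂`,
where `l` is `ms.length`. The prefix sums give `pairMin` plus the cost, and the cost averages to `l
E₂`, so that all `E₂` terms cancel. -/
lemma sum_levGeo_take (hx : x ^ n = 0) (hn : 0 < n) {k : ℤ} {ms : List ℕ} {m0 : ℕ}
    (hm : ∀ z ∈ m0 :: ms, n * n + 2 * n ≤ z) {pm S : ℤ} {a : ℕ}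
    (hM : ∀ L ∈ arrangements (block k (m0 :: ms)), pairMin L = pm ∧ L.sum = S ∧ L.length = a) :
    ∑ j ∈ Ico 1 a, levGeo n x a j *
      ∑ L ∈ arrangements (block k (m0 :: ms)), x ^ cost L * ((L.take j).sum : ℤ) =
    partProd n x ^ ms.length * (pm + S * ∑ j ∈ Ico 1 n, lamb n x j) := by
  have hL : ∀ L ∈ arrangements (block k (m0 :: ms)),
      ∑ j ∈ Ico 1 a, levGeo n x a j * (x ^ cost L * ((L.take j).sum : ℤ)) =
      x ^ cost L * (cost L : R) + x ^ cost L * (pm + S * (∑ j ∈ Ico 1 n, lamb n x j)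
        - ms.length * eisSum n x) := by
    intro L hLm
    obtain ⟨h1, h2, h3⟩ := hM L hLm
    rw [mem_arrangements] at hLm
    by_cases hc : cost L < n
    · have hmem : ∀ z ∈ L, z ∈ block k (m0 :: ms) := fun z hz => by rw [← hLm]; exact hz
      have hcount : ∀ z, L.count z = (block k (m0 :: ms)).count z := fun z => by
        rw [← hLm, Multiset.coe_count]
      have hk1 : 2 * n ≤ L.count k := by
        rw [hcount, count_block]
        have := hm m0 (by simp)
        omega
      have hlast : 2 * n ≤ L.count (k + ms.length) := by
        rw [hcount]
        obtain ⟨ms', m', hms⟩ : ∃ ms' m', m0 :: ms = ms' ++ [m'] :=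
          ⟨_, _, (List.dropLast_append_getLast (by simp)).symm⟩
        have hlen : ms.length = ms'.length := by
          have := congrArg List.length hms
          simpa using this
        rw [hms, hlen, count_block_last]
        have := hm m' (by rw [hms]; simp)
        omega
      have hna : n ≤ a := by
        have := List.count_le_length (a := k) (l := L)
        omega
      -- Only the first and the last `n` prefix sums meet a nonzero `lamb`, so knowing these is
      -- enough.
      have t1 : ∀ i ≤ n, (L.take i).sum = i * k := by
        intro i hi
        rw [take_eq_replicate_of_cost_lt (fun z hz => (le_of_mem_block (hmem z hz)).1) hk1 hc hi]
        simp
      have t2 : ∀ i ≤ n, (L.take (a - i)).sum = S - i * (k + ms.length) := by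
        intro i hi
        have e1 := drop_eq_replicate_of_cost_lt (l := L) (k := k + ms.length) (n := n)
          (fun z hz => by
            have := (le_of_mem_block (hmem z hz)).2
            rw [List.length_cons] at this; push_cast at this; omega) hlast hc hi
        have e2 : (L.take (a - i)).sum + (L.drop (a - i)).sum = L.sum := List.sum_take_add_sum_drop
          L (a - i)
        rw [← h3, e1, h3, h2, List.sum_replicate] at e2
        simp only [nsmul_eq_mul] at e2
        linarith
      have t3 : ∑ j ∈ Ico 1 a, (((L.take j).sum : ℤ) : R) = pm + cost L := by
        have e := sum_sum_take L
        rw [h3, range_eq_Ico, sum_eq_sum_Ico_succ_bot (by omega), h1] at e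
        simp only [List.take_zero, List.sum_nil, zero_add] at e
        have e' := congrArg (Int.cast : ℤ → R) e
        rw [Int.cast_sum, Int.cast_add, Int.cast_natCast] at e'
        exact e'
      have t4 : ∑ j ∈ Ico 1 a, (((L.take j).sum : ℤ) : R) * lamb n x j = k * eisSum n x := by
        rw [sum_mul_lamb hx hna, eisSum_eq hx le_rfl, mul_sum]
        refine sum_congr rfl fun j hj => ?_
        rw [mem_Ico] at hj
        rw [t1 j hj.2.le]; push_cast; ring
      have t5 : ∑ j ∈ Ico 1 a, (((L.take j).sum : ℤ) : R) * lamb n x (a - j) =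
          S * (∑ j ∈ Ico 1 n, lamb n x j) - (k + ms.length) * eisSum n x := by
        rw [← sum_Ico_reflect' a, sum_congr rfl (g := fun j =>
          (((L.take (a - j)).sum : ℤ) : R) * lamb n x j), sum_mul_lamb hx hna, eisSum_eq hx le_rfl,
          mul_sum, mul_sum, ← sum_sub_distrib]
        · refine sum_congr rfl fun j hj => ?_
          rw [mem_Ico] at hj
          rw [t2 j hj.2.le]; push_cast; ring
        · intro j hj
          rw [mem_Ico] at hj
          rw [show a - (a - j) = j by omega]
      have t6 : ∀ j ∈ Ico 1 a, levGeo n x a j * (x ^ cost L * ((L.take j).sum : ℤ)) =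
          x ^ cost L * ((L.take j).sum : ℤ) + x ^ cost L * (((L.take j).sum : ℤ) * lamb n x j) +
          x ^ cost L * (((L.take j).sum : ℤ) * lamb n x (a - j)) := by
        intro j hj
        rw [mem_Ico] at hj
        rw [levGeo_eq hx hna hj.1 hj.2]; ring
      rw [sum_congr rfl t6, sum_add_distrib, sum_add_distrib, ← mul_sum, ← mul_sum, ← mul_sum, t3,
        t4, t5]
      ring
    · rw [pow_eq_zero_of_le_exp hx (by omega)]; simp
  simp only [mul_sum]
  rw [sum_comm]
  simp only [← mul_sum]
  have hL' : ∀ L ∈ arrangements (block k (m0 :: ms)),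
      ∑ j ∈ Ico 1 a, levGeo n x a j * (x ^ cost L * ((L.take j).sum : ℤ)) = _ := hL
  rw [sum_congr rfl hL', sum_add_distrib, sum_arrangements_cost_mul hn hx k m0 ms hm, ← sum_mul,
    sum_arrangements_cost hn hx k m0 ms hm]
  ring

/-- The flow is linear in the number of marked ends and in the two prefix sums of slopes, so the sum
splits into the sums over levels computed before. The coefficient of `E₂` is `-8` from the ends and
`-4` from the further edge. -/
theorem dataSum_eq (hx : x ^ n = 0) (hn : 0 < n) {a s B b' : ℕ} {k k' : ℤ} {m0 m0' : ℕ}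
    {ms ms' : List ℕ} (hm : ∀ z ∈ m0 :: ms, n * n + 2 * n ≤ z)
    (hm' : ∀ z ∈ m0' :: ms', n * n + 2 * n ≤ z) {pm pm' S S' : ℤ}
    (hM : ∀ L ∈ arrangements (block k (m0 :: ms)), pairMin L = pm ∧ L.sum = S ∧ L.length = a)
    (hM' : ∀ L ∈ arrangements (block k' (m0' :: ms')),
      pairMin L = pm' ∧ L.sum = S' ∧ L.length = a)
    (hna : n ≤ a) (hS : S + S' = (2 * s + B : ℕ) - (b' : ℤ)) (hB : 4 * n + n * (2 * n) ≤ B)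
    (hB' : 4 * n + n * (2 * n) ≤ b') :
    dataSum n x a s (2 * s + B) b' (block k (m0 :: ms)) (block k' (m0' :: ms')) =
      partProd n x ^ (4 + ms.length + ms'.length) *
        (((a : R) - 1) * ((2 * s + B : ℕ) - 1) - pm - pm' + 2 * s * lamb n x 1
          - 12 * eisSum n x) := by
  set b := 2 * s + B with hb
  set ML := block k (m0 :: ms)
  set MR := block k' (m0' :: ms')
  set P := partProd n x ^ 4
  set sg : ℕ → R := fun j => s * (2 * (1 - x ^ (2 * j))) +
      (srcLog n x a B j + srcLog n x a b' (a - j)) with hsg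
  have step1 : ∀ j ∈ Ico 1 a, ∀ L ∈ arrangements ML, ∀ L' ∈ arrangements MR,
      ∑ ω ∈ endWords a s (levAt j) (2 * a) b b',
        endFactor n x s (b + b') * x ^ (cost L + cost L' + (ω.map (ltrCost a)).sum) *
        (dblSum x (flow j L L' ω) + longSum n x a j) =
      P * levGeo n x a j * ((x ^ cost L * x ^ cost L') *
        (sg j - b' - 1 + (dblCorr n x + longSum n x a j)) -
        (x ^ cost L * ((L.take j).sum : ℤ)) * x ^ cost L' -
        x ^ cost L * (x ^ cost L' * ((L'.take j).sum : ℤ))) := by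
    intro j hj L hL L' hL'
    rw [mem_Ico] at hj
    obtain ⟨-, hL2, hL3⟩ := hM L hL
    obtain ⟨-, hL2', hL3'⟩ := hM' L' hL'
    have hterm : ∀ ω ∈ endWords a s (levAt j) (2 * a) b b',
        endFactor n x s (b + b') * x ^ (cost L + cost L' + (ω.map (ltrCost a)).sum) *
        (dblSum x (flow j L L' ω) + longSum n x a j) =
        (x ^ cost L * x ^ cost L') * (endFactor n x s (b + b') * x ^ (ω.map (ltrCost a)).sum *
          ((ω.map (ltrIn j)).sum : ℕ)) +
        ((x ^ cost L * x ^ cost L') * (- b' - 1 + (dblCorr n x + longSum n x a j)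
          - ((L.take j).sum : ℤ) - ((L'.take j).sum : ℤ))) *
          (endFactor n x s (b + b') * x ^ (ω.map (ltrCost a)).sum) := by
      intro ω hω
      obtain ⟨-, -, -, h4, h5⟩ := mem_endWords.mp hω
      rw [pow_add, pow_add]
      -- The formula for doubled edges needs a large flow, which is available exactly where the
      -- power of `x` does not already vanish.
      by_cases hc : cost L + cost L' + (ω.map (ltrCost a)).sum < n
      · have hf := le_flow hj.1 hj.2 hL3 hL3' (by rw [hL2, hL2', hS]) h4 hc
        have hf' : 2 * (n : ℤ) ≤ flow j L L' ω := by
          have : (4 * n : ℤ) ≤ min (b : ℤ) b' := by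
            rw [le_min_iff]; constructor <;> exact_mod_cast (by omega)
          linarith
        rw [dblSum_eq hx hn hf', flow, sum_ltrFlow, h5]
        simp only [Int.cast_sub, Int.cast_natCast]
        ring
      · have h0 : x ^ cost L * x ^ cost L' * x ^ (ω.map (ltrCost a)).sum = 0 := by
          rw [← pow_add, ← pow_add, pow_eq_zero_of_le_exp hx (by omega)]
        linear_combination (endFactor n x s (b + b') *
          (dblSum x (flow j L L' ω) + longSum n x a j) -
          endFactor n x s (b + b') * ((ω.map (ltrIn j)).sum : ℕ) -
          (- b' - 1 + (dblCorr n x + longSum n x a j)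
          - ((L.take j).sum : ℤ) - ((L'.take j).sum : ℤ)) * endFactor n x s (b + b')) * h0
    rw [sum_congr rfl hterm, sum_add_distrib, ← mul_sum, ← mul_sum,
      sum_endWords_base hn hx hna hj.1 hj.2 (by omega) (by omega),
      sum_endWords_in hn hx hna hj.1 hj.2 (by omega) (by omega)]
    simp only [hsg, levGeo, P]
    ring
  have step2 : ∀ j ∈ Ico 1 a, ∑ L ∈ arrangements ML, ∑ L' ∈ arrangements MR,
      ∑ ω ∈ endWords a s (levAt j) (2 * a) b b',
        endFactor n x s (b + b') * x ^ (cost L + cost L' + (ω.map (ltrCost a)).sum) *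
        (dblSum x (flow j L L' ω) + longSum n x a j) =
      P * partProd n x ^ (ms.length + ms'.length) * (levGeo n x a j * (sg j - b' - 1)) +
      P * partProd n x ^ (ms.length + ms'.length) *
        (levGeo n x a j * (dblCorr n x + longSum n x a j)) -
      P * partProd n x ^ ms'.length * (levGeo n x a j *
        ∑ L ∈ arrangements ML, x ^ cost L * ((L.take j).sum : ℤ)) -
      P * partProd n x ^ ms.length * (levGeo n x a j *
        ∑ L ∈ arrangements MR, x ^ cost L * ((L.take j).sum : ℤ)) := by
    intro j hj
    rw [sum_congr rfl fun L hL => sum_congr rfl (step1 j hj L hL)]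
    simp only [← mul_sum, sum_sub_distrib, ← sum_mul]
    rw [sum_arrangements_cost hn hx k m0 ms hm, sum_arrangements_cost hn hx k' m0' ms' hm']
    ring
  rw [dataSum, sum_congr rfl step2]
  simp only [sum_sub_distrib, sum_add_distrib, ← mul_sum]
  rw [sum_levGeo_corr hx hna, sum_levGeo_take hx hn hm hM, sum_levGeo_take hx hn hm' hM',
    sum_levGeo_ends hx hna hn s B b']
  have hS' := congrArg (Int.cast : ℤ → R) hS
  push_cast [hb] at hS' ⊢
  simp only [P]
  -- The total of the slopes is the difference of the numbers of sources and sinks, so the multiples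
  -- of `∑ λ_j` from ends and slopes cancel.
  linear_combination (-(partProd n x ^ (4 + ms.length + ms'.length) *
    ∑ j ∈ Ico 1 n, lamb n x j)) * hS'

end DataSum

/-! ### Words of marked floor diagrams -/

/-- The letters of the word of a marked floor diagram, in which floors are referred to by their
number: a floor with its slopes, a bounded edge with its first and last floor and its weight, a
source with its floor, a sink with its floor. -/
inductive Tok where
  | F (l r : ℤ)
  | B (i i' w : ℕ)
  | S (m : ℕ)
  | T (m : ℕ)

namespace Tok

/-- The underlying letter. -/
def toLtr : Tok → Ltr
  | F _ _ => Ltr.K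
  | B _ _ _ => Ltr.K
  | S m => Ltr.S m
  | T m => Ltr.T m

/-- The letter is a floor. -/
def isF : Tok → Bool
  | F _ _ => true
  | _ => false

/-- The letter is a bounded edge. -/
def isB : Tok → Bool
  | B _ _ _ => true
  | _ => false

/-- The letter is a floor or a bounded edge. -/
def isK (t : Tok) : Bool := t.toLtr.isK

/-- The slopes of a floor. -/
def slopes : Tok → Option (ℤ × ℤ)
  | F l r => some (l, r)
  | _ => none

/-- The contribution of a bounded edge to the codegree. -/
def excess : Tok → ℕ
  | B i i' w => w * (i' - i - 1)
  | _ => 0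

/-- The weight of a bounded edge if it passes the level `j`. -/
def cross (j : ℕ) : Tok → ℤ
  | B i i' w => if i ≤ j ∧ j < i' then w else 0
  | _ => 0

/-- The multiplicity of a bounded edge. -/
def mult {R : Type*} [CommRing R] (x : R) : Tok → R
  | B _ _ w => (1 - x ^ w) ^ 2
  | _ => 1

/-- The letter may be placed after the first `c` of altogether `a` floors. -/
def Ok (a c : ℕ) : Tok → Prop
  | F _ _ => True
  | B i i' w => 1 ≤ i ∧ i ≤ c ∧ c < i' ∧ i' ≤ a ∧ 0 < w
  | S m => c < m ∧ m ≤ a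
  | T m => 1 ≤ m ∧ m ≤ c ∧ m ≤ a

/-- The number of floors given by a letter. -/
def incr (t : Tok) : ℕ := if t.isF then 1 else 0

end Tok

/-- The letters of the word are attached in agreement with the order. -/
def OkWord (a : ℕ) : ℕ → List Tok → Prop
  | _, [] => True
  | c, t :: W => t.Ok a c ∧ OkWord a (c + t.incr) W

/-- The slopes of the floors. -/
def slopesList (W : List Tok) : List (ℤ × ℤ) := W.filterMap Tok.slopes

/-- Inserts floors and bounded edges in a word of ends. -/
def merge : List Ltr → List Tok → List Tok
  | [], _ => []
  | Ltr.K :: _, [] => []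
  | Ltr.K :: ω, t :: sk => t :: merge ω sk
  | Ltr.S m :: ω, sk => Tok.S m :: merge ω sk
  | Ltr.T m :: ω, sk => Tok.T m :: merge ω sk

section Merge

variable {ω : List Ltr} {sk : List Tok}

lemma merge_cons_K (t : Tok) : merge (Ltr.K :: ω) (t :: sk) = t :: merge ω sk := by
  rw [merge]

lemma merge_cons_S (m : ℕ) : merge (Ltr.S m :: ω) sk = Tok.S m :: merge ω sk := by
  rcases sk <;> rw [merge]

lemma merge_cons_T (m : ℕ) : merge (Ltr.T m :: ω) sk = Tok.T m :: merge ω sk := by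
  rcases sk <;> rw [merge]

/-- The list of letters fits the places of the letters `K` of the word of ends. -/
inductive Fits : List Ltr → List Tok → Prop
  | nil : Fits [] []
  | consK (ω t sk) (ht : t.isK = true) (h : Fits ω sk) : Fits (Ltr.K :: ω) (t :: sk)
  | consS (ω sk m) (h : Fits ω sk) : Fits (Ltr.S m :: ω) sk
  | consT (ω sk m) (h : Fits ω sk) : Fits (Ltr.T m :: ω) sk

lemma fits_of_countP (h1 : ∀ t ∈ sk, Tok.isK t = true) (h2 : ω.countP Ltr.isK = sk.length) :
    Fits ω sk := by
  induction ω generalizing sk with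
  | nil =>
    rw [List.countP_nil] at h2
    rw [List.eq_nil_of_length_eq_zero h2.symm]
    exact .nil
  | cons z ω ih =>
    rcases z with _ | m | m
    · rcases sk with _ | ⟨t, sk⟩
      · simp [Ltr.isK] at h2
      · rw [List.countP_cons_of_pos rfl, List.length_cons, Nat.add_right_cancel_iff] at h2
        exact .consK _ _ _ (h1 t (by simp)) (ih (fun t ht => h1 t (by simp [ht])) h2)
    · rw [List.countP_cons_of_neg (by simp [Ltr.isK])] at h2
      exact .consS _ _ _ (ih h1 h2)
    · rw [List.countP_cons_of_neg (by simp [Ltr.isK])] at h2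
      exact .consT _ _ _ (ih h1 h2)

lemma map_toLtr_merge (h1 : ∀ t ∈ sk, Tok.isK t = true) (h2 : ω.countP Ltr.isK = sk.length) :
    (merge ω sk).map Tok.toLtr = ω := by
  have h := fits_of_countP h1 h2
  clear h1 h2
  induction h with
  | nil => simp [merge]
  | consK ω t sk ht _ ih =>
    rw [merge_cons_K, List.map_cons, ih]
    rcases t <;> simp_all [Tok.isK, Tok.toLtr, Ltr.isK]
  | consS ω sk m _ ih => rw [merge_cons_S, List.map_cons, ih]; rfl
  | consT ω sk m _ ih => rw [merge_cons_T, List.map_cons, ih]; rfl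

lemma filter_isK_merge (h1 : ∀ t ∈ sk, Tok.isK t = true) (h2 : ω.countP Ltr.isK = sk.length) :
    (merge ω sk).filter Tok.isK = sk := by
  have h := fits_of_countP h1 h2
  clear h1 h2
  induction h with
  | nil => simp [merge]
  | consK ω t sk ht _ ih => rw [merge_cons_K, List.filter_cons_of_pos ht, ih]
  | consS ω sk m _ ih => rw [merge_cons_S, List.filter_cons_of_neg (by simp [Tok.isK, Tok.toLtr,
      Ltr.isK]), ih]
  | consT ω sk m _ ih => rw [merge_cons_T, List.filter_cons_of_neg (by simp [Tok.isK, Tok.toLtr,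
      Ltr.isK]), ih]

/-- With `map_toLtr_merge` and `filter_isK_merge`, a word is the same thing as a word of ends
together with a fitting skeleton of floors and bounded edges. -/
lemma merge_map_filter (W : List Tok) : merge (W.map Tok.toLtr) (W.filter Tok.isK) = W := by
  induction W with
  | nil => simp [merge]
  | cons t W ih =>
    rcases t with ⟨l, r⟩ | ⟨i, i', w⟩ | m | m
    · rw [List.filter_cons_of_pos rfl, List.map_cons, Tok.toLtr, merge_cons_K, ih]
    · rw [List.filter_cons_of_pos rfl, List.map_cons, Tok.toLtr, merge_cons_K, ih]
    · rw [List.filter_cons_of_neg (by simp [Tok.isK, Tok.toLtr, Ltr.isK]), List.map_cons,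
        Tok.toLtr, merge_cons_S, ih]
    · rw [List.filter_cons_of_neg (by simp [Tok.isK, Tok.toLtr, Ltr.isK]), List.map_cons,
        Tok.toLtr, merge_cons_T, ih]

lemma prod_merge {M : Type*} [CommMonoid M] (f : Tok → M) (hS : ∀ m, f (Tok.S m) = 1)
    (hT : ∀ m, f (Tok.T m) = 1)
    (h1 : ∀ t ∈ sk, Tok.isK t = true) (h2 : ω.countP Ltr.isK = sk.length) :
    ((merge ω sk).map f).prod = (sk.map f).prod := by
  have h := fits_of_countP h1 h2
  clear h1 h2
  induction h with
  | nil => simp [merge]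
  | consK ω t sk ht _ ih => simp [merge_cons_K, ih]
  | consS ω sk m _ ih => simp [merge_cons_S, ih, hS]
  | consT ω sk m _ ih => simp [merge_cons_T, ih, hT]

lemma sum_merge {M : Type*} [AddCommMonoid M] (f : Tok → M) (hS : ∀ m, f (Tok.S m) = 0)
    (hT : ∀ m, f (Tok.T m) = 0)
    (h1 : ∀ t ∈ sk, Tok.isK t = true) (h2 : ω.countP Ltr.isK = sk.length) :
    ((merge ω sk).map f).sum = (sk.map f).sum := by
  have h := fits_of_countP h1 h2
  clear h1 h2
  induction h with
  | nil => simp [merge]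
  | consK ω t sk ht _ ih => simp [merge_cons_K, ih]
  | consS ω sk m _ ih => simp [merge_cons_S, ih, hS]
  | consT ω sk m _ ih => simp [merge_cons_T, ih, hT]

lemma slopesList_merge (h1 : ∀ t ∈ sk, Tok.isK t = true) (h2 : ω.countP Ltr.isK = sk.length) :
    slopesList (merge ω sk) = slopesList sk := by
  have h := fits_of_countP h1 h2
  clear h1 h2
  induction h with
  | nil => simp [merge]
  | consK ω t sk ht _ ih =>
    simp only [slopesList, merge_cons_K, List.filterMap_cons] at ih ⊢
    rw [ih]
  | consS ω sk m _ ih => rw [merge_cons_S, slopesList, List.filterMap_cons_none rfl]; exact ih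
  | consT ω sk m _ ih => rw [merge_cons_T, slopesList, List.filterMap_cons_none rfl]; exact ih

/-- The ends see the skeleton only through the number of floors before each of its places. This is
what separates the sum over ends from the rest. -/
lemma okWord_merge {a c : ℕ} (h1 : ∀ t ∈ sk, Tok.isK t = true)
    (h2 : ω.countP Ltr.isK = sk.length) :
    OkWord a c (merge ω sk) ↔ OkWord a c sk ∧
      ValidWord a (fun p => c + (sk.take p).countP Tok.isF) ω := by
  have h := fits_of_countP h1 h2
  clear h1 h2
  induction h generalizing c with
  | nil => simp [merge, OkWord, ValidWord]
  | consK ω t sk ht _ ih =>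
    have ih' : ∀ c, OkWord a c (merge ω sk) ↔ OkWord a c sk ∧
        ValidWord a (fun p => c + (sk.take p).countP Tok.isF) ω := fun c => ih
    rw [merge_cons_K, OkWord, OkWord, ih' (c + t.incr), ValidWord, and_assoc]
    have : ∀ p, c + t.incr + (sk.take p).countP Tok.isF =
        c + ((t :: sk).take (p + 1)).countP Tok.isF := by
      intro p
      rw [List.take_succ_cons, List.countP_cons, Tok.incr]; ring
    simp only [this]
  | consS ω sk m _ ih =>
    have ih' : ∀ c, OkWord a c (merge ω sk) ↔ OkWord a c sk ∧
        ValidWord a (fun p => c + (sk.take p).countP Tok.isF) ω := fun c => ih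
    rw [merge_cons_S, OkWord, Tok.incr, if_neg (by simp [Tok.isF]), add_zero, ih' c, ValidWord,
      Tok.Ok]
    simp only [List.take_zero, List.countP_nil, add_zero]
    tauto
  | consT ω sk m _ ih =>
    have ih' : ∀ c, OkWord a c (merge ω sk) ↔ OkWord a c sk ∧
        ValidWord a (fun p => c + (sk.take p).countP Tok.isF) ω := fun c => ih
    rw [merge_cons_T, OkWord, Tok.incr, if_neg (by simp [Tok.isF]), add_zero, ih' c, ValidWord,
      Tok.Ok]
    simp only [List.take_zero, List.countP_nil, add_zero]
    tauto

lemma validWord_congr {a : ℕ} {lev lev' : ℕ → ℕ} (ω : List Ltr)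
    (h : ∀ q ≤ ω.countP Ltr.isK, lev q = lev' q) :
    ValidWord a lev ω ↔ ValidWord a lev' ω := by
  induction ω generalizing lev lev' with
  | nil => simp [ValidWord]
  | cons z ω ih =>
    rcases z with _ | m | m
    · rw [ValidWord, ValidWord]
      refine ih fun q hq => h (q + 1) ?_
      rw [List.countP_cons_of_pos rfl]; omega
    · rw [ValidWord, ValidWord, ih fun q hq => h q (by
        rw [List.countP_cons_of_neg (by simp [Ltr.isK])]; exact hq), h 0 (Nat.zero_le _)]
    · rw [ValidWord, ValidWord, ih fun q hq => h q (by
        rw [List.countP_cons_of_neg (by simp [Ltr.isK])]; exact hq), h 0 (Nat.zero_le _)]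

end Merge

/-! ### Skeletons -/

/-- The list of the floors with given slopes, the floor number `m` being followed by the edges
`E m`. -/
def gskel (E : ℕ → List Tok) : ℕ → List (ℤ × ℤ) → List Tok
  | _, [] => []
  | m, lr :: LR => Tok.F lr.1 lr.2 :: (E m ++ gskel E (m + 1) LR)

section Skeleton

variable {E : ℕ → List Tok}

lemma gskel_congr {E' : ℕ → List Tok} (LR : List (ℤ × ℤ)) (m : ℕ)
    (h : ∀ c, m ≤ c → c < m + LR.length → E c = E' c) : gskel E m LR = gskel E' m LR := by
  induction LR generalizing m with
  | nil => rfl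
  | cons lr LR ih =>
    rw [List.length_cons] at h
    rw [gskel, gskel, h m le_rfl (by omega), ih (m + 1) fun c h1 h2 => h c (by omega) (by omega)]

lemma mem_gskel {t : Tok} {LR : List (ℤ × ℤ)} {m : ℕ} (h : t ∈ gskel E m LR) :
    t.isF = true ∨ ∃ c, m ≤ c ∧ c < m + LR.length ∧ t ∈ E c := by
  induction LR generalizing m with
  | nil => simp [gskel] at h
  | cons lr LR ih =>
    rw [gskel, List.mem_cons, List.mem_append] at h
    rw [List.length_cons]
    rcases h with rfl | h | h
    · exact Or.inl rfl
    · exact Or.inr ⟨m, le_rfl, by omega, h⟩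
    · rcases ih h with h | ⟨c, h1, h2, h3⟩
      · exact Or.inl h
      · exact Or.inr ⟨c, by omega, by omega, h3⟩

lemma mem_gskel_of_mem {t : Tok} {LR : List (ℤ × ℤ)} {m c : ℕ} (hc : m ≤ c)
    (hc' : c < m + LR.length) (ht : t ∈ E c) : t ∈ gskel E m LR := by
  induction LR generalizing m with
  | nil => simp at hc'; omega
  | cons lr LR ih =>
    rw [List.length_cons] at hc'
    rw [gskel, List.mem_cons, List.mem_append]
    rcases Nat.eq_or_lt_of_le hc with rfl | h
    · exact Or.inr (Or.inl ht)
    · exact Or.inr (Or.inr (ih h (by omega)))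

lemma sum_gskel {M : Type*} [AddCommMonoid M] (f : Tok → M) (hF : ∀ l r, f (Tok.F l r) = 0)
    (LR : List (ℤ × ℤ)) (m : ℕ) :
    ((gskel E m LR).map f).sum = ∑ c ∈ Ico m (m + LR.length), ((E c).map f).sum := by
  induction LR generalizing m with
  | nil => simp [gskel]
  | cons lr LR ih =>
    rw [gskel, List.map_cons, List.sum_cons, hF, zero_add, List.map_append, List.sum_append, ih,
      List.length_cons, show m + (LR.length + 1) = m + 1 + LR.length by omega,
      sum_eq_sum_Ico_succ_bot (show m < m + 1 + LR.length by omega)]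

lemma prod_gskel {M : Type*} [CommMonoid M] (f : Tok → M) (hF : ∀ l r, f (Tok.F l r) = 1)
    (LR : List (ℤ × ℤ)) (m : ℕ) :
    ((gskel E m LR).map f).prod = ∏ c ∈ Ico m (m + LR.length), ((E c).map f).prod := by
  induction LR generalizing m with
  | nil => simp [gskel]
  | cons lr LR ih =>
    rw [gskel, List.map_cons, List.prod_cons, hF, one_mul, List.map_append, List.prod_append, ih,
      List.length_cons, show m + (LR.length + 1) = m + 1 + LR.length by omega,
      prod_eq_prod_Ico_succ_bot (show m < m + 1 + LR.length by omega)]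

lemma okWord_append {a c : ℕ} (W W' : List Tok) :
    OkWord a c (W ++ W') ↔ OkWord a c W ∧ OkWord a (c + W.countP Tok.isF) W' := by
  induction W generalizing c with
  | nil => simp [OkWord]
  | cons t W ih =>
    rw [List.cons_append, OkWord, OkWord, ih, List.countP_cons, Tok.incr, and_assoc,
      show c + (if t.isF then 1 else 0) + W.countP Tok.isF =
        c + (W.countP Tok.isF + if t.isF then 1 else 0) by ring]

lemma okWord_of_isB {a c : ℕ} {es : List Tok} (hes : ∀ t ∈ es, Tok.isB t = true) :
    OkWord a c es ↔ ∀ t ∈ es, t.Ok a c := by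
  induction es with
  | nil => simp [OkWord]
  | cons t es ih =>
    have ht := hes t (by simp)
    have : t.incr = 0 := by rcases t <;> simp_all [Tok.isB, Tok.incr, Tok.isF]
    rw [OkWord, this, add_zero, ih fun t ht => hes t (by simp [ht]), List.forall_mem_cons]

lemma countP_isF_of_isB {es : List Tok} (hes : ∀ t ∈ es, Tok.isB t = true) :
    es.countP Tok.isF = 0 := by
  rw [List.countP_eq_zero]
  intro t ht
  have := hes t ht
  rcases t <;> simp_all [Tok.isB, Tok.isF]

lemma okWord_gskel {a : ℕ} (hE : ∀ c, ∀ t ∈ E c, Tok.isB t = true) (LR : List (ℤ × ℤ)) (m : ℕ) :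
    OkWord a m (gskel E (m + 1) LR) ↔
      ∀ c, m + 1 ≤ c → c < m + 1 + LR.length → ∀ t ∈ E c, t.Ok a c := by
  induction LR generalizing m with
  | nil => simp [gskel, OkWord]; omega
  | cons lr LR ih =>
    rw [gskel, OkWord, okWord_append, okWord_of_isB (hE _), countP_isF_of_isB (hE _), add_zero,
      show m + (Tok.F lr.1 lr.2).incr = m + 1 from rfl, ih, List.length_cons]
    constructor
    · rintro ⟨-, h1, h2⟩ c hc hc'
      rcases Nat.eq_or_lt_of_le hc with rfl | h
      · exact h1
      · exact h2 c h (by omega)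
    · intro h
      exact ⟨trivial, h (m + 1) le_rfl (by omega), fun c h1 h2 => h c (by omega) (by omega)⟩

lemma slopesList_gskel (hE : ∀ c, ∀ t ∈ E c, Tok.isB t = true) (LR : List (ℤ × ℤ)) (m : ℕ) :
    slopesList (gskel E m LR) = LR := by
  induction LR generalizing m with
  | nil => rfl
  | cons lr LR ih =>
    have h1 : (E m).filterMap Tok.slopes = [] := by
      rw [List.filterMap_eq_nil_iff]
      intro t ht
      have := hE m t ht
      rcases t <;> simp_all [Tok.isB, Tok.slopes]
    have := ih (m + 1)
    rw [slopesList] at this ⊢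
    rw [gskel, List.filterMap_cons, List.filterMap_append, h1, this]
    rfl

/-- Floors separate the groups of edges, so the groups can be read off the skeleton. -/
lemma gskel_injective {E' : ℕ → List Tok} (hE : ∀ c, ∀ t ∈ E c, Tok.isB t = true)
    (hE' : ∀ c, ∀ t ∈ E' c, Tok.isB t = true) (LR : List (ℤ × ℤ)) (m : ℕ)
    (h : gskel E m LR = gskel E' m LR) : ∀ c, m ≤ c → c < m + LR.length → E c = E' c := by
  have key : ∀ (es es' rest rest' : List Tok), (∀ t ∈ es, Tok.isB t = true) →
      (∀ t ∈ es', Tok.isB t = true) → (∀ t ∈ rest.head?, Tok.isB t = false) →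
      (∀ t ∈ rest'.head?, Tok.isB t = false) → es ++ rest = es' ++ rest' →
      es = es' ∧ rest = rest' := by
    intro es
    induction es with
    | nil =>
      intro es' rest rest' _ h2 h3 _ h5
      rcases es' with _ | ⟨t, es'⟩
      · exact ⟨rfl, h5⟩
      · rw [List.nil_append] at h5
        have e1 := h3 t (by rw [h5]; simp)
        have e2 := h2 t (by simp)
        rw [e1] at e2; cases e2
    | cons t es ih =>
      intro es' rest rest' h1 h2 h3 h4 h5
      rcases es' with _ | ⟨t', es'⟩
      · rw [List.nil_append] at h5
        have e1 := h4 t (by rw [← h5]; simp)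
        have e2 := h1 t (by simp)
        rw [e1] at e2; cases e2
      · rw [List.cons_append, List.cons_append, List.cons.injEq] at h5
        obtain ⟨rfl, h5⟩ := h5
        obtain ⟨rfl, h6⟩ := ih es' rest rest' (fun t ht => h1 t (by simp [ht]))
          (fun t ht => h2 t (by simp [ht])) h3 h4 h5
        exact ⟨rfl, h6⟩
  have hhead : ∀ (E : ℕ → List Tok) m LR, ∀ t ∈ (gskel E m LR).head?, Tok.isB t = false := by
    intro E m LR t ht
    rcases LR with _ | ⟨lr, LR⟩
    · simp [gskel] at ht
    · simp only [gskel, List.head?_cons, Option.mem_def, Option.some.injEq] at ht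
      rw [← ht]; rfl
  induction LR generalizing m with
  | nil => intro c h1 h2; simp at h2; omega
  | cons lr LR ih =>
    rw [gskel, gskel, List.cons.injEq] at h
    obtain ⟨h1, h2⟩ := key _ _ _ _ (hE m) (hE' m) (hhead _ _ _) (hhead _ _ _) h.2
    intro c hc hc'
    rw [List.length_cons] at hc'
    rcases Nat.eq_or_lt_of_le hc with rfl | h3
    · exact h1
    · exact ih (m + 1) h2 c h3 (by omega)

/-- Cutting at the floors; `E c` collects the edges that stand before the next floor, since the
induction may start between floors. -/
lemma exists_gskel {a c : ℕ} {sk : List Tok} (h1 : ∀ t ∈ sk, Tok.isK t = true)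
    (h2 : OkWord a c sk) :
    ∃ E : ℕ → List Tok, (∀ c, ∀ t ∈ E c, Tok.isB t = true ∧ t.Ok a c) ∧
      sk = E c ++ gskel E (c + 1) (slopesList sk) := by
  induction sk generalizing c with
  | nil => exact ⟨fun _ => [], by simp, by simp [slopesList, gskel]⟩
  | cons t sk ih =>
    rw [OkWord] at h2
    have h1' : ∀ t ∈ sk, Tok.isK t = true := fun t ht => h1 t (by simp [ht])
    rcases t with ⟨l, r⟩ | ⟨i, i', w⟩ | m | m
    · obtain ⟨E, hE1, hE2⟩ := @ih (c + 1) h1' h2.2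
      refine ⟨fun m => if m = c then [] else E m, ?_, ?_⟩
      · intro m t ht
        dsimp only at ht
        split_ifs at ht
        · simp at ht
        · exact hE1 m t ht
      · simp only [if_true, List.nil_append]
        have : slopesList (Tok.F l r :: sk) = (l, r) :: slopesList sk := rfl
        rw [this, gskel]
        simp only [Nat.succ_ne_self, if_false]
        congr 1
        conv_lhs => rw [hE2]
        congr 1
        refine gskel_congr _ _ fun m h3 _ => ?_
        rw [if_neg (by omega)]
    · have h2' := h2.2
      rw [Tok.incr, if_neg (by simp [Tok.isF]), add_zero] at h2'
      obtain ⟨E, hE1, hE2⟩ := @ih c h1' h2'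
      refine ⟨fun m => if m = c then Tok.B i i' w :: E m else E m, ?_, ?_⟩
      · intro m t ht
        dsimp only at ht
        split_ifs at ht with hm
        · rw [List.mem_cons] at ht
          rcases ht with rfl | ht
          · exact ⟨rfl, hm ▸ h2.1⟩
          · exact hE1 m t ht
        · exact hE1 m t ht
      · simp only [if_true]
        have : slopesList (Tok.B i i' w :: sk) = slopesList sk := rfl
        rw [this, List.cons_append]
        congr 1
        conv_lhs => rw [hE2]
        congr 1
        refine gskel_congr _ _ fun m h3 _ => ?_
        rw [if_neg (by omega)]
    · have := h1 (Tok.S m) (by simp); simp [Tok.isK, Tok.toLtr, Ltr.isK] at this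
    · have := h1 (Tok.T m) (by simp); simp [Tok.isK, Tok.toLtr, Ltr.isK] at this

end Skeleton

/-! ### Words of genus one and small codegree -/

/-- The edges that are placed after the floors of number `1, …, a`: an edge from each floor to the
next one, and another edge `t` at the level `j`. -/
def levelEdges (a j : ℕ) (ε : Bool) (t : Tok) (wt : ℕ → ℕ) (c : ℕ) : List Tok :=
  if 1 ≤ c ∧ c < a then
    if c = j then
      if ε then [Tok.B c (c + 1) (wt c), t] else [t, Tok.B c (c + 1) (wt c)]
    else [Tok.B c (c + 1) (wt c)]
  else []

lemma length_gskel {E : ℕ → List Tok} (LR : List (ℤ × ℤ)) (m : ℕ) :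
    (gskel E m LR).length = LR.length + ∑ c ∈ Ico m (m + LR.length), (E c).length := by
  induction LR generalizing m with
  | nil => simp [gskel]
  | cons lr LR ih =>
    rw [gskel, List.length_cons, List.length_append, ih, List.length_cons,
      show m + (LR.length + 1) = m + 1 + LR.length by omega,
      sum_eq_sum_Ico_succ_bot (show m < m + 1 + LR.length by omega)]
    omega

lemma countP_take_gskel {E : ℕ → List Tok} (hE : ∀ c, ∀ t ∈ E c, Tok.isB t = true)
    (LR : List (ℤ × ℤ)) (m : ℕ) (h : ∀ c, m ≤ c → c + 1 < m + LR.length → (E c).length = 1)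
    {p : ℕ} (hp : p ≤ 2 * LR.length) :
    ((gskel E m LR).take p).countP Tok.isF = (p + 1) / 2 := by
  induction LR generalizing m p with
  | nil =>
    obtain rfl : p = 0 := by simpa using hp
    simp
  | cons lr LR ih =>
    rw [List.length_cons] at h hp
    rcases p with _ | p
    · simp
    rw [gskel, List.take_succ_cons, List.countP_cons_of_pos rfl]
    rcases p with _ | p
    · simp
    rcases LR with _ | ⟨lr', LR⟩
    · rw [gskel, List.append_nil, countP_isF_of_isB fun t ht => hE m t (List.mem_of_mem_take ht)]
      simp at hp
      omega
    · obtain ⟨t, ht⟩ := List.length_eq_one_iff.1 (h m le_rfl (by rw [List.length_cons]; omega))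
      have hB := hE m t (by simp [ht])
      have hF : t.isF = false := by rcases t <;> simp_all [Tok.isB, Tok.isF]
      rw [ht, List.singleton_append, List.take_succ_cons, List.countP_cons_of_neg (by simp [hF]),
        ih (m + 1) (fun c h1 h2 => h c (by omega) (by omega)) (by omega)]
      omega

/-- Floors and edges alternate; after the doubled level the pattern is shifted by one, so the
rounding changes from up to down. -/
lemma countP_take_gskel_of_le {E : ℕ → List Tok} (hE : ∀ c, ∀ t ∈ E c, Tok.isB t = true) {j : ℕ}
    (LR : List (ℤ × ℤ)) (m : ℕ) (hmj : m ≤ j) (hj : j + 1 < m + LR.length)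
    (h : ∀ c, m ≤ c → c + 1 < m + LR.length → (E c).length = if c = j then 2 else 1)
    {p : ℕ} (hp : p ≤ 2 * LR.length) :
    ((gskel E m LR).take p).countP Tok.isF =
      (p + if p ≤ 2 * (j + 1 - m) then 1 else 0) / 2 := by
  induction LR generalizing m p with
  | nil => simp at hj; omega
  | cons lr LR ih =>
    rw [List.length_cons] at h hp hj
    rcases p with _ | p
    · simp
    rw [gskel, List.take_succ_cons, List.countP_cons_of_pos rfl]
    rcases p with _ | p
    · rw [if_pos (by omega)]; simp
    have h0 := h m le_rfl (by omega)
    have aux : ∀ t ∈ E m, ¬ t.isF = true := by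
      intro t ht
      have hB := hE m t ht
      rcases t <;> simp_all [Tok.isB, Tok.isF]
    rcases Nat.eq_or_lt_of_le hmj with rfl | hlt
    · rw [if_pos rfl] at h0
      obtain ⟨t, t', ht⟩ := List.length_eq_two.1 h0
      rw [ht, List.cons_append, List.take_succ_cons,
        List.countP_cons_of_neg (aux t (by simp [ht])), List.cons_append, List.nil_append]
      rcases p with _ | p
      · rw [if_pos (by omega)]; simp
      · rw [List.take_succ_cons, List.countP_cons_of_neg (aux t' (by simp [ht])),
          countP_take_gskel hE LR (m + 1) (fun c h1 h2 => by
            rw [h c (by omega) (by omega), if_neg (by omega)]) (by omega), if_neg (by omega)]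
        omega
    · rw [if_neg (by omega)] at h0
      obtain ⟨t, ht⟩ := List.length_eq_one_iff.1 h0
      rw [ht, List.singleton_append, List.take_succ_cons,
        List.countP_cons_of_neg (aux t (by simp [ht])),
        ih (m + 1) hlt (by omega) (fun c h1 h2 => h c (by omega) (by omega)) (by omega)]
      split_ifs <;> omega

section LevelEdges

variable {a j : ℕ} {ε : Bool} {t : Tok} {wt : ℕ → ℕ}

lemma isB_levelEdges (ht : t.isB = true) (c : ℕ) :
    ∀ u ∈ levelEdges a j ε t wt c, Tok.isB u = true := by
  intro u hu
  rw [levelEdges] at hu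
  split_ifs at hu <;> simp at hu
  · rcases hu with rfl | rfl
    exacts [rfl, ht]
  · rcases hu with rfl | rfl
    exacts [ht, rfl]
  · rw [hu]; rfl

lemma length_levelEdges (c : ℕ) : (levelEdges a j ε t wt c).length =
    if 1 ≤ c ∧ c < a then (if c = j then 2 else 1) else 0 := by
  rw [levelEdges]; split_ifs <;> rfl

lemma sum_map_levelEdges {M : Type*} [AddCommMonoid M] (f : Tok → M) (h1 : 1 ≤ j) (hj : j < a)
    (c : ℕ) : ((levelEdges a j ε t wt c).map f).sum =
    (if 1 ≤ c ∧ c < a then f (Tok.B c (c + 1) (wt c)) else 0) + if c = j then f t else 0 := by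
  rw [levelEdges]
  split_ifs <;> simp [add_comm] <;> omega

lemma prod_map_levelEdges {M : Type*} [CommMonoid M] (f : Tok → M) (h1 : 1 ≤ j) (hj : j < a)
    (c : ℕ) : ((levelEdges a j ε t wt c).map f).prod =
    (if 1 ≤ c ∧ c < a then f (Tok.B c (c + 1) (wt c)) else 1) * if c = j then f t else 1 := by
  rw [levelEdges]
  split_ifs <;> simp [mul_comm] <;> omega

lemma sum_levelEdges {M : Type*} [AddCommMonoid M] (f : Tok → M) (h1 : 1 ≤ j) (hj : j < a) :
    ∑ c ∈ Ico 1 (1 + a), ((levelEdges a j ε t wt c).map f).sum =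
      ∑ c ∈ Ico 1 a, f (Tok.B c (c + 1) (wt c)) + f t := by
  simp only [sum_map_levelEdges f h1 hj]
  rw [sum_add_distrib, sum_ite_eq', if_pos (mem_Ico.2 ⟨h1, by omega⟩), ← sum_filter]
  congr 2
  ext c
  simp only [mem_filter, mem_Ico]
  omega

lemma prod_levelEdges {M : Type*} [CommMonoid M] (f : Tok → M) (h1 : 1 ≤ j) (hj : j < a) :
    ∏ c ∈ Ico 1 (1 + a), ((levelEdges a j ε t wt c).map f).prod =
      (∏ c ∈ Ico 1 a, f (Tok.B c (c + 1) (wt c))) * f t := by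
  simp only [prod_map_levelEdges f h1 hj]
  rw [prod_mul_distrib, prod_ite_eq', if_pos (mem_Ico.2 ⟨h1, by omega⟩), ← prod_filter]
  congr 2
  ext c
  simp only [mem_filter, mem_Ico]
  omega

variable {LR : List (ℤ × ℤ)} (ht : t.isB = true) (h1 : 1 ≤ j) (hj : j < a) (hLR : LR.length = a)

lemma isK_gskel {E : ℕ → List Tok} (hE : ∀ c, ∀ t ∈ E c, Tok.isB t = true) (m : ℕ) :
    ∀ u ∈ gskel E m LR, Tok.isK u = true := by
  intro u hu
  rcases mem_gskel hu with h | ⟨c, -, -, h⟩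
  · rcases u <;> simp_all [Tok.isF, Tok.isK, Tok.toLtr, Ltr.isK]
  · have := hE c u h
    rcases u <;> simp_all [Tok.isB, Tok.isK, Tok.toLtr, Ltr.isK]

include h1 hj hLR in
lemma length_gskel_levelEdges : (gskel (levelEdges a j ε t wt) 1 LR).length = 2 * a := by
  have := sum_levelEdges (ε := ε) (t := t) (wt := wt) (fun _ => 1) h1 hj
  simp only [List.map_const', List.sum_replicate, smul_eq_mul, mul_one, sum_const,
    Nat.card_Ico] at this
  rw [length_gskel, hLR, this]
  omega

include ht h1 hj hLR in
lemma countP_take_gskel_levelEdges {p : ℕ} (hp : p ≤ 2 * a) :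
    ((gskel (levelEdges a j ε t wt) 1 LR).take p).countP Tok.isF = levAt j p := by
  rw [countP_take_gskel_of_le (j := j) (isB_levelEdges ht) LR 1 h1 (by omega) (fun c h2 h3 => by
    rw [length_levelEdges, if_pos (by omega)]) (by omega), levAt, Nat.add_sub_cancel]

include ht h1 hj hLR in
lemma okWord_levelEdges {ω : List Ltr} (hω : ω.countP Ltr.isK = 2 * a) :
    OkWord a 0 (merge ω (gskel (levelEdges a j ε t wt) 1 LR)) ↔
      (t.Ok a j ∧ ∀ c ∈ Ico 1 a, 0 < wt c) ∧ ValidWord a (levAt j) ω := by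
  have hlen := length_gskel_levelEdges (ε := ε) (t := t) (wt := wt) h1 hj hLR
  rw [okWord_merge (isK_gskel (isB_levelEdges ht) 1) (by rw [hω, hlen]),
    okWord_gskel (isB_levelEdges ht)]
  refine and_congr ?_ (validWord_congr ω fun q hq => ?_)
  · constructor
    · intro h
      refine ⟨h j (by omega) (by omega) t ?_, fun c hc => ?_⟩
      · rw [levelEdges, if_pos ⟨h1, hj⟩, if_pos rfl]
        split_ifs <;> simp
      · rw [mem_Ico] at hc
        have := h c (by omega) (by omega) (Tok.B c (c + 1) (wt c)) (by
          rw [levelEdges, if_pos hc]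
          split_ifs <;> simp)
        exact this.2.2.2.2
    · rintro ⟨h2, h3⟩ c hc hc' u hu
      rw [levelEdges] at hu
      split_ifs at hu with h4 h5 h6
      · rw [List.mem_cons, List.mem_singleton] at hu
        rcases hu with rfl | rfl
        · exact ⟨h4.1, le_rfl, by omega, by omega, h3 c (mem_Ico.2 h4)⟩
        · rw [h5]; exact h2
      · rw [List.mem_cons, List.mem_singleton] at hu
        rcases hu with rfl | rfl
        · rw [h5]; exact h2
        · exact ⟨h4.1, le_rfl, by omega, by omega, h3 c (mem_Ico.2 h4)⟩
      · rw [List.mem_singleton] at hu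
        rw [hu]
        exact ⟨h4.1, le_rfl, by omega, by omega, h3 c (mem_Ico.2 h4)⟩
      · simp at hu
  · rw [zero_add, countP_take_gskel_levelEdges ht h1 hj hLR (by omega)]

include ht h1 hj hLR in
lemma sum_merge_levelEdges {ω : List Ltr} (hω : ω.countP Ltr.isK = 2 * a) {M : Type*}
    [AddCommMonoid M] (f : Tok → M) (hF : ∀ l r, f (Tok.F l r) = 0) (hS : ∀ m, f (Tok.S m) = 0)
    (hT : ∀ m, f (Tok.T m) = 0) :
    ((merge ω (gskel (levelEdges a j ε t wt) 1 LR)).map f).sum =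
      ∑ c ∈ Ico 1 a, f (Tok.B c (c + 1) (wt c)) + f t := by
  rw [sum_merge f hS hT (isK_gskel (isB_levelEdges ht) 1)
    (by rw [hω, length_gskel_levelEdges h1 hj hLR]), sum_gskel f hF, hLR, sum_levelEdges f h1 hj]

include ht h1 hj hLR in
lemma prod_merge_levelEdges {ω : List Ltr} (hω : ω.countP Ltr.isK = 2 * a) {M : Type*}
    [CommMonoid M] (f : Tok → M) (hF : ∀ l r, f (Tok.F l r) = 1) (hS : ∀ m, f (Tok.S m) = 1)
    (hT : ∀ m, f (Tok.T m) = 1) :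
    ((merge ω (gskel (levelEdges a j ε t wt) 1 LR)).map f).prod =
      (∏ c ∈ Ico 1 a, f (Tok.B c (c + 1) (wt c))) * f t := by
  rw [prod_merge f hS hT (isK_gskel (isB_levelEdges ht) 1)
    (by rw [hω, length_gskel_levelEdges h1 hj hLR]), prod_gskel f hF, hLR, prod_levelEdges f h1 hj]

include ht h1 hj hLR in
lemma slopesList_merge_levelEdges {ω : List Ltr} (hω : ω.countP Ltr.isK = 2 * a) :
    slopesList (merge ω (gskel (levelEdges a j ε t wt) 1 LR)) = LR := by
  rw [slopesList_merge (isK_gskel (isB_levelEdges ht) 1)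
    (by rw [hω, length_gskel_levelEdges h1 hj hLR]), slopesList_gskel (isB_levelEdges ht)]

include ht h1 hj hLR in
lemma toLtr_merge_levelEdges {ω : List Ltr} (hω : ω.countP Ltr.isK = 2 * a) :
    (merge ω (gskel (levelEdges a j ε t wt) 1 LR)).map Tok.toLtr = ω :=
  map_toLtr_merge (isK_gskel (isB_levelEdges ht) 1)
    (by rw [hω, length_gskel_levelEdges h1 hj hLR])

end LevelEdges

/-- The codegree of a word. -/
def wordCost (a : ℕ) (W : List Tok) : ℕ :=
  cost ((slopesList W).map Prod.fst) + cost ((slopesList W).map Prod.snd) +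
    ((W.map Tok.toLtr).map (ltrCost a)).sum + (W.map Tok.excess).sum

/-- The words of the marked floor diagrams of genus one and codegree smaller than `n`, with `a`
floors, `b` sources, `b'` sinks and slopes `ML`, `MR`, in which the first `2 * s` letters are
pairs of equal sources. -/
structure IsLowWord (n a s b b' : ℕ) (ML MR : Multiset ℤ) (W : List Tok) : Prop where
  ok : OkWord a 0 W
  left : (((slopesList W).map Prod.fst : List ℤ) : Multiset ℤ) = ML
  right : (((slopesList W).map Prod.snd : List ℤ) : Multiset ℤ) = MR
  countK : (W.map Tok.toLtr).countP Ltr.isK = 2 * a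
  countS : (W.map Tok.toLtr).countP Ltr.isS = b
  countT : (W.map Tok.toLtr).countP Ltr.isT = b'
  balance : ∀ m, 1 ≤ m → m < a → (W.map (Tok.cross m)).sum =
    flow m ((slopesList W).map Prod.fst) ((slopesList W).map Prod.snd) (W.map Tok.toLtr)
  cost_lt : wordCost a W < n
  pairs : PairPrefix s (W.map Tok.toLtr)

/-- The weights of the edges between consecutive floors, in terms of another edge. -/
def chainWt (L R : List ℤ) (ω : List Ltr) (i i' w m : ℕ) : ℕ :=
  (flow m L R ω - if i ≤ m ∧ m < i' then (w : ℤ) else 0).toNat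

/-- The word with given slopes and ends and a further edge at the level `j`. -/
def dataWord (a j : ℕ) (L R : List ℤ) (ω : List Ltr) (e : Bool × ℕ × ℕ × ℕ) : List Tok :=
  merge ω (gskel (levelEdges a j e.1 (Tok.B e.2.1 e.2.2.1 e.2.2.2)
    (chainWt L R ω e.2.1 e.2.2.1 e.2.2.2)) 1 (L.zip R))

/-- The possible further edges at the level `j`: an edge to the next floor of weight smaller than
`F`, or a longer edge of weight smaller than `n`. -/
def furtherEdges (n a j F : ℕ) : Finset (Bool × ℕ × ℕ × ℕ) :=
  (Ico 1 F).image (fun w => (false, j, j + 1, w)) ∪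
    ((univ : Finset Bool) ×ˢ Icc 1 j ×ˢ Icc (j + 1) a ×ˢ Ico 1 n).filter
      fun e => e.2.1 + 2 ≤ e.2.2.1

lemma mem_furtherEdges {n a j F : ℕ} {e : Bool × ℕ × ℕ × ℕ} : e ∈ furtherEdges n a j F ↔
    (e.1 = false ∧ e.2.1 = j ∧ e.2.2.1 = j + 1 ∧ 1 ≤ e.2.2.2 ∧ e.2.2.2 < F) ∨
    ((1 ≤ e.2.1 ∧ e.2.1 ≤ j) ∧ (j + 1 ≤ e.2.2.1 ∧ e.2.2.1 ≤ a) ∧ (1 ≤ e.2.2.2 ∧ e.2.2.2 < n) ∧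
      e.2.1 + 2 ≤ e.2.2.1) := by
  obtain ⟨ε, i, i', w⟩ := e
  simp only [furtherEdges, mem_union, mem_image, mem_filter, mem_product, mem_univ, true_and,
    mem_Icc, mem_Ico, Prod.mk.injEq]
  constructor
  · rintro (⟨w', h1, rfl, rfl, rfl, rfl⟩ | h)
    · exact Or.inl ⟨rfl, rfl, rfl, h1⟩
    · exact Or.inr (by tauto)
  · rintro (⟨rfl, rfl, rfl, h⟩ | h)
    · exact Or.inl ⟨w, h, rfl, rfl, rfl, rfl⟩
    · exact Or.inr (by tauto)

lemma sum_furtherEdges {R : Type*} [CommRing R] (n : ℕ) (x : R) (a j : ℕ) (f : ℤ) :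
    ∑ e ∈ furtherEdges n a j f.toNat, x ^ (e.2.2.2 * (e.2.2.1 - e.2.1 - 1)) *
      ((1 - x ^ e.2.2.2) ^ 2 *
        if e.2.2.1 = e.2.1 + 1 then (1 - x ^ (f.toNat - e.2.2.2)) ^ 2 else 1) =
      dblSum x f + longSum n x a j := by
  rw [furtherEdges, sum_union]
  · congr 1
    · rw [sum_image (fun w _ w' _ h => by simpa using h), dblSum]
      refine sum_congr rfl fun w _ => ?_
      simp
    · rw [sum_filter, sum_product, Fintype.sum_bool, longSum]
      simp only [sum_product]
      rw [← sum_add_distrib]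
      refine sum_congr rfl fun i _ => ?_
      rw [← sum_add_distrib]
      refine sum_congr rfl fun i' _ => ?_
      rw [← sum_add_distrib]
      refine sum_congr rfl fun w _ => ?_
      split_ifs with h1 h2
      · omega
      · ring
      · ring
  · rw [disjoint_left]
    rintro e h1 h2
    obtain ⟨w, -, rfl⟩ := mem_image.1 h1
    have := (mem_filter.1 h2).2
    simp only at this
    omega

section LowWords

variable {n a s b b' j : ℕ} {ML MR : Multiset ℤ} {L R : List ℤ} {ω : List Ltr}
  {e : Bool × ℕ × ℕ × ℕ}

/-- The further edge is lighter than the flow at every level it passes, so the truncation to natural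
numbers in `chainWt` never acts and chain edges keep positive weight. -/
lemma natCast_chainWt (hn0 : 0 < n) (hF : ∀ m, 1 ≤ m → m < a → 2 * (n : ℤ) ≤ flow m L R ω) (h1 : 1 ≤ j)
    (hj : j < a) (he : e ∈ furtherEdges n a j (flow j L R ω).toNat) {m : ℕ} (hm : 1 ≤ m)
    (hma : m < a) :
    (chainWt L R ω e.2.1 e.2.2.1 e.2.2.2 m : ℤ) =
      flow m L R ω - (if e.2.1 ≤ m ∧ m < e.2.2.1 then (e.2.2.2 : ℤ) else 0) ∧
    0 < chainWt L R ω e.2.1 e.2.2.1 e.2.2.2 m := by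
  have h2 := hF m hm hma
  have h3 := hF j h1 hj
  rw [chainWt]
  rw [mem_furtherEdges] at he
  rcases he with he | he
  · split_ifs with h
    · obtain rfl : m = j := by omega
      omega
    · omega
  · split_ifs <;> omega

lemma le_chainWt (hF : ∀ m, 1 ≤ m → m < a → 2 * (n : ℤ) ≤ flow m L R ω)
    (he : e ∈ furtherEdges n a j (flow j L R ω).toNat) {m : ℕ} (hm : 1 ≤ m)
    (hma : m < a) (h : m ≠ j ∨ e.2.1 + 2 ≤ e.2.2.1) :
    n ≤ chainWt L R ω e.2.1 e.2.2.1 e.2.2.2 m := by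
  have h2 := hF m hm hma
  rw [chainWt]
  rw [mem_furtherEdges] at he
  split_ifs <;> omega

lemma flow_ge (hn : 4 * n ≤ b) (hn' : 4 * n ≤ b') (hsum : ML.sum + MR.sum = (b : ℤ) - b')
    (hML : ML.card = a) (hMR : MR.card = a)
    (hL : (L : Multiset ℤ) = ML) (hR : (R : Multiset ℤ) = MR)
    (hω : ω.countP Ltr.isS = b) (hcost : cost L + cost R + (ω.map (ltrCost a)).sum < n) :
    ∀ m, 1 ≤ m → m < a → 2 * (n : ℤ) ≤ flow m L R ω := by
  intro m hm hma
  have := le_flow (b' := b') (n := n) hm hma (L := L) (R := R) (ω := ω)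
    (by rw [← hML, ← hL, Multiset.coe_card]) (by rw [← hMR, ← hR, Multiset.coe_card])
    (by rw [← hsum, ← hL, ← hR, Multiset.sum_coe, Multiset.sum_coe]) hω hcost
  omega

variable (hn : 4 * n ≤ b) (hn' : 4 * n ≤ b') (hsum : ML.sum + MR.sum = (b : ℤ) - b')
  (hML : ML.card = a) (hMR : MR.card = a)

include hn hn' hsum hML hMR

section

variable (h1 : 1 ≤ j) (hj : j < a) (hL : L ∈ arrangements ML) (hR : R ∈ arrangements MR)
  (hω : ω ∈ endWords a s (levAt j) (2 * a) b b')
  (he : e ∈ furtherEdges n a j (flow j L R ω).toNat)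

include h1 hj hL hR hω

omit hn hn' hsum in
lemma slopesList_dataWord : slopesList (dataWord a j L R ω e) = L.zip R ∧
    (slopesList (dataWord a j L R ω e)).map Prod.fst = L ∧
    (slopesList (dataWord a j L R ω e)).map Prod.snd = R := by
  rw [mem_arrangements] at hL hR
  rw [mem_endWords] at hω
  have hLl : L.length = a := by rw [← hML, ← hL, Multiset.coe_card]
  have hRl : R.length = a := by rw [← hMR, ← hR, Multiset.coe_card]
  have key : slopesList (dataWord a j L R ω e) = L.zip R :=
    slopesList_merge_levelEdges rfl h1 hj (by rw [List.length_zip, hLl, hRl, min_self]) hω.2.2.1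
  rw [key]
  exact ⟨rfl, List.map_fst_zip (by omega), List.map_snd_zip (by omega)⟩

omit hn hn' hsum in
lemma toLtr_dataWord : (dataWord a j L R ω e).map Tok.toLtr = ω := by
  rw [mem_arrangements] at hL hR
  rw [mem_endWords] at hω
  have hLl : L.length = a := by rw [← hML, ← hL, Multiset.coe_card]
  have hRl : R.length = a := by rw [← hMR, ← hR, Multiset.coe_card]
  exact toLtr_merge_levelEdges rfl h1 hj (by rw [List.length_zip, hLl, hRl, min_self]) hω.2.2.1

omit hn hn' hsum in
lemma wordCost_dataWord : wordCost a (dataWord a j L R ω e) =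
    cost L + cost R + (ω.map (ltrCost a)).sum + e.2.2.2 * (e.2.2.1 - e.2.1 - 1) := by
  obtain ⟨-, h2, h3⟩ := slopesList_dataWord (e := e) hML hMR h1 hj hL hR hω
  rw [wordCost, h2, h3, toLtr_dataWord hML hMR h1 hj hL hR hω]
  rw [mem_arrangements] at hL hR
  rw [mem_endWords] at hω
  have hLl : L.length = a := by rw [← hML, ← hL, Multiset.coe_card]
  have hRl : R.length = a := by rw [← hMR, ← hR, Multiset.coe_card]
  rw [dataWord, sum_merge_levelEdges rfl h1 hj (by rw [List.length_zip, hLl, hRl, min_self])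
    hω.2.2.1 Tok.excess (fun _ _ => rfl) (fun _ => rfl) fun _ => rfl, sum_eq_zero, zero_add]
  · rfl
  · intro c _
    simp [Tok.excess]

include he

lemma isLowWord_dataWord
    (hcost : cost L + cost R + (ω.map (ltrCost a)).sum + e.2.2.2 * (e.2.2.1 - e.2.1 - 1) < n) :
    IsLowWord n a s b b' ML MR (dataWord a j L R ω e) := by
  obtain ⟨-, h2, h3⟩ := slopesList_dataWord (e := e) hML hMR h1 hj hL hR hω
  have h4 := toLtr_dataWord (e := e) hML hMR h1 hj hL hR hω
  have h5 := wordCost_dataWord (e := e) hML hMR h1 hj hL hR hω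
  rw [mem_arrangements] at hL hR
  rw [mem_endWords] at hω
  have hLl : L.length = a := by rw [← hML, ← hL, Multiset.coe_card]
  have hRl : R.length = a := by rw [← hMR, ← hR, Multiset.coe_card]
  have hzip : (L.zip R).length = a := by rw [List.length_zip, hLl, hRl, min_self]
  have hF := flow_ge hn hn' hsum hML hMR hL hR hω.2.2.2.1 (by omega)
  have hwt := fun m => natCast_chainWt (n := n) (by omega) hF h1 hj he (m := m)
  refine ⟨?_, ?_, ?_, ?_, ?_, ?_, ?_, ?_, ?_⟩
  · rw [dataWord, okWord_levelEdges rfl h1 hj hzip hω.2.2.1]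
    refine ⟨⟨?_, fun c hc => ?_⟩, hω.1⟩
    · rw [mem_furtherEdges] at he
      rw [Tok.Ok]
      omega
    · rw [mem_Ico] at hc
      exact (hwt c hc.1 hc.2).2
  · rw [h2, hL]
  · rw [h3, hR]
  · rw [h4]; exact hω.2.2.1
  · rw [h4]; exact hω.2.2.2.1
  · rw [h4]; exact hω.2.2.2.2
  · intro m hm hma
    rw [h2, h3, h4, dataWord, sum_merge_levelEdges rfl h1 hj hzip hω.2.2.1 (Tok.cross m)
      (fun _ _ => rfl) (fun _ => rfl) fun _ => rfl]
    have : ∀ c ∈ Ico 1 a, (Tok.B c (c + 1) (chainWt L R ω e.2.1 e.2.2.1 e.2.2.2 c)).cross m =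
        if c = m then (chainWt L R ω e.2.1 e.2.2.1 e.2.2.2 c : ℤ) else 0 := by
      intro c _
      rw [Tok.cross]
      exact if_congr (by omega) rfl rfl
    rw [sum_congr rfl this, sum_ite_eq', if_pos (mem_Ico.2 ⟨hm, hma⟩), (hwt m hm hma).1, Tok.cross]
    ring
  · rw [h5]; exact hcost
  · rw [h4]; exact hω.2.1

/-- Chain edges of weight at least `n` have multiplicity `1`. The only other chain edge is the one
parallel to the further edge, with the complementary weight. -/
lemma prod_mult_dataWord {A : Type*} [CommRing A] {x : A} (hx : x ^ n = 0)
    (hcost : cost L + cost R + (ω.map (ltrCost a)).sum < n) :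
    ((dataWord a j L R ω e).map (Tok.mult x)).prod = (1 - x ^ e.2.2.2) ^ 2 *
      if e.2.2.1 = e.2.1 + 1 then (1 - x ^ ((flow j L R ω).toNat - e.2.2.2)) ^ 2 else 1 := by
  rw [mem_arrangements] at hL hR
  rw [mem_endWords] at hω
  have hLl : L.length = a := by rw [← hML, ← hL, Multiset.coe_card]
  have hRl : R.length = a := by rw [← hMR, ← hR, Multiset.coe_card]
  have hzip : (L.zip R).length = a := by rw [List.length_zip, hLl, hRl, min_self]
  have hF := flow_ge hn hn' hsum hML hMR hL hR hω.2.2.2.1 (by omega)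
  have hwt := fun m => natCast_chainWt (n := n) (by omega) hF h1 hj he (m := m)
  rw [dataWord, prod_merge_levelEdges rfl h1 hj hzip hω.2.2.1 (Tok.mult x)
      (fun _ _ => rfl) (fun _ => rfl) (fun _ => rfl), mul_comm]
  congr 1
  rw [prod_eq_single_of_mem j (mem_Ico.2 ⟨h1, hj⟩)]
  · rw [Tok.mult]
    split_ifs with h
    · have h2 := (hwt j h1 hj).1
      rw [if_pos (by rw [mem_furtherEdges] at he; omega)] at h2
      congr 3
      omega
    · have := le_chainWt hF he h1 hj (Or.inr (by rw [mem_furtherEdges] at he; omega))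
      rw [pow_eq_zero_of_le_exp hx this]
      ring
  · intro m hm hmj
    rw [mem_Ico] at hm
    have := le_chainWt hF he hm.1 hm.2 (Or.inl hmj)
    rw [Tok.mult, pow_eq_zero_of_le_exp hx this]
    ring

end

omit hn hn' hsum in
-- Slopes and ends are read off directly, and `j` is the only level that has two edges.
lemma dataWord_injective {j₂ : ℕ} {L₂ R₂ : List ℤ} {ω₂ : List Ltr} {e₂ : Bool × ℕ × ℕ × ℕ}
    (h1 : 1 ≤ j) (hj : j < a) (hL : L ∈ arrangements ML) (hR : R ∈ arrangements MR)
    (hω : ω ∈ endWords a s (levAt j) (2 * a) b b')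
    (he : e ∈ furtherEdges n a j (flow j L R ω).toNat)
    (h1' : 1 ≤ j₂) (hj' : j₂ < a) (hL' : L₂ ∈ arrangements ML) (hR' : R₂ ∈ arrangements MR)
    (hω' : ω₂ ∈ endWords a s (levAt j₂) (2 * a) b b')
    (he' : e₂ ∈ furtherEdges n a j₂ (flow j₂ L₂ R₂ ω₂).toNat)
    (h : dataWord a j L R ω e = dataWord a j₂ L₂ R₂ ω₂ e₂) :
    j = j₂ ∧ L = L₂ ∧ R = R₂ ∧ ω = ω₂ ∧ e = e₂ := by
  have a1 := slopesList_dataWord (e := e) hML hMR h1 hj hL hR hω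
  have a2 := slopesList_dataWord (e := e₂) hML hMR h1' hj' hL' hR' hω'
  have b1 := toLtr_dataWord (e := e) hML hMR h1 hj hL hR hω
  have b2 := toLtr_dataWord (e := e₂) hML hMR h1' hj' hL' hR' hω'
  rw [h] at a1 b1
  obtain rfl := a1.2.1.symm.trans a2.2.1
  obtain rfl := a1.2.2.symm.trans a2.2.2
  obtain rfl := b1.symm.trans b2
  rw [mem_arrangements] at hL hR
  rw [mem_endWords] at hω
  have hLl : L.length = a := by rw [← hML, ← hL, Multiset.coe_card]
  have hRl : R.length = a := by rw [← hMR, ← hR, Multiset.coe_card]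
  have hzip : (L.zip R).length = a := by rw [List.length_zip, hLl, hRl, min_self]
  have h2 := congrArg (List.filter Tok.isK) h
  rw [dataWord, dataWord, filter_isK_merge (isK_gskel (isB_levelEdges rfl) 1)
    (by rw [hω.2.2.1, length_gskel_levelEdges h1 hj hzip]),
    filter_isK_merge (isK_gskel (isB_levelEdges rfl) 1)
    (by rw [hω.2.2.1, length_gskel_levelEdges h1' hj' hzip])] at h2
  have h3 := gskel_injective (isB_levelEdges rfl) (isB_levelEdges rfl) _ _ h2 j h1 (by omega)
  have h4 := congrArg List.length h3
  rw [length_levelEdges, length_levelEdges, if_pos (show 1 ≤ j ∧ j < a from ⟨h1, hj⟩), if_pos rfl,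
    if_pos (show 1 ≤ j ∧ j < a from ⟨h1, hj⟩)] at h4
  obtain rfl : j = j₂ := by
    by_contra hne
    rw [if_neg hne] at h4
    omega
  refine ⟨rfl, rfl, rfl, rfl, ?_⟩
  simp only [levelEdges, show 1 ≤ j ∧ j < a from ⟨h1, hj⟩, and_self, if_true] at h3
  obtain ⟨ε, i, i', w⟩ := e
  obtain ⟨ε₂, i₂, i₂', w₂⟩ := e₂
  simp only [mem_furtherEdges] at he he'
  -- The flag is `true` only for long edges; for the two orders to give the same word, a long edge
  -- would have to be a chain edge.
  rcases ε <;> rcases ε₂ <;> simp at h3 he he' ⊢ <;> omega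

/-- An edge passing a level without joining the two adjacent floors has excess at least its weight.
Were there no edge between the floors `m` and `m + 1`, the flow at level `m` would be at most the
total excess, hence less than `n`, contrary to `flow_ge`. So `a - 1` of the `a` bounded edges form a
chain, one edge is left over, and the balance at each level determines the weights of the chain. -/
lemma exists_dataWord {W : List Tok} (hW : IsLowWord n a s b b' ML MR W) :
    ∃ j L R ω e, 1 ≤ j ∧ j < a ∧ L ∈ arrangements ML ∧ R ∈ arrangements MR ∧
      ω ∈ endWords a s (levAt j) (2 * a) b b' ∧ e ∈ furtherEdges n a j (flow j L R ω).toNat ∧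
      dataWord a j L R ω e = W := by
  obtain ⟨ok, left, right, countK, countS, countT, balance, cost_lt, pairs⟩ := hW
  set L := (slopesList W).map Prod.fst with hL
  set R := (slopesList W).map Prod.snd with hR
  set ω := W.map Tok.toLtr with hω
  set sk := W.filter Tok.isK with hsk
  have hmerge : merge ω sk = W := merge_map_filter W
  have hLR : slopesList W = L.zip R := by
    rw [hL, hR, ← List.unzip_fst, ← List.unzip_snd, List.zip_unzip]
  have hLl : L.length = a := by rw [← hML, ← left, Multiset.coe_card]
  have hRl : R.length = a := by rw [← hMR, ← right, Multiset.coe_card]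
  have hzip : (L.zip R).length = a := by rw [List.length_zip, hLl, hRl, min_self]
  have hskK : ∀ t ∈ sk, Tok.isK t = true := fun t ht => (List.mem_filter.1 ht).2
  have hlen : sk.length = 2 * a := by
    rw [← countK, hsk, hω, ← List.countP_eq_length_filter, List.countP_map]
    rfl
  have hskl : slopesList sk = L.zip R := by
    rw [← hLR, ← hmerge, slopesList_merge hskK (by rw [countK, hlen])]
  have hc : cost L + cost R + (ω.map (ltrCost a)).sum + (W.map Tok.excess).sum < n := cost_lt
  have hF := flow_ge hn hn' hsum hML hMR left right countS (by omega)
  have hokm : OkWord a 0 (merge ω sk) := by rw [hmerge]; exact ok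
  rw [okWord_merge hskK (by rw [countK, hlen])] at hokm
  obtain ⟨E, hE, hEsk⟩ := exists_gskel hskK hokm.1
  rw [hskl] at hEsk
  have hE0 : E 0 = [] := by
    rw [List.eq_nil_iff_forall_not_mem]
    intro t ht
    obtain ⟨hb, hok⟩ := hE 0 t ht
    rcases t with _ | ⟨i, i', w⟩ | _ | _ <;> simp [Tok.isB] at hb
    rw [Tok.Ok] at hok
    omega
  have hEa : E a = [] := by
    rw [List.eq_nil_iff_forall_not_mem]
    intro t ht
    obtain ⟨hb, hok⟩ := hE a t ht
    rcases t with _ | ⟨i, i', w⟩ | _ | _ <;> simp [Tok.isB] at hb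
    rw [Tok.Ok] at hok
    omega
  rw [hE0, List.nil_append, zero_add] at hEsk
  have hEB : ∀ c, ∀ t ∈ E c, Tok.isB t = true := fun c t ht => (hE c t ht).1
  -- the sum over all bounded edges of a function
  have hsumW : ∀ (M : Type) [AddCommMonoid M] (f : Tok → M), (∀ l r, f (Tok.F l r) = 0) →
      (∀ m, f (Tok.S m) = 0) → (∀ m, f (Tok.T m) = 0) →
      (W.map f).sum = ∑ c ∈ Ico 1 (1 + a), ((E c).map f).sum := by
    intro M _ f h1 h2 h3
    rw [← hmerge, sum_merge f h2 h3 hskK (by rw [countK, hlen]), hEsk, sum_gskel f h1, hzip]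
  have hexc : ∀ c, 1 ≤ c → c ≤ a → ∀ t ∈ E c, t.excess < n := by
    intro c hc hca t ht
    have e1 : (W.map Tok.excess).sum = ∑ c ∈ Ico 1 (1 + a), ((E c).map Tok.excess).sum :=
      hsumW ℕ Tok.excess (fun _ _ => rfl) (fun _ => rfl) fun _ => rfl
    have e2 : ((E c).map Tok.excess).sum ≤ ∑ c ∈ Ico 1 (1 + a), ((E c).map Tok.excess).sum :=
      single_le_sum (f := fun c => ((E c).map Tok.excess).sum) (fun _ _ => Nat.zero_le _)
        (mem_Ico.2 ⟨hc, by omega⟩)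
    have e3 : t.excess ≤ ((E c).map Tok.excess).sum :=
      List.single_le_sum (fun _ _ => Nat.zero_le _) _ (List.mem_map_of_mem ht)
    omega
  -- every level has an edge between consecutive floors
  have hchain : ∀ m, 1 ≤ m → m < a → ∃ w, Tok.B m (m + 1) w ∈ E m := by
    intro m hm hma
    by_contra hno
    push Not at hno
    have h1 : (W.map (Tok.cross m)).sum ≤ ((W.map Tok.excess).sum : ℤ) := by
      rw [hsumW ℤ (Tok.cross m) (fun _ _ => rfl) (fun _ => rfl) fun _ => rfl,
        hsumW ℕ Tok.excess (fun _ _ => rfl) (fun _ => rfl) fun _ => rfl, Nat.cast_sum]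
      refine sum_le_sum fun c hc => ?_
      have : ∀ es : List Tok, (∀ t ∈ es, t.isB = true ∧ t.Ok a c ∧ ∀ w, t ≠ Tok.B m (m + 1) w) →
          (es.map (Tok.cross m)).sum ≤ ((es.map Tok.excess).sum : ℕ) := by
        intro es
        induction es with
        | nil => simp
        | cons t es ih =>
          intro h
          have h2 := ih fun t ht => h t (by simp [ht])
          obtain ⟨h3, h4, h5⟩ := h t (by simp)
          rw [List.map_cons, List.map_cons, List.sum_cons, List.sum_cons, Nat.cast_add]
          refine add_le_add ?_ h2
          rcases t with _ | ⟨i, i', w⟩ | _ | _ <;> simp [Tok.isB] at h3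
          rw [Tok.cross, Tok.excess]
          split_ifs with h6
          · have : 1 ≤ i' - i - 1 := by
              by_contra h7
              have e1 : i = m := by omega
              have e2 : i' = m + 1 := by omega
              exact h5 w (by rw [e1, e2])
            exact_mod_cast Nat.le_mul_of_pos_right w this
          · exact Nat.cast_nonneg _
      refine this (E c) fun t ht => ⟨(hE c t ht).1, (hE c t ht).2, ?_⟩
      rintro w rfl
      have := (hE c _ ht).2
      rw [Tok.Ok] at this
      obtain rfl : c = m := by omega
      exact hno w ht
    rw [balance m hm hma] at h1
    have h2 := hF m hm hma
    omega
  have hpos : ∀ m ∈ Ico 1 a, 1 ≤ (E m).length := by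
    intro m hm
    rw [mem_Ico] at hm
    obtain ⟨w, hw⟩ := hchain m hm.1 hm.2
    exact List.length_pos_of_mem hw
  -- Of the `2 * a` letters of the skeleton `a` are floors, and no edge starts after the last floor.
  have htot : ∑ c ∈ Ico 1 a, (E c).length = a := by
    have := congrArg List.length hEsk
    rw [length_gskel, hlen, hzip] at this
    rcases Nat.eq_zero_or_pos a with rfl | ha
    · simp
    · rw [add_comm 1 a, sum_Ico_succ_top (by omega), hEa, List.length_nil] at this
      simpa using (by omega : ∑ c ∈ Ico 1 a, (E c).length + 0 = a)
  -- Without floors no source can be attached, whereas `b` is positive because the cost bound forces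
  -- `n` to be positive.
  have ha1 : 1 ≤ a := by
    by_contra h
    have : a = 0 := by omega
    have hb0 : b = 0 ∨ 0 < b := by omega
    rcases hb0 with h0 | h0
    · omega
    · rw [← countS, List.countP_pos_iff] at h0
      obtain ⟨z, hz, hz'⟩ := h0
      have key : ∀ (ω : List Ltr) (lev : ℕ → ℕ), ValidWord a lev ω → ∀ m, Ltr.S m ∉ ω := by
        intro ω
        induction ω with
        | nil => simp
        | cons y ω ih =>
          intro lev hv m hm
          rw [List.mem_cons] at hm
          rcases y with _ | m' | m'
          · rcases hm with hm | hm
            · cases hm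
            · exact ih _ hv m hm
          · rw [ValidWord] at hv; omega
          · rcases hm with hm | hm
            · cases hm
            · exact ih _ hv.2 m hm
      rcases z with _ | m | m <;> simp [Ltr.isS] at hz'
      exact key _ _ hokm.2 m hz
  obtain ⟨j, hj, hj2, hother⟩ : ∃ j ∈ Ico 1 a, (E j).length = 2 ∧
      ∀ m ∈ Ico 1 a, m ≠ j → (E m).length = 1 := by
    -- There are `a` edges on `a - 1` levels, each nonempty, so exactly one level has a second edge.
    have h0 : ∑ c ∈ Ico 1 a, ((E c).length - 1) = 1 := by
      have h1 : ∑ c ∈ Ico 1 a, ((E c).length - 1) + ∑ c ∈ Ico 1 a, 1 = a := by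
        rw [← sum_add_distrib]
        conv_rhs => rw [← htot]
        exact sum_congr rfl fun c hc => by have := hpos c hc; omega
      rw [sum_const, smul_eq_mul, mul_one, Nat.card_Ico] at h1
      omega
    obtain ⟨j, hj, hj0⟩ : ∃ j ∈ Ico 1 a, (E j).length - 1 ≠ 0 := by
      by_contra hno
      push Not at hno
      rw [sum_eq_zero hno] at h0
      omega
    rw [← add_sum_erase _ _ hj] at h0
    refine ⟨j, hj, by omega, fun m hm hmj => ?_⟩
    have h2 : (E m).length - 1 ≤ ∑ c ∈ (Ico 1 a).erase j, ((E c).length - 1) :=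
      single_le_sum (f := fun c => (E c).length - 1) (fun _ _ => Nat.zero_le _)
        (mem_erase.2 ⟨hmj, hm⟩)
    have := hpos m hm
    omega
  have hj' := mem_Ico.1 hj
  -- the form of the two edges at the level `j`
  obtain ⟨ε, i, i', w, w', hEj, hlong⟩ : ∃ (ε : Bool) (i i' w w' : ℕ),
      E j = (if ε = true then [Tok.B j (j + 1) w', Tok.B i i' w]
        else [Tok.B i i' w, Tok.B j (j + 1) w']) ∧ (ε = true → i + 2 ≤ i') := by
    obtain ⟨t, t', ht⟩ := List.length_eq_two.1 hj2
    obtain ⟨w', hw'⟩ := hchain j hj'.1 hj'.2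
    have o1 := hE j t (by rw [ht]; simp)
    have o2 := hE j t' (by rw [ht]; simp)
    rcases t with _ | ⟨i, i', w⟩ | _ | _ <;> simp [Tok.isB] at o1
    rcases t' with _ | ⟨i₂, i₂', w₂⟩ | _ | _ <;> simp [Tok.isB] at o2
    rw [Tok.Ok] at o1 o2
    -- The second letter is taken as the further edge exactly when it is long. If both edges join
    -- consecutive floors, the first is the further edge, in accordance with the convention of
    -- `furtherEdges`.
    by_cases h2 : i₂ + 2 ≤ i₂'
    · have : i = j ∧ i' = j + 1 := by
        rw [ht] at hw'
        simp only [List.mem_cons, Tok.B.injEq, List.not_mem_nil, or_false] at hw'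
        omega
      exact ⟨true, i₂, i₂', w₂, w, by rw [ht, this.1, this.2]; rfl, fun _ => h2⟩
    · have : i₂ = j ∧ i₂' = j + 1 := by omega
      exact ⟨false, i, i', w, w₂, by rw [ht, this.1, this.2]; rfl, by simp⟩
  obtain ⟨wt, hwt⟩ : ∃ wt : ℕ → ℕ, ∀ m, 1 ≤ m → m < a →
      E m = levelEdges a j ε (Tok.B i i' w) wt m := by
    have : ∀ m, ∃ k, 1 ≤ m → m < a → E m = if m = j then
        (if ε = true then [Tok.B m (m + 1) k, Tok.B i i' w]
        else [Tok.B i i' w, Tok.B m (m + 1) k]) else [Tok.B m (m + 1) k] := by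
      intro m
      by_cases hm : 1 ≤ m ∧ m < a
      · by_cases hmj : m = j
        · subst hmj
          exact ⟨w', fun _ _ => by rw [hEj, if_pos rfl]⟩
        · obtain ⟨k, hk⟩ := hchain m hm.1 hm.2
          obtain ⟨t, ht⟩ := List.length_eq_one_iff.1 (hother m (mem_Ico.2 hm) hmj)
          rw [ht, List.mem_singleton] at hk
          exact ⟨k, fun _ _ => by rw [ht, if_neg hmj, hk]⟩
      · exact ⟨0, fun h1 h2 => absurd ⟨h1, h2⟩ hm⟩
    choose wt hwt using this
    refine ⟨wt, fun m h1 h2 => ?_⟩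
    rw [hwt m h1 h2, levelEdges, if_pos (show 1 ≤ m ∧ m < a from ⟨h1, h2⟩)]
  have hsk' : ∀ wt', (∀ m, 1 ≤ m → m < a → wt m = wt' m) →
      sk = gskel (levelEdges a j ε (Tok.B i i' w) wt') 1 (L.zip R) := by
    intro wt' h
    rw [hEsk]
    refine gskel_congr _ _ fun c h1 h2 => ?_
    rcases Nat.lt_or_ge c a with h3 | h3
    · rw [hwt c h1 h3, levelEdges, levelEdges, h c h1 h3]
    · obtain rfl : c = a := by omega
      rw [hEa, levelEdges, if_neg (by omega)]
  have hWeq : W = merge ω (gskel (levelEdges a j ε (Tok.B i i' w) wt) 1 (L.zip R)) := by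
    rw [← hsk' wt fun _ _ _ => rfl, hmerge]
  have hok2 := ok
  rw [hWeq, okWord_levelEdges rfl hj'.1 hj'.2 hzip countK, Tok.Ok] at hok2
  obtain ⟨⟨hoke, hwtpos⟩, hvalid⟩ := hok2
  have hwtflow : ∀ m, 1 ≤ m → m < a →
      (wt m : ℤ) + (if i ≤ m ∧ m < i' then (w : ℤ) else 0) = flow m L R ω := by
    intro m hm hma
    rw [← balance m hm hma, hWeq, sum_merge_levelEdges rfl hj'.1 hj'.2 hzip countK (Tok.cross m)
      (fun _ _ => rfl) (fun _ => rfl) fun _ => rfl]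
    have : ∀ c ∈ Ico 1 a, (Tok.B c (c + 1) (wt c)).cross m =
        if c = m then (wt c : ℤ) else 0 := by
      intro c _
      rw [Tok.cross]
      exact if_congr (by omega) rfl rfl
    rw [sum_congr rfl this, sum_ite_eq', if_pos (mem_Ico.2 ⟨hm, hma⟩), Tok.cross]
  refine ⟨j, L, R, ω, (ε, i, i', w), hj'.1, hj'.2, mem_arrangements.2 left,
    mem_arrangements.2 right, mem_endWords.2 ⟨hvalid, pairs, countK, countS, countT⟩, ?_, ?_⟩
  · rw [mem_furtherEdges]
    dsimp only
    by_cases h2 : i + 2 ≤ i'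
    · refine Or.inr ⟨by omega, by omega, ⟨by omega, ?_⟩, h2⟩
      have := hexc j hj'.1 hj'.2.le (Tok.B i i' w) (by rw [hEj]; split_ifs <;> simp)
      rw [Tok.excess] at this
      have h3 : w * 1 ≤ w * (i' - i - 1) := Nat.mul_le_mul_left w (by omega)
      omega
    · have h3 := hwtflow j hj'.1 hj'.2
      have h4 := hwtpos j hj
      rw [if_pos (by omega)] at h3
      refine Or.inl ⟨?_, by omega, by omega, by omega, by omega⟩
      by_contra hε
      exact h2 (hlong (by simpa using hε))
  · conv_rhs => rw [← hmerge]
    rw [dataWord, hsk' (chainWt L R ω i i' w)]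
    intro m hm hma
    have := hwtflow m hm hma
    rw [chainWt]
    omega

omit hn hn' hsum hML hMR in
/-- The data of the words of genus one and small codegree. -/
def dataIndex (n a s b b' : ℕ) (ML MR : Multiset ℤ) :
    Finset (Σ _ : ℕ, Σ _ : List ℤ, Σ _ : List ℤ, Σ _ : List Ltr, Bool × ℕ × ℕ × ℕ) :=
  (Ico 1 a).sigma fun j => (arrangements ML).sigma fun L => (arrangements MR).sigma fun L' =>
    (endWords a s (levAt j) (2 * a) b b').sigma fun ω => furtherEdges n a j (flow j L L' ω).toNat

omit hn hn' hsum hML hMR in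
open Classical in
/-- The words of genus one and codegree smaller than `n`. -/
def lowWords (n a s b b' : ℕ) (ML MR : Multiset ℤ) : Finset (List Tok) :=
  ((dataIndex n a s b b' ML MR).image fun d =>
    dataWord a d.1 d.2.1 d.2.2.1 d.2.2.2.1 d.2.2.2.2).filter fun W => wordCost a W < n

lemma mem_lowWords {W : List Tok} :
    W ∈ lowWords n a s b b' ML MR ↔ IsLowWord n a s b b' ML MR W := by
  simp only [lowWords, mem_filter, mem_image, dataIndex, mem_sigma, Sigma.exists, mem_Ico]
  constructor
  · rintro ⟨⟨j, L, R, ω, e, ⟨⟨h1, hj⟩, hL, hR, hω, he⟩, rfl⟩, hcost⟩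
    rw [wordCost_dataWord hML hMR h1 hj hL hR hω] at hcost
    exact isLowWord_dataWord hn hn' hsum hML hMR h1 hj hL hR hω he hcost
  · intro h
    obtain ⟨j, L, R, ω, e, h1, hj, hL, hR, hω, he, rfl⟩ :=
      exists_dataWord hn hn' hsum hML hMR h
    exact ⟨⟨j, L, R, ω, e, ⟨⟨h1, hj⟩, hL, hR, hω, he⟩, rfl⟩, h.cost_lt⟩

/-- Data whose total cost reaches `n` are missing on the left, and on the right their terms vanish.
-/
lemma sum_lowWords {A : Type*} [CommRing A] {x : A} (hx : x ^ n = 0) :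
    ∑ W ∈ lowWords n a s b b' ML MR,
      endFactor n x s (b + b') * x ^ wordCost a W * (W.map (Tok.mult x)).prod =
    dataSum n x a s b b' ML MR := by
  classical
  have hinj : Set.InjOn (fun d : Σ _ : ℕ, Σ _ : List ℤ, Σ _ : List ℤ, Σ _ : List Ltr,
      Bool × ℕ × ℕ × ℕ => dataWord a d.1 d.2.1 d.2.2.1 d.2.2.2.1 d.2.2.2.2)
      (dataIndex n a s b b' ML MR) := by
    rintro ⟨j, L, R, ω, e⟩ h ⟨j', L', R', ω', e'⟩ h' heq
    simp only [mem_coe, dataIndex, mem_sigma, mem_Ico] at h h'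
    obtain ⟨rfl, rfl, rfl, rfl, rfl⟩ := dataWord_injective hML hMR h.1.1 h.1.2 h.2.1 h.2.2.1
      h.2.2.2.1 h.2.2.2.2 h'.1.1 h'.1.2 h'.2.1 h'.2.2.1 h'.2.2.2.1 h'.2.2.2.2 heq
    rfl
  simp only [lowWords]
  rw [sum_filter, sum_image hinj, dataIndex, sum_sigma, dataSum]
  refine sum_congr rfl fun j hj => ?_
  rw [sum_sigma]
  refine sum_congr rfl fun L hL => ?_
  rw [sum_sigma]
  refine sum_congr rfl fun R hR => ?_
  rw [sum_sigma]
  refine sum_congr rfl fun ω hω => ?_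
  rw [← sum_furtherEdges, mul_sum]
  refine sum_congr rfl fun e he => ?_
  rw [mem_Ico] at hj
  dsimp only at he hω ⊢
  rw [wordCost_dataWord hML hMR hj.1 hj.2 hL hR hω]
  by_cases h : cost L + cost R + (ω.map (ltrCost a)).sum + e.2.2.2 * (e.2.2.1 - e.2.1 - 1) < n
  · rw [if_pos h, prod_mult_dataWord hn hn' hsum hML hMR hj.1 hj.2 hL hR hω he hx (by omega),
      pow_add]
    simp only [mul_assoc]
  · have : x ^ (cost L + cost R + (ω.map (ltrCost a)).sum) *
        x ^ (e.2.2.2 * (e.2.2.1 - e.2.1 - 1)) = 0 := by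
      rw [← pow_add, pow_eq_zero_of_le_exp hx (not_lt.1 h)]
    rw [if_neg h, ← mul_assoc, mul_assoc _ (x ^ _) (x ^ _), this, mul_zero, zero_mul]

end LowWords

/-! ### Ranks of floors -/

/-- The number of places with value `true` before the place `k`. -/
def rk (l : List Bool) (k : ℕ) : ℕ := (l.take k).count true

section Rank

variable {l : List Bool}

lemma rk_succ {i : ℕ} (h : i < l.length) :
    rk l (i + 1) = rk l i + if l[i] = true then 1 else 0 := by
  rw [rk, rk, List.take_succ_eq_append_getElem h, List.count_append, List.count_singleton]
  simp

lemma rk_mono : Monotone (rk l) := by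
  intro i j h
  exact List.Sublist.count_le _ (List.take_sublist_take_left h)

lemma rk_le (k : ℕ) : rk l k ≤ l.count true := List.Sublist.count_le _ (List.take_sublist _ _)

lemma rk_lt {i : ℕ} (h : i < l.length) (hi : l[i] = true) : rk l i < l.count true := by
  have := rk_succ h
  rw [if_pos hi] at this
  have h2 := rk_le (l := l) (i + 1)
  omega

lemma rk_lt_of_lt {i j : ℕ} (h : i < l.length) (hi : l[i] = true) (hij : i < j) :
    rk l i < rk l j := by
  have := rk_succ h
  rw [if_pos hi] at this
  have h2 := rk_mono (l := l) (show i + 1 ≤ j by omega)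
  omega

lemma rk_injective {i j : ℕ} (h : i < l.length) (hi : l[i] = true) (h' : j < l.length)
    (hj : l[j] = true) (heq : rk l i = rk l j) : i = j := by
  rcases lt_trichotomy i j with h1 | h1 | h1
  · have := rk_lt_of_lt h hi h1; omega
  · exact h1
  · have := rk_lt_of_lt h' hj h1; omega

lemma lt_of_rk_lt {i j : ℕ} (h : rk l i < rk l j) : i < j := by
  by_contra hij
  have := rk_mono (l := l) (not_lt.1 hij)
  omega

lemma exists_rk {m : ℕ} (h : m < l.count true) :
    ∃ (i : ℕ) (hi : i < l.length), l[i] = true ∧ rk l i = m := by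
  induction l generalizing m with
  | nil => simp at h
  | cons b l ih =>
    rcases b with _ | _
    · rw [List.count_cons_of_ne (by simp)] at h
      obtain ⟨i, hi, h1, h2⟩ := ih h
      refine ⟨i + 1, by simpa using hi, by simpa using h1, ?_⟩
      rw [← h2]
      simp [rk]
    · rw [List.count_cons_self] at h
      rcases m with _ | m
      · exact ⟨0, by simp, by simp, by simp [rk]⟩
      · obtain ⟨i, hi, h1, h2⟩ := ih (by omega : m < l.count true)
        refine ⟨i + 1, by simpa using hi, by simpa using h1, ?_⟩
        rw [← h2]
        simp [rk]

end Rank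

lemma okWord_iff {a c : ℕ} {W : List Tok} : OkWord a c W ↔
    ∀ (i : ℕ) (h : i < W.length), (W[i]).Ok a (c + rk (W.map Tok.isF) i) := by
  induction W generalizing c with
  | nil => simp [OkWord]
  | cons t W ih =>
    rw [OkWord, ih]
    have key : ∀ i, c + t.incr + rk (W.map Tok.isF) i = c + rk ((t :: W).map Tok.isF) (i + 1) := by
      intro i
      rw [rk, rk, List.map_cons, List.take_succ_cons, List.count_cons, Tok.incr]
      rcases t.isF <;> simp <;> omega
    simp only [key]
    constructor
    · rintro ⟨h1, h2⟩ i h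
      rcases i with _ | i
      · simpa [rk] using h1
      · exact h2 i (by simpa using h)
    · intro h
      have h0 := h 0 (by simp)
      rw [List.getElem_cons_zero] at h0
      exact ⟨by simpa [rk] using h0, fun i hi => h (i + 1) (by simpa using hi)⟩

lemma getElem?_slopesList {W : List Tok} {i : ℕ} (h : i < W.length) {l r : ℤ}
    (hi : W[i] = Tok.F l r) : (slopesList W)[rk (W.map Tok.isF) i]? = some (l, r) := by
  induction W generalizing i with
  | nil => simp at h
  | cons t W ih =>
    rcases i with _ | i
    · simp only [List.getElem_cons_zero] at hi
      rw [hi]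
      simp [slopesList, Tok.slopes, rk]
    · have := ih (i := i) (by simpa using h) (by simpa using hi)
      rcases t with ⟨l', r'⟩ | _ | _ | _ <;>
        simpa [slopesList, Tok.slopes, rk, Tok.isF, List.filterMap_cons] using this

lemma length_slopesList (W : List Tok) : (slopesList W).length = (W.map Tok.isF).count true := by
  induction W with
  | nil => rfl
  | cons t W ih =>
    rcases t with ⟨l', r'⟩ | _ | _ | _ <;>
      simpa [slopesList, Tok.slopes, Tok.isF, List.filterMap_cons] using ih

lemma count_slopesList (W : List Tok) (f : ℤ × ℤ → ℤ) (k : ℤ) :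
    ((slopesList W).map f).count k = W.countP fun t => t.slopes.map f = some k := by
  induction W with
  | nil => rfl
  | cons t W ih =>
    rw [List.countP_cons, ← ih]
    rcases t with ⟨l', r'⟩ | _ | _ | _ <;>
      simp [slopesList, Tok.slopes, List.filterMap_cons, List.count_cons]

lemma pairPrefix_iff {s : ℕ} {ω : List Ltr} : PairPrefix s ω ↔
    ∀ k < s, ∃ m, ω[2 * k]? = some (Ltr.S m) ∧ ω[2 * k + 1]? = some (Ltr.S m) := by
  induction s generalizing ω with
  | zero => simp [PairPrefix]
  | succ s ih =>
    rcases ω with _ | ⟨z, _ | ⟨z', ω⟩⟩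
    · simp only [PairPrefix, false_iff]
      intro h
      obtain ⟨m, h1, -⟩ := h 0 (by omega)
      simp at h1
    · rcases z with _ | m | m <;> simp only [PairPrefix, false_iff] <;> intro h <;>
        obtain ⟨m, -, h1⟩ := h 0 (by omega) <;> simp at h1
    · have key : (∀ k < s + 1, ∃ m, (z :: z' :: ω)[2 * k]? = some (Ltr.S m) ∧
          (z :: z' :: ω)[2 * k + 1]? = some (Ltr.S m)) ↔
          (∃ m, z = Ltr.S m ∧ z' = Ltr.S m) ∧ PairPrefix s ω := by
        rw [ih]
        constructor
        · intro h
          refine ⟨by simpa using h 0 (by omega), fun k hk => ?_⟩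
          have := h (k + 1) (by omega)
          rw [show 2 * (k + 1) = 2 * k + 1 + 1 by ring] at this
          simpa only [List.getElem?_cons_succ] using this
        · rintro ⟨h1, h2⟩ k hk
          rcases k with _ | k
          · simpa using h1
          · rw [show 2 * (k + 1) = 2 * k + 1 + 1 by ring]
            simpa only [List.getElem?_cons_succ] using h2 k (by omega)
      rw [key]
      rcases z with _ | m | m <;> rcases z' with _ | m' | m' <;> simp [PairPrefix, eq_comm]

/-- The sources of the word, except for a number of them that is at most the codegree, come before
all other letters. -/
lemma exists_prefix_sources {a : ℕ} {W : List Tok} (h : OkWord a 0 W) :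
    ∃ pre rest, W = pre ++ rest ∧ (∀ t ∈ pre, ∃ m, t = Tok.S m) ∧
      (W.map Tok.toLtr).countP Ltr.isS ≤ pre.length + ((W.map Tok.toLtr).map (ltrCost a)).sum := by
  -- After the first floor a source can only enter a floor of number at least two, and so costs at
  -- least one.
  have key : ∀ (W : List Tok) c, OkWord a (c + 1) W →
      (W.map Tok.toLtr).countP Ltr.isS ≤ ((W.map Tok.toLtr).map (ltrCost a)).sum := by
    intro W
    induction W with
    | nil => simp
    | cons t W ih =>
      intro c h
      rw [OkWord] at h
      have h2 := ih (c + t.incr) (by rw [add_right_comm]; exact h.2)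
      rw [List.map_cons, List.map_cons, List.sum_cons, List.countP_cons]
      rcases t with _ | _ | m | _ <;> simp only [Tok.toLtr, Ltr.isS, ltrCost] <;>
        simp only [Bool.false_eq_true, if_false, if_true]
      · omega
      · omega
      · have := h.1
        rw [Tok.Ok] at this
        omega
      · omega
  induction W with
  | nil => exact ⟨[], [], rfl, by simp, by simp⟩
  | cons t W ih =>
    rw [OkWord] at h
    -- Before the first floor nothing but sources can occur, since bounded edges and sinks leave an
    -- earlier floor.
    rcases t with ⟨l, r⟩ | ⟨i, i', w⟩ | m | m
    · refine ⟨[], Tok.F l r :: W, rfl, by simp, ?_⟩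
      have := key W 0 h.2
      simpa [Tok.toLtr, Ltr.isS, ltrCost] using this
    · have := h.1
      rw [Tok.Ok] at this
      omega
    · obtain ⟨pre, rest, rfl, h2, h3⟩ := ih h.2
      refine ⟨Tok.S m :: pre, rest, rfl, ?_, ?_⟩
      · intro t ht
        rcases List.mem_cons.1 ht with rfl | ht
        · exact ⟨m, rfl⟩
        · exact h2 t ht
      · rw [List.map_cons, List.map_cons, List.sum_cons, List.countP_cons_of_pos rfl,
          List.length_cons]
        omega
    · have := h.1
      rw [Tok.Ok] at this
      omega

/-! ### The word of a marked floor diagram -/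

lemma card_filter_eq_countP {α : Type*} {N : ℕ} (f : Fin N → α) (P : α → Bool) :
    (univ.filter fun i => P (f i) = true).card = (List.ofFn f).countP P := by
  rw [List.ofFn_eq_map, List.countP_map, Finset.card_def, filter_val, 
    ← Multiset.countP_eq_card_filter,
    show (univ : Finset (Fin N)).val = (List.finRange N : Multiset (Fin N)) from rfl,
    Multiset.coe_countP]
  simp [Function.comp_def]

/-- The places of the floors. -/
def floorPattern {N M : ℕ} (p : Fin N → Piece M) : List Bool := List.ofFn fun i => (p i).isFloor

/-- The letter of an element of a graph, in terms of numbers of the floors. -/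
def Piece.tok {N : ℕ} (r : Fin N → ℕ) : Piece N → Tok
  | floor l r' => Tok.F l r'
  | bounded u v w => Tok.B (r u) (r v) w
  | source v => Tok.S (r v)
  | sink u => Tok.T (r u)

/-- The word of a graph. -/
def word {N : ℕ} (p : Fin N → Piece N) : List Tok :=
  List.ofFn fun i => (p i).tok fun u => rk (floorPattern p) u + 1

/-- The contribution of a letter to the incoming minus the outgoing weights of the first `m`
floors. -/
def Tok.net (m : ℕ) : Tok → ℤ
  | Tok.F _ _ => 0
  | Tok.B i i' w => (if i' ≤ m then (w : ℤ) else 0) - if i ≤ m then (w : ℤ) else 0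
  | Tok.S i => if i ≤ m then 1 else 0
  | Tok.T i => if i ≤ m then -1 else 0

lemma Tok.net_eq {a c m : ℕ} {t : Tok} (h : t.Ok a c) :
    t.net m = ltrFlow m t.toLtr - t.cross m := by
  rcases t with _ | ⟨i, i', w⟩ | i | i
  · simp [Tok.net, Tok.toLtr, ltrFlow, Tok.cross]
  · rw [Tok.Ok] at h
    simp only [Tok.net, Tok.toLtr, ltrFlow, Tok.cross]
    split_ifs <;> omega
  · simp [Tok.net, Tok.toLtr, ltrFlow, Tok.cross]
  · simp [Tok.net, Tok.toLtr, ltrFlow, Tok.cross]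

lemma OkWord.of_mem {a c : ℕ} {W : List Tok} (h : OkWord a c W) {t : Tok} (ht : t ∈ W) :
    ∃ c', t.Ok a c' := by
  obtain ⟨i, hi, rfl⟩ := List.mem_iff_getElem.1 ht
  exact ⟨_, okWord_iff.1 h i hi⟩

lemma OkWord.sum_net {a c : ℕ} {W : List Tok} (h : OkWord a c W) (m : ℕ) :
    (W.map (Tok.net m)).sum =
      ((W.map Tok.toLtr).map (ltrFlow m)).sum - (W.map (Tok.cross m)).sum := by
  induction W generalizing c with
  | nil => simp
  | cons t W ih =>
    rw [OkWord] at h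
    simp only [List.map_cons, List.sum_cons, ih h.2, Tok.net_eq h.1]
    ring

section Word

variable {N : ℕ} {p q : Fin N → Piece N}

lemma isF_tok (r : Fin N → ℕ) (e : Piece N) : (e.tok r).isF = e.isFloor := by
  rcases e <;> rfl

lemma length_word : (word p).length = N := by rw [word, List.length_ofFn]

lemma length_floorPattern : (floorPattern p).length = N := by rw [floorPattern, List.length_ofFn]

lemma getElem_word {i : ℕ} (h : i < (word p).length) : (word p)[i] =
    (p ⟨i, length_word (p := p) ▸ h⟩).tok fun u => rk (floorPattern p) u + 1 := by
  simp [word]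

lemma getElem_floorPattern {i : ℕ} (h : i < (floorPattern p).length) : (floorPattern p)[i] =
    (p ⟨i, length_floorPattern (p := p) ▸ h⟩).isFloor := by
  simp [floorPattern]

lemma map_isF_word : (word p).map Tok.isF = floorPattern p := by
  rw [word, floorPattern, List.map_ofFn]
  congr 1
  funext i
  exact isF_tok _ _

lemma sum_map_word {M : Type*} [AddCommMonoid M] (f : Tok → M) : ((word p).map f).sum =
    ∑ i, f ((p i).tok fun u => rk (floorPattern p) u + 1) := by
  rw [word, List.map_ofFn, List.sum_ofFn]
  rfl

lemma prod_map_word {M : Type*} [CommMonoid M] (f : Tok → M) : ((word p).map f).prod =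
    ∏ i, f ((p i).tok fun u => rk (floorPattern p) u + 1) := by
  rw [word, List.map_ofFn, List.prod_ofFn]
  rfl

lemma countP_word (P : Tok → Bool) : (word p).countP P =
    (univ.filter fun i => P ((p i).tok fun u => rk (floorPattern p) u + 1) = true).card := by
  rw [word, card_filter_eq_countP]

lemma count_floorPattern : (floorPattern p).count true =
    (univ.filter fun i => (p i).isFloor = true).card := by
  have h := card_filter_eq_countP (fun i => (p i).isFloor) id
  simp only [id] at h
  rw [floorPattern, h, List.count_eq_countP]
  congr 1
  funext b
  cases b <;> rfl

variable (htail : ∀ e v, (p e).tail = some v → (p v).isFloor = true ∧ v < e)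
  (hhead : ∀ e v, (p e).head = some v → (p v).isFloor = true ∧ e < v)

lemma rk_floorPattern_lt {v : Fin N} (hv : (p v).isFloor = true) :
    rk (floorPattern p) v < (floorPattern p).count true :=
  rk_lt (by rw [length_floorPattern]; exact v.2) (by rw [getElem_floorPattern]; exact hv)

lemma rk_floorPattern_injective {u v : Fin N} (hu : (p u).isFloor = true)
    (hv : (p v).isFloor = true) (h : rk (floorPattern p) u = rk (floorPattern p) v) : u = v :=
  Fin.ext (rk_injective (by rw [length_floorPattern]; exact u.2)
    (by rw [getElem_floorPattern]; exact hu) (by rw [length_floorPattern]; exact v.2)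
    (by rw [getElem_floorPattern]; exact hv) h)

include htail hhead in
lemma okWord_word (hw : ∀ e, (p e).isFloor = false → 0 < (p e).weight) :
    OkWord ((floorPattern p).count true) 0 (word p) := by
  rw [okWord_iff]
  intro i hi
  rw [length_word] at hi
  rw [getElem_word, map_isF_word, zero_add]
  have h1 := htail ⟨i, hi⟩
  have h2 := hhead ⟨i, hi⟩
  have h3 := hw ⟨i, hi⟩
  have ht : ∀ v, (p ⟨i, hi⟩).tail = some v → rk (floorPattern p) v < rk (floorPattern p) i :=
    fun v hv => rk_lt_of_lt (by rw [length_floorPattern]; exact v.2)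
      (by rw [getElem_floorPattern]; exact (h1 v hv).1) (h1 v hv).2
  have hh : ∀ v, (p ⟨i, hi⟩).head = some v → rk (floorPattern p) i ≤ rk (floorPattern p) v ∧
      rk (floorPattern p) v < (floorPattern p).count true :=
    fun v hv => ⟨rk_mono (h2 v hv).2.le, rk_floorPattern_lt (h2 v hv).1⟩
  have h4 := rk_le (l := floorPattern p) i
  rcases hp : p ⟨i, hi⟩ with ⟨l, r⟩ | ⟨u, v, w⟩ | v | u <;> rw [hp] at ht hh h3
  · trivial
  · have := ht u rfl
    have := hh v rfl
    have := h3 rfl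
    simp only [Piece.weight] at this
    simp only [Piece.tok, Tok.Ok]
    omega
  · have := hh v rfl
    simp only [Piece.tok, Tok.Ok]
    omega
  · have := ht u rfl
    simp only [Piece.tok, Tok.Ok]
    omega

include htail hhead in
-- `Tok.net m` totals the divergence over the first `m` floors, so a difference of consecutive
-- values isolates one floor.
lemma divergence_eq {v : Fin N} (hv : (p v).isFloor = true) :
    (∑ e with (p e).head = some v, ((p e).weight : ℤ))
      - ∑ e with (p e).tail = some v, ((p e).weight : ℤ) =
    ((word p).map (Tok.net (rk (floorPattern p) v + 1))).sum -
      ((word p).map (Tok.net (rk (floorPattern p) v))).sum := by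
  rw [sum_map_word, sum_map_word, sum_filter, sum_filter, ← sum_sub_distrib, ← sum_sub_distrib]
  refine sum_congr rfl fun e _ => ?_
  have h1 := htail e
  have h2 := hhead e
  have key : ∀ u, (p u).isFloor = true → (u = v ↔
      rk (floorPattern p) u = rk (floorPattern p) v) := fun u hu =>
    ⟨fun h => by rw [h], rk_floorPattern_injective hu hv⟩
  rcases hp : p e with ⟨l, r⟩ | ⟨u, u', w⟩ | u' | u <;> rw [hp] at h1 h2
  · simp [Piece.head, Piece.tail, Piece.tok, Tok.net]
  · have := key u (h1 u rfl).1
    have := key u' (h2 u' rfl).1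
    simp only [Piece.head, Piece.tail, Piece.tok, Tok.net, Piece.weight, Option.some.injEq]
    split_ifs <;> omega
  · have := key u' (h2 u' rfl).1
    simp only [Piece.head, Piece.tail, Piece.tok, Tok.net, Piece.weight, Option.some.injEq]
    split_ifs <;> first | omega | simp_all
  · have := key u (h1 u rfl).1
    simp only [Piece.head, Piece.tail, Piece.tok, Tok.net, Piece.weight, Option.some.injEq]
    split_ifs <;> first | omega | simp_all

/-- The word shows where the floors are, and on floors the rank is injective; the endpoints of the
edges can thus be recovered from their numbers. -/
lemma word_injective (htail : ∀ e v, (p e).tail = some v → (p v).isFloor = true)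
    (hhead : ∀ e v, (p e).head = some v → (p v).isFloor = true)
    (htail' : ∀ e v, (q e).tail = some v → (q v).isFloor = true)
    (hhead' : ∀ e v, (q e).head = some v → (q v).isFloor = true) (h : word p = word q) :
    p = q := by
  have hpat : floorPattern p = floorPattern q := by rw [← map_isF_word, h, map_isF_word]
  have hfl : ∀ v, (p v).isFloor = (q v).isFloor := by
    intro v
    have := List.ofFn_injective (n := N) (α := Bool) hpat
    exact congrFun this v
  have hinj : ∀ u v, (p u).isFloor = true → (q v).isFloor = true →
      rk (floorPattern p) u + 1 = rk (floorPattern q) v + 1 → u = v := by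
    intro u v hu hv h
    rw [← hpat] at h
    exact rk_floorPattern_injective hu (by rw [hfl]; exact hv) (by omega)
  funext e
  have he := congrFun (List.ofFn_injective (n := N) (α := Tok) h) e
  have h1 := htail e
  have h2 := hhead e
  have h3 := htail' e
  have h4 := hhead' e
  rcases hp : p e with ⟨l, r⟩ | ⟨u, u', w⟩ | u' | u <;>
    rcases hq : q e with ⟨l', r'⟩ | ⟨v, v', w'⟩ | v' | v <;>
    rw [hp, hq] at he <;> simp only [Piece.tok, reduceCtorEq, Tok.F.injEq, Tok.B.injEq,
      Tok.S.injEq, Tok.T.injEq] at he <;> rw [hp] at h1 h2 <;> rw [hq] at h3 h4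
  · rw [he.1, he.2]
  · rw [hinj u v (h1 u rfl) (h3 v rfl) he.1, hinj u' v' (h2 u' rfl) (h4 v' rfl) he.2.1, he.2.2]
  · rw [hinj u' v' (h2 u' rfl) (h4 v' rfl) he]
  · rw [hinj u v (h1 u rfl) (h3 v rfl) he]

end Word

/-- Every word whose letters are attached in agreement with the order is the word of a graph. -/
lemma exists_word {a : ℕ} (ha : 0 < a) {W : List Tok} (hok : OkWord a 0 W)
    (hcount : (W.map Tok.isF).count true = a) :
    ∃ p : Fin W.length → Piece W.length, word p = W ∧
      (∀ e v, (p e).tail = some v → (p v).isFloor = true ∧ v < e) ∧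
      (∀ e v, (p e).head = some v → (p v).isFloor = true ∧ e < v) ∧
      (∀ e, (p e).isFloor = false → 0 < (p e).weight) := by
  set pat := W.map Tok.isF with hpat
  have hpl : pat.length = W.length := List.length_map _
  have h0 : ∃ i : Fin W.length, (W[i]).isF = true ∧ rk pat i = 0 := by
    obtain ⟨i, hi, h1, h2⟩ := exists_rk (l := pat) (m := 0) (by omega)
    exact ⟨⟨i, hpl ▸ hi⟩, by simpa [hpat] using h1, h2⟩
  -- A default position for floor numbers outside `1, …, a`, which do not occur in the word.
  obtain ⟨i0, -⟩ := h0
  have : ∀ m, ∃ i : Fin W.length, 1 ≤ m → m ≤ a → (W[i]).isF = true ∧ rk pat i + 1 = m := by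
    intro m
    by_cases hm : 1 ≤ m ∧ m ≤ a
    · obtain ⟨i, hi, h1, h2⟩ := exists_rk (l := pat) (m := m - 1) (by omega)
      exact ⟨⟨i, hpl ▸ hi⟩, fun _ _ => ⟨by simpa [hpat] using h1, by simp only; omega⟩⟩
    · exact ⟨i0, fun h1 h2 => absurd ⟨h1, h2⟩ hm⟩
  choose pos hpos using this
  let q : Tok → Piece W.length := fun t => match t with
    | Tok.F l r => Piece.floor l r
    | Tok.B i i' w => Piece.bounded (pos i) (pos i') w
    | Tok.S i => Piece.source (pos i)
    | Tok.T i => Piece.sink (pos i)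
  have hq : ∀ t, (q t).isFloor = t.isF := by
    intro t
    rcases t <;> rfl
  have hfp : floorPattern (fun i : Fin W.length => q W[i]) = pat := by
    simp only [floorPattern, hq]
    refine List.ext_getElem (by simp [hpat]) fun i h1 h2 => ?_
    simp [hpat]
  have hokW : ∀ (i : ℕ) (h : i < W.length), (W[i]).Ok a (0 + rk pat i) := okWord_iff.1 hok
  refine ⟨fun i => q W[i], ?_, ?_, ?_, ?_⟩
  · rw [word, hfp]
    refine List.ext_getElem (by simp) fun i h1 h2 => ?_
    have := hokW i h2
    simp only [List.getElem_ofFn, Fin.getElem_fin]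
    rcases hW : W[i] with ⟨l, r⟩ | ⟨j, j', w⟩ | j | j <;> rw [hW] at this <;>
      simp only [Tok.Ok] at this <;> simp only [q, Piece.tok]
    · rw [(hpos j (by omega) (by omega)).2, (hpos j' (by omega) (by omega)).2]
    · rw [(hpos j (by omega) (by omega)).2]
    · rw [(hpos j (by omega) (by omega)).2]
  · intro e v he
    have := hokW e e.2
    simp only [Fin.getElem_fin, hq] at he ⊢
    rcases hW : W[(e : ℕ)] with ⟨l, r⟩ | ⟨j, j', w⟩ | j | j <;> rw [hW] at this he <;>
      simp only [Tok.Ok] at this <;> simp only [q, Piece.tail, reduceCtorEq, Option.some.injEq] at he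
    · obtain ⟨h1, h2⟩ := hpos j (by omega) (by omega)
      rw [he] at h1 h2
      exact ⟨h1, lt_of_rk_lt (l := pat) (by rw [zero_add] at this; omega)⟩
    · obtain ⟨h1, h2⟩ := hpos j (by omega) (by omega)
      rw [he] at h1 h2
      exact ⟨h1, lt_of_rk_lt (l := pat) (by rw [zero_add] at this; omega)⟩
  · intro e v he
    have := hokW e e.2
    simp only [Fin.getElem_fin, hq] at he ⊢
    have haux : ∀ j, pos j = v → 1 ≤ j → j ≤ a → rk pat e < j → (W[e]).isF = false →
        (W[(v : ℕ)]).isF = true ∧ e < v := by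
      intro j hj hj1 hj2 hj3 hef
      obtain ⟨h1, h2⟩ := hpos j hj1 hj2
      rw [hj] at h1 h2
      refine ⟨h1, ?_⟩
      rcases lt_trichotomy e v with h | h | h
      · exact h
      · rw [h] at hef; rw [hef] at h1; cases h1
      · have := rk_lt_of_lt (l := pat) (by rw [hpl]; exact v.2) (by simpa [hpat] using h1) h
        omega
    rcases hW : W[(e : ℕ)] with ⟨l, r⟩ | ⟨j, j', w⟩ | j | j <;> rw [hW] at this he <;>
      simp only [Tok.Ok] at this <;> simp only [q, Piece.head, reduceCtorEq, Option.some.injEq] at he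
    · exact haux j' he (by omega) (by omega) (by omega) (by simp [hW, Tok.isF])
    · exact haux j he (by omega) (by omega) (by omega) (by simp [hW, Tok.isF])
  · intro e he
    have := hokW e e.2
    simp only [Fin.getElem_fin, hq] at he ⊢
    rcases hW : W[(e : ℕ)] with ⟨l, r⟩ | ⟨j, j', w⟩ | j | j <;> rw [hW] at this he <;>
      simp only [Tok.Ok] at this <;> simp only [q, Piece.weight]
    · simp [Tok.isF] at he
    · exact this.2.2.2.2
    · exact one_pos
    · exact one_pos

/-! ### The words of the diagrams of a polygon -/

/-- The multisets `b_left`, `b_right` of a polygon, with the sums of the minima of the pairs of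
their elements, in terms of which the area is expressed. -/
structure SlopeData (Δ : LatticePolygon) (ML MR : Multiset ℤ) (pm pm' : ℤ) : Prop where
  count_left : ∀ k, ML.count k = Δ.leftMult k
  count_right : ∀ k, MR.count k = Δ.rightMult k
  card_left : ML.card = Δ.height
  card_right : MR.card = Δ.height
  sum_eq : ML.sum + MR.sum = (Δ.bottomLength : ℤ) - Δ.topLength
  pairMin_left : ∀ L : List ℤ, (L : Multiset ℤ) = ML → pairMin L = pm
  pairMin_right : ∀ L : List ℤ, (L : Multiset ℤ) = MR → pairMin L = pm'
  area_eq : Δ.area = ((Δ.bottomLength : ℝ) + Δ.topLength) / 2 +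
    ((Δ.height : ℝ) - 1) * Δ.bottomLength - pm - pm'

/-- The weight of a bounded edge. -/
def Tok.wt : Tok → ℕ
  | Tok.B _ _ w => w
  | _ => 0

lemma Tok.sum_cross {a c : ℕ} {t : Tok} (h : t.Ok a c) :
    ∑ m ∈ Ico 1 a, t.cross m = (t.wt : ℤ) + t.excess := by
  rcases t with _ | ⟨i, i', w⟩ | i | i
  · simp [Tok.cross, Tok.wt, Tok.excess]
  · rw [Tok.Ok] at h
    simp only [Tok.cross, Tok.wt, Tok.excess]
    rw [← sum_filter, sum_const, show (Ico 1 a).filter (fun m => i ≤ m ∧ m < i') = Ico i i' by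
      ext m; simp only [mem_filter, mem_Ico]; omega, Nat.card_Ico, nsmul_eq_mul,
      show i' - i = (i' - i - 1) + 1 by omega]
    push_cast
    ring
  · simp [Tok.cross, Tok.wt, Tok.excess]
  · simp [Tok.cross, Tok.wt, Tok.excess]

lemma Tok.sum_ltrFlow {a c : ℕ} {t : Tok} (h : t.Ok a c) :
    ∑ m ∈ Ico 1 a, ltrFlow m t.toLtr =
      (if t.toLtr.isS then (a : ℤ) - 1 else 0) - ltrCost a t.toLtr := by
  rcases t with _ | _ | i | i
  · simp [Tok.toLtr, ltrFlow, ltrCost, Ltr.isS]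
  · simp [Tok.toLtr, ltrFlow, ltrCost, Ltr.isS]
  · rw [Tok.Ok] at h
    simp only [Tok.toLtr, ltrFlow, ltrCost, Ltr.isS, if_true]
    rw [← sum_filter, sum_const, show (Ico 1 a).filter (fun m => i ≤ m) = Ico i a by
      ext m; simp only [mem_filter, mem_Ico]; omega, Nat.card_Ico, nsmul_eq_mul]
    omega
  · rw [Tok.Ok] at h
    simp only [Tok.toLtr, ltrFlow, ltrCost, Ltr.isS, Bool.false_eq_true, if_false]
    rw [← sum_filter, sum_const, show (Ico 1 a).filter (fun m => i ≤ m) = Ico i a by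
      ext m; simp only [mem_filter, mem_Ico]; omega, Nat.card_Ico, nsmul_eq_mul]
    omega

lemma OkWord.sum_cross {a c : ℕ} {W : List Tok} (h : OkWord a c W) :
    ∑ m ∈ Ico 1 a, (W.map (Tok.cross m)).sum =
      (((W.map Tok.wt).sum : ℕ) : ℤ) + ((W.map Tok.excess).sum : ℕ) := by
  induction W generalizing c with
  | nil => simp
  | cons t W ih =>
    rw [OkWord] at h
    simp only [List.map_cons, List.sum_cons, sum_add_distrib, ih h.2, Tok.sum_cross h.1,
      Nat.cast_add]
    ring

lemma OkWord.sum_ltrFlow {a c : ℕ} {W : List Tok} (h : OkWord a c W) :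
    ∑ m ∈ Ico 1 a, ((W.map Tok.toLtr).map (ltrFlow m)).sum =
      ((W.map Tok.toLtr).countP Ltr.isS : ℤ) * ((a : ℤ) - 1) -
        (((W.map Tok.toLtr).map (ltrCost a)).sum : ℕ) := by
  induction W generalizing c with
  | nil => simp
  | cons t W ih =>
    rw [OkWord] at h
    simp only [List.map_cons, List.sum_cons, sum_add_distrib, ih h.2, Tok.sum_ltrFlow h.1,
      Nat.cast_add, List.countP_cons]
    split_ifs <;> simp only [Nat.cast_one, Nat.cast_zero] <;> ring

namespace MarkedFloorDiagram

variable {Δ : LatticePolygon} (D : MarkedFloorDiagram Δ) {ML MR : Multiset ℤ} {pm pm' : ℤ}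

lemma count_pattern : (floorPattern D.piece).count true = Δ.height := by
  rw [count_floorPattern, D.card_floors]

lemma okWord : OkWord Δ.height 0 (word D.piece) := by
  have := okWord_word D.tail_lt D.lt_head D.weight_pos
  rwa [D.count_pattern] at this

lemma countS_word : ((word D.piece).map Tok.toLtr).countP Ltr.isS = Δ.bottomLength := by
  rw [List.countP_map, countP_word, ← D.card_sources]
  congr 1
  ext i
  simp only [mem_filter, mem_univ, true_and]
  rcases D.piece i <;> simp [Piece.tok, Tok.toLtr, Ltr.isS, Piece.isSource]

lemma countT_word : ((word D.piece).map Tok.toLtr).countP Ltr.isT = Δ.topLength := by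
  rw [List.countP_map, countP_word, ← D.card_sinks]
  congr 1
  ext i
  simp only [mem_filter, mem_univ, true_and]
  rcases D.piece i <;> simp [Piece.tok, Tok.toLtr, Ltr.isT, Piece.isSink]

lemma countK_word : ((word D.piece).map Tok.toLtr).countP Ltr.isK = Δ.height + D.numBounded := by
  rw [List.countP_map, countP_word, ← D.card_floors, numBounded, ← card_union_of_disjoint]
  · congr 1
    ext i
    simp only [mem_filter, mem_univ, true_and, mem_union]
    rcases D.piece i <;> simp [Piece.tok, Tok.toLtr, Ltr.isK, Piece.isFloor, Piece.isBounded]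
  · rw [disjoint_left]
    intro i
    simp only [mem_filter, mem_univ, true_and]
    rcases D.piece i <;> simp [Piece.isFloor, Piece.isBounded]

lemma coe_left (h : SlopeData Δ ML MR pm pm') :
    (((slopesList (word D.piece)).map Prod.fst : List ℤ) : Multiset ℤ) = ML := by
  ext k
  rw [Multiset.coe_count, count_slopesList, countP_word, h.count_left, ← D.card_left]
  congr 1
  ext i
  simp only [mem_filter, mem_univ, true_and]
  rcases D.piece i <;> simp [Piece.tok, Tok.slopes, Piece.slopes]

lemma coe_right (h : SlopeData Δ ML MR pm pm') :
    (((slopesList (word D.piece)).map Prod.snd : List ℤ) : Multiset ℤ) = MR := by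
  ext k
  rw [Multiset.coe_count, count_slopesList, countP_word, h.count_right, ← D.card_right]
  congr 1
  ext i
  simp only [mem_filter, mem_univ, true_and]
  rcases D.piece i <;> simp [Piece.tok, Tok.slopes, Piece.slopes]

lemma sum_net {m : ℕ} (hm : m ≤ Δ.height) : ((word D.piece).map (Tok.net m)).sum =
    (((slopesList (word D.piece)).map Prod.fst).take m).sum +
      (((slopesList (word D.piece)).map Prod.snd).take m).sum := by
  induction m with
  | zero =>
    rw [List.take_zero, List.take_zero, List.sum_nil, add_zero]
    refine List.sum_eq_zero fun z hz => ?_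
    obtain ⟨t, ht, rfl⟩ := List.mem_map.1 hz
    obtain ⟨c, hc⟩ := D.okWord.of_mem ht
    rcases t with _ | ⟨i, i', w⟩ | i | i
    · rfl
    · rw [Tok.Ok] at hc
      rw [Tok.net, if_neg (by omega), if_neg (by omega), sub_zero]
    · rw [Tok.Ok] at hc
      rw [Tok.net, if_neg (by omega)]
    · rw [Tok.Ok] at hc
      rw [Tok.net, if_neg (by omega)]
  | succ m ih =>
    have ih := ih (by omega)
    obtain ⟨i, hi, h1, h2⟩ := exists_rk (l := floorPattern D.piece) (m := m)
      (by rw [D.count_pattern]; omega)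
    have hi' : i < D.size := by rwa [length_floorPattern] at hi
    rw [getElem_floorPattern] at h1
    have h3 := divergence_eq D.tail_lt D.lt_head h1
    simp only [h2] at h3
    rcases hp : D.piece ⟨i, hi'⟩ with ⟨l, r⟩ | _ | _ | _ <;> rw [hp] at h1 <;>
      simp only [Piece.isFloor, Bool.false_eq_true] at h1
    rw [D.divergence _ l r hp] at h3
    have h4 := getElem?_slopesList (W := word D.piece) (i := i) (by rwa [length_word]) (l := l)
      (r := r) (by rw [getElem_word, hp]; rfl)
    rw [map_isF_word, h2] at h4
    rw [List.take_add_one, List.take_add_one, List.getElem?_map, List.getElem?_map, h4]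
    simp only [Option.map_some, Option.toList_some, List.sum_append, List.sum_singleton]
    linarith

lemma balance {m : ℕ} (hm : m ≤ Δ.height) : ((word D.piece).map (Tok.cross m)).sum =
    flow m ((slopesList (word D.piece)).map Prod.fst) ((slopesList (word D.piece)).map Prod.snd)
      ((word D.piece).map Tok.toLtr) := by
  have h1 := D.sum_net hm
  rw [D.okWord.sum_net] at h1
  rw [flow]
  linarith

/-- The balance is summed over all levels. An edge from `i` to `i'` is counted `i' - i` times,
giving weight plus excess; the ends give `b (a - 1)` minus their cost, and prefix sums of slopes
give `pairMin` plus the cost by `sum_sum_take`. Total weight plus total cost is therefore the same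
for all diagrams. -/
lemma sum_wt (h : SlopeData Δ ML MR pm pm') : (((word D.piece).map Tok.wt).sum : ℤ) +
    wordCost Δ.height (word D.piece) = ((Δ.height : ℤ) - 1) * Δ.bottomLength - pm - pm' := by
  have hl := D.coe_left h
  have hr := D.coe_right h
  set L := (slopesList (word D.piece)).map Prod.fst
  set R := (slopesList (word D.piece)).map Prod.snd
  have h1 : ∑ m ∈ Ico 1 Δ.height, ((word D.piece).map (Tok.cross m)).sum =
      ∑ m ∈ Ico 1 Δ.height, flow m L R ((word D.piece).map Tok.toLtr) :=
    sum_congr rfl fun m hm => D.balance (mem_Ico.1 hm).2.le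
  simp only [flow, sum_sub_distrib] at h1
  rw [D.okWord.sum_cross, D.okWord.sum_ltrFlow, D.countS_word] at h1
  have key : ∀ l : List ℤ, l.length = Δ.height →
      ∑ m ∈ Ico 1 Δ.height, (l.take m).sum = pairMin l + cost l := by
    intro l hl
    rw [← sum_sum_take, hl]
    rcases Nat.eq_zero_or_pos Δ.height with h0 | h0
    · rw [h0]; rfl
    · rw [range_eq_Ico, sum_eq_sum_Ico_succ_bot h0]
      simp
  rw [key L (by rw [← h.card_left, ← hl, Multiset.coe_card]),
    key R (by rw [← h.card_right, ← hr, Multiset.coe_card]), h.pairMin_left L hl,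
    h.pairMin_right R hr] at h1
  have h2 : wordCost Δ.height (word D.piece) = cost L + cost R +
    (((word D.piece).map Tok.toLtr).map (ltrCost Δ.height)).sum +
      ((word D.piece).map Tok.excess).sum := rfl
  rw [h2]
  simp only [Nat.cast_add]
  linarith

/-- The constant of `sum_wt` is the area up to half the horizontal sides, which is how the sum of
pairwise minima enters `SlopeData`. In particular the codegree is a natural number and its floor in
the multiplicities loses nothing. -/
lemma codeg_eq (h : SlopeData Δ ML MR pm pm') :
    D.codeg = wordCost Δ.height (word D.piece) := by
  have h1 := D.sum_wt h
  have h2 : ∑ e with (D.piece e).isBounded = true, ((D.piece e).weight : ℝ) =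
      (((word D.piece).map Tok.wt).sum : ℕ) := by
    rw [sum_map_word, sum_filter, Nat.cast_sum]
    refine sum_congr rfl fun e _ => ?_
    rcases D.piece e <;> simp [Piece.isBounded, Piece.weight, Piece.tok, Tok.wt]
  have h3 : ((((word D.piece).map Tok.wt).sum : ℕ) : ℝ) +
      wordCost Δ.height (word D.piece) = ((Δ.height : ℝ) - 1) * Δ.bottomLength - pm - pm' := by
    have := congrArg (Int.cast : ℤ → ℝ) h1
    simpa only [Int.cast_add, Int.cast_sub, Int.cast_mul, Int.cast_natCast, Int.cast_one] using this
  rw [codeg, degree, h.area_eq, h2]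
  linarith

lemma floor_codeg (h : SlopeData Δ ML MR pm pm') :
    ⌊D.codeg⌋₊ = wordCost Δ.height (word D.piece) := by
  rw [D.codeg_eq h, Nat.floor_natCast]

lemma eq_of_word_eq {D D' : MarkedFloorDiagram Δ} (h : word D.piece = word D'.piece) : D = D' := by
  have hs : D.size = D'.size := by
    have := congrArg List.length h
    rwa [length_word, length_word] at this
  rcases D with ⟨N, p, h1, h2, h3, h4, h5, h6, h7, h8, h9, h10⟩
  rcases D' with ⟨N', p', h1', h2', h3', h4', h5', h6', h7', h8', h9', h10'⟩
  obtain rfl : N = N' := hs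
  obtain rfl : p = p' := word_injective (fun e v he => (h1 e v he).1)
    (fun e v he => (h2 e v he).1) (fun e v he => (h1' e v he).1) (fun e v he => (h2' e v he).1) h
  rfl

lemma numBounded_eq (hg : D.genus = ((1 : ℕ) : ℤ)) : D.numBounded = Δ.height := by
  rw [genus] at hg
  push_cast at hg
  omega

/-- The first elements of a diagram of small codegree are sources. -/
lemma exists_source {n s : ℕ} (hs : 2 * s + n ≤ Δ.bottomLength)
    (hcost : wordCost Δ.height (word D.piece) < n) (e : Fin D.size) (he : e.val < 2 * s) :
    ∃ v, D.piece e = Piece.source v := by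
  obtain ⟨pre, rest, h1, h2, h3⟩ := exists_prefix_sources D.okWord
  rw [D.countS_word] at h3
  have h4 : (((word D.piece).map Tok.toLtr).map (ltrCost Δ.height)).sum ≤
    wordCost Δ.height (word D.piece) := by rw [wordCost]; omega
  have h5 : e.val < (word D.piece).length := by rw [length_word]; exact e.2
  have h6 : (word D.piece)[e.val] ∈ pre := by
    simp only [h1]
    rw [List.getElem_append_left (by omega)]
    exact List.getElem_mem _
  obtain ⟨m, hm⟩ := h2 _ h6
  rw [getElem_word] at hm
  rcases hp : D.piece e with _ | _ | v | _ <;> rw [Fin.eta, hp] at hm <;>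
    simp only [Piece.tok, reduceCtorEq] at hm
  exact ⟨v, rfl⟩

lemma isLowWord {n s : ℕ} (h : SlopeData Δ ML MR pm pm') (hg : D.genus = ((1 : ℕ) : ℤ))
    (hc : D.IsCompatible s) (hs : 2 * s + n ≤ Δ.bottomLength)
    (hcost : wordCost Δ.height (word D.piece) < n) :
    IsLowWord n Δ.height s Δ.bottomLength Δ.topLength ML MR (word D.piece) := by
  refine ⟨D.okWord, D.coe_left h, D.coe_right h, ?_, D.countS_word, D.countT_word,
    fun m _ hm => D.balance hm.le, hcost, ?_⟩
  · rw [D.countK_word, D.numBounded_eq hg]; ring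
  · rw [pairPrefix_iff]
    intro k hk
    have hsize := hc.1
    obtain ⟨v, hv⟩ := D.exists_source hs hcost ⟨2 * k, by omega⟩ (by simp only; omega)
    obtain ⟨v', hv'⟩ := D.exists_source hs hcost ⟨2 * k + 1, by omega⟩ (by simp only; omega)
    -- Both elements of the pair are sources. Neither is a floor and neither leaves a floor, so
    -- among the compatible configurations only a common target remains.
    have hvv : v = v' := by
      rcases hc.2 ⟨2 * k, by omega⟩ ⟨2 * k + 1, by omega⟩
        ⟨by simp only; omega, rfl, by simp only; omega⟩ with (h1 | h1) | (h1 | h1) | ⟨u, h1 | h1⟩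
      · rw [hv] at h1; cases h1
      · have := (D.lt_head _ _ h1).1
        rw [hv'] at this; cases this
      · rw [hv'] at h1; cases h1
      · have := (D.lt_head _ _ h1).1
        rw [hv] at this; cases this
      · rw [hv] at h1; cases h1.1
      · rw [hv, hv'] at h1
        have e1 : v = u := Option.some.inj h1.1
        have e2 : v' = u := Option.some.inj h1.2
        rw [e1, e2]
    subst hvv
    have l1 : 2 * k < (word D.piece).length := by rw [length_word]; omega
    have l2 : 2 * k + 1 < (word D.piece).length := by rw [length_word]; omega
    refine ⟨rk (floorPattern D.piece) v + 1, ?_, ?_⟩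
    · rw [List.getElem?_map, List.getElem?_eq_getElem l1, getElem_word, hv]
      rfl
    · rw [List.getElem?_map, List.getElem?_eq_getElem l2, getElem_word, hv']
      rfl

end MarkedFloorDiagram

/-! ### Multiplicities at small codegree -/

lemma one_add_X_mul_invOneAdd : (1 + PowerSeries.X) * invOneAdd = 1 := by
  ext n
  rw [add_mul, one_mul, map_add, invOneAdd]
  rcases n with _ | n
  · simp
  · rw [PowerSeries.coeff_succ_X_mul, PowerSeries.coeff_mk, PowerSeries.coeff_mk,
      PowerSeries.coeff_one, if_neg (by omega), pow_succ]
    ring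

lemma one_sub_X_mul_qInt (w : ℕ) : (1 - PowerSeries.X) * qInt w = 1 - PowerSeries.X ^ w :=
  mul_neg_geom_sum _ _

lemma qInt_one : qInt 1 = 1 := by simp [qInt]

lemma qInt_two : qInt 2 = 1 + PowerSeries.X := by simp [qInt, sum_range_succ]

namespace MarkedFloorDiagram

variable {Δ : LatticePolygon} (D : MarkedFloorDiagram Δ) {ML MR : Multiset ℤ} {pm pm' : ℤ}
  {n s : ℕ}

/-- A pair of sources of weight `1` contributes `[1] [1] [2] / [2] = 1`, unpaired ends contribute
`1`, and the clearing factor gives each bounded edge `(1 - x) ^ 2 [w] ^ 2 = (1 - x ^ w) ^ 2`. -/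
lemma clearedMult_eq_simpleMult (h : ∀ e : Fin D.size, e.val < 2 * s →
    ∃ v, D.piece e = Piece.source v) : D.clearedMult s = D.simpleMult s := by
  have h1 : (∏ i, ∏ i', if D.IsPair s i i' then pairFactor (D.piece i) (D.piece i') else 1) =
      1 := by
    refine prod_eq_one fun i _ => prod_eq_one fun i' _ => ?_
    split_ifs with hp
    · obtain ⟨v, hv⟩ := h i (by have := hp.2; omega)
      obtain ⟨v', hv'⟩ := h i' hp.2.2
      rw [hv, hv']
      simp only [pairFactor, Piece.weight, qInt_one, one_mul, Nat.reduceAdd, qInt_two]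
      exact one_add_X_mul_invOneAdd
    · rfl
  have h2 : ∏ e with (D.piece e).isFloor = false ∧ 2 * s ≤ e.val, qInt (D.piece e).weight ^ 2 =
      ∏ e with (D.piece e).isBounded = true, qInt (D.piece e).weight ^ 2 := by
    rw [prod_filter, prod_filter]
    refine prod_congr rfl fun e _ => ?_
    have he := h e
    rcases hp : D.piece e with _ | _ | _ | _ <;> rw [hp] at he <;>
      simp [Piece.isFloor, Piece.isBounded, Piece.weight, qInt_one]
    intro h3
    exact absurd (he h3) (by simp)
  have h3 : (1 - PowerSeries.X : PowerSeries ℤ) ^ (2 * D.numBounded) =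
      ∏ e with (D.piece e).isBounded = true, (1 - PowerSeries.X : PowerSeries ℤ) ^ 2 := by
    rw [prod_const, ← pow_mul]
    rfl
  have h4 : ∏ e with (D.piece e).isBounded = true,
      (1 - PowerSeries.X ^ (D.piece e).weight : PowerSeries ℤ) ^ 2 =
      (1 - PowerSeries.X : PowerSeries ℤ) ^ (2 * D.numBounded) *
        ∏ e with (D.piece e).isBounded = true, qInt (D.piece e).weight ^ 2 := by
    rw [h3, ← prod_mul_distrib]
    exact prod_congr rfl fun e _ => by rw [← mul_pow, one_sub_X_mul_qInt]
  rw [clearedMult, simpleMult, refinedMult, h1, h2, h4, pow_add]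
  ring

variable {A : Type*} [CommRing A] (φ : PowerSeries ℤ →+* A)

lemma map_simpleMult (h : SlopeData Δ ML MR pm pm') (hφ : φ PowerSeries.X ^ n = 0) :
    φ (D.simpleMult s) = endFactor n (φ PowerSeries.X) s (Δ.bottomLength + Δ.topLength) *
      φ PowerSeries.X ^ wordCost Δ.height (word D.piece) *
        ((word D.piece).map (Tok.mult (φ PowerSeries.X))).prod := by
  have h1 : ((word D.piece).map (Tok.mult (φ PowerSeries.X))).prod =
      ∏ e with (D.piece e).isBounded = true, (1 - φ PowerSeries.X ^ (D.piece e).weight) ^ 2 := by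
    rw [prod_map_word, prod_filter]
    refine prod_congr rfl fun e _ => ?_
    rcases D.piece e <;> simp [Piece.tok, Tok.mult, Piece.isBounded, Piece.weight]
  rw [simpleMult, D.floor_codeg h, h1, endFactor, add_comm Δ.topLength]
  simp only [map_mul, map_pow, map_sub, map_add, map_one, map_prod, map_invOneSub φ hφ]
  ring

lemma map_simpleMult_of_le (h : SlopeData Δ ML MR pm pm') (hφ : φ PowerSeries.X ^ n = 0)
    (hcost : n ≤ wordCost Δ.height (word D.piece)) : φ (D.simpleMult s) = 0 := by
  rw [D.map_simpleMult φ h hφ, pow_eq_zero_of_le_exp hφ hcost, mul_zero, zero_mul]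

lemma map_clearedMult_of_le (h : SlopeData Δ ML MR pm pm') (hφ : φ PowerSeries.X ^ n = 0)
    (hcost : n ≤ wordCost Δ.height (word D.piece)) : φ (D.clearedMult s) = 0 := by
  rw [clearedMult, D.floor_codeg h, map_mul, map_mul, map_mul, map_pow,
    pow_eq_zero_of_le_exp hφ hcost, zero_mul, zero_mul, zero_mul]

end MarkedFloorDiagram

/-! ### Diagrams of genus one and words of small codegree -/

section Count

variable {Δ : LatticePolygon} {ML MR : Multiset ℤ} {pm pm' : ℤ} {n s : ℕ}

/-- Consecutive floors of a word of genus one and small codegree are joined by an edge. -/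
lemma IsLowWord.exists_mem {a b b' : ℕ} (hn : 4 * n ≤ b) (hn' : 4 * n ≤ b')
    (hsum : ML.sum + MR.sum = (b : ℤ) - b') (hML : ML.card = a) (hMR : MR.card = a) {W : List Tok}
    (h : IsLowWord n a s b b' ML MR W) {m : ℕ} (hm : 1 ≤ m) (hma : m < a) :
    ∃ w, Tok.B m (m + 1) w ∈ W := by
  obtain ⟨j, L, R, ω, e, h1, hj, hL, hR, hω, he, rfl⟩ := exists_dataWord hn hn' hsum hML hMR h
  rw [mem_arrangements] at hL hR
  rw [mem_endWords] at hω
  have hLl : L.length = a := by rw [← hML, ← hL, Multiset.coe_card]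
  have hRl : R.length = a := by rw [← hMR, ← hR, Multiset.coe_card]
  have hzip : (L.zip R).length = a := by rw [List.length_zip, hLl, hRl, min_self]
  refine ⟨chainWt L R ω e.2.1 e.2.2.1 e.2.2.2 m, ?_⟩
  rw [dataWord]
  refine List.mem_of_mem_filter (p := Tok.isK) ?_
  rw [filter_isK_merge (isK_gskel (isB_levelEdges rfl) 1)
    (by rw [hω.2.2.1, length_gskel_levelEdges h1 hj hzip])]
  refine mem_gskel_of_mem hm (by omega) ?_
  rw [levelEdges, if_pos ⟨hm, hma⟩]
  split_ifs <;> simp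

/-- The divergence condition at a floor is the difference of the balances at the two adjacent
levels, the chain of edges between consecutive floors gives connectedness, and the equal sources at
the start give compatibility. -/
lemma exists_diagram (h : SlopeData Δ ML MR pm pm') (hn : 4 * n ≤ Δ.bottomLength)
    (hn' : 4 * n ≤ Δ.topLength) (ha : 0 < Δ.height) {W : List Tok}
    (hW : IsLowWord n Δ.height s Δ.bottomLength Δ.topLength ML MR W) :
    ∃ D : MarkedFloorDiagram Δ, D.genus = ((1 : ℕ) : ℤ) ∧ D.IsCompatible s ∧
      word D.piece = W := by
  have hlen : (slopesList W).length = Δ.height := by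
    rw [← h.card_left, ← hW.left, Multiset.coe_card, List.length_map]
  have hcount : (W.map Tok.isF).count true = Δ.height := by rw [← length_slopesList, hlen]
  obtain ⟨N, p, hp, htail, hhead, hw⟩ : ∃ N, ∃ p : Fin N → Piece N, word p = W ∧
      (∀ e v, (p e).tail = some v → (p v).isFloor = true ∧ v < e) ∧
      (∀ e v, (p e).head = some v → (p v).isFloor = true ∧ e < v) ∧
      (∀ e, (p e).isFloor = false → 0 < (p e).weight) := ⟨_, exists_word ha hW.ok hcount⟩
  have hN : W.length = N := by rw [← hp, length_word]
  have hpat : floorPattern p = W.map Tok.isF := by rw [← map_isF_word, hp]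
  have hcp : (floorPattern p).count true = Δ.height := by rw [hpat, hcount]
  set L := (slopesList W).map Prod.fst with hL
  set R := (slopesList W).map Prod.snd with hR
  have hLl : L.length = Δ.height := by rw [hL, List.length_map, hlen]
  have hRl : R.length = Δ.height := by rw [hR, List.length_map, hlen]
  have hnet : ∀ m ≤ Δ.height, ((word p).map (Tok.net m)).sum = (L.take m).sum + (R.take m).sum := by
    intro m hm
    rw [hp, hW.ok.sum_net]
    -- The balance is given at inner levels only. No bounded edge passes the levels `0` and `a`; at
    -- level `a` the identity is the relation between the sum of all slopes and the lengths of the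
    -- horizontal sides.
    rcases Nat.eq_zero_or_pos m with rfl | hm0
    · have e1 : ((W.map Tok.toLtr).map (ltrFlow 0)).sum = 0 := by
        refine List.sum_eq_zero fun z hz => ?_
        rw [List.map_map] at hz
        obtain ⟨t, ht, rfl⟩ := List.mem_map.1 hz
        obtain ⟨c, hc⟩ := hW.ok.of_mem ht
        rcases t with _ | _ | i | i <;> simp only [Function.comp, Tok.toLtr, ltrFlow]
        · rw [Tok.Ok] at hc; rw [if_neg (by omega)]
        · rw [Tok.Ok] at hc; rw [if_neg (by omega)]
      have e2 : (W.map (Tok.cross 0)).sum = 0 := by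
        refine List.sum_eq_zero fun z hz => ?_
        obtain ⟨t, ht, rfl⟩ := List.mem_map.1 hz
        obtain ⟨c, hc⟩ := hW.ok.of_mem ht
        rcases t with _ | _ | i | i <;> simp only [Tok.cross]
        rw [Tok.Ok] at hc; rw [if_neg (by omega)]
      rw [e1, e2]
      simp
    · rcases Nat.lt_or_ge m Δ.height with hlt | hge
      · have := hW.balance m hm0 hlt
        rw [flow] at this
        linarith
      · obtain rfl : m = Δ.height := by omega
        have e1 : (W.map (Tok.cross Δ.height)).sum = 0 := by
          refine List.sum_eq_zero fun z hz => ?_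
          obtain ⟨t, ht, rfl⟩ := List.mem_map.1 hz
          obtain ⟨c, hc⟩ := hW.ok.of_mem ht
          rcases t with _ | _ | i | i <;> simp only [Tok.cross]
          rw [Tok.Ok] at hc; rw [if_neg (by omega)]
        have e2 : ∀ (W : List Tok) c, OkWord Δ.height c W →
            ((W.map Tok.toLtr).map (ltrFlow Δ.height)).sum =
            ((W.map Tok.toLtr).countP Ltr.isS : ℤ) - (W.map Tok.toLtr).countP Ltr.isT := by
          intro W
          induction W with
          | nil => simp
          | cons t W ih =>
            intro c hc
            rw [OkWord] at hc
            have hok := hc.1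
            simp only [List.map_cons, List.sum_cons, List.countP_cons, ih _ hc.2, Nat.cast_add]
            rcases t with _ | _ | i | i <;> simp only [Tok.toLtr, ltrFlow, Ltr.isS, Ltr.isT]
            · simp
            · simp
            · rw [Tok.Ok] at hok; rw [if_pos (by omega)]; simp; ring
            · rw [Tok.Ok] at hok; rw [if_pos (by omega)]; simp; ring
        rw [e1, e2 W 0 hW.ok, hW.countS, hW.countT, List.take_of_length_le (by omega),
          List.take_of_length_le (by omega)]
        have e3 := h.sum_eq
        rw [← hW.left, ← hW.right, Multiset.sum_coe, Multiset.sum_coe] at e3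
        linarith
  have hslopes : ∀ v l r, p v = Piece.floor l r →
      (slopesList W)[rk (floorPattern p) v]? = some (l, r) := by
    intro v l r hv
    have := getElem?_slopesList (W := word p) (i := v) (by rw [length_word]; exact v.2) (l := l)
      (r := r) (by rw [getElem_word, Fin.eta, hv]; rfl)
    rwa [map_isF_word, hp] at this
  have hfloor : ∀ m, m < Δ.height → ∃ v, (p v).isFloor = true ∧ rk (floorPattern p) v = m := by
    intro m hm
    obtain ⟨i, hi, h1, h2⟩ := exists_rk (l := floorPattern p) (m := m) (by omega)
    rw [getElem_floorPattern] at h1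
    exact ⟨_, h1, h2⟩
  have hinvB : ∀ (e : Fin N) i i' w,
      (p e).tok (fun u => rk (floorPattern p) u + 1) = Tok.B i i' w →
      ∃ u v, p e = Piece.bounded u v w ∧ rk (floorPattern p) u + 1 = i ∧
        rk (floorPattern p) v + 1 = i' := by
    intro e i i' w he
    rcases hpe : p e with _ | ⟨u, v, w'⟩ | _ | _ <;> rw [hpe] at he <;>
      simp only [Piece.tok, reduceCtorEq, Tok.B.injEq] at he
    exact ⟨u, v, by rw [he.2.2], he.1, he.2.1⟩
  have hstep : ∀ m, m + 1 < Δ.height → ∃ u v, (p u).isFloor = true ∧ (p v).isFloor = true ∧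
      rk (floorPattern p) u = m ∧ rk (floorPattern p) v = m + 1 ∧
      ∃ e w, p e = Piece.bounded u v w := by
    intro m hm
    obtain ⟨w, hw'⟩ := hW.exists_mem hn hn' h.sum_eq h.card_left h.card_right
      (m := m + 1) (by omega) hm
    rw [← hp, List.mem_iff_getElem] at hw'
    obtain ⟨i, hi, hi'⟩ := hw'
    rw [getElem_word] at hi'
    obtain ⟨u, v, h1, h2, h3⟩ := hinvB _ _ _ _ hi'
    exact ⟨u, v, (htail _ u (by rw [h1]; rfl)).1, (hhead _ v (by rw [h1]; rfl)).1, by omega,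
      by omega, _, w, h1⟩
  have hsize : 2 * s ≤ W.length := by
    have h1 := length_eq_counts (W.map Tok.toLtr)
    rw [List.length_map] at h1
    rcases Nat.eq_zero_or_pos s with rfl | hs
    · omega
    · obtain ⟨m, -, h2⟩ := pairPrefix_iff.1 hW.pairs (s - 1) (by omega)
      have := (List.getElem?_eq_some_iff.1 h2).1
      rw [List.length_map] at this
      omega
  have hinvS : ∀ (e : Fin N) m, (W.map Tok.toLtr)[e.val]? = some (Ltr.S m) →
      ∃ v, p e = Piece.source v ∧ rk (floorPattern p) v + 1 = m := by
    intro e m he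
    have hl : e.val < (word p).length := by rw [length_word]; exact e.2
    rw [← hp, List.getElem?_map, List.getElem?_eq_getElem hl, getElem_word,
      Fin.eta] at he
    rcases hpe : p e with _ | _ | v | _ <;> rw [hpe] at he <;>
      simp only [Piece.tok, Tok.toLtr, Option.map_some, Option.some.injEq, reduceCtorEq,
        Ltr.S.injEq] at he
    exact ⟨v, rfl, he⟩
  let D : MarkedFloorDiagram Δ :=
    { size := N
      piece := p
      tail_lt := htail
      lt_head := hhead
      weight_pos := hw
      card_floors := by rw [← count_floorPattern, hcp]
      card_sinks := by
        rw [← hW.countT, ← hp, List.countP_map, countP_word]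
        congr 1
        ext i
        simp only [mem_filter, mem_univ, true_and]
        rcases p i <;> simp [Piece.tok, Tok.toLtr, Ltr.isT, Piece.isSink]
      card_sources := by
        rw [← hW.countS, ← hp, List.countP_map, countP_word]
        congr 1
        ext i
        simp only [mem_filter, mem_univ, true_and]
        rcases p i <;> simp [Piece.tok, Tok.toLtr, Ltr.isS, Piece.isSource]
      card_left := by
        intro k
        rw [← h.count_left, ← hW.left, Multiset.coe_count, count_slopesList, ← hp, countP_word]
        congr 1
        ext i
        simp only [mem_filter, mem_univ, true_and]
        rcases p i <;> simp [Piece.tok, Tok.slopes, Piece.slopes]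
      card_right := by
        intro k
        rw [← h.count_right, ← hW.right, Multiset.coe_count, count_slopesList, ← hp, countP_word]
        congr 1
        ext i
        simp only [mem_filter, mem_univ, true_and]
        rcases p i <;> simp [Piece.tok, Tok.slopes, Piece.slopes]
      divergence := by
        intro v l r hv
        have hvF : (p v).isFloor = true := by rw [hv]; rfl
        have hlt := rk_floorPattern_lt hvF
        rw [hcp] at hlt
        rw [divergence_eq htail hhead hvF, hnet _ hlt, hnet _ hlt.le, List.take_add_one,
          List.take_add_one, hL, hR, List.getElem?_map, List.getElem?_map, hslopes v l r hv]
        simp only [Option.map_some, Option.toList_some, List.sum_append, List.sum_singleton]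
        ring
      connected := by
        obtain ⟨v0, hv0, hr0⟩ := hfloor 0 ha
        have key : ∀ m v, (p v).isFloor = true → rk (floorPattern p) v = m →
            Relation.EqvGen (fun u u' => ∃ e w, p e = Piece.bounded u u' w) v0 v := by
          intro m
          induction m with
          | zero =>
            intro v hv hr
            rw [rk_floorPattern_injective hv0 hv (hr0.trans hr.symm)]
            exact Relation.EqvGen.refl _
          | succ m ih =>
            intro v hv hr
            have := rk_floorPattern_lt hv
            rw [hcp] at this
            obtain ⟨u, v', hu, hv', hu2, hv2, hedge⟩ := hstep m (by omega)
            obtain rfl := rk_floorPattern_injective hv' hv (hv2.trans hr.symm)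
            exact (ih u hu hu2).trans _ _ _ (Relation.EqvGen.rel _ _ hedge)
        intro v v' hv hv'
        exact ((key _ v hv rfl).symm _ _).trans _ _ _ (key _ v' hv' rfl) }
  refine ⟨D, ?_, ⟨hsize.trans hN.le, ?_⟩, hp⟩
  · have h1 := D.countK_word
    have h2 : ((word D.piece).map Tok.toLtr).countP Ltr.isK = 2 * Δ.height := by
      rw [← hW.countK]
      exact congrArg (fun W => (List.map Tok.toLtr W).countP Ltr.isK) hp
    rw [MarkedFloorDiagram.genus]
    push_cast
    omega
  · intro i i' hpair
    obtain ⟨h1, h2, h3⟩ := hpair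
    obtain ⟨m, h4, h5⟩ := pairPrefix_iff.1 hW.pairs (i.val / 2) (by omega)
    rw [show 2 * (i.val / 2) = i.val by omega] at h4 h5
    rw [← h2] at h5
    obtain ⟨v, hv, hv2⟩ := hinvS i m h4
    obtain ⟨v', hv', hv2'⟩ := hinvS i' m h5
    have : v = v' := rk_floorPattern_injective (hhead i v (by rw [hv]; rfl)).1
      (hhead i' v' (by rw [hv']; rfl)).1 (by omega)
    refine Or.inr (Or.inr ⟨v, Or.inr ⟨?_, ?_⟩⟩)
    · change (p i).head = _
      rw [hv]; rfl
    · change (p i').head = _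
      rw [hv', this]; rfl

/-- There are finitely many compatible diagrams of genus one. -/
lemma finite_compatibleDiagram (h : SlopeData Δ ML MR pm pm') :
    Finite (CompatibleDiagram Δ 1 s) := by
  classical
  set a := Δ.height
  -- By `sum_wt` this bounds the total weight of the bounded edges, so only finitely many letters
  -- are possible.
  set w₀ := (((a : ℤ) - 1) * Δ.bottomLength - pm - pm').toNat
  let T : Finset Tok := (ML.toFinset ×ˢ MR.toFinset).image (fun z => Tok.F z.1 z.2) ∪
    (range (a + 1) ×ˢ range (a + 1) ×ˢ range (w₀ + 1)).image (fun z => Tok.B z.1 z.2.1 z.2.2) ∪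
    (range (a + 1)).image Tok.S ∪ (range (a + 1)).image Tok.T
  set N := 2 * a + Δ.bottomLength + Δ.topLength
  have hfin : (Set.range fun f : Fin N → T => List.ofFn fun i => (f i).1).Finite :=
    Set.finite_range _
  have : Finite (Set.range fun f : Fin N → T => List.ofFn fun i => (f i).1) := hfin
  have hmem : ∀ D : CompatibleDiagram Δ 1 s, word D.1.piece ∈
      Set.range fun f : Fin N → T => List.ofFn fun i => (f i).1 := by
    rintro ⟨D, hg, -⟩
    have hlen : (word D.piece).length = N := by
      have := length_eq_counts ((word D.piece).map Tok.toLtr)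
      rw [List.length_map, D.countK_word, D.countS_word, D.countT_word, D.numBounded_eq hg] at this
      simp only [N, a]
      omega
    have hT : ∀ t ∈ word D.piece, t ∈ T := by
      intro t ht
      obtain ⟨c, hc⟩ := D.okWord.of_mem ht
      have e1 : t.wt ≤ ((word D.piece).map Tok.wt).sum :=
        List.single_le_sum (fun _ _ => Nat.zero_le _) _ (List.mem_map_of_mem ht)
      have e2 := D.sum_wt h
      simp only [T, mem_union, mem_image, mem_product, Multiset.mem_toFinset, mem_range]
      rcases t with ⟨l, r⟩ | ⟨i, i', w⟩ | i | i
      · refine Or.inl (Or.inl (Or.inl ⟨(l, r), ⟨?_, ?_⟩, rfl⟩))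
        · rw [← D.coe_left h, Multiset.mem_coe]
          exact List.mem_map.2 ⟨(l, r), List.mem_filterMap.2 ⟨_, ht, rfl⟩, rfl⟩
        · rw [← D.coe_right h, Multiset.mem_coe]
          exact List.mem_map.2 ⟨(l, r), List.mem_filterMap.2 ⟨_, ht, rfl⟩, rfl⟩
      · rw [Tok.Ok] at hc
        rw [Tok.wt] at e1
        refine Or.inl (Or.inl (Or.inr ⟨(i, i', w), ⟨?_, ?_, ?_⟩, rfl⟩))
        · simp only [a]; omega
        · simp only [a]; omega
        · simp only [w₀, a]; omega
      · rw [Tok.Ok] at hc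
        exact Or.inl (Or.inr ⟨i, by omega, rfl⟩)
      · rw [Tok.Ok] at hc
        exact Or.inr ⟨i, by omega, rfl⟩
    refine ⟨fun i => ⟨(word D.piece)[i.val]'(by rw [hlen]; exact i.2), hT _ (List.getElem_mem _)⟩,
      List.ext_getElem (by simp [hlen]) fun i h1 h2 => by simp⟩
  refine Finite.of_injective (fun D : CompatibleDiagram Δ 1 s =>
    (⟨word D.1.piece, hmem D⟩ : Set.range fun f : Fin N → T => List.ofFn fun i => (f i).1)) ?_
  intro D D' hDD
  exact Subtype.ext (MarkedFloorDiagram.eq_of_word_eq (congrArg Subtype.val hDD))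

variable {A : Type*} [CommRing A] (φ : PowerSeries ℤ →+* A)

/-- The sum of a multiplicity over the diagrams of genus one as a sum over data. -/
lemma map_finsum_eq_dataSum (h : SlopeData Δ ML MR pm pm') (hn : 2 * s + 4 * n ≤ Δ.bottomLength)
    (hn' : 4 * n ≤ Δ.topLength) (ha : 0 < Δ.height) (hφ : φ PowerSeries.X ^ n = 0)
    (f : MarkedFloorDiagram Δ → PowerSeries ℤ)
    (hf : ∀ D : MarkedFloorDiagram Δ, n ≤ wordCost Δ.height (word D.piece) → φ (f D) = 0)
    (hf' : ∀ D : MarkedFloorDiagram Δ, wordCost Δ.height (word D.piece) < n →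
      f D = D.simpleMult s) :
    φ (∑ᶠ D : CompatibleDiagram Δ 1 s, f D.1) =
      dataSum n (φ PowerSeries.X) Δ.height s Δ.bottomLength Δ.topLength ML MR := by
  classical
  have := finite_compatibleDiagram (s := s) h
  have := Fintype.ofFinite (CompatibleDiagram Δ 1 s)
  have hmem := fun W => mem_lowWords (s := s) (n := n) (W := W) (by omega) hn' h.sum_eq h.card_left h.card_right
  rw [finsum_eq_sum_of_fintype, map_sum, ← sum_lowWords (by omega) hn' h.sum_eq h.card_left
    h.card_right hφ, ← sum_filter_of_ne
      (p := fun D : CompatibleDiagram Δ 1 s => wordCost Δ.height (word D.1.piece) < n)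
      (fun D _ hD => by by_contra hlt; exact hD (hf _ (not_lt.1 hlt)))]
  refine sum_nbij (fun D => word D.1.piece) ?_ ?_ ?_ ?_
  · intro D hD
    rw [mem_filter] at hD
    exact (hmem _).2 (D.1.isLowWord h D.2.1 D.2.2 (by omega) hD.2)
  · intro D _ D' _ hDD
    exact Subtype.ext (MarkedFloorDiagram.eq_of_word_eq hDD)
  · intro W hW
    have hW := (hmem _).1 (mem_coe.1 hW)
    obtain ⟨D, h1, h2, rfl⟩ := exists_diagram h (by omega) hn' ha hW
    exact ⟨⟨D, h1, h2⟩, by simpa using hW.cost_lt, rfl⟩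
  · intro D hD
    rw [mem_filter] at hD
    rw [hf' _ hD.2, D.1.map_simpleMult φ h hφ]

theorem map_simpleCount (h : SlopeData Δ ML MR pm pm') (hn : 2 * s + 4 * n ≤ Δ.bottomLength)
    (hn' : 4 * n ≤ Δ.topLength) (ha : 0 < Δ.height) (hφ : φ PowerSeries.X ^ n = 0) :
    φ (simpleCount 1 s Δ) =
      dataSum n (φ PowerSeries.X) Δ.height s Δ.bottomLength Δ.topLength ML MR :=
  map_finsum_eq_dataSum φ h hn hn' ha hφ _ (fun D => D.map_simpleMult_of_le φ h hφ)
    fun _ _ => rfl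

theorem map_gsInvariant (h : SlopeData Δ ML MR pm pm') (hn : 2 * s + 4 * n ≤ Δ.bottomLength)
    (hn' : 4 * n ≤ Δ.topLength) (ha : 0 < Δ.height) (hφ : φ PowerSeries.X ^ n = 0) :
    φ (gsInvariant 1 s Δ) =
      dataSum n (φ PowerSeries.X) Δ.height s Δ.bottomLength Δ.topLength ML MR :=
  map_finsum_eq_dataSum φ h hn hn' ha hφ _ (fun D => D.map_clearedMult_of_le φ h hφ)
    fun D hD => D.clearedMult_eq_simpleMult fun e he =>
      D.exists_source (n := n) (by omega) hD e he

end Count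

/-! ### Sides of lattice polygons -/

/-- The pairing of an integral covector with a point of the plane. -/
def rpair (n : ℤ × ℤ) (p : ℝ × ℝ) : ℝ := n.1 * p.1 + n.2 * p.2

lemma rpair_toPlane (n u : ℤ × ℤ) : rpair n (toPlane u) = pairing n u := by
  simp [rpair, toPlane, pairing]

lemma isLinearMap_rpair (n : ℤ × ℤ) : IsLinearMap ℝ (rpair n) where
  map_add p q := by simp only [rpair, Prod.fst_add, Prod.snd_add]; ring
  map_smul c p := by simp only [rpair, Prod.smul_fst, Prod.smul_snd, smul_eq_mul]; ring

lemma rpair_le_of_mem_convexHull {S : Set (ℤ × ℤ)} {n : ℤ × ℤ} {h : ℤ}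
    (hS : ∀ u ∈ S, pairing n u ≤ h) {p : ℝ × ℝ} (hp : p ∈ convexHull ℝ (toPlane '' S)) :
    rpair n p ≤ h := by
  have : convexHull ℝ (toPlane '' S) ⊆ {p | rpair n p ≤ h} := by
    refine convexHull_min ?_ (convex_halfSpace_le (isLinearMap_rpair n) _)
    rintro _ ⟨u, hu, rfl⟩
    rw [Set.mem_ofPred_eq, rpair_toPlane]
    exact_mod_cast hS u hu
  exact this hp

lemma eq_of_rpair_eq {n m : ℤ × ℤ} (hdet : IsUnit (n.1 * m.2 - n.2 * m.1)) {p q : ℝ × ℝ}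
    (h1 : rpair n p = rpair n q) (h2 : rpair m p = rpair m q) : p = q := by
  have hd : ((n.1 : ℝ) * m.2 - n.2 * m.1) ≠ 0 := by exact_mod_cast hdet.ne_zero
  simp only [rpair] at h1 h2
  refine Prod.ext ?_ ?_
  · exact mul_left_cancel₀ hd (by linear_combination (m.2 : ℝ) * h1 - (n.2 : ℝ) * h2)
  · exact mul_left_cancel₀ hd (by linear_combination (n.1 : ℝ) * h2 - (m.1 : ℝ) * h1)

lemma toPlane_injective : Function.Injective toPlane := by
  intro u v h
  simp only [toPlane, Prod.mk.injEq, Int.cast_inj] at h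
  exact Prod.ext h.1 h.2

namespace LatticePolygon

variable (Δ : LatticePolygon)

lemma convex_carrier : Convex ℝ Δ.carrier := by
  obtain ⟨S, hS⟩ := Δ.isHull
  rw [hS]
  exact convex_convexHull ℝ _

/-- The face with outgoing normal vector `n`, on which `n` has the value `h`, goes from the lattice
point `u` to the lattice point `v`, if its points are ordered by the values of `m`. -/
structure IsSide (n m : ℤ × ℤ) (h : ℤ) (u v : ℤ × ℤ) : Prop where
  mem_left : u ∈ Δ.points
  mem_right : v ∈ Δ.points
  pairing_left : pairing n u = h
  pairing_right : pairing n v = h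
  le : ∀ p ∈ Δ.carrier, rpair n p ≤ h
  bounds : ∀ p ∈ Δ.carrier, rpair n p = h → pairing m u ≤ rpair m p ∧ rpair m p ≤ pairing m v

/-- A lexicographic maximum is a maximum of the single form `M n + m` for large `M`: off the face
the integer `pairing n` is smaller by at least one, which outweighs `m`. -/
lemma rpair_le_of_isMax {S : Finset (ℤ × ℤ)} {n m : ℤ × ℤ} {h β : ℤ}
    (hn : ∀ u ∈ S, pairing n u ≤ h) (hm : ∀ u ∈ S, pairing n u = h → pairing m u ≤ β)
    {p : ℝ × ℝ} (hp : p ∈ convexHull ℝ (toPlane '' (S : Set (ℤ × ℤ)))) (hph : rpair n p = h) :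
    rpair m p ≤ β := by
  -- The sum of absolute values bounds every individual `pairing m s - β`.
  set M := ∑ s ∈ S, |pairing m s - β| with hM
  have hM1 : ∀ s ∈ S, pairing m s - β ≤ M := fun s hs => (le_abs_self _).trans
    (single_le_sum (f := fun s => |pairing m s - β|) (fun _ _ => abs_nonneg _) hs)
  have hM0 : 0 ≤ M := sum_nonneg fun _ _ => abs_nonneg _
  have key := rpair_le_of_mem_convexHull (S := (S : Set (ℤ × ℤ)))
    (n := (M * n.1 + m.1, M * n.2 + m.2)) (h := M * h + β) (fun u hu => ?_) hp
  · have e : rpair (M * n.1 + m.1, M * n.2 + m.2) p = M * rpair n p + rpair m p := by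
      simp only [rpair]; push_cast; ring
    rw [e, hph] at key
    push_cast at key
    linarith
  · have e : pairing (M * n.1 + m.1, M * n.2 + m.2) u = M * pairing n u + pairing m u := by
      simp only [pairing]; ring
    rw [e]
    rcases (hn u hu).eq_or_lt with h1 | h1
    · rw [h1]
      have := hm u hu h1
      linarith
    · have := hM1 u hu
      nlinarith

lemma exists_isSide (n m : ℤ × ℤ) : ∃ h u v, Δ.IsSide n m h u v := by
  obtain ⟨S, hS⟩ := Δ.isHull
  have hmem : ∀ u ∈ S, u ∈ Δ.points := by
    intro u hu
    change toPlane u ∈ Δ.carrier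
    rw [hS]
    exact subset_convexHull ℝ _ ⟨u, hu, rfl⟩
  have hne : S.Nonempty := by
    by_contra hS0
    rw [not_nonempty_iff_eq_empty] at hS0
    have := Δ.interior_nonempty
    rw [hS, hS0] at this
    simp at this
  obtain ⟨s, hs, hmax⟩ := exists_max_image S (pairing n) hne
  have hne' : (S.filter fun u => pairing n u = pairing n s).Nonempty := ⟨s, by simp [hs]⟩
  obtain ⟨u, hu, hu'⟩ := exists_min_image _ (pairing m) hne'
  obtain ⟨v, hv, hv'⟩ := exists_max_image _ (pairing m) hne'
  rw [mem_filter] at hu hv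
  refine ⟨pairing n s, u, v, hmem u hu.1, hmem v hv.1, hu.2, hv.2, fun p hp => ?_,
    fun p hp hph => ⟨?_, ?_⟩⟩
  · rw [hS] at hp
    exact rpair_le_of_mem_convexHull (fun w hw => hmax w hw) hp
  · rw [hS] at hp
    have := rpair_le_of_isMax (m := -m) (β := -pairing m u) (fun w hw => hmax w hw)
      (fun w hw hw' => ?_) hp hph
    · simp only [rpair, Prod.fst_neg, Prod.snd_neg] at this ⊢
      push_cast at this
      linarith
    · have := hu' w (mem_filter.2 ⟨hw, hw'⟩)
      simp only [pairing, Prod.fst_neg, Prod.snd_neg] at this ⊢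
      linarith
  · rw [hS] at hp
    exact rpair_le_of_isMax (fun w hw => hmax w hw)
      (fun w hw hw' => hv' w (mem_filter.2 ⟨hw, hw'⟩)) hp hph

variable {Δ} {n m u v : ℤ × ℤ} {h : ℤ}

namespace IsSide

variable (H : Δ.IsSide n m h u v)

include H

lemma pairing_le : pairing m u ≤ pairing m v := by
  have := (H.bounds _ H.mem_right (by rw [rpair_toPlane, H.pairing_right])).1
  rw [rpair_toPlane] at this
  exact_mod_cast this

lemma mem_face_iff {w : ℤ × ℤ} : w ∈ Δ.face n ↔ w ∈ Δ.points ∧ pairing n w = h := by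
  have hle : ∀ w ∈ Δ.points, pairing n w ≤ h := by
    intro w hw
    have := H.le _ hw
    rw [rpair_toPlane] at this
    exact_mod_cast this
  constructor
  · rintro ⟨h1, h2⟩
    refine ⟨h1, le_antisymm (hle w h1) ?_⟩
    have := h2 u H.mem_left
    rwa [H.pairing_left] at this
  · rintro ⟨h1, h2⟩
    exact ⟨h1, fun w' hw' => h2 ▸ hle w' hw'⟩

lemma mem_carrier (hdet : IsUnit (n.1 * m.2 - n.2 * m.1)) {p : ℝ × ℝ} (h1 : rpair n p = h)
    (h2 : pairing m u ≤ rpair m p) (h3 : rpair m p ≤ pairing m v) : p ∈ Δ.carrier := by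
  set α := (pairing m u : ℝ) with hα
  set β := (pairing m v : ℝ) with hβ
  have hu : rpair n (toPlane u) = h := by rw [rpair_toPlane, H.pairing_left]
  have hv : rpair n (toPlane v) = h := by rw [rpair_toPlane, H.pairing_right]
  have hu' : rpair m (toPlane u) = α := rpair_toPlane _ _
  have hv' : rpair m (toPlane v) = β := rpair_toPlane _ _
  rcases (h2.trans h3).eq_or_lt with heq | hlt
  · rw [eq_of_rpair_eq hdet (h1.trans hu.symm) ((by linarith : rpair m p = α).trans hu'.symm)]
    exact H.mem_left
  · have hd : 0 < β - α := by linarith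
    have hconv := Δ.convex_carrier H.mem_left H.mem_right
      (a := (β - rpair m p) / (β - α)) (b := (rpair m p - α) / (β - α))
      (div_nonneg (by linarith) hd.le) (div_nonneg (by linarith) hd.le) (by field_simp; ring)
    convert hconv using 1
    refine eq_of_rpair_eq hdet ?_ ?_
    · rw [(isLinearMap_rpair n).map_add, (isLinearMap_rpair n).map_smul,
        (isLinearMap_rpair n).map_smul, hu, hv, h1, smul_eq_mul, smul_eq_mul]
      field_simp
      ring
    · rw [(isLinearMap_rpair m).map_add, (isLinearMap_rpair m).map_smul,
        (isLinearMap_rpair m).map_smul, hu', hv', smul_eq_mul, smul_eq_mul]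
      field_simp
      ring

/-- As `n` and `m` form a basis of the dual lattice, `m` maps the lattice points of the face
bijectively to an interval of integers. -/
lemma sideLength_eq (hdet : IsUnit (n.1 * m.2 - n.2 * m.1)) :
    (Δ.sideLength n : ℤ) = pairing m v - pairing m u := by
  have hinj : Set.InjOn (pairing m) (Δ.face n) := by
    intro w hw w' hw' hww
    rw [H.mem_face_iff] at hw hw'
    refine toPlane_injective (eq_of_rpair_eq hdet ?_ ?_)
    · rw [rpair_toPlane, rpair_toPlane, hw.2, hw'.2]
    · rw [rpair_toPlane, rpair_toPlane, hww]
  have himage : pairing m '' Δ.face n = Set.Icc (pairing m u) (pairing m v) := by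
    ext i
    constructor
    · rintro ⟨w, hw, rfl⟩
      rw [H.mem_face_iff] at hw
      have := H.bounds _ hw.1 (by rw [rpair_toPlane, hw.2])
      rw [rpair_toPlane] at this
      exact_mod_cast this
    · rintro ⟨h1, h2⟩
      set d := n.1 * m.2 - n.2 * m.1 with hd
      have hdd : d * d = 1 := by
        rcases Int.isUnit_iff.1 hdet with h | h <;> rw [h] <;> rfl
      -- Walks from `u` along the primitive direction of the side; `m` changes by `d` with each
      -- step, and the factor `d` corrects the sign because `d * d = 1`.
      set w : ℤ × ℤ := (u.1 - (i - pairing m u) * d * n.2, u.2 + (i - pairing m u) * d * n.1)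
        with hw
      have e1 : pairing n w = h := by
        rw [← H.pairing_left]
        simp only [pairing, hw]
        ring
      have e2 : pairing m w = i := by
        have : pairing m w = pairing m u + (i - pairing m u) * (d * d) := by
          simp only [pairing, hw, hd]
          ring
        rw [this, hdd]
        ring
      refine ⟨w, H.mem_face_iff.2 ⟨H.mem_carrier hdet (by rw [rpair_toPlane, e1]) ?_ ?_, e1⟩, e2⟩
      · rw [rpair_toPlane, e2]; exact_mod_cast h1
      · rw [rpair_toPlane, e2]; exact_mod_cast h2
  have hle := H.pairing_le
  rw [sideLength, ← hinj.ncard_image, himage, ← Finset.coe_Icc, Set.ncard_coe_finset,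
    Int.card_Icc]
  omega

end IsSide

lemma exists_isUnit_det (hn : IsCoprime n.1 n.2) :
    ∃ m : ℤ × ℤ, IsUnit (n.1 * m.2 - n.2 * m.1) := by
  obtain ⟨p, q, hpq⟩ := hn
  exact ⟨(-q, p), Int.isUnit_iff.2 (Or.inl (by linear_combination hpq))⟩

/-! ### Dilations -/

open scoped Pointwise in
/-- The dilation of a polygon by a positive integer. -/
def dilate (Δ : LatticePolygon) (t : ℕ) (ht : 0 < t) : LatticePolygon where
  carrier := (t : ℝ) • Δ.carrier
  isHull := by
    classical
    obtain ⟨S, hS⟩ := Δ.isHull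
    refine ⟨S.image fun u => ((t : ℤ) * u.1, (t : ℤ) * u.2), ?_⟩
    rw [hS, ← convexHull_smul]
    congr 1
    ext p
    simp only [Set.mem_smul_set, Set.mem_image, mem_coe, coe_image, exists_exists_and_eq_and]
    refine exists_congr fun u => and_congr_right fun _ => ?_
    simp [toPlane]
  interior_nonempty := by
    have h0 : (t : ℝ) ≠ 0 := by exact_mod_cast ht.ne'
    rw [interior_smul₀ h0]
    exact Δ.interior_nonempty.smul_set

lemma mem_carrier_dilate {t : ℕ} (ht : 0 < t) {p : ℝ × ℝ} :
    p ∈ (Δ.dilate t ht).carrier ↔ ((t : ℝ)⁻¹) • p ∈ Δ.carrier := by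
  have h0 : (t : ℝ) ≠ 0 := by exact_mod_cast ht.ne'
  exact Set.mem_smul_set_iff_inv_smul_mem₀ h0 _ _

lemma IsSide.dilate (H : Δ.IsSide n m h u v) {t : ℕ} (ht : 0 < t) :
    (Δ.dilate t ht).IsSide n m (t * h) (t * u.1, t * u.2) (t * v.1, t * v.2) := by
  have h0 : (0 : ℝ) < t := by exact_mod_cast ht
  have hpair : ∀ m w : ℤ × ℤ, pairing m (t * w.1, t * w.2) = t * pairing m w := by
    intro m w
    simp only [pairing]
    ring
  have hmem : ∀ w ∈ Δ.points, ((t : ℤ) * w.1, (t : ℤ) * w.2) ∈ (Δ.dilate t ht).points := by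
    intro w hw
    change toPlane _ ∈ (Δ.dilate t ht).carrier
    rw [mem_carrier_dilate]
    convert (show toPlane w ∈ Δ.carrier from hw) using 1
    simp only [toPlane, Prod.smul_mk, smul_eq_mul]
    push_cast
    rw [inv_mul_cancel_left₀ h0.ne', inv_mul_cancel_left₀ h0.ne']
  refine ⟨hmem u H.mem_left, hmem v H.mem_right, by rw [hpair, H.pairing_left],
    by rw [hpair, H.pairing_right], fun p hp => ?_, fun p hp hph => ?_⟩
  · rw [mem_carrier_dilate] at hp
    have := H.le _ hp
    rw [(isLinearMap_rpair n).map_smul, smul_eq_mul, inv_mul_le_iff₀ h0] at this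
    push_cast
    exact this
  · rw [mem_carrier_dilate] at hp
    push_cast at hph
    have := H.bounds _ hp (by
      rw [(isLinearMap_rpair n).map_smul, smul_eq_mul, hph, inv_mul_cancel_left₀ h0.ne'])
    rw [(isLinearMap_rpair m).map_smul, smul_eq_mul, inv_mul_le_iff₀ h0, le_inv_mul_iff₀ h0] at this
    rw [hpair, hpair]
    push_cast
    exact this

lemma sideLength_dilate (hn : IsCoprime n.1 n.2) {t : ℕ} (ht : 0 < t) :
    (Δ.dilate t ht).sideLength n = t * Δ.sideLength n := by
  obtain ⟨m, hm⟩ := exists_isUnit_det hn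
  obtain ⟨h, u, v, H⟩ := Δ.exists_isSide n m
  have h1 := H.sideLength_eq hm
  have h2 := (H.dilate ht).sideLength_eq hm
  have : pairing m (t * v.1, t * v.2) - pairing m (t * u.1, t * u.2) =
      t * (pairing m v - pairing m u) := by
    simp only [pairing]
    ring
  rw [this, ← h1] at h2
  exact_mod_cast h2

lemma outerNormals_dilate {t : ℕ} (ht : 0 < t) :
    (Δ.dilate t ht).outerNormals = Δ.outerNormals := by
  ext n
  refine and_congr_right fun hn => ?_
  rw [sideLength_dilate hn ht]
  exact ⟨fun h => Nat.pos_of_mul_pos_left h, fun h => Nat.mul_pos ht h⟩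

end LatticePolygon

/-! ### The left and the right boundary of a polygon -/

lemma exists_mem_of_mem_interior {s : Set (ℝ × ℝ)} {p : ℝ × ℝ} (hp : p ∈ interior s) :
    ∃ ε > 0, ∀ d d' : ℝ, |d| ≤ ε → |d'| ≤ ε → (p.1 + d, p.2 + d') ∈ s := by
  obtain ⟨ε, hε, hball⟩ := Metric.isOpen_iff.1 isOpen_interior p hp
  refine ⟨ε / 2, by linarith, fun d d' hd hd' => interior_subset (hball ?_)⟩
  rw [Metric.mem_ball, Prod.dist_eq, max_lt_iff, Real.dist_eq, Real.dist_eq]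
  simp only [add_sub_cancel_left]
  exact ⟨by linarith, by linarith⟩

namespace LatticePolygon

variable (Δ : LatticePolygon)

/-- The polygon lies over the interval from `y₀` to `y₀ + a`, and over the interval from `y₀ + j`
to `y₀ + j + 1` its left side (for `σ = 1`) and its right side (for `σ = -1`) lie on lines of
integral slopes `k σ j`; here `X σ j` is the end of the side at height `y₀ + j`. -/
structure Strips (y₀ : ℤ) (a : ℕ) (k X : ℤ → ℕ → ℤ) : Prop where
  pos : 0 < a
  snd_mem : ∀ p ∈ Δ.carrier, (y₀ : ℝ) ≤ p.2 ∧ p.2 ≤ y₀ + a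
  X_succ : ∀ σ : ℤ, σ = 1 ∨ σ = -1 → ∀ j < a, X σ (j + 1) = X σ j + k σ j
  le : ∀ σ : ℤ, σ = 1 ∨ σ = -1 → ∀ j < a, ∀ p ∈ Δ.carrier,
    (X σ j : ℝ) + k σ j * (p.2 - (y₀ + j)) ≤ σ * p.1
  mem : ∀ σ : ℤ, σ = 1 ∨ σ = -1 → ∀ j < a, ∀ y : ℝ, y₀ + j ≤ y → y ≤ y₀ + j + 1 →
    ((σ : ℝ) * (X σ j + k σ j * (y - (y₀ + j))), y) ∈ Δ.carrier

variable {Δ}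

/-- There is a side that passes the height `j + 1 / 2` at its left (for `σ = 1`), respectively right
(for `σ = -1`), end. -/
lemma exists_isSide_of_height (hT : Δ.IsHTransverse) {S : Finset (ℤ × ℤ)}
    (hS : Δ.carrier = convexHull ℝ (toPlane '' (S : Set (ℤ × ℤ)))) {σ : ℤ} (hσ : σ = 1 ∨ σ = -1)
    {j : ℤ} (h1 : ∃ u ∈ S, u.2 ≤ j) (h2 : ∃ v ∈ S, j + 1 ≤ v.2) :
    ∃ k h u v, Δ.IsSide (-σ, k) (0, 1) h u v ∧ u.2 ≤ j ∧ j + 1 ≤ v.2 := by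
  -- The value is `2 σ` times the abscissa at which the segment joining the two points crosses the
  -- height `j + 1 / 2`. A segment minimizing it lies on the boundary.
  set f : (ℤ × ℤ) × (ℤ × ℤ) → ℚ := fun z =>
    ((σ * z.1.1 * (2 * z.2.2 - 2 * j - 1) + σ * z.2.1 * (2 * j + 1 - 2 * z.1.2) : ℤ) : ℚ) /
      ((z.2.2 - z.1.2 : ℤ) : ℚ) with hf
  obtain ⟨u0, hu0, hu0'⟩ := h1
  obtain ⟨v0, hv0, hv0'⟩ := h2
  obtain ⟨⟨u, v⟩, huv, hmin⟩ := exists_min_image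
    ((S.filter fun u => u.2 ≤ j) ×ˢ (S.filter fun v => j + 1 ≤ v.2)) f
    ⟨(u0, v0), mem_product.2 ⟨mem_filter.2 ⟨hu0, hu0'⟩, mem_filter.2 ⟨hv0, hv0'⟩⟩⟩
  rw [mem_product, mem_filter, mem_filter] at huv
  obtain ⟨⟨hu, huj⟩, hv, hvj⟩ := huv
  dsimp only at hu huj hv hvj
  -- Replacing the endpoint on the same side of the height by `w` cannot decrease the crossing
  -- point, so `w` lies on the inner side of the line through `u` and `v`.
  have hE : ∀ w ∈ S, 0 ≤ (v.2 - u.2) * (σ * (w.1 - u.1)) - (w.2 - u.2) * (σ * (v.1 - u.1)) := by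
    intro w hw
    rcases le_or_gt w.2 j with hwj | hwj
    · have := hmin (w, v) (mem_product.2 ⟨mem_filter.2 ⟨hw, hwj⟩, mem_filter.2 ⟨hv, hvj⟩⟩)
      rw [hf] at this
      dsimp only at this
      rw [div_le_div_iff₀ (by exact_mod_cast (by omega : 0 < v.2 - u.2))
        (by exact_mod_cast (by omega : 0 < v.2 - w.2))] at this
      norm_cast at this
      refine (mul_nonneg_iff_of_pos_left (by omega : 0 < 2 * v.2 - 2 * j - 1)).1 ?_
      linarith
    · have := hmin (u, w) (mem_product.2 ⟨mem_filter.2 ⟨hu, huj⟩, mem_filter.2 ⟨hw, hwj⟩⟩)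
      rw [hf] at this
      dsimp only at this
      rw [div_le_div_iff₀ (by exact_mod_cast (by omega : 0 < v.2 - u.2))
        (by exact_mod_cast (by omega : 0 < w.2 - u.2))] at this
      norm_cast at this
      refine (mul_nonneg_iff_of_pos_left (by omega : 0 < 2 * j + 1 - 2 * u.2)).1 ?_
      linarith
  have hσ0 : σ ≠ 0 := by rcases hσ with rfl | rfl <;> norm_num
  set N : ℤ × ℤ := (-σ * (v.2 - u.2), σ * (v.1 - u.1)) with hN
  have hN0 : N.1 ≠ 0 := mul_ne_zero (neg_ne_zero.2 hσ0) (by omega)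
  have hg : 0 < Int.gcd N.1 N.2 := Int.gcd_pos_of_ne_zero_left _ hN0
  obtain ⟨n1, n2, hcop, e1, e2⟩ := Int.exists_gcd_one hg
  set g : ℤ := (Int.gcd N.1 N.2 : ℤ)
  have hg' : 0 < g := by simp only [g]; exact_mod_cast hg
  have hNw : ∀ w, pairing N w = g * pairing (n1, n2) w := by
    intro w
    simp only [pairing]
    rw [e1, e2]
    ring
  have hle : ∀ w ∈ S, pairing (n1, n2) w ≤ pairing (n1, n2) u := by
    intro w hw
    have h3 := hE w hw
    refine le_of_mul_le_mul_left ?_ hg'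
    rw [← hNw, ← hNw]
    simp only [pairing, hN]
    linarith
  have huv' : pairing (n1, n2) v = pairing (n1, n2) u := by
    refine mul_left_cancel₀ hg'.ne' ?_
    rw [← hNw, ← hNw]
    simp only [pairing, hN]
    ring
  have huP : u ∈ Δ.points := by
    change toPlane u ∈ Δ.carrier
    rw [hS]
    exact subset_convexHull ℝ _ ⟨u, hu, rfl⟩
  have hvP : v ∈ Δ.points := by
    change toPlane v ∈ Δ.carrier
    rw [hS]
    exact subset_convexHull ℝ _ ⟨v, hv, rfl⟩
  have hleP : ∀ p ∈ Δ.carrier, rpair (n1, n2) p ≤ pairing (n1, n2) u := by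
    intro p hp
    rw [hS] at hp
    exact rpair_le_of_mem_convexHull hle hp
  have hheight : ∀ m h u' v', Δ.IsSide (n1, n2) m h u' v' → h = pairing (n1, n2) u ∧
      pairing m u' ≤ pairing m u ∧ pairing m u ≤ pairing m v' ∧
      pairing m u' ≤ pairing m v ∧ pairing m v ≤ pairing m v' := by
    intro m h u' v' H
    have h3 := hleP _ H.mem_left
    rw [rpair_toPlane, H.pairing_left] at h3
    have h4 := H.le _ huP
    rw [rpair_toPlane] at h4
    have h5 : h = pairing (n1, n2) u := le_antisymm (by exact_mod_cast h3) (by exact_mod_cast h4)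
    have h6 := H.bounds _ huP (by rw [rpair_toPlane, h5])
    have h7 := H.bounds _ hvP (by rw [rpair_toPlane, h5, huv'])
    rw [rpair_toPlane] at h6 h7
    norm_cast at h6 h7
    exact ⟨h5, h6.1, h6.2, h7.1, h7.2⟩
  have hout : (n1, n2) ∈ Δ.outerNormals := by
    have hcop' : IsCoprime n1 n2 := Int.isCoprime_iff_gcd_eq_one.2 hcop
    refine ⟨hcop', ?_⟩
    obtain ⟨m, hm⟩ := exists_isUnit_det (n := (n1, n2)) hcop'
    obtain ⟨h, u', v', H⟩ := Δ.exists_isSide (n1, n2) m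
    have h3 := hheight _ _ _ _ H
    have h4 := H.sideLength_eq hm
    by_contra h5
    have h6 : pairing m u = pairing m v := by omega
    have := toPlane_injective (eq_of_rpair_eq hm (p := toPlane u) (q := toPlane v)
      (by rw [rpair_toPlane, rpair_toPlane, huv']) (by rw [rpair_toPlane, rpair_toPlane, h6]))
    rw [this] at huj
    omega
  -- The side is not horizontal, so `h`-transversality makes the first coordinate of its primitive
  -- normal `1` or `-1`; the sign is that of `N.1`.
  have hn1 : n1 = -σ := by
    have e3 : -σ * (v.2 - u.2) = n1 * g := e1
    have hpos : 0 < v.2 - u.2 := by omega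
    rcases hT _ hout with h3 | h3 | h3 | h3
    · rw [Prod.mk.injEq] at h3
      exact absurd (by rw [e1, h3.1, zero_mul]) hN0
    · rw [Prod.mk.injEq] at h3
      exact absurd (by rw [e1, h3.1, zero_mul]) hN0
    · change n1 = 1 at h3
      rw [h3] at e3
      rcases hσ with rfl | rfl
      · linarith
      · rw [h3]; rfl
    · change n1 = -1 at h3
      rw [h3] at e3
      rcases hσ with rfl | rfl
      · rw [h3]
      · linarith
  obtain ⟨h, u', v', H⟩ := Δ.exists_isSide (n1, n2) (0, 1)
  have h3 := hheight _ _ _ _ H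
  simp only [pairing] at h3
  rw [hn1] at H
  exact ⟨n2, h, u', v', H, by omega, by omega⟩

/-- At each half-integral height the side found by `exists_isSide_of_height` has an integral slope
and covers the whole unit strip, since its endpoints are lattice points. -/
lemma exists_strips (hT : Δ.IsHTransverse) : ∃ y₀ a k X, Δ.Strips y₀ a k X := by
  obtain ⟨S, hS⟩ := Δ.isHull
  have hne : S.Nonempty := by
    by_contra hS0
    rw [not_nonempty_iff_eq_empty] at hS0
    have := Δ.interior_nonempty
    rw [hS, hS0] at this
    simp at this
  obtain ⟨uB, huB, hminB⟩ := exists_min_image S Prod.snd hne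
  obtain ⟨uT, huT, hmaxT⟩ := exists_max_image S Prod.snd hne
  have hlo : ∀ p ∈ Δ.carrier, (uB.2 : ℝ) ≤ p.2 := by
    intro p hp
    rw [hS] at hp
    have := rpair_le_of_mem_convexHull (n := (0, -1)) (h := -uB.2) (fun u hu => by
      have := hminB u hu
      simp only [pairing]
      omega) hp
    simp only [rpair] at this
    push_cast at this
    linarith
  have hhi : ∀ p ∈ Δ.carrier, p.2 ≤ (uT.2 : ℝ) := by
    intro p hp
    rw [hS] at hp
    have := rpair_le_of_mem_convexHull (n := (0, 1)) (h := uT.2) (fun u hu => by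
      have := hmaxT u hu
      simp only [pairing]
      omega) hp
    simp only [rpair] at this
    push_cast at this
    linarith
  have hlt : uB.2 < uT.2 := by
    obtain ⟨p, hp⟩ := Δ.interior_nonempty
    obtain ⟨ε, hε, hmem⟩ := exists_mem_of_mem_interior hp
    have h1 := hhi _ (hmem 0 ε (by simp [hε.le]) (abs_of_pos hε).le)
    have h2 := hlo _ (hmem 0 0 (by simp [hε.le]) (by simp [hε.le]))
    simp only [add_zero] at h1 h2
    exact_mod_cast (by linarith : (uB.2 : ℝ) < uT.2)
  obtain ⟨a, ha⟩ : ∃ a : ℕ, uT.2 = uB.2 + a := ⟨(uT.2 - uB.2).toNat, by omega⟩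
  have ha0 : 0 < a := by omega
  set y₀ := uB.2 with hy₀
  have hside : ∀ (σ : ℤ) (j : ℕ), ∃ (k h : ℤ) (u v : ℤ × ℤ), (σ = 1 ∨ σ = -1) → j < a →
      Δ.IsSide (-σ, k) (0, 1) h u v ∧ u.2 ≤ y₀ + j ∧ y₀ + j + 1 ≤ v.2 := by
    intro σ j
    by_cases hσj : (σ = 1 ∨ σ = -1) ∧ j < a
    · obtain ⟨k, h, u, v, H⟩ := exists_isSide_of_height hT hS hσj.1 (j := y₀ + j)
        ⟨uB, huB, by omega⟩ ⟨uT, huT, by omega⟩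
      exact ⟨k, h, u, v, fun _ _ => H⟩
    · exact ⟨0, 0, 0, 0, fun h1 h2 => absurd ⟨h1, h2⟩ hσj⟩
  choose k h u v H using hside
  have hle : ∀ σ : ℤ, σ = 1 ∨ σ = -1 → ∀ j < a, ∀ p ∈ Δ.carrier,
      (k σ j : ℝ) * p.2 - h σ j ≤ σ * p.1 := by
    intro σ hσ j hj p hp
    have := (H σ j hσ hj).1.le p hp
    simp only [rpair] at this
    push_cast at this
    linarith
  have hmem : ∀ σ : ℤ, σ = 1 ∨ σ = -1 → ∀ j < a, ∀ y : ℝ, y₀ + j ≤ y → y ≤ y₀ + j + 1 →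
      ((σ : ℝ) * (k σ j * y - h σ j), y) ∈ Δ.carrier := by
    intro σ hσ j hj y h1 h2
    obtain ⟨H1, H2, H3⟩ := H σ j hσ hj
    have hσσ : (σ : ℝ) * σ = 1 := by rcases hσ with rfl | rfl <;> norm_num
    refine H1.mem_carrier ?_ ?_ ?_ ?_
    · rw [Int.isUnit_iff]
      rcases hσ with rfl | rfl <;> simp
    · simp only [rpair]
      push_cast
      linear_combination -(k σ j * y - h σ j) * hσσ
    · simp only [rpair, pairing]
      push_cast
      have : ((u σ j).2 : ℝ) ≤ y₀ + j := by exact_mod_cast H2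
      linarith
    · simp only [rpair, pairing]
      push_cast
      have : (y₀ : ℝ) + j + 1 ≤ (v σ j).2 := by exact_mod_cast H3
      linarith
  -- At the top height `a` no strip begins, so the line of the last strip is used there.
  refine ⟨y₀, a, k, fun σ j => if j < a then k σ j * (y₀ + j) - h σ j
    else k σ (a - 1) * (y₀ + a) - h σ (a - 1), ha0, fun p hp => ⟨hlo p hp, ?_⟩, ?_, ?_, ?_⟩
  · have := hhi p hp
    rw [ha] at this
    push_cast at this
    exact this
  · intro σ hσ j hj
    have hσσ : (σ : ℝ) * σ = 1 := by rcases hσ with rfl | rfl <;> norm_num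
    rw [if_pos hj]
    by_cases hj1 : j + 1 < a
    · rw [if_pos hj1]
      -- The lines of two adjacent strips meet at their common height: the end of each lies in the
      -- polygon and satisfies the inequality of the other.
      have h1 := hle σ hσ (j + 1) hj1 _ (hmem σ hσ j hj (y₀ + j + 1) (by linarith) le_rfl)
      have h2 := hle σ hσ j hj _ (hmem σ hσ (j + 1) hj1 (y₀ + (j + 1 : ℕ)) le_rfl (by linarith))
      dsimp only at h1 h2
      rw [← mul_assoc, hσσ, one_mul] at h1 h2
      have h3 : (k σ (j + 1) * (y₀ + j + 1) - h σ (j + 1) : ℤ) =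
          k σ j * (y₀ + j + 1) - h σ j := by
        refine le_antisymm ?_ ?_
        · have : ((k σ (j + 1) * (y₀ + j + 1) - h σ (j + 1) : ℤ) : ℝ) ≤
              ((k σ j * (y₀ + j + 1) - h σ j : ℤ) : ℝ) := by
            push_cast
            linarith
          exact_mod_cast this
        · have : ((k σ j * (y₀ + j + 1) - h σ j : ℤ) : ℝ) ≤
              ((k σ (j + 1) * (y₀ + j + 1) - h σ (j + 1) : ℤ) : ℝ) := by
            push_cast at h2 ⊢
            have e : (y₀ : ℝ) + (j + 1) = y₀ + j + 1 := by ring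
            rw [e] at h2
            exact h2
          exact_mod_cast this
      push_cast
      linarith
    · rw [if_neg hj1]
      obtain rfl : a = j + 1 := by omega
      rw [Nat.add_sub_cancel]
      push_cast
      ring
  · intro σ hσ j hj p hp
    rw [if_pos hj]
    have := hle σ hσ j hj p hp
    push_cast
    linarith
  · intro σ hσ j hj y h1 h2
    rw [if_pos hj]
    convert hmem σ hσ j hj y h1 h2 using 3
    push_cast
    ring

end LatticePolygon

/-! ### Slopes, side lengths and height in terms of strips -/

lemma cost_eq_zero {l : List ℤ} (h : l.Pairwise (· ≤ ·)) : cost l = 0 := by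
  induction l with
  | nil => rfl
  | cons z l ih =>
    rw [List.pairwise_cons] at h
    rw [cost, ih h.2, add_zero]
    refine List.sum_eq_zero fun c hc => ?_
    obtain ⟨z', hz', rfl⟩ := List.mem_map.1 hc
    have := h.1 z' hz'
    omega

namespace LatticePolygon

variable {Δ : LatticePolygon} {y₀ : ℤ} {a : ℕ} {k X : ℤ → ℕ → ℤ}

/-- The slopes of the boundary of a polygon from the bottom to the top. -/
def slopes (a : ℕ) (k : ℤ → ℕ → ℤ) (σ : ℤ) : List ℤ := (List.range a).map (k σ)

lemma length_slopes (σ : ℤ) : (slopes a k σ).length = a := by simp [slopes]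

/-- The width of a polygon at the height `j`. -/
def width (X : ℤ → ℕ → ℤ) (j : ℕ) : ℤ := -X (-1) j - X 1 j

namespace Strips

variable (H : Δ.Strips y₀ a k X)

include H

section

variable {σ : ℤ} (hσ : σ = 1 ∨ σ = -1)

include hσ

omit H in
lemma sign_mul_self : (σ : ℝ) * σ = 1 := by rcases hσ with rfl | rfl <;> norm_num

lemma slope_le_succ {j : ℕ} (hj : j + 1 < a) : k σ j ≤ k σ (j + 1) := by
  have h1 := H.le σ hσ j (by omega) _ (H.mem σ hσ (j + 1) hj (y₀ + (j + 1 : ℕ) + 1) (by linarith)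
    le_rfl)
  dsimp only at h1
  have h2 := H.X_succ σ hσ j (by omega)
  rw [← mul_assoc, sign_mul_self hσ, one_mul, h2] at h1
  push_cast at h1
  have : (k σ j : ℝ) ≤ k σ (j + 1) := by linarith
  exact_mod_cast this

lemma slope_mono {i j : ℕ} (hij : i ≤ j) (hj : j < a) : k σ i ≤ k σ j := by
  induction j, hij using Nat.le_induction with
  | base => exact le_rfl
  | succ j hij ih => exact (ih (by omega)).trans (H.slope_le_succ hσ hj)

lemma mem_left {j : ℕ} (hj : j ≤ a) : ((σ : ℝ) * X σ j, (y₀ : ℝ) + j) ∈ Δ.carrier := by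
  rcases hj.lt_or_eq with h | rfl
  · have := H.mem σ hσ j h (y₀ + j) le_rfl (by linarith)
    rwa [sub_self, mul_zero, add_zero] at this
  · obtain ⟨i, rfl⟩ : ∃ i, j = i + 1 := ⟨j - 1, by have := H.pos; omega⟩
    have := H.mem σ hσ i (by omega) (y₀ + (i + 1 : ℕ)) (by push_cast; linarith)
      (by push_cast; linarith)
    rw [H.X_succ σ hσ i (by omega)]
    convert this using 3
    push_cast
    ring

lemma X_le {j : ℕ} (hj : j ≤ a) {p : ℝ × ℝ} (hp : p ∈ Δ.carrier) (hpj : p.2 = y₀ + j) :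
    (X σ j : ℝ) ≤ σ * p.1 := by
  rcases hj.lt_or_eq with h | rfl
  · have := H.le σ hσ j h p hp
    rwa [hpj, sub_self, mul_zero, add_zero] at this
  · obtain ⟨i, rfl⟩ : ∃ i, j = i + 1 := ⟨j - 1, by have := H.pos; omega⟩
    have := H.le σ hσ i (by omega) p hp
    rw [H.X_succ σ hσ i (by omega)]
    rw [hpj] at this
    push_cast at this ⊢
    linarith

lemma mem_points {j : ℕ} (hj : j ≤ a) : (σ * X σ j, y₀ + (j : ℤ)) ∈ Δ.points := by
  have := H.mem_left hσ hj
  change toPlane _ ∈ Δ.carrier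
  simpa [toPlane] using this

lemma mem_face {i j : ℕ} (hi : i < a) (hj : j = i ∨ j = i + 1) :
    (σ * X σ j, y₀ + (j : ℤ)) ∈ Δ.face (-σ, k σ i) := by
  refine ⟨H.mem_points hσ (by omega), fun v hv => ?_⟩
  have h1 := H.le σ hσ i hi _ hv
  have h2 : X σ j = X σ i + k σ i * (j - i) := by
    rcases hj with rfl | rfl
    · ring
    · rw [H.X_succ σ hσ i hi]
      push_cast
      ring
  have h3 : σ * σ = 1 := by exact_mod_cast sign_mul_self hσ
  simp only [toPlane] at h1
  have h4 : X σ i + k σ i * (v.2 - (y₀ + i)) ≤ σ * v.1 := by exact_mod_cast h1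
  simp only [pairing]
  rw [h2]
  linear_combination h4 + (X σ i + k σ i * (j - i)) * h3

/-- The side with normal vector `(-σ, κ)` covers exactly the strips of slope `κ`, and its primitive
direction vector has height one, so its integral length is the number of these strips. -/
lemma card_slope (κ : ℤ) :
    Δ.sideLength (-σ, κ) = ((range a).filter fun j => k σ j = κ).card := by
  obtain ⟨h, u, v, hS⟩ := Δ.exists_isSide (-σ, κ) (0, 1)
  have hdet : IsUnit ((-σ, κ).1 * ((0, 1) : ℤ × ℤ).2 - (-σ, κ).2 * ((0, 1) : ℤ × ℤ).1) := by
    rw [Int.isUnit_iff]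
    rcases hσ with rfl | rfl <;> simp
  have hlen := hS.sideLength_eq hdet
  have hle := hS.pairing_le
  have hσσ := sign_mul_self hσ
  have hu := H.snd_mem _ hS.mem_left
  have hv := H.snd_mem _ hS.mem_right
  have e1 : pairing (0, 1) u = u.2 := by simp [pairing]
  have e2 : pairing (0, 1) v = v.2 := by simp [pairing]
  rw [e1, e2] at hlen hle
  simp only [toPlane] at hu hv
  have hu1 : y₀ ≤ u.2 := by exact_mod_cast hu.1
  have hv2 : v.2 ≤ y₀ + a := by exact_mod_cast hv.2
  have key : (range a).filter (fun j => k σ j = κ) =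
      (range a).filter fun j : ℕ => u.2 ≤ y₀ + (j : ℤ) ∧ y₀ + (j : ℤ) < v.2 := by
    refine filter_congr fun j hj => ?_
    rw [mem_range] at hj
    constructor
    · rintro rfl
      have h1 := H.mem_left hσ (j := j) (by omega)
      have h2 := H.mem_left hσ (j := j + 1) (by omega)
      have h3 := H.le σ hσ j hj _ hS.mem_left
      have h4 := hS.pairing_left
      have h3' : (X σ j : ℝ) - k σ j * (y₀ + j) ≤ -h := by
        rw [← h4]
        simp only [toPlane, pairing] at h3 ⊢
        push_cast
        linarith
      have f1 := hS.le _ h1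
      have f2 := hS.le _ h2
      have hX : (X σ (j + 1) : ℝ) = X σ j + k σ j := by rw [H.X_succ σ hσ j hj]; push_cast; ring
      have r1 : rpair (-σ, k σ j) ((σ : ℝ) * X σ j, (y₀ : ℝ) + j) =
          -(X σ j) + k σ j * (y₀ + j) := by
        simp only [rpair]
        push_cast
        linear_combination -(X σ j : ℝ) * hσσ
      have r2 : rpair (-σ, k σ j) ((σ : ℝ) * X σ (j + 1), (y₀ : ℝ) + (j + 1 : ℕ)) =
          -(X σ j) + k σ j * (y₀ + j) := by
        simp only [rpair]
        push_cast
        rw [hX]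
        linear_combination -(X σ j + k σ j : ℝ) * hσσ
      have g1 := (hS.bounds _ h1 (by rw [r1]; rw [r1] at f1; linarith)).1
      have g2 := (hS.bounds _ h2 (by rw [r2]; rw [r2] at f2; linarith)).2
      rw [e1] at g1
      rw [e2] at g2
      simp only [rpair] at g1 g2
      have g1' : (u.2 : ℝ) ≤ y₀ + j := by push_cast at g1; linarith
      have g2' : (y₀ : ℝ) + j + 1 ≤ v.2 := by push_cast at g2; linarith
      exact ⟨by exact_mod_cast g1', by exact_mod_cast g2'⟩
    · rintro ⟨h1, h2⟩
      have aux : ∀ y : ℝ, y₀ + j ≤ y → y ≤ y₀ + j + 1 →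
          (X σ j : ℝ) + k σ j * (y - (y₀ + j)) = κ * y - h := by
        intro y hy1 hy2
        have h1' : (u.2 : ℝ) ≤ y₀ + j := by exact_mod_cast h1
        have h2' : (y₀ : ℝ) + j + 1 ≤ v.2 := by exact_mod_cast h2
        refine le_antisymm ?_ ?_
        · have hm : ((σ : ℝ) * (κ * y - h), y) ∈ Δ.carrier := by
            refine hS.mem_carrier hdet ?_ ?_ ?_
            · simp only [rpair]
              push_cast
              linear_combination -(κ * y - h : ℝ) * hσσ
            · rw [e1]
              simp only [rpair]
              push_cast
              linarith
            · rw [e2]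
              simp only [rpair]
              push_cast
              linarith
          have := H.le σ hσ j hj _ hm
          dsimp only at this
          rwa [← mul_assoc, hσσ, one_mul] at this
        · have := hS.le _ (H.mem σ hσ j hj y hy1 hy2)
          simp only [rpair] at this
          push_cast at this
          have e : -(σ : ℝ) * (σ * (X σ j + k σ j * (y - (y₀ + j)))) =
              -(X σ j + k σ j * (y - (y₀ + j))) := by
            linear_combination -(X σ j + k σ j * (y - (y₀ + j)) : ℝ) * hσσ
          rw [e] at this
          linarith
      have a1 := aux (y₀ + j) le_rfl (by linarith)
      have a2 := aux (y₀ + j + 1) (by linarith) le_rfl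
      have : (k σ j : ℝ) = κ := by linarith
      exact_mod_cast this
  rw [key]
  have hcard : ((range a).filter fun j : ℕ => u.2 ≤ y₀ + (j : ℤ) ∧ y₀ + (j : ℤ) < v.2) =
      Ico (u.2 - y₀).toNat (v.2 - y₀).toNat := by
    ext j
    simp only [mem_filter, mem_range, mem_Ico]
    omega
  rw [hcard, Nat.card_Ico]
  omega

lemma count_slopes (κ : ℤ) : (slopes a k σ).count κ = Δ.sideLength (-σ, κ) := by
  rw [H.card_slope hσ, slopes, List.count_eq_countP, List.countP_map, card_def, filter_val,
    range_val, ← Multiset.countP_eq_card_filter, Multiset.range, Multiset.coe_countP]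
  rfl

lemma pairwise_slopes : (slopes a k σ).Pairwise (· ≤ ·) := by
  rw [slopes, List.pairwise_map]
  exact (List.pairwise_lt_range (n := a)).imp_of_mem fun {i j} _ hj hij =>
    H.slope_mono hσ hij.le (List.mem_range.1 hj)

lemma sum_take_slopes {j : ℕ} (hj : j ≤ a) : ((slopes a k σ).take j).sum = X σ j - X σ 0 := by
  induction j with
  | zero => simp
  | succ j ih =>
    rw [List.take_add_one, List.sum_append, ih (by omega), H.X_succ σ hσ j (by omega), slopes,
      List.getElem?_map, List.getElem?_range (by omega)]
    simp only [Option.map_some, Option.toList_some, List.sum_singleton]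
    ring

lemma sum_slopes : (slopes a k σ).sum = X σ a - X σ 0 := by
  rw [← H.sum_take_slopes hσ le_rfl, List.take_of_length_le (by rw [length_slopes])]

/-- By convexity the slopes of the boundary are already sorted, so the cost in `sum_sum_take` is
zero and the prefix sums are the abscissas of the boundary. -/
lemma pairMin_slopes : pairMin (slopes a k σ) = ∑ j ∈ range a, X σ j - a * X σ 0 := by
  have h1 := sum_sum_take (slopes a k σ)
  rw [cost_eq_zero (H.pairwise_slopes hσ), length_slopes,
    sum_congr rfl fun j hj => H.sum_take_slopes hσ (mem_range.1 hj).le] at h1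
  simp only [sum_sub_distrib, sum_const, card_range, nsmul_eq_mul, Nat.cast_zero] at h1
  linarith

end

/-- The lengths of the bottom and the top side. -/
lemma sideLength_horizontal {τ : ℤ} {j : ℕ} (hτ : τ = -1 ∧ j = 0 ∨ τ = 1 ∧ j = a) :
    (Δ.sideLength (0, τ) : ℤ) = width X j := by
  obtain ⟨h, u, v, hS⟩ := Δ.exists_isSide (0, τ) (1, 0)
  have hdet : IsUnit (((0, τ) : ℤ × ℤ).1 * ((1, 0) : ℤ × ℤ).2 -
      ((0, τ) : ℤ × ℤ).2 * ((1, 0) : ℤ × ℤ).1) := by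
    rw [Int.isUnit_iff]
    rcases hτ with ⟨rfl, -⟩ | ⟨rfl, -⟩ <;> simp
  have hj : j ≤ a := by omega
  have hp1 := H.mem_left (Or.inl rfl : (1 : ℤ) = 1 ∨ (1 : ℤ) = -1) hj
  have hp2 := H.mem_left (Or.inr rfl : (-1 : ℤ) = 1 ∨ (-1 : ℤ) = -1) hj
  have e1 : pairing (1, 0) u = u.1 := by simp [pairing]
  have e2 : pairing (1, 0) v = v.1 := by simp [pairing]
  have hu := H.snd_mem _ hS.mem_left
  have hv := H.snd_mem _ hS.mem_right
  have hpu := hS.pairing_left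
  have hpv := hS.pairing_right
  have hle := hS.le _ hp1
  simp only [toPlane] at hu hv
  have hu1 : y₀ ≤ u.2 := by exact_mod_cast hu.1
  have hu2 : u.2 ≤ y₀ + a := by exact_mod_cast hu.2
  have hv1 : y₀ ≤ v.2 := by exact_mod_cast hv.1
  have hv2 : v.2 ≤ y₀ + a := by exact_mod_cast hv.2
  simp only [pairing, zero_mul, zero_add] at hpu hpv
  have hle' : τ * (y₀ + j) ≤ h := by
    simp only [rpair] at hle
    push_cast at hle
    rw [zero_mul, zero_add] at hle
    exact_mod_cast hle
  have hh : h = τ * (y₀ + j) ∧ u.2 = y₀ + j ∧ v.2 = y₀ + j := by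
    rcases hτ with ⟨rfl, rfl⟩ | ⟨rfl, rfl⟩ <;> refine ⟨?_, ?_, ?_⟩ <;> push_cast at * <;> omega
  have hr : ∀ x : ℝ, rpair (0, τ) (x, (y₀ : ℝ) + j) = h := by
    intro x
    rw [hh.1]
    simp [rpair]
  have b1 := (hS.bounds _ hp1 (hr _)).1
  have b2 := (hS.bounds _ hp2 (hr _)).2
  have c1 := H.X_le (Or.inl rfl : (1 : ℤ) = 1 ∨ (1 : ℤ) = -1) hj hS.mem_left
    (by simp only [toPlane]; rw [hh.2.1]; push_cast; ring)
  have c2 := H.X_le (Or.inr rfl : (-1 : ℤ) = 1 ∨ (-1 : ℤ) = -1) hj hS.mem_right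
    (by simp only [toPlane]; rw [hh.2.2]; push_cast; ring)
  rw [hS.sideLength_eq hdet, e1, e2, width]
  rw [e1] at b1
  rw [e2] at b2
  simp only [rpair, toPlane] at b1 b2 c1 c2
  push_cast at b1 b2 c1 c2
  have d1 : (u.1 : ℝ) ≤ X 1 j := by linarith
  have d2 : -(X (-1) j : ℝ) ≤ v.1 := by linarith
  have d3 : (X 1 j : ℝ) ≤ u.1 := by linarith
  have d4 : (v.1 : ℝ) ≤ -X (-1) j := by linarith
  have d1' : u.1 ≤ X 1 j := by exact_mod_cast d1
  have d2' : -(X (-1) j) ≤ v.1 := by exact_mod_cast d2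
  have d3' : X 1 j ≤ u.1 := by exact_mod_cast d3
  have d4' : v.1 ≤ -X (-1) j := by exact_mod_cast d4
  omega

lemma topLength_eq : (Δ.topLength : ℤ) = width X a :=
  H.sideLength_horizontal (Or.inr ⟨rfl, rfl⟩)

lemma bottomLength_eq : (Δ.bottomLength : ℤ) = width X 0 :=
  H.sideLength_horizontal (Or.inl ⟨rfl, rfl⟩)

lemma height_eq : Δ.height = a := by
  have h1 : ∀ u ∈ Δ.points, y₀ ≤ u.2 ∧ u.2 ≤ y₀ + a := by
    intro u hu
    have := H.snd_mem _ hu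
    simp only [toPlane] at this
    exact ⟨by exact_mod_cast this.1, by exact_mod_cast this.2⟩
  have hσ : (1 : ℤ) = 1 ∨ (1 : ℤ) = -1 := Or.inl rfl
  have h2 : IsGreatest (Prod.snd '' Δ.points) (y₀ + a) :=
    ⟨⟨_, H.mem_points hσ le_rfl, rfl⟩, by rintro _ ⟨u, hu, rfl⟩; exact (h1 u hu).2⟩
  have h3 : IsLeast (Prod.snd '' Δ.points) y₀ :=
    ⟨⟨_, H.mem_points hσ (Nat.zero_le a), by simp⟩, by rintro _ ⟨u, hu, rfl⟩; exact (h1 u hu).1⟩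
  rw [height, h2.csSup_eq, h3.csInf_eq]
  omega

/-- The slopes of consecutive sides of a polygon with nonsingular toric surface differ by one. -/
lemma slope_succ_le (hN : Δ.IsNonsingular) {σ : ℤ} (hσ : σ = 1 ∨ σ = -1) {j : ℕ}
    (hj : j + 1 < a) : k σ (j + 1) ≤ k σ j + 1 := by
  by_contra hlt
  have hout : ∀ i < a, (-σ, k σ i) ∈ Δ.outerNormals := by
    intro i hi
    refine ⟨?_, ?_⟩
    · rcases hσ with rfl | rfl
      · exact isCoprime_one_left.neg_left
      · rw [neg_neg]
        exact isCoprime_one_left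
    · rw [H.card_slope hσ]
      exact card_pos.2 ⟨i, by simp [hi]⟩
  -- The two sides meet at height `j + 1`, and the determinant of their normal vectors is the
  -- difference of the slopes up to sign.
  have h1 := hN _ (hout j (by omega)) _ (hout (j + 1) hj)
    (by rw [Ne, Prod.mk.injEq]; omega)
    ⟨_, H.mem_face hσ (by omega) (Or.inr rfl), H.mem_face hσ hj (Or.inl rfl)⟩
  dsimp only at h1
  rw [Int.isUnit_iff] at h1
  rcases hσ with rfl | rfl <;> omega

/-- The slopes of a polygon with nonsingular toric surface are consecutive integers. -/
lemma sideLength_pos_iff (hN : Δ.IsNonsingular) {σ : ℤ} (hσ : σ = 1 ∨ σ = -1) (κ : ℤ) :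
    0 < Δ.sideLength (-σ, κ) ↔ k σ 0 ≤ κ ∧ κ ≤ k σ (a - 1) := by
  have hpos := H.pos
  rw [H.card_slope hσ, card_pos]
  constructor
  · rintro ⟨j, hj⟩
    rw [mem_filter, mem_range] at hj
    rw [← hj.2]
    exact ⟨H.slope_mono hσ (Nat.zero_le _) hj.1, H.slope_mono hσ (by omega) (by omega)⟩
  · rintro ⟨h1, h2⟩
    -- A discrete intermediate value argument: the slopes rise by at most one per strip.
    have key : ∀ i < a, κ ≤ k σ i → ∃ j ≤ i, k σ j = κ := by
      intro i
      induction i with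
      | zero => intro _ h; exact ⟨0, le_rfl, by omega⟩
      | succ i ih =>
        intro hi h
        by_cases h3 : κ ≤ k σ i
        · obtain ⟨j, hj, hj'⟩ := ih (by omega) h3
          exact ⟨j, by omega, hj'⟩
        · have := H.slope_succ_le hN hσ hi
          exact ⟨i + 1, le_rfl, by omega⟩
    obtain ⟨j, hj, hj'⟩ := key (a - 1) (by omega) h2
    exact ⟨j, by simp only [mem_filter, mem_range]; exact ⟨by omega, hj'⟩⟩

end Strips

end LatticePolygon

/-! ### Area and interior lattice points by horizontal slices -/

namespace LatticePolygon

variable {Δ : LatticePolygon} {y₀ : ℤ} {a : ℕ} {k X : ℤ → ℕ → ℤ}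

lemma isCompact_carrier : IsCompact Δ.carrier := by
  obtain ⟨S, hS⟩ := Δ.isHull
  rw [hS]
  exact (S.finite_toSet.image _).isCompact_convexHull (𝕜 := ℝ)

lemma mem_carrier_of_le {x x' z y : ℝ} (h : (x, y) ∈ Δ.carrier) (h' : (x', y) ∈ Δ.carrier)
    (h1 : x ≤ z) (h2 : z ≤ x') : (z, y) ∈ Δ.carrier := by
  have hc : Convex ℝ {z : ℝ | (z, y) ∈ Δ.carrier} := by
    intro z hz z' hz' c c' hc hc' hcc
    have := Δ.convex_carrier hz hz' hc hc' hcc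
    simp only [Prod.smul_mk, Prod.mk_add_mk, smul_eq_mul, ← add_mul, hcc, one_mul] at this
    exact this
  exact hc.ordConnected.out h h' ⟨h1, h2⟩

namespace Strips

variable (H : Δ.Strips y₀ a k X)

include H

lemma mem_of_le {j : ℕ} (hj : j < a) {p : ℝ × ℝ} (h1 : (y₀ : ℝ) + j ≤ p.2)
    (h2 : p.2 ≤ y₀ + j + 1)
    (h : ∀ σ : ℤ, σ = 1 ∨ σ = -1 → (X σ j : ℝ) + k σ j * (p.2 - (y₀ + j)) ≤ σ * p.1) :
    p ∈ Δ.carrier := by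
  have m1 := H.mem 1 (Or.inl rfl) j hj _ h1 h2
  have m2 := H.mem (-1) (Or.inr rfl) j hj _ h1 h2
  have l1 := h 1 (Or.inl rfl)
  have l2 := h (-1) (Or.inr rfl)
  refine mem_carrier_of_le m1 m2 ?_ ?_ <;> push_cast at * <;> linarith

lemma volume_slice {j : ℕ} (hj : j < a) {y : ℝ} (h1 : (y₀ : ℝ) + j ≤ y) (h2 : y ≤ y₀ + j + 1) :
    (MeasureTheory.volume ((fun x : ℝ => (x, y)) ⁻¹' Δ.carrier)).toReal =
      width X j + (width X (j + 1) - width X j) * (y - (y₀ + j)) := by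
  have hset : (fun x : ℝ => (x, y)) ⁻¹' Δ.carrier =
      Set.Icc (X 1 j + k 1 j * (y - (y₀ + j))) (-(X (-1) j + k (-1) j * (y - (y₀ + j)))) := by
    ext x
    rw [Set.mem_preimage, Set.mem_Icc]
    constructor
    · intro hx
      have l1 := H.le 1 (Or.inl rfl) j hj _ hx
      have l2 := H.le (-1) (Or.inr rfl) j hj _ hx
      push_cast at l1 l2
      exact ⟨by linarith, by linarith⟩
    · rintro ⟨l1, l2⟩
      refine H.mem_of_le hj h1 h2 fun σ hσ => ?_
      rcases hσ with rfl | rfl <;> push_cast <;> linarith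
  have hle := H.le 1 (Or.inl rfl) j hj _ (H.mem (-1) (Or.inr rfl) j hj y h1 h2)
  have e1 := H.X_succ 1 (Or.inl rfl) j hj
  have e2 := H.X_succ (-1) (Or.inr rfl) j hj
  push_cast at hle
  rw [hset, Real.volume_Icc, ENNReal.toReal_ofReal (by linarith)]
  simp only [width, e1, e2]
  push_cast
  ring

/-- Cavalieri's principle: the length of a slice is linear on each unit strip, so every strip is a
trapezoid. -/
lemma area_eq_sum : Δ.area = ∑ j ∈ range a, ((width X j : ℝ) + width X (j + 1)) / 2 := by
  set ℓ : ℝ → ℝ := fun y =>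
    (MeasureTheory.volume ((fun x : ℝ => (x, y)) ⁻¹' Δ.carrier)).toReal with hℓ
  have hmeas : MeasurableSet Δ.carrier := isCompact_carrier.measurableSet
  have hzero : ∀ y, y ∉ Set.Ioc ((y₀ : ℝ) + (0 : ℕ)) (y₀ + a) → y ≠ y₀ → ℓ y = 0 := by
    intro y hy hy'
    have : (fun x : ℝ => (x, y)) ⁻¹' Δ.carrier = ∅ := by
      ext x
      simp only [Set.mem_preimage, Set.mem_empty_iff_false, iff_false]
      intro hx
      have := H.snd_mem _ hx
      refine hy ⟨?_, this.2⟩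
      rw [Nat.cast_zero, add_zero]
      exact lt_of_le_of_ne this.1 (Ne.symm hy')
    rw [hℓ]
    simp only [this, MeasureTheory.measure_empty, ENNReal.toReal_zero]
  have hlin : ∀ j < a, Set.EqOn ℓ
      (fun y => width X j + (width X (j + 1) - width X j) * (y - (y₀ + j)))
      (Set.uIcc ((y₀ : ℝ) + j) (y₀ + (j + 1 : ℕ))) := by
    intro j hj y hy
    push_cast at hy
    rw [Set.uIcc_of_le (by linarith), Set.mem_Icc] at hy
    exact H.volume_slice hj hy.1 (by linarith)
  have hint : ∀ j < a, IntervalIntegrable ℓ MeasureTheory.volume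
      ((y₀ : ℝ) + j) (y₀ + (j + 1 : ℕ)) := by
    intro j hj
    have hc : Continuous fun y : ℝ =>
        (width X j : ℝ) + (width X (j + 1) - width X j) * (y - (y₀ + j)) := by fun_prop
    exact (hc.intervalIntegrable _ _).congr ((hlin j hj).mono Set.uIoc_subset_uIcc).symm
  have hfin : MeasureTheory.volume Δ.carrier ≠ ⊤ := isCompact_carrier.measure_ne_top
  have h1 : Δ.area = ∫ y, ℓ y := by
    rw [area, MeasureTheory.Measure.volume_eq_prod] at *
    rw [MeasureTheory.Measure.prod_apply_symm hmeas] at *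
    rw [hℓ, MeasureTheory.integral_toReal (measurable_measure_prodMk_right hmeas).aemeasurable]
    exact MeasureTheory.ae_lt_top (measurable_measure_prodMk_right hmeas) hfin
  have h2 : ∫ y, ℓ y = ∫ y in ((y₀ : ℝ) + (0 : ℕ))..(y₀ + a), ℓ y := by
    rw [intervalIntegral.integral_of_le (by simp),
      MeasureTheory.setIntegral_eq_integral_of_ae_compl_eq_zero]
    -- The bottom slice may have positive length although its height is not in the half-open
    -- interval; a single height is negligible.
    have : ∀ᵐ y : ℝ, y ≠ y₀ := MeasureTheory.Measure.ae_ne _ _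
    filter_upwards [this] with y hy hy'
    exact hzero y hy' hy
  rw [h1, h2, ← intervalIntegral.sum_integral_adjacent_intervals
    (a := fun j : ℕ => (y₀ : ℝ) + j) hint]
  refine sum_congr rfl fun j hj => ?_
  rw [mem_range] at hj
  rw [intervalIntegral.integral_congr (hlin j hj)]
  have e : ∀ y : ℝ, (width X j : ℝ) + (width X (j + 1) - width X j) * (y - (y₀ + j)) =
      (width X j - (width X (j + 1) - width X j) * (y₀ + j)) +
        (width X (j + 1) - width X j) * y := fun y => by ring
  simp only [e]
  rw [intervalIntegral.integral_add (by simp) (Continuous.intervalIntegrable (by fun_prop) _ _),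
    intervalIntegral.integral_const, intervalIntegral.integral_const_mul, integral_id]
  push_cast
  simp only [smul_eq_mul]
  ring

lemma pairMin_add : pairMin (slopes a k 1) + pairMin (slopes a k (-1)) =
    a * width X 0 - ∑ j ∈ range a, width X j := by
  rw [H.pairMin_slopes (Or.inl rfl), H.pairMin_slopes (Or.inr rfl)]
  simp only [width, sum_sub_distrib, sum_neg_distrib]
  ring

lemma area_eq : Δ.area = ((Δ.bottomLength : ℝ) + Δ.topLength) / 2 +
    ((Δ.height : ℝ) - 1) * Δ.bottomLength - (pairMin (slopes a k 1) : ℤ) -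
      (pairMin (slopes a k (-1)) : ℤ) := by
  have h1 : (Δ.topLength : ℝ) = width X a := by exact_mod_cast H.topLength_eq
  have h2 : (Δ.bottomLength : ℝ) = width X 0 := by exact_mod_cast H.bottomLength_eq
  have h3 : ((pairMin (slopes a k 1) : ℤ) : ℝ) + (pairMin (slopes a k (-1)) : ℤ) =
      a * width X 0 - ∑ j ∈ range a, (width X j : ℝ) := by exact_mod_cast H.pairMin_add
  have h4 : ∑ j ∈ range a, (width X (j + 1) : ℝ) =
      ∑ j ∈ range a, (width X j : ℝ) + width X a - width X 0 := by
    rw [← sum_range_succ (fun j => (width X j : ℝ)) a, sum_range_succ']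
    ring
  rw [H.area_eq_sum, H.height_eq, ← sum_div, sum_add_distrib, h4, h1, h2]
  linear_combination h3

/-- An interior lattice point lies strictly between the two ends of a horizontal chord. -/
lemma toPlane_mem_interior_iff (u : ℤ × ℤ) : toPlane u ∈ interior Δ.carrier ↔
    ∃ j ∈ Ico 1 a, u.2 = y₀ + (j : ℕ) ∧ X 1 j < u.1 ∧ u.1 < -X (-1) j := by
  constructor
  · intro hu
    obtain ⟨ε, hε, hmem⟩ := exists_mem_of_mem_interior hu
    have s1 := H.snd_mem _ (hmem 0 ε (by simp [hε.le]) (abs_of_pos hε).le)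
    have s2 := H.snd_mem _ (hmem 0 (-ε) (by simp [hε.le]) (by rw [abs_neg, abs_of_pos hε]))
    simp only [toPlane] at s1 s2 hmem
    have s3 : (y₀ : ℝ) < u.2 := by linarith
    have s4 : (u.2 : ℝ) < y₀ + a := by linarith
    have s3' : y₀ < u.2 := by exact_mod_cast s3
    have s4' : u.2 < y₀ + a := by exact_mod_cast s4
    obtain ⟨j, hj⟩ : ∃ j : ℕ, u.2 = y₀ + j := ⟨(u.2 - y₀).toNat, by omega⟩
    have hja : j ≤ a := by omega
    have e : (u.2 : ℝ) + 0 = y₀ + j := by rw [hj]; push_cast; ring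
    have t1 := H.X_le (Or.inl rfl : (1 : ℤ) = 1 ∨ (1 : ℤ) = -1) hja
      (hmem (-ε) 0 (by rw [abs_neg, abs_of_pos hε]) (by simp [hε.le])) e
    have t2 := H.X_le (Or.inr rfl : (-1 : ℤ) = 1 ∨ (-1 : ℤ) = -1) hja
      (hmem ε 0 (abs_of_pos hε).le (by simp [hε.le])) e
    push_cast at t1 t2
    have t3 : (X 1 j : ℝ) < u.1 := by linarith
    have t4 : (u.1 : ℝ) < -X (-1) j := by linarith
    exact ⟨j, by rw [mem_Ico]; omega, hj, by exact_mod_cast t3, by exact_mod_cast t4⟩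
  · rintro ⟨j, hj, hu, h1, h2⟩
    rw [mem_Ico] at hj
    obtain ⟨i, rfl⟩ : ∃ i, j = i + 1 := ⟨j - 1, by omega⟩
    -- Near a boundary height two strips matter. Strict inequalities for the lines of both strips,
    -- on both sides, define an open set inside the polygon.
    set U : Set (ℝ × ℝ) := {p | (y₀ : ℝ) + i < p.2 ∧ p.2 < y₀ + i + 2 ∧
      ∀ σ ∈ ({1, -1} : Finset ℤ), ∀ m ∈ ({i, i + 1} : Finset ℕ),
        (X σ (i + 1) : ℝ) + k σ m * (p.2 - (y₀ + i + 1)) < σ * p.1} with hU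
    have hopen : IsOpen U := by
      have o1 : IsOpen {p : ℝ × ℝ | (y₀ : ℝ) + i < p.2} := isOpen_lt (by fun_prop) (by fun_prop)
      have o2 : IsOpen {p : ℝ × ℝ | p.2 < y₀ + i + 2} := isOpen_lt (by fun_prop) (by fun_prop)
      have o3 : IsOpen (⋂ σ ∈ ({1, -1} : Finset ℤ), ⋂ m ∈ ({i, i + 1} : Finset ℕ),
          {p : ℝ × ℝ | (X σ (i + 1) : ℝ) + k σ m * (p.2 - (y₀ + i + 1)) < σ * p.1}) :=
        isOpen_biInter_finset fun σ _ => isOpen_biInter_finset fun m _ =>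
          isOpen_lt (by fun_prop) (by fun_prop)
      convert o1.inter (o2.inter o3) using 1
      ext p
      simp only [hU, Set.mem_ofPred_eq, Set.mem_inter_iff, Set.mem_iInter]
    refine interior_maximal ?_ hopen ?_
    · rintro p ⟨p1, p2, p3⟩
      rcases le_total p.2 (y₀ + i + 1) with hp | hp
      · refine H.mem_of_le (j := i) (by omega) p1.le hp fun σ hσ => ?_
        have := p3 σ (by simpa using hσ) i (by simp)
        rw [H.X_succ σ hσ i (by omega)] at this
        push_cast at this
        linarith
      · refine H.mem_of_le (j := i + 1) (by omega) (by push_cast; linarith)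
          (by push_cast; linarith) fun σ hσ => ?_
        have := p3 σ (by simpa using hσ) (i + 1) (by simp)
        push_cast
        linarith
    · have hu' : (u.2 : ℝ) = y₀ + i + 1 := by rw [hu]; push_cast; ring
      simp only [hU, toPlane, Set.mem_ofPred_eq, hu']
      refine ⟨by linarith, by linarith, fun σ hσ m _ => ?_⟩
      rw [sub_self, mul_zero, add_zero]
      have hσ' : σ = 1 ∨ σ = -1 := by simpa using hσ
      have : X σ (i + 1) < σ * u.1 := by rcases hσ' with rfl | rfl <;> omega
      exact_mod_cast this

/-- By convexity the width at height `j` is at least the linear interpolation between the widths of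
the horizontal sides. -/
lemma width_pos (h0 : 0 < width X 0) (h1 : 0 < width X a) {j : ℕ} (hj : j ≤ a) :
    0 < width X j := by
  have ha : (0 : ℝ) < a := by exact_mod_cast H.pos
  have hj' : (j : ℝ) ≤ a := by exact_mod_cast hj
  have key : ∀ σ : ℤ, σ = 1 ∨ σ = -1 →
      (X σ j : ℝ) * a ≤ (a - j) * X σ 0 + j * X σ a := by
    intro σ hσ
    have hc := Δ.convex_carrier (H.mem_left hσ (Nat.zero_le a)) (H.mem_left hσ le_rfl)
      (a := (a - j) / a) (b := j / a) (div_nonneg (by linarith) ha.le) (by positivity)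
      (by field_simp; ring)
    have h := H.X_le hσ hj hc (by
      simp only [Prod.smul_mk, Prod.mk_add_mk, smul_eq_mul]
      field_simp
      push_cast
      ring)
    simp only [Prod.smul_mk, Prod.mk_add_mk, smul_eq_mul] at h
    have hσσ := sign_mul_self hσ
    have e : (σ : ℝ) * ((a - j) / a * (σ * X σ 0) + j / a * (σ * X σ a)) =
        ((a - j) * X σ 0 + j * X σ a) / a := by
      field_simp
      linear_combination ((a - j) * X σ 0 + j * X σ a : ℝ) * hσσ
    rw [e, le_div_iff₀ ha] at h
    exact h
  have k1 := key 1 (Or.inl rfl)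
  have k2 := key (-1) (Or.inr rfl)
  have w0 : (1 : ℝ) ≤ width X 0 := by exact_mod_cast h0
  have w1 : (1 : ℝ) ≤ width X a := by exact_mod_cast h1
  have : (0 : ℝ) < width X j := by
    simp only [width] at *
    push_cast at *
    have m1 := mul_le_mul_of_nonneg_left w0 (sub_nonneg.2 hj')
    have m2 := mul_le_mul_of_nonneg_left w1 (Nat.cast_nonneg (α := ℝ) j)
    nlinarith
  exact_mod_cast this

/-- A chord of integral width at an inner height contains one interior lattice point fewer than its
width; the sum of the widths is governed by the sums of pairwise minima of the slopes. This matches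
the constant term of `dataSum_eq`. -/
lemma gmax_eq (h0 : 0 < width X 0) (h1 : 0 < width X a) : (Δ.gmax : ℤ) =
    ((a : ℤ) - 1) * ((Δ.bottomLength : ℤ) - 1) - pairMin (slopes a k 1) -
      pairMin (slopes a k (-1)) := by
  have hset : {u : ℤ × ℤ | toPlane u ∈ interior Δ.carrier} =
      (((Ico 1 a).sigma fun j => Ioo (X 1 j) (-X (-1) j)).image
        fun z : (_ : ℕ) × ℤ => (z.2, y₀ + (z.1 : ℤ)) : Finset (ℤ × ℤ)) := by
    ext u
    rw [Set.mem_ofPred_eq, H.toPlane_mem_interior_iff, coe_image, Set.mem_image]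
    constructor
    · rintro ⟨j, hj, hu, hx⟩
      exact ⟨⟨j, u.1⟩, mem_coe.2 (mem_sigma.2 ⟨hj, mem_Ioo.2 hx⟩), Prod.ext rfl hu.symm⟩
    · rintro ⟨⟨j, x⟩, hz, rfl⟩
      have := mem_sigma.1 (mem_coe.1 hz)
      exact ⟨j, this.1, rfl, mem_Ioo.1 this.2⟩
  rw [gmax, hset, Set.ncard_coe_finset, card_image_of_injOn, card_sigma]
  · have hw : ∀ j ∈ Ico 1 a, ((Ioo (X 1 j) (-X (-1) j)).card : ℤ) = width X j - 1 := by
      intro j hj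
      rw [mem_Ico] at hj
      have := H.width_pos h0 h1 (j := j) (by omega)
      rw [Int.card_Ioo]
      simp only [width] at *
      omega
    have hpos := H.pos
    have hp := H.pairMin_add
    rw [range_eq_Ico, sum_eq_sum_Ico_succ_bot hpos] at hp
    push_cast
    rw [sum_congr rfl hw, sum_sub_distrib, H.bottomLength_eq, sum_const, Nat.card_Ico,
      nsmul_eq_mul, Nat.cast_sub (by omega)]
    push_cast at hp ⊢
    linear_combination hp
  · rintro ⟨j, x⟩ - ⟨j', x'⟩ - h
    simp only [Prod.mk.injEq] at h
    obtain ⟨rfl, h⟩ := h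
    obtain rfl : j = j' := by omega
    rfl

lemma slopeData : SlopeData Δ (slopes a k 1) (slopes a k (-1)) (pairMin (slopes a k 1))
    (pairMin (slopes a k (-1))) where
  count_left κ := by rw [Multiset.coe_count, H.count_slopes (Or.inl rfl)]; rfl
  count_right κ := by rw [Multiset.coe_count, H.count_slopes (Or.inr rfl), neg_neg]; rfl
  card_left := by rw [Multiset.coe_card, length_slopes, H.height_eq]
  card_right := by rw [Multiset.coe_card, length_slopes, H.height_eq]
  sum_eq := by
    rw [Multiset.sum_coe, Multiset.sum_coe, H.sum_slopes (Or.inl rfl), H.sum_slopes (Or.inr rfl),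
      H.bottomLength_eq, H.topLength_eq, width, width]
    ring
  pairMin_left _ h := pairMin_perm h
  pairMin_right _ h := pairMin_perm h
  area_eq := H.area_eq

end Strips

end LatticePolygon

/-! ### Normal vectors as two intervals of slopes -/

lemma count_block_map (f : ℤ → ℕ) (k κ : ℤ) (l : ℕ) :
    (block k ((List.range l).map fun i : ℕ => f (k + i))).count κ =
      if k ≤ κ ∧ κ < k + l then f κ else 0 := by
  induction l generalizing k with
  | zero =>
    rw [List.range_zero, List.map_nil, block, Multiset.count_zero, if_neg (by omega)]
  | succ l ih =>
    have e : (List.range (l + 1)).map (fun i : ℕ => f (k + i)) =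
        f k :: (List.range l).map fun i : ℕ => f (k + 1 + i) := by
      rw [List.range_succ_eq_map, List.map_cons, List.map_map, Nat.cast_zero, add_zero]
      congr 2
      funext i
      simp only [Function.comp_apply, Nat.succ_eq_add_one, Nat.cast_add, Nat.cast_one]
      congr 1
      ring
    rw [e, block, Multiset.count_add, ih, Multiset.count_replicate]
    by_cases h : k = κ
    · subst h
      rw [if_pos rfl, if_neg (by omega), if_pos (by omega), add_zero]
    · rw [if_neg h, zero_add]
      refine if_congr ?_ rfl rfl
      push_cast
      omega

namespace LatticePolygon

/-- The outgoing normal vectors `(-1, κ)` and `(1, κ)` of the sides of a polygon are those with `κ`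
in the intervals from `κ₀ σ` to `κ₀ σ + l σ`, where `σ = 1`, respectively `σ = -1`. -/
def NormalIntervals (Δ : LatticePolygon) (κ₀ : ℤ → ℤ) (l : ℤ → ℕ) : Prop :=
  ∀ σ : ℤ, σ = 1 ∨ σ = -1 → ∀ κ, 0 < Δ.sideLength (-σ, κ) ↔ κ₀ σ ≤ κ ∧ κ ≤ κ₀ σ + l σ

variable {Δ : LatticePolygon} {κ₀ : ℤ → ℤ} {l : ℤ → ℕ}

lemma isCoprime_neg_sign {σ : ℤ} (hσ : σ = 1 ∨ σ = -1) (κ : ℤ) : IsCoprime (-σ) κ := by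
  rcases hσ with rfl | rfl
  · exact isCoprime_one_left.neg_left
  · rw [neg_neg]
    exact isCoprime_one_left

lemma mem_outerNormals_sign {σ : ℤ} (hσ : σ = 1 ∨ σ = -1) {κ : ℤ} :
    (-σ, κ) ∈ Δ.outerNormals ↔ 0 < Δ.sideLength (-σ, κ) :=
  and_iff_right (isCoprime_neg_sign hσ κ)

lemma exists_normalIntervals (hT : Δ.IsHTransverse) (hN : Δ.IsNonsingular) :
    ∃ κ₀ l, Δ.NormalIntervals κ₀ l := by
  obtain ⟨y₀, a, k, X, H⟩ := exists_strips hT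
  refine ⟨fun σ => k σ 0, fun σ => (k σ (a - 1) - k σ 0).toNat, fun σ hσ κ => ?_⟩
  have := H.pos
  have := H.slope_mono hσ (Nat.zero_le (a - 1)) (by omega)
  rw [H.sideLength_pos_iff hN hσ]
  dsimp only
  omega

lemma NormalIntervals.of_outerNormals_eq (h : Δ.NormalIntervals κ₀ l) {Δ' : LatticePolygon}
    (h' : Δ'.outerNormals = Δ.outerNormals) : Δ'.NormalIntervals κ₀ l := fun σ hσ κ => by
  rw [← h σ hσ κ, ← mem_outerNormals_sign hσ, h', mem_outerNormals_sign hσ]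

/-- Two horizontal sides, `l 1 + 1` sides on the left and `l (-1) + 1` on the right. -/
lemma NormalIntervals.eulerChar_eq (h : Δ.NormalIntervals κ₀ l) (hT : Δ.IsHTransverse)
    (hH : Δ.IsHorizontal) : Δ.eulerChar = 4 + l 1 + l (-1) := by
  have hset : Δ.outerNormals = (({0} ×ˢ {1, -1} ∪ ({-1} ×ˢ Icc (κ₀ 1) (κ₀ 1 + l 1) ∪
      {1} ×ˢ Icc (κ₀ (-1)) (κ₀ (-1) + l (-1))) : Finset (ℤ × ℤ)) : Set (ℤ × ℤ)) := by
    ext ⟨n₁, κ⟩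
    have h1 := (mem_outerNormals_sign (Δ := Δ) (Or.inl rfl : (1 : ℤ) = 1 ∨ (1 : ℤ) = -1)).trans
      (h 1 (Or.inl rfl) κ)
    have h2 := (mem_outerNormals_sign (Δ := Δ) (Or.inr rfl : (-1 : ℤ) = 1 ∨ (-1 : ℤ) = -1)).trans
      (h (-1) (Or.inr rfl) κ)
    rw [neg_neg] at h2
    simp only [mem_coe, mem_union, mem_product, mem_insert, mem_singleton, mem_Icc]
    constructor
    · intro hn
      rcases hT _ hn with e | e | e | e
      · rw [Prod.mk.injEq] at e
        exact Or.inl ⟨e.1, Or.inl e.2⟩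
      · rw [Prod.mk.injEq] at e
        exact Or.inl ⟨e.1, Or.inr e.2⟩
      · dsimp only at e
        subst e
        exact Or.inr (Or.inr ⟨rfl, h2.1 hn⟩)
      · dsimp only at e
        subst e
        exact Or.inr (Or.inl ⟨rfl, h1.1 hn⟩)
    · rintro (⟨rfl, rfl | rfl⟩ | ⟨rfl, hκ⟩ | ⟨rfl, hκ⟩)
      · exact hH.1
      · exact hH.2
      · exact h1.2 hκ
      · exact h2.2 hκ
  have d1 : Disjoint (({-1} : Finset ℤ) ×ˢ Icc (κ₀ 1) (κ₀ 1 + l 1))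
      ({1} ×ˢ Icc (κ₀ (-1)) (κ₀ (-1) + l (-1))) :=
    disjoint_product.2 (Or.inl (by simp))
  have d2 : Disjoint (({0} : Finset ℤ) ×ˢ ({1, -1} : Finset ℤ))
      ({-1} ×ˢ Icc (κ₀ 1) (κ₀ 1 + l 1) ∪ {1} ×ˢ Icc (κ₀ (-1)) (κ₀ (-1) + l (-1))) :=
    disjoint_union_right.2 ⟨disjoint_product.2 (Or.inl (by simp)),
      disjoint_product.2 (Or.inl (by simp))⟩
  rw [eulerChar, hset, Set.ncard_coe_finset, card_union_of_disjoint d2, card_union_of_disjoint d1]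
  simp only [card_product, card_singleton, Int.card_Icc, one_mul, card_pair (show (1 : ℤ) ≠ -1 by simp)]
  omega

variable {y₀ : ℤ} {a : ℕ} {k X : ℤ → ℕ → ℤ}

lemma Strips.slopes_eq_block (H : Δ.Strips y₀ a k X) (h : Δ.NormalIntervals κ₀ l) {σ : ℤ}
    (hσ : σ = 1 ∨ σ = -1) : (slopes a k σ : Multiset ℤ) = block (κ₀ σ)
      ((List.range (l σ + 1)).map fun i : ℕ => Δ.sideLength (-σ, κ₀ σ + i)) := by
  refine Multiset.ext.2 fun κ => ?_
  rw [Multiset.coe_count, H.count_slopes hσ, count_block_map fun κ => Δ.sideLength (-σ, κ)]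
  have := h σ hσ κ
  split_ifs with hκ
  · rfl
  · push_cast at hκ
    omega

end LatticePolygon

/-! ### Reduction modulo a power of `X` and the asymptotic series -/

/-- The reduction modulo `X ^ n`. -/
def truncHom (n : ℕ) :
    PowerSeries ℤ →+* PowerSeries ℤ ⧸ Ideal.span {(PowerSeries.X : PowerSeries ℤ) ^ n} :=
  Ideal.Quotient.mk _

lemma truncHom_X_pow (n : ℕ) : truncHom n PowerSeries.X ^ n = 0 := by
  rw [← map_pow]
  exact Ideal.Quotient.eq_zero_iff_mem.2 (Ideal.mem_span_singleton_self _)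

lemma coeff_eq_of_truncHom_eq {n : ℕ} {f g : PowerSeries ℤ} (h : truncHom n f = truncHom n g)
    {i : ℕ} (hi : i < n) : PowerSeries.coeff i f = PowerSeries.coeff i g := by
  have := Ideal.mem_span_singleton.1 ((Ideal.Quotient.mk_eq_mk_iff_sub_mem _ _).1 h)
  rw [PowerSeries.X_pow_dvd_iff] at this
  have := this i hi
  rwa [map_sub, sub_eq_zero] at this

/-- `F` is, up to any given order, a sum over words for all large polygons. -/
def IsWordCount (s : ℕ) (F : LatticePolygon → PowerSeries ℤ) : Prop :=
  ∀ ⦃n : ℕ⦄ ⦃Δ : LatticePolygon⦄ ⦃ML MR : Multiset ℤ⦄ ⦃pm pm' : ℤ⦄, SlopeData Δ ML MR pm pm' →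
    2 * s + 4 * n ≤ Δ.bottomLength → 4 * n ≤ Δ.topLength → 0 < Δ.height →
    truncHom n (F Δ) = dataSum n (truncHom n PowerSeries.X) Δ.height s Δ.bottomLength Δ.topLength
      ML MR

lemma isWordCount_simpleCount (s : ℕ) : IsWordCount s (simpleCount 1 s) :=
  fun n _ _ _ _ _ h hn hn' ha => map_simpleCount _ h hn hn' ha (truncHom_X_pow n)

lemma isWordCount_gsInvariant (s : ℕ) : IsWordCount s (gsInvariant 1 s) :=
  fun n _ _ _ _ _ h hn hn' ha => map_gsInvariant _ h hn hn' ha (truncHom_X_pow n)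

/-- The asymptotic series in genus one. -/
def asympSeries (s χ g : ℕ) : PowerSeries ℤ :=
  partitionSeries ^ χ * ((g : PowerSeries ℤ) +
    2 * (s : PowerSeries ℤ) * (PowerSeries.X * invOneSub) - 12 * eisensteinTwo)

lemma truncHom_asympSeries {n : ℕ} (hn : 0 < n) (s χ g : ℕ) :
    truncHom n (asympSeries s χ g) = partProd n (truncHom n PowerSeries.X) ^ χ *
      ((g : PowerSeries ℤ ⧸ Ideal.span {(PowerSeries.X : PowerSeries ℤ) ^ n}) +
        2 * s * lamb n (truncHom n PowerSeries.X) 1 - 12 * eisSum n (truncHom n PowerSeries.X)) := by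
  have h := truncHom_X_pow n
  rw [asympSeries, map_mul, map_pow, map_partitionSeries _ hn h, map_sub, map_add, map_mul, map_mul,
    map_mul, map_mul, map_eisensteinTwo _ h, map_invOneSub _ h, map_natCast, map_natCast, lamb,
    pow_one]
  simp only [map_ofNat]

/-- The coefficients of a word count of a large polygon. -/
theorem coeff_eq_coeff_asympSeries {s : ℕ} {F : LatticePolygon → PowerSeries ℤ}
    (hF : IsWordCount s F) {Δ : LatticePolygon} (hT : Δ.IsHTransverse) {κ₀ : ℤ → ℤ} {l : ℤ → ℕ}
    (hI : Δ.NormalIntervals κ₀ l) {n : ℕ}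
    (h0 : 2 * s + 4 * n + n * (2 * n) + 1 ≤ Δ.bottomLength)
    (h1 : 4 * n + n * (2 * n) + 1 ≤ Δ.topLength)
    (h2 : ∀ σ : ℤ, σ = 1 ∨ σ = -1 → ∀ κ, 0 < Δ.sideLength (-σ, κ) →
      n * n + 2 * n ≤ Δ.sideLength (-σ, κ)) {i : ℕ} (hi : i < n) :
    PowerSeries.coeff i (F Δ) =
      PowerSeries.coeff i (asympSeries s (4 + l 1 + l (-1)) Δ.gmax) := by
  obtain ⟨y₀, a, k, X, H⟩ := LatticePolygon.exists_strips hT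
  refine coeff_eq_of_truncHom_eq ?_ hi
  have hn : 0 < n := by omega
  have hlist : ∀ σ : ℤ, σ = 1 ∨ σ = -1 → ∃ m0 ms, ms.length = l σ ∧
      (∀ z ∈ m0 :: ms, n * n + 2 * n ≤ z) ∧
      (LatticePolygon.slopes a k σ : Multiset ℤ) = block (κ₀ σ) (m0 :: ms) := by
    intro σ hσ
    have hb := H.slopes_eq_block hI hσ
    obtain ⟨m0, ms, hms⟩ := List.exists_cons_of_length_pos
      (l := (List.range (l σ + 1)).map fun i : ℕ => Δ.sideLength (-σ, κ₀ σ + i)) (by simp)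
    refine ⟨m0, ms, ?_, ?_, hms ▸ hb⟩
    · have := congrArg List.length hms
      simp only [List.length_map, List.length_range, List.length_cons] at this
      omega
    · rw [← hms]
      intro z hz
      rw [List.mem_map] at hz
      obtain ⟨i, hi, rfl⟩ := hz
      rw [List.mem_range] at hi
      exact h2 σ hσ _ ((hI σ hσ _).2 (by omega))
  have hσ : (1 : ℤ) = 1 ∨ (1 : ℤ) = -1 := Or.inl rfl
  have hσ' : (-1 : ℤ) = 1 ∨ (-1 : ℤ) = -1 := Or.inr rfl
  obtain ⟨m0, ms, hl, hm, hM⟩ := hlist 1 hσ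
  obtain ⟨m0', ms', hl', hm', hM'⟩ := hlist (-1) hσ'
  have hslopes := H.slopeData
  have hha := H.height_eq
  have hpos := H.pos
  have hna : n ≤ a := by
    have e1 : m0 ≤ a := by
      rw [← LatticePolygon.length_slopes (a := a) (k := k) 1, ← count_block (κ₀ 1) m0 ms, ← hM,
        Multiset.coe_count]
      exact List.count_le_length
    have := hm m0 (by simp)
    nlinarith
  -- `B` is the number of sources that are not in pairs.
  obtain ⟨B, hB⟩ : ∃ B, Δ.bottomLength = 2 * s + B := ⟨Δ.bottomLength - 2 * s, by omega⟩
  have hperm : ∀ σ : ℤ, ∀ L : List ℤ, (L : Multiset ℤ) = LatticePolygon.slopes a k σ →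
      pairMin L = pairMin (LatticePolygon.slopes a k σ) ∧
        L.sum = (LatticePolygon.slopes a k σ).sum ∧ L.length = a := by
    intro σ L hL
    refine ⟨pairMin_perm hL, ?_, ?_⟩
    · rw [← Multiset.sum_coe, hL, Multiset.sum_coe]
    · rw [← Multiset.coe_card, hL, Multiset.coe_card, LatticePolygon.length_slopes]
  have hsum := hslopes.sum_eq
  rw [Multiset.sum_coe, Multiset.sum_coe, hB] at hsum
  rw [hF hslopes (by omega) (by omega) (by omega), truncHom_asympSeries hn, hM, hM', hha, hB,
    dataSum_eq (truncHom_X_pow n) hn hm hm' (fun L hL => hperm 1 L (by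
      rw [mem_arrangements.1 hL, hM])) (fun L hL => hperm (-1) L (by
      rw [mem_arrangements.1 hL, hM'])) hna hsum (by omega) (by omega), hl, hl']
  have hg := H.gmax_eq (by have := H.bottomLength_eq; omega) (by have := H.topLength_eq; omega)
  rw [hB] at hg
  rw [← Int.cast_natCast (R := PowerSeries ℤ ⧸ Ideal.span {(PowerSeries.X : PowerSeries ℤ) ^ n})
    Δ.gmax, hg]
  push_cast
  ring

/-! ### Polynomial functions on the ample classes -/

variable {Δ : LatticePolygon}

/-- A polynomial function with coefficients in `ℚ⟦X⟧` on the ample classes. -/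
def IsPolyFun (Δ : LatticePolygon) (f : Ample Δ → PowerSeries ℚ) : Prop :=
  ∃ P : MvPolynomial Δ.outerNormals (PowerSeries ℚ), ∀ β : Ample Δ,
    f β = MvPolynomial.eval (fun n => (β.1.sideLength n.1 : PowerSeries ℚ)) P

namespace IsPolyFun

variable {f g : Ample Δ → PowerSeries ℚ}

lemma const (c : PowerSeries ℚ) : IsPolyFun Δ fun _ => c :=
  ⟨MvPolynomial.C c, fun _ => (MvPolynomial.eval_C _).symm⟩

lemma add (hf : IsPolyFun Δ f) (hg : IsPolyFun Δ g) : IsPolyFun Δ fun β => f β + g β := by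
  obtain ⟨P, hP⟩ := hf
  obtain ⟨Q, hQ⟩ := hg
  exact ⟨P + Q, fun β => by rw [map_add, ← hP, ← hQ]⟩

lemma mul (hf : IsPolyFun Δ f) (hg : IsPolyFun Δ g) : IsPolyFun Δ fun β => f β * g β := by
  obtain ⟨P, hP⟩ := hf
  obtain ⟨Q, hQ⟩ := hg
  exact ⟨P * Q, fun β => by rw [map_mul, ← hP, ← hQ]⟩

lemma sub (hf : IsPolyFun Δ f) (hg : IsPolyFun Δ g) : IsPolyFun Δ fun β => f β - g β := by
  obtain ⟨P, hP⟩ := hf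
  obtain ⟨Q, hQ⟩ := hg
  exact ⟨P - Q, fun β => by rw [map_sub, ← hP, ← hQ]⟩

lemma sum {ι : Type*} {F : ι → Ample Δ → PowerSeries ℚ} {t : Finset ι}
    (h : ∀ i ∈ t, IsPolyFun Δ (F i)) : IsPolyFun Δ fun β => ∑ i ∈ t, F i β := by
  classical
  induction t using Finset.induction_on with
  | empty => simpa using const 0
  | insert i t hi ih =>
    simp only [sum_insert hi]
    exact (h i (mem_insert_self i t)).add (ih fun j hj => h j (mem_insert_of_mem hj))

lemma sideLength {n : ℤ × ℤ} (hn : n ∈ Δ.outerNormals) :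
    IsPolyFun Δ fun β => (β.1.sideLength n : PowerSeries ℚ) :=
  ⟨MvPolynomial.X ⟨n, hn⟩, fun β => by rw [MvPolynomial.eval_X]⟩

end IsPolyFun

namespace LatticePolygon

variable {κ₀ : ℤ → ℤ} {l : ℤ → ℕ} {y₀ : ℤ} {a : ℕ} {k X : ℤ → ℕ → ℤ}

lemma Strips.sum_map_slopes (H : Δ.Strips y₀ a k X) (h : Δ.NormalIntervals κ₀ l) {σ : ℤ}
    (hσ : σ = 1 ∨ σ = -1) (f : ℤ → ℤ) : ((slopes a k σ).map f).sum =
      ∑ κ ∈ Icc (κ₀ σ) (κ₀ σ + l σ), (Δ.sideLength (-σ, κ) : ℤ) * f κ := by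
  have h1 := Finset.sum_multiset_map_count (slopes a k σ : Multiset ℤ) f
  rw [Multiset.map_coe, Multiset.sum_coe] at h1
  rw [h1, sum_congr rfl fun κ _ => by
    rw [Multiset.coe_count, H.count_slopes hσ, nsmul_eq_mul]]
  refine sum_subset (fun κ hκ => ?_) fun κ _ hκ => ?_
  · rw [mem_Icc, ← h σ hσ, ← H.count_slopes hσ, List.count_pos_iff]
    rwa [Multiset.mem_toFinset, Multiset.mem_coe] at hκ
  · rw [Multiset.mem_toFinset, Multiset.mem_coe] at hκ
    rw [← H.count_slopes hσ, List.count_eq_zero_of_not_mem hκ, Nat.cast_zero, zero_mul]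

/-- The number of interior lattice points in terms of the lengths of the sides. -/
lemma NormalIntervals.two_mul_gmax (h : Δ.NormalIntervals κ₀ l) (hT : Δ.IsHTransverse)
    (hH : Δ.IsHorizontal) : 2 * (Δ.gmax : ℤ) =
      2 * ((∑ κ ∈ Icc (κ₀ 1) (κ₀ 1 + l 1), (Δ.sideLength (-1, κ) : ℤ)) - 1) *
        (Δ.sideLength (0, -1) - 1) -
      ∑ σ ∈ {1, -1}, ∑ κ ∈ Icc (κ₀ σ) (κ₀ σ + l σ), (Δ.sideLength (-σ, κ) : ℤ) *
        ((∑ κ' ∈ Icc (κ₀ σ) (κ₀ σ + l σ), (Δ.sideLength (-σ, κ') : ℤ) * min κ κ') - κ) := by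
  obtain ⟨y₀, a, k, X, H⟩ := exists_strips hT
  have hpm : ∀ σ : ℤ, σ = 1 ∨ σ = -1 → 2 * pairMin (slopes a k σ) =
      ∑ κ ∈ Icc (κ₀ σ) (κ₀ σ + l σ), (Δ.sideLength (-σ, κ) : ℤ) *
        ((∑ κ' ∈ Icc (κ₀ σ) (κ₀ σ + l σ), (Δ.sideLength (-σ, κ') : ℤ) * min κ κ') - κ) := by
    intro σ hσ
    have h1 := two_mul_pairMin (slopes a k σ)
    have h2 := H.sum_map_slopes h hσ id
    rw [List.map_id] at h2
    rw [h2] at h1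
    simp only [H.sum_map_slopes h hσ, id] at h1
    simp only [mul_sub, sum_sub_distrib]
    linarith
  have ha := H.sum_map_slopes h (Or.inl rfl) fun _ => 1
  simp only [mul_one, List.map_const', List.sum_replicate, length_slopes, nsmul_eq_mul] at ha
  have hb := H.bottomLength_eq
  have ht := H.topLength_eq
  have hb' : 0 < Δ.bottomLength := hH.2.2
  have ht' : 0 < Δ.topLength := hH.1.2
  have hg := H.gmax_eq (by omega) (by omega)
  rw [sum_pair (by simp), ← hpm 1 (Or.inl rfl), ← hpm (-1) (Or.inr rfl), hg, ← ha]
  change _ = 2 * ((a : ℤ) - 1) * ((Δ.bottomLength : ℤ) - 1) - _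
  ring

end LatticePolygon

lemma LatticePolygon.IsHTransverse.ample (hT : Δ.IsHTransverse) (β : Ample Δ) :
    β.1.IsHTransverse := by
  rw [IsHTransverse, β.2]
  exact hT

lemma LatticePolygon.IsHorizontal.ample (hH : Δ.IsHorizontal) (β : Ample Δ) :
    β.1.IsHorizontal := by
  rw [IsHorizontal, β.2]
  exact hH

/-- Twice the number of interior points is a quadratic polynomial in the side lengths with integral
coefficients; the factor `1 / 2` is the reason for rational coefficients. -/
lemma isPolyFun_gmax (hT : Δ.IsHTransverse) (hH : Δ.IsHorizontal) {κ₀ : ℤ → ℤ} {l : ℤ → ℕ}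
    (h : Δ.NormalIntervals κ₀ l) : IsPolyFun Δ fun β => (β.1.gmax : PowerSeries ℚ) := by
  have h2 : PowerSeries.C (1 / 2 : ℚ) * 2 = 1 := by
    rw [← map_ofNat (PowerSeries.C (R := ℚ)) 2, ← map_mul]
    norm_num
  have hmem : ∀ σ : ℤ, σ = 1 ∨ σ = -1 → ∀ κ ∈ Icc (κ₀ σ) (κ₀ σ + l σ),
      (-σ, κ) ∈ Δ.outerNormals := fun σ hσ κ hκ =>
    (LatticePolygon.mem_outerNormals_sign hσ).2 ((h σ hσ κ).2 (mem_Icc.1 hκ))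
  have e : ∀ β : Ample Δ, (β.1.gmax : PowerSeries ℚ) = PowerSeries.C (1 / 2 : ℚ) *
      (2 * ((∑ κ ∈ Icc (κ₀ 1) (κ₀ 1 + l 1), (β.1.sideLength (-1, κ) : PowerSeries ℚ)) - 1) *
        (β.1.sideLength (0, -1) - 1) -
      ∑ σ ∈ {1, -1}, ∑ κ ∈ Icc (κ₀ σ) (κ₀ σ + l σ), (β.1.sideLength (-σ, κ) : PowerSeries ℚ) *
        ((∑ κ' ∈ Icc (κ₀ σ) (κ₀ σ + l σ), (β.1.sideLength (-σ, κ') : PowerSeries ℚ) *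
          (min κ κ' : ℤ)) - (κ : ℤ))) := by
    intro β
    have := congrArg (Int.cast (R := PowerSeries ℚ))
      ((h.of_outerNormals_eq β.2).two_mul_gmax (hT.ample β) (hH.ample β))
    push_cast at this
    rw [← this, ← mul_assoc, h2, one_mul]
  simp only [e]
  have hlen : ∀ σ : ℤ, σ = 1 ∨ σ = -1 → ∀ κ ∈ Icc (κ₀ σ) (κ₀ σ + l σ),
      IsPolyFun Δ fun β => (β.1.sideLength (-σ, κ) : PowerSeries ℚ) :=
    fun σ hσ κ hκ => IsPolyFun.sideLength (hmem σ hσ κ hκ)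
  have hsum : IsPolyFun Δ fun β => ∑ κ ∈ Icc (κ₀ 1) (κ₀ 1 + l 1),
      (β.1.sideLength (-1, κ) : PowerSeries ℚ) := IsPolyFun.sum (hlen 1 (Or.inl rfl))
  have hquad : ∀ σ : ℤ, σ = 1 ∨ σ = -1 → ∀ κ ∈ Icc (κ₀ σ) (κ₀ σ + l σ), IsPolyFun Δ fun β =>
      (β.1.sideLength (-σ, κ) : PowerSeries ℚ) * ((∑ κ' ∈ Icc (κ₀ σ) (κ₀ σ + l σ),
        (β.1.sideLength (-σ, κ') : PowerSeries ℚ) * (min κ κ' : ℤ)) - (κ : ℤ)) := by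
    intro σ hσ κ hκ
    refine (hlen σ hσ κ hκ).mul (IsPolyFun.sub ?_ (IsPolyFun.const _))
    exact IsPolyFun.sum fun κ' hκ' => (hlen σ hσ κ' hκ').mul (IsPolyFun.const _)
  have hbot := (IsPolyFun.sideLength hH.2).sub (IsPolyFun.const 1)
  refine (IsPolyFun.const _).mul (IsPolyFun.sub
    (((IsPolyFun.const 2).mul (hsum.sub (IsPolyFun.const 1))).mul hbot) ?_)
  exact IsPolyFun.sum fun σ hσ => IsPolyFun.sum (hquad σ (by simpa using hσ))

lemma isPolynomial_asympSeries (hT : Δ.IsHTransverse) (hH : Δ.IsHorizontal)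
    (hN : Δ.IsNonsingular) (s χ : ℕ) :
    IsPolynomial Δ fun β => asympSeries s χ β.1.gmax := by
  obtain ⟨κ₀, l, h⟩ := LatticePolygon.exists_normalIntervals hT hN
  change IsPolyFun Δ _
  have e : ∀ β : Ample Δ, PowerSeries.map (Int.castRingHom ℚ) (asympSeries s χ β.1.gmax) =
      PowerSeries.map (Int.castRingHom ℚ) (partitionSeries ^ χ) * ((β.1.gmax : PowerSeries ℚ) +
        PowerSeries.map (Int.castRingHom ℚ)
          (2 * (s : PowerSeries ℤ) * (PowerSeries.X * invOneSub) - 12 * eisensteinTwo)) := by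
    intro β
    rw [asympSeries, add_sub_assoc, map_mul, map_add, map_natCast]
  simp only [e]
  exact (IsPolyFun.const _).mul ((isPolyFun_gmax hT hH h).add (IsPolyFun.const _))

/-! ### Uniqueness -/

/-- The multiple `t β` of an ample class. -/
def Ample.dilate (β : Ample Δ) (t : ℕ) (ht : 0 < t) : Ample Δ :=
  ⟨β.1.dilate t ht, (LatticePolygon.outerNormals_dilate ht).trans β.2⟩

/-- Because `t` is a constant series, the coefficient of order `i` is a rational polynomial in `t`;
it has infinitely many zeros. -/
lemma eq_zero_of_polynomial {Q : Polynomial (PowerSeries ℚ)} {i C : ℕ}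
    (h : ∀ t : ℕ, C ≤ t → PowerSeries.coeff i (Q.eval (t : PowerSeries ℚ)) = 0) (t : ℕ) :
    PowerSeries.coeff i (Q.eval (t : PowerSeries ℚ)) = 0 := by
  set q : Polynomial ℚ := ∑ j ∈ range (Q.natDegree + 1),
    Polynomial.C (PowerSeries.coeff i (Q.coeff j)) * Polynomial.X ^ j with hq
  have hev : ∀ t : ℕ, PowerSeries.coeff i (Q.eval (t : PowerSeries ℚ)) = q.eval (t : ℚ) := by
    intro t
    rw [Polynomial.eval_eq_sum_range, map_sum, hq, Polynomial.eval_finsetSum]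
    refine sum_congr rfl fun j _ => ?_
    rw [Polynomial.eval_mul, Polynomial.eval_C, Polynomial.eval_pow, Polynomial.eval_X,
      ← map_natCast (PowerSeries.C (R := ℚ)), ← map_pow, PowerSeries.coeff_mul_C]
  have hzero : q = 0 := by
    refine Polynomial.eq_zero_of_infinite_isRoot q (Set.Infinite.mono ?_
      ((Set.Ici_infinite C).image (Nat.cast_injective (R := ℚ)).injOn))
    rintro _ ⟨t, ht, rfl⟩
    change q.eval (t : ℚ) = 0
    rw [← hev, h t ht]
  rw [hev, hzero, Polynomial.eval_zero]

/-- Along the multiples `t β` both polynomials agree with `F` to any given order once `t` is large.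
Their difference is polynomial in `t`, hence vanishes to that order for all `t`, in particular at `t
= 1`. -/
lemma IsAsymptotic.unique {F : LatticePolygon → PowerSeries ℤ} {A A' : Ample Δ → PowerSeries ℤ}
    (h : IsAsymptotic Δ F A) (h' : IsAsymptotic Δ F A') : A = A' := by
  obtain ⟨⟨P, hP⟩, hA⟩ := h
  obtain ⟨⟨P', hP'⟩, hA'⟩ := h'
  funext β
  refine PowerSeries.ext fun i => ?_
  obtain ⟨C, hC⟩ := hA (i + 1)
  obtain ⟨C', hC'⟩ := hA' (i + 1)
  -- The restriction of the difference of the two polynomials to the ray through `β`, with `t` as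
  -- the variable.
  set Q : Polynomial (PowerSeries ℚ) := MvPolynomial.eval₂ Polynomial.C
    (fun n : Δ.outerNormals => Polynomial.X * Polynomial.C (β.1.sideLength n.1 : PowerSeries ℚ))
    (P - P') with hQ
  have hev : ∀ (γ : Ample Δ) (t : ℕ), (∀ n ∈ Δ.outerNormals,
      γ.1.sideLength n = t * β.1.sideLength n) → Q.eval (t : PowerSeries ℚ) =
        PowerSeries.map (Int.castRingHom ℚ) (A γ - A' γ) := by
    intro γ t hγ
    rw [map_sub, hP, hP', ← map_sub, hQ, ← Polynomial.coe_evalRingHom, MvPolynomial.hom_eval₂]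
    change _ = MvPolynomial.eval₂ (RingHom.id _) _ _
    congr 1
    · ext c : 1
      simp
    · funext n
      rw [Polynomial.coe_evalRingHom, Polynomial.eval_mul, Polynomial.eval_X, Polynomial.eval_C,
        hγ n.1 n.2, Nat.cast_mul]
  have key := eq_zero_of_polynomial (Q := Q) (i := i) (C := max 1 (max C C')) fun t ht => by
    have ht0 : 0 < t := by omega
    have hlarge : ∀ m ∈ Δ.outerNormals, t ≤ (β.dilate t ht0).1.sideLength m := by
      intro m hm
      rw [← β.2] at hm
      rw [Ample.dilate, LatticePolygon.sideLength_dilate hm.1]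
      exact Nat.le_mul_of_pos_right _ hm.2
    have e1 := hC (β.dilate t ht0) (fun m hm => le_trans (by omega) (hlarge m hm)) i (by omega)
    have e2 := hC' (β.dilate t ht0) (fun m hm => le_trans (by omega) (hlarge m hm)) i (by omega)
    rw [hev (β.dilate t ht0) t fun m hm => by
        rw [← β.2] at hm
        exact LatticePolygon.sideLength_dilate hm.1 ht0,
      PowerSeries.coeff_map, map_sub, ← e1, ← e2, sub_self, map_zero]
  have k1 := key 1
  rw [hev β 1 fun m _ => (one_mul _).symm, PowerSeries.coeff_map, map_sub] at k1
  exact sub_eq_zero.1 (Int.cast_eq_zero.1 k1)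

theorem isAsymptotic_iff {s : ℕ} {F : LatticePolygon → PowerSeries ℤ} (hF : IsWordCount s F)
    (hT : Δ.IsHTransverse) (hH : Δ.IsHorizontal) (hN : Δ.IsNonsingular)
    (A : Ample Δ → PowerSeries ℤ) :
    IsAsymptotic Δ F A ↔ ∀ β : Ample Δ, A β = asympSeries s Δ.eulerChar β.1.gmax := by
  have main : IsAsymptotic Δ F fun β => asympSeries s Δ.eulerChar β.1.gmax := by
    refine ⟨isPolynomial_asympSeries hT hH hN s _, fun n => ?_⟩
    obtain ⟨κ₀, l, h⟩ := LatticePolygon.exists_normalIntervals hT hN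
    -- One bound for all sides: `2 * s` sources are used by the pairs, `4 * n` makes every flow at
    -- least `2 * n`, `n * (2 * n)` makes the series of the ends stable, and the total also exceeds
    -- the `n * n + 2 * n` required of the slopes.
    refine ⟨2 * s + 4 * n + n * (2 * n) + 1, fun β hβ i hi => ?_⟩
    rw [h.eulerChar_eq hT hH]
    refine coeff_eq_coeff_asympSeries hF (hT.ample β) (h.of_outerNormals_eq β.2) (hβ _ hH.2)
      (le_trans (by omega) (hβ _ hH.1)) (fun σ hσ κ hκ => ?_) hi
    refine le_trans (by nlinarith) (hβ (-σ, κ) ?_)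
    rw [← β.2]
    exact (LatticePolygon.mem_outerNormals_sign hσ).2 hκ
  refine ⟨fun hA β => congrFun (hA.unique main) β, fun hA => ?_⟩
  rwa [funext hA]

end RefinedFloors

end

theorem mainTheorem6 (Δ : RefinedFloors.LatticePolygon)
    (hT : Δ.IsHTransverse) (hH : Δ.IsHorizontal) (hN : Δ.IsNonsingular) (s : ℕ)
    (A : RefinedFloors.Ample Δ → PowerSeries ℤ) :
    (RefinedFloors.IsAsymptotic Δ (RefinedFloors.gsInvariant 1 s) A ↔
      ∀ β : RefinedFloors.Ample Δ,
        A β = RefinedFloors.partitionSeries ^ Δ.eulerChar *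
          ((β.1.gmax : PowerSeries ℤ)
            + 2 * (s : PowerSeries ℤ) * (PowerSeries.X * RefinedFloors.invOneSub)
            - 12 * RefinedFloors.eisensteinTwo)) ∧
    (RefinedFloors.IsAsymptotic Δ (RefinedFloors.simpleCount 1 s) A ↔
      ∀ β : RefinedFloors.Ample Δ,
        A β = RefinedFloors.partitionSeries ^ Δ.eulerChar *
          ((β.1.gmax : PowerSeries ℤ)
            + 2 * (s : PowerSeries ℤ) * (PowerSeries.X * RefinedFloors.invOneSub)
            - 12 * RefinedFloors.eisensteinTwo)) :=
  ⟨RefinedFloors.isAsymptotic_iff (RefinedFloors.isWordCount_gsInvariant s) hT hH hN A,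
    RefinedFloors.isAsymptotic_iff (RefinedFloors.isWordCount_simpleCount s) hT hH hN A⟩
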